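/- **Conventions.** Fix $\hbar,k,\rho,\sigma\in\mathbb C$; write $q^{x}=e^{\hbar x}$ for $x\in\mathbb C$, $[x]=\frac{q^x-q^{-x}}{q-q^{-1}}$, $u=q^\rho$, $v=q^\sigma$, $h(u,v)=quv-\frac{[k+2]}{[k+1]}u^2+q^{-1}uv^{-1}$. Assume that $q$ and $k$ are generic in the following sense: neither $q$ nor $q^k$ is a root of unity, and $[2k+2]$, $[k+2]$, $[k+3]$ are non-zero. Put $\mathbb Z^{\rm NS}=\mathbb Z+\frac12$, $\mathbb Z^{\rm R}=\mathbb Z$. **The algebra.** A left (right) module of $\mathcal{SV}ir_{q,k}$ in the sector ${\rm A}\in\{{\rm NS},{\rm R}\}$ is a complex vector space with linear operators $K^+_m$ $(m\ge0)$, $K^-_m$ $(m\le 0)$, $T_m$ $(m\in\mathbb Z)$, $G^\pm_m$ $(m\in\mathbb Z^{\rm A})$ acting from the left (right), such that every vector is annihilated by all generators of sufficiently large positive mode (right modules: of sufficiently negative mode), so that the sums below are finite on each vector, and such that $K_0^+=K_0^-$ is invertible and, with $K^\pm_m=0$ for $\pm m<0$, $$K^\pm_mK^\pm_n=K^\pm_nK^\pm_m,\qquad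 G^\pm_mG^\pm_n+G^\pm_nG^\pm_m=0,$$ $$K^-_mK^+_n=K^+_nK^-_m-(q-q^{-1})^2\sum_{\ell=1}^{-m}\tfrac{[k][k+2][2\ell]}{[2]}K^+_{n-\ell}K^-_{m+\ell},$$ $$K^-_mT_n=T_nK^-_m+(q-q^{-1})^2\sum_{\ell=1}^{-m}\tfrac{[k+2][(k+3)\ell]}{[k+3]}T_{n-\ell}K^-_{m+\ell},$$ $$T_mK^+_n=K^+_nT_m+(q-q^{-1})^2\sum_{\ell=1}^{n}\tfrac{[k+2][(k+3)\ell]}{[k+3]}K^+_{n-\ell}T_{m+\ell},$$ $$K^-_mG^\pm_n=q^{\pm(k+2)}G^\pm_nK^-_m\pm(q-q^{-1})[k+2]\sum_{\ell=1}^{-m}q^{\pm2(k+2)\ell}G^\pm_{n-\ell}K^-_{m+\ell},$$ $$G^\pm_mK^+_n=q^{\mp(k+2)}K^+_nG^\pm_m\mp(q-q^{-1})[k+2]\sum_{\ell=1}^{n}q^{\mp2(k+2)\ell}K^+_{n-\ell}G^\pm_{m+\ell},$$ $$G^+_mG^-_n+G^-_nG^+_m=\tfrac1{(q-q^{-1})^2}\Bigl(\tfrac{q^{(2k+2)(m-n)}}{[k+1]}\sum_{\alpha,\beta\ge0}\delta_{m+n+\alpha-\beta,0}K^-_{-\alpha}K^+_\beta-q^{(k+2)(m-n)}\delta_{m+n,0}+q^{(k+1)(m-n)}T_{m+n}\Bigr),$$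 $$G^\pm_mT_n-T_nG^\pm_m=\pm(q-q^{-1})\tfrac{[k+2]}{[k+1]}q^{\pm(k+1)(2m-n)}\sum_{\alpha,\beta\ge0}K^-_{-\alpha}G^\pm_{m+n+\alpha-\beta}K^+_\beta,$$ $$T_mT_n-T_nT_m=(q-q^{-1})^2\tfrac{[k+2]^2}{[k+1]}[(m-n)(k+1)]\sum_{\alpha,\beta\ge0}K^-_{-\alpha}W_{m+n+\alpha-\beta}K^+_\beta,$$ $$W_m=\tfrac{c_m(2k+2)}{[k+1]}\sum_{\mu,\nu\ge0}\delta_{m+\mu-\nu,0}K^-_{-\mu}K^+_\nu-c_m(k+2)\delta_{m,0}+c_m(k+1)T_m-(q-q^{-1})^3\sum_{\gamma\in\mathbb Z^{\rm A}}{:}G^+_{-\gamma}G^-_{m+\gamma}{:}.$$ Here $c_m(x)=\frac1{[x]}$ if (${\rm A}={\rm NS}$ and $m$ is even) or (${\rm A}={\rm R}$ and $m$ is odd), and $c_m(x)=\frac1{[x]}\frac{q^x+q^{-x}}2$ otherwise; ${:}G^+_mG^-_n{:}$ is $G^+_mG^-_n$ for $m<n$, $\frac12(G^+_mG^-_m-G^-_mG^+_m)$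 for $m=n$, and $-G^-_nG^+_m$ for $m>n$. **Fock spaces.** Let $\widetilde\alpha_n,\overline\alpha_n,\beta_n$ $(n\in\mathbb Z)$ and $Q_{\widetilde\alpha},Q_{\overline\alpha},Q_\beta$ satisfy $[\widetilde\alpha_n,\widetilde\alpha_m]=\frac{[(k+2)n][kn]}n\delta_{n+m,0}$, $[\overline\alpha_n,\overline\alpha_m]=-\frac{[2n][kn]}n\delta_{n+m,0}$, $[\beta_n,\beta_m]=\frac{[2n][(k+2)n]}n\delta_{n+m,0}$ (zero for $n=0$), $[\widetilde\alpha_n,Q_{\widetilde\alpha}]=[\beta_n,Q_\beta]=\delta_{n,0}=-[\overline\alpha_n,Q_{\overline\alpha}]$, all other commutators being zero. Let $|\xi,\rho,\sigma\rangle=e^{\xi Q_{\widetilde\alpha}+\rho Q_{\overline\alpha}+\sigma Q_\beta}|0\rangle$, where $|0\rangle$ is annihilated by all modes $n\ge0$; let $\mathcal F(\xi,\rho,\sigma)$ be the space of polynomials in the negative modes applied to $|\xi,\rho,\sigma\rangle$. Dually, $\langle\xi,\rho,\sigma|=\langle0|e^{-\xi Q_{\widetilde\alpha}-\rho Q_{\overline\alpha}-\sigma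 Q_\beta}$, where $\langle0|$ is annihilated (from the right) by all modes $n\le0$, and $\mathcal F^*(\xi,\rho,\sigma)$ consists of $\langle\xi,\rho,\sigma|$ times polynomials in the positive modes. Set $$\mathcal F_{\rm NS}(u,v)=\bigoplus_{n\in\mathbb Z}\mathcal F(\rho+(k+2)n,\rho+2n,\sigma),\qquad \mathcal F_{\rm R}(u,v)=\bigoplus_{n\in\mathbb Z}\mathcal F(\tfrac k2+\rho+(k+2)n,\rho+2n,\sigma),$$ and define $\mathcal F^*_{\rm NS}(u,v)$, $\mathcal F^*_{\rm R}(u,v)$ in the same way with $\mathcal F^*$. Give the oscillators $\widetilde\alpha_{-m},\overline\alpha_{-m},\beta_{-m}$ (dual spaces: $\widetilde\alpha_m,\overline\alpha_m,\beta_m$), $m>0$, the $p$-degree $m$ and the $x$-degree $0$, and the ground vector of the $n$-th summand the $x$-degree $n$ and the $p$-degree $\frac{n^2}2$ (NS), $\frac{n(n+1)}2$ (R). **Currents.** With ${:}\ {:}$ putting the negative modes and the $Q$'s to the left of the non-negative modes, let $$\widetilde V^\pm(z)=e^{\pm(k+2)Q_{\widetilde\alpha}}z^{\pm\frac1k\widetilde\alpha_0}{:}\exp\Bigl(\mp\sum_{m\ne0}\tfrac{z^{-m}}{[km]}\widetilde\alpha_m\Bigr){:},\quad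 Y^\pm(z)=e^{\pm2Q_{\overline\alpha}}z^{\pm\frac1k\overline\alpha_0}{:}\exp\Bigl(\mp\sum_{m\ne0}q^{\mp\frac k2|m|}\tfrac{z^{-m}}{[km]}\overline\alpha_m\Bigr){:},$$ $$Z_\pm(z)=\exp\Bigl(\mp(q-q^{-1})\sum_{m\ge1}z^{\mp m}\tfrac{[m]}{[2m]}\overline\alpha_{\pm m}\Bigr)q^{\mp\frac12\overline\alpha_0},\quad W_\pm(z)=\exp\Bigl(\mp(q-q^{-1})\sum_{m\ge1}z^{\mp m}\tfrac{[m]}{[2m]}\beta_{\pm m}\Bigr)q^{\mp\frac12\beta_0},$$ $$e_\pm(z)={:}Y^+(z)Z_\pm(q^{\mp\frac{k+2}2}z)W_\pm(q^{\mp\frac k2}z){:},\qquad f_\pm(z)={:}Y^-(z)Z_\pm(q^{\pm\frac{k+2}2}z)W_\pm(q^{\pm\frac k2}z)^{-1}{:},$$ $$\mathbf K^\pm(z)=q^{\widetilde\alpha_0}\exp\Bigl((q-q^{-1})\sum_{\pm m>0}\widetilde\alpha_mz^{-m}\Bigr),$$ $$\mathbf T(z)={:}\widetilde V^+(q^{-1}z)\widetilde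 V^-(qz){:}\Bigl(q^{-1}{:}e_+(q^{-\frac{k+2}2}z)f_-(q^{\frac{k+2}2}z){:}-\tfrac{[k+2]}{[k+1]}{:}e_+(q^{-\frac{k+2}2}z)f_+(q^{\frac{k+2}2}z){:}+q\,{:}e_-(q^{-\frac{k+2}2}z)f_+(q^{\frac{k+2}2}z){:}\Bigr),$$ $$\mathbf G^+(z)=\tfrac{z^{1/2}}{q-q^{-1}}\widetilde V^+(q^{-k-2}z)(e_+-e_-)(q^{-\frac{3k+4}2}z),\qquad \mathbf G^-(z)=-\tfrac{z^{1/2}}{q-q^{-1}}\widetilde V^-(q^{k+2}z)(f_+-f_-)(q^{\frac{3k+4}2}z),$$ and let $\mathbf K^\pm_m,\mathbf T_m,\mathbf G^\pm_m$ be the coefficients of $z^{-m}$ in these currents ($m\in\mathbb Z$ for $\mathbf K^\pm,\mathbf T$, and $m\in\mathbb Z^{\rm A}$ for $\mathbf G^\pm$ in the sector A). **Statement.** For ${\rm A}={\rm NS}$ and ${\rm A}={\rm R}$, the operators $\mathbf K^\pm_m,\mathbf T_m,\mathbf G^\pm_m$ preserve $\mathcal F_{\rm A}(u,v)$ and $\mathcal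 F^*_{\rm A}(u,v)$ and make them a left, respectively right, module of $\mathcal{SV}ir_{q,k}$ in the sector A. A generator of mode $m$ changes the $p$-degree by $-m$ on $\mathcal F_{\rm A}$ and by $m$ on $\mathcal F^*_{\rm A}$; $\mathbf G^\pm_m$ changes the $x$-degree by $\pm1$ on $\mathcal F_{\rm A}$ and by $\mp1$ on $\mathcal F^*_{\rm A}$; the other generators preserve the $x$-degree. Moreover: 1. In the NS sector, $|\rho,\rho,\sigma\rangle$ is a highest weight vector: $\mathbf K^\pm_0$ and $\mathbf T_0$ have the eigenvalues $u$ and $h(u,v)$ on it, and $\mathbf K^+_m,\mathbf T_m$ $(m>0)$ and $\mathbf G^\pm_m$ $(m\ge\frac12)$ annihilate it. Likewise $\langle\rho,\rho,\sigma|$ has the eigenvalues $u$ and $h(u,v)$, and is annihilated by $\mathbf K^-_m,\mathbf T_m$ $(m<0)$ and $\mathbf G^\pm_m$ $(m\le-\frac12)$. 2. In the R sector, $|\frac k2+\rho,\rho,\sigma\rangle$ is a highest weight vector: $\mathbf K^\pm_0$ and $\mathbf T_0$ have the eigenvalues $q^{k/2}u$ and $q^{-1}h(u,v)$ on it, and $\mathbf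 K^+_m,\mathbf T_m$ $(m>0)$, $\mathbf G^+_m$ $(m\ge0)$ and $\mathbf G^-_m$ $(m>0)$ annihilate it. Likewise $\langle\frac k2+\rho,\rho,\sigma|$ has the eigenvalues $q^{k/2}u$ and $q^{-1}h(u,v)$, and is annihilated by $\mathbf K^-_m,\mathbf T_m$ $(m<0)$, $\mathbf G^+_m$ $(m<0)$ and $\mathbf G^-_m$ $(m\le0)$. 3. The homogeneous components are finite-dimensional, and for $|p|<1$ (with a choice of $p^{1/2}$) and $x\ne0$ the characters $\sum_{d,j}\dim(\text{component of }p\text{-degree }d\text{ and }x\text{-degree }j)\,p^dx^j$ of the Fock space and of its dual converge absolutely to the $N=2$ Verma characters $$\prod_{i=0}^\infty\frac{(1+p^{i+1/2}x)(1+p^{i+1/2}x^{-1})}{(1-p^{i+1})^2}\ \ ({\rm NS}),\qquad\prod_{i=0}^\infty\frac{(1+p^{i+1}x)(1+p^ix^{-1})}{(1-p^{i+1})^2}\ \ ({\rm R}).$$ -/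

import Mathlib

noncomputable section

namespace SVirFock

open scoped Classical in
/-- The sum of a family of operators that is locally finite (on every vector only finitely many
members of the family are non-zero). -/
def locSum {V ι : Type*} [AddCommGroup V] [Module ℂ V] (f : ι → Module.End ℂ V) :
    Module.End ℂ V :=
  if h : ∀ v, (Function.support fun i => f i v).Finite then
    { toFun := fun v => ∑ᶠ i, f i v
      map_add' := fun v w => by
        simp only [map_add]
        exact finsum_add_distrib (h v) (h w)
      map_smul' := fun c v => by
        simp only [map_smul, RingHom.id_apply]
        exact (smul_finsum' c (h v)).symm }
  else 0

/-! ### Notation: `q = exp ħ`, `q ^ x = exp (ħ x)`, `[x] = (q ^ x - q ^ (-x)) / (q - q ^ (-1))` -/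

/-- `q ^ x`, where `q = exp ħ`. -/
def qpow (ħ x : ℂ) : ℂ := Complex.exp (ħ * x)

/-- `q - q⁻¹`. -/
def qdiff (ħ : ℂ) : ℂ := qpow ħ 1 - qpow ħ (-1)

/-- The `q`-number `[x]`. -/
def qnum (ħ x : ℂ) : ℂ := (qpow ħ x - qpow ħ (-x)) / qdiff ħ

/-- A sign as a complex number. -/
def sg (ε : ℤˣ) : ℂ := ((ε : ℤ) : ℂ)

/-- The Neveu-Schwarz and the Ramond sector. -/
inductive Sector
  | NS
  | R

/-- Twice the shift of the modes of `G^±`: the index set of these modes is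
`ℤ + 1/2` in the NS sector and `ℤ` in the R sector, i.e. `ℤ + shift₂ / 2`. -/
def Sector.shift₂ : Sector → ℤ
  | .NS => 1
  | .R => 0

/-- Left modules and right modules. -/
inductive Side
  | left
  | right

/-- The operator by which a product `a b` of two algebra elements acts, in terms of the operators
by which `a` and `b` act: `(a b) v = a (b v)` on a left module, `v (a b) = (v a) b` on a right
module. -/
def Side.mul {V : Type*} [AddCommGroup V] [Module ℂ V] :
    Side → Module.End ℂ V → Module.End ℂ V → Module.End ℂ V
  | .left, a, b => a * b
  | .right, a, b => b * a

/-- `+1` for left modules, `-1` for right modules. -/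
def Side.sign : Side → ℤ
  | .left => 1
  | .right => -1

/-! ### Representations of the quantum `N = 2` superconformal algebra -/

/-- Operators for the generators: `K ε m` for `K^ε_m`, `T m` for `T_m`, and `G ε r` for
`G^ε_{r + 1/2}` in the NS sector, for `G^ε_r` in the R sector. -/
structure SVirOps (V : Type*) [AddCommGroup V] [Module ℂ V] where
  K : ℤˣ → ℤ → Module.End ℂ V
  T : ℤ → Module.End ℂ V
  G : ℤˣ → ℤ → Module.End ℂ V

/-- The coefficients `c^A_m(x)`. -/
def cCoeff (ħ : ℂ) (A : Sector) (m : ℤ) (x : ℂ) : ℂ :=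
  match A with
  | .NS => if Even m then 1 / qnum ħ x else 1 / qnum ħ x * ((qpow ħ x + qpow ħ (-x)) / 2)
  | .R => if Even m then 1 / qnum ħ x * ((qpow ħ x + qpow ħ (-x)) / 2) else 1 / qnum ħ x

section Relations

variable {V : Type*} [AddCommGroup V] [Module ℂ V]

/-- The normal ordered product of `G^+` and `G^-` (mode indices `r`, `s`). -/
def SVirOps.normalG (X : SVirOps V) (S : Side) (r s : ℤ) : Module.End ℂ V :=
  if r < s then S.mul (X.G 1 r) (X.G (-1) s)
  else if r = s then
    (1 / 2 : ℂ) • (S.mul (X.G 1 r) (X.G (-1) r) - S.mul (X.G (-1) r) (X.G 1 r))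
  else -S.mul (X.G (-1) s) (X.G 1 r)

/-- The modes `W_m`. In the last sum `g` is the index of the mode `γ = g + shift₂ / 2`, so that
`-γ` has the index `-g - shift₂`. -/
def SVirOps.W (X : SVirOps V) (ħ k : ℂ) (A : Sector) (S : Side) (m : ℤ) : Module.End ℂ V :=
  locSum (fun x : ℕ × ℕ =>
      if m + x.1 - x.2 = 0 then
        (cCoeff ħ A m (2 * k + 2) * (1 / qnum ħ (k + 1))) •
          S.mul (X.K (-1) (-x.1)) (X.K 1 x.2)
      else 0)
    - (if m = 0 then cCoeff ħ A m (k + 2) else 0) • (1 : Module.End ℂ V)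
    + cCoeff ħ A m (k + 1) • X.T m
    - qdiff ħ ^ 3 • locSum fun g : ℤ => X.normalG S (-g - A.shift₂) (m + g)

/-- `X` is a representation of `SVir_{q,k}` in the sector `A` (a left or a right module according
to `S`). By `smooth`, all the infinite sums in the relations are finite on each vector. -/
structure IsSVirRep (ħ k : ℂ) (A : Sector) (S : Side) (X : SVirOps V) : Prop where
  /-- The generators are `K^+_m` for `m ≥ 0` and `K^-_m` for `m ≤ 0` only. -/
  K_zero : ∀ (ε : ℤˣ) (m : ℤ), (ε : ℤ) * m < 0 → X.K ε m = 0
  smooth : ∀ v : V, ∃ N : ℤ, ∀ m : ℤ, N < S.sign * m →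
    X.T m v = 0 ∧ ∀ ε : ℤˣ, X.K ε m v = 0 ∧ X.G ε m v = 0
  K0_eq : X.K 1 0 = X.K (-1) 0
  K0_unit : ∀ ε, IsUnit (X.K ε 0)
  KK : ∀ (ε : ℤˣ) (m n : ℤ),
    S.mul (X.K ε m) (X.K ε n) = S.mul (X.K ε n) (X.K ε m)
  KmKp : ∀ m n : ℤ, m ≤ 0 → 0 ≤ n →
    S.mul (X.K (-1) m) (X.K 1 n) = S.mul (X.K 1 n) (X.K (-1) m)
      - qdiff ħ ^ 2 • ∑ l ∈ Finset.Icc 1 (-m),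
        (qnum ħ k * qnum ħ (k + 2) * qnum ħ (2 * l) / qnum ħ 2) •
          S.mul (X.K 1 (n - l)) (X.K (-1) (m + l))
  KmT : ∀ m n : ℤ, m ≤ 0 →
    S.mul (X.K (-1) m) (X.T n) = S.mul (X.T n) (X.K (-1) m)
      + qdiff ħ ^ 2 • ∑ l ∈ Finset.Icc 1 (-m),
        (qnum ħ (k + 2) * qnum ħ ((k + 3) * l) / qnum ħ (k + 3)) •
          S.mul (X.T (n - l)) (X.K (-1) (m + l))
  TKp : ∀ m n : ℤ, 0 ≤ n →
    S.mul (X.T m) (X.K 1 n) = S.mul (X.K 1 n) (X.T m)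
      + qdiff ħ ^ 2 • ∑ l ∈ Finset.Icc 1 n,
        (qnum ħ (k + 2) * qnum ħ ((k + 3) * l) / qnum ħ (k + 3)) •
          S.mul (X.K 1 (n - l)) (X.T (m + l))
  KmG : ∀ (ε : ℤˣ) (m r : ℤ), m ≤ 0 →
    S.mul (X.K (-1) m) (X.G ε r) =
      qpow ħ (sg ε * (k + 2)) • S.mul (X.G ε r) (X.K (-1) m)
      + (sg ε * qdiff ħ * qnum ħ (k + 2)) • ∑ l ∈ Finset.Icc 1 (-m),
        qpow ħ (sg ε * (2 * (k + 2) * l)) • S.mul (X.G ε (r - l)) (X.K (-1) (m + l))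
  GKp : ∀ (ε : ℤˣ) (r n : ℤ), 0 ≤ n →
    S.mul (X.G ε r) (X.K 1 n) =
      qpow ħ (-sg ε * (k + 2)) • S.mul (X.K 1 n) (X.G ε r)
      - (sg ε * qdiff ħ * qnum ħ (k + 2)) • ∑ l ∈ Finset.Icc 1 n,
        qpow ħ (-sg ε * (2 * (k + 2) * l)) • S.mul (X.K 1 (n - l)) (X.G ε (r + l))
  GG : ∀ (ε : ℤˣ) (r s : ℤ),
    S.mul (X.G ε r) (X.G ε s) + S.mul (X.G ε s) (X.G ε r) = 0
  GpGm : ∀ r s : ℤ,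
    S.mul (X.G 1 r) (X.G (-1) s) + S.mul (X.G (-1) s) (X.G 1 r) =
      (1 / qdiff ħ ^ 2) •
        ((1 / qnum ħ (k + 1) * qpow ħ ((2 * k + 2) * (r - s))) •
            locSum (fun x : ℕ × ℕ =>
              if r + s + A.shift₂ + x.1 - x.2 = 0 then S.mul (X.K (-1) (-x.1)) (X.K 1 x.2)
              else 0)
          - (if r + s + A.shift₂ = 0 then qpow ħ ((k + 2) * (r - s)) else 0) •
            (1 : Module.End ℂ V)
          + qpow ħ ((k + 1) * (r - s)) • X.T (r + s + A.shift₂))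
  GT : ∀ (ε : ℤˣ) (r n : ℤ),
    S.mul (X.G ε r) (X.T n) - S.mul (X.T n) (X.G ε r) =
      (sg ε * qdiff ħ * (qnum ħ (k + 2) / qnum ħ (k + 1)) *
          qpow ħ (sg ε * ((k + 1) * (2 * r + A.shift₂ - n)))) •
        locSum fun x : ℕ × ℕ =>
          S.mul (X.K (-1) (-x.1)) (S.mul (X.G ε (r + n + x.1 - x.2)) (X.K 1 x.2))
  TT : ∀ m n : ℤ,
    S.mul (X.T m) (X.T n) - S.mul (X.T n) (X.T m) =
      (qdiff ħ ^ 2 * (qnum ħ (k + 2) ^ 2 / qnum ħ (k + 1)) * qnum ħ ((m - n) * (k + 1))) •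
        locSum fun x : ℕ × ℕ =>
          S.mul (X.K (-1) (-x.1)) (S.mul (X.W ħ k A S (m + n + x.1 - x.2)) (X.K 1 x.2))

/-- `v` is a highest weight vector in the sector `A` on which `K^±_0` and `T_0` have the
eigenvalues `κ` and `τ`. (Indices: in the NS sector `G ε r` is the mode `r + 1/2`.) -/
def IsHighestWeight (A : Sector) (S : Side) (X : SVirOps V) (κ τ : ℂ) (v : V) : Prop :=
  v ≠ 0 ∧ (∀ ε, X.K ε 0 v = κ • v) ∧ X.T 0 v = τ • v ∧
  match S, A with
  | .left, .NS => (∀ m > 0, X.K 1 m v = 0 ∧ X.T m v = 0) ∧ (∀ ε, ∀ r ≥ 0, X.G ε r v = 0)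
  | .left, .R => (∀ m > 0, X.K 1 m v = 0 ∧ X.T m v = 0) ∧
      (∀ r ≥ 0, X.G 1 r v = 0) ∧ (∀ r > 0, X.G (-1) r v = 0)
  | .right, .NS => (∀ m < 0, X.K (-1) m v = 0 ∧ X.T m v = 0) ∧ (∀ ε, ∀ r < 0, X.G ε r v = 0)
  | .right, .R => (∀ m < 0, X.K (-1) m v = 0 ∧ X.T m v = 0) ∧
      (∀ r < 0, X.G 1 r v = 0) ∧ (∀ r ≤ 0, X.G (-1) r v = 0)

end Relations

/-! ### The Heisenberg algebra and its Fock spaces -/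

/-- The three bosons `α̃`, `ᾱ`, `β`. -/
inductive Boson
  | tilde
  | bar
  | beta
  deriving DecidableEq

instance : Fintype Boson where
  elems := {.tilde, .bar, .beta}
  complete i := by cases i <;> simp

/-- `[a_{i,m}, a_{i,-m}]`. -/
def heisComm (ħ k : ℂ) (i : Boson) (m : ℂ) : ℂ :=
  match i with
  | .tilde => qnum ħ ((k + 2) * m) * qnum ħ (k * m) / m
  | .bar => -(qnum ħ (2 * m) * qnum ħ (k * m) / m)
  | .beta => qnum ħ (2 * m) * qnum ħ ((k + 2) * m) / m

/-- The sign in `[a_{i,0}, Q_i] = ± 1`. -/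
def zeroSign : Boson → ℂ
  | .tilde => 1
  | .bar => -1
  | .beta => 1

/-- Polynomials in the creation operators: the variable `(i, j)` is `a_{i,-(j+1)}` for the Fock
space and `a_{i,j+1}` for the dual Fock space. -/
abbrev Osc : Type := MvPolynomial (Boson × ℕ) ℂ

/-- The action of `a_{i,-(j+1)}`, from the left on `ℂ[a_{-1}, …]|p⟩` or from the right on
`⟨p|ℂ[a_1, …]`. -/
def heisNeg (ħ k : ℂ) (S : Side) (i : Boson) (j : ℕ) : Module.End ℂ Osc :=
  match S with
  | .left => LinearMap.mulLeft ℂ (MvPolynomial.X (i, j))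
  | .right => heisComm ħ k i (j + 1) • (MvPolynomial.pderiv (i, j)).toLinearMap

/-- The action of `a_{i,j+1}`, from the left on `ℂ[a_{-1}, …]|p⟩` or from the right on
`⟨p|ℂ[a_1, …]`. -/
def heisPos (ħ k : ℂ) (S : Side) (i : Boson) (j : ℕ) : Module.End ℂ Osc :=
  match S with
  | .left => heisComm ħ k i (j + 1) • (MvPolynomial.pderiv (i, j)).toLinearMap
  | .right => LinearMap.mulLeft ℂ (MvPolynomial.X (i, j))

/-- The direct sum of the spaces `F(ξ,ρ,σ)` (or of the dual spaces `F^*(ξ,ρ,σ)`) over all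
`(ξ,ρ,σ) ∈ ℂ³`. -/
abbrev BigFock : Type := (Boson → ℂ) →₀ Osc

/-- The momentum `(ξ,ρ,σ)`. -/
def mom3 (ξ ρ σ : ℂ) : Boson → ℂ
  | .tilde => ξ
  | .bar => ρ
  | .beta => σ

/-- The vector `|p⟩`, or `⟨p|`. -/
def vac (p : Boson → ℂ) : BigFock := Finsupp.single p 1

/-! ### Vertex operators -/

/-- A normal ordered exponential
`: exp (∑ᵢ Qᵢ-part + log z ∑ᵢ logz i a_{i,0} + log q ∑ᵢ logq i a_{i,0}
  + ∑_{i, m ≠ 0} osc i m z^(-m) a_{i,m}) :`, where the `Qᵢ`-part is `charge i` times `Q_i`. -/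
structure Vertex where
  charge : Boson → ℂ
  logz : Boson → ℂ
  logq : Boson → ℂ
  osc : Boson → ℤ → ℂ

namespace Vertex

/-- The normal ordered product `: A(z) B(z) :`. -/
def nmul (A B : Vertex) : Vertex where
  charge i := A.charge i + B.charge i
  logz i := A.logz i + B.logz i
  logq i := A.logq i + B.logq i
  osc i m := A.osc i m + B.osc i m

/-- The inverse `: A(z)⁻¹ :`. -/
def inv (A : Vertex) : Vertex where
  charge i := -A.charge i
  logz i := -A.logz i
  logq i := -A.logq i
  osc i m := -A.osc i m

/-- `A(q^s z)`. -/
def rescale (ħ s : ℂ) (A : Vertex) : Vertex where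
  charge := A.charge
  logz := A.logz
  logq i := A.logq i + s * A.logz i
  osc i m := qpow ħ (-s * m) * A.osc i m

end Vertex

/-- `exp F` for a formal power series `F` without constant term over a `ℂ`-algebra. -/
def expSeries {R : Type*} [Ring R] [Algebra ℂ R] (F : PowerSeries R) : PowerSeries R :=
  PowerSeries.mk fun n => ∑ r ∈ Finset.range (n + 1),
    ((r.factorial : ℂ)⁻¹) • PowerSeries.coeff n (F ^ r)

/-- The coefficient of `z ^ a` in `exp (∑_{i, m > 0} osc i (-m) z^m a_{i,-m})`. -/
def creation (ħ k : ℂ) (S : Side) (A : Vertex) (a : ℕ) : Module.End ℂ Osc :=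
  PowerSeries.coeff a <| expSeries <| PowerSeries.mk fun
    | 0 => 0
    | j + 1 => ∑ i, A.osc i (-(j + 1)) • heisNeg ħ k S i j

/-- The coefficient of `z ^ (-b)` in `exp (∑_{i, m > 0} osc i m z^(-m) a_{i,m})`. -/
def annihilation (ħ k : ℂ) (S : Side) (A : Vertex) (b : ℕ) : Module.End ℂ Osc :=
  PowerSeries.coeff b <| expSeries <| PowerSeries.mk fun
    | 0 => 0
    | j + 1 => ∑ i, A.osc i (j + 1) • heisPos ħ k S i j

/-- The momentum after `exp (∑ᵢ charge i Q_i)` has acted from the left on `|p⟩`, or from the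
right on `⟨p|`. -/
def Vertex.shift (S : Side) (A : Vertex) (p : Boson → ℂ) : Boson → ℂ :=
  match S with
  | .left => fun i => p i + A.charge i
  | .right => fun i => p i - A.charge i

/-- The momentum on which the zero modes `a_{i,0}` act: in `A(z)` they stand to the right of
`exp (∑ᵢ charge i Q_i)`. -/
def Vertex.zeroMom (S : Side) (A : Vertex) (p : Boson → ℂ) : Boson → ℂ :=
  match S with
  | .left => p
  | .right => A.shift S p

open scoped Classical in
/-- The coefficient of `z ^ e`, `e ∈ ℂ`, in the vertex operator `A(z)`, acting on the (dual) Fock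
spaces. As `a_{i,0}` is `zeroSign i * p i` on the momentum `p`, the zero modes contribute
`z ^ (∑ i, logz i * zeroSign i * p i) * q ^ (∑ i, logq i * zeroSign i * p i)`. -/
def Vertex.coeff (ħ k : ℂ) (S : Side) (A : Vertex) (e : ℂ) : Module.End ℂ BigFock :=
  Finsupp.lsum ℂ fun p : Boson → ℂ =>
    (Finsupp.lsingle (A.shift S p)).comp <|
      qpow ħ (∑ i, A.logq i * (zeroSign i * A.zeroMom S p i)) •
        locSum fun x : ℕ × ℕ =>
          if (∑ i, A.logz i * (zeroSign i * A.zeroMom S p i)) + x.1 - x.2 = e then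
            S.mul (creation ħ k S A x.1) (annihilation ħ k S A x.2)
          else 0

/-- `Ṽ^±(z)`. -/
def Vt (ħ k : ℂ) (ε : ℤˣ) : Vertex where
  charge | .tilde => sg ε * (k + 2) | _ => 0
  logz | .tilde => sg ε * (1 / k) | _ => 0
  logq _ := 0
  osc | .tilde, m => -sg ε / qnum ħ (k * m) | _, _ => 0

/-- `Y^±(z)`. -/
def Yv (ħ k : ℂ) (ε : ℤˣ) : Vertex where
  charge | .bar => sg ε * 2 | _ => 0
  logz | .bar => sg ε * (1 / k) | _ => 0
  logq _ := 0
  osc | .bar, m => -sg ε * (qpow ħ (-sg ε * (k / 2) * m.natAbs) / qnum ħ (k * m)) | _, _ => 0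

/-- `Z_±(z)` (for `i = ᾱ`) and `W_±(z)` (for `i = β`):
`exp (∓ (q - q⁻¹) ∑_{m ≥ 1} z^(∓m) [m]/[2m] a_{i,±m}) q^(∓ a_{i,0} / 2)`. -/
def Zv (ħ : ℂ) (i : Boson) (ε : ℤˣ) : Vertex where
  charge _ := 0
  logz _ := 0
  logq i' := if i' = i then -sg ε / 2 else 0
  osc i' m := if i' = i ∧ 0 < (ε : ℤ) * m then
    -sg ε * qdiff ħ * (qnum ħ m.natAbs / qnum ħ (2 * m.natAbs)) else 0

/-- `e_±(z) = : Y^+(z) Z_±(q^(∓(k+2)/2) z) W_±(q^(∓k/2) z) :`. -/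
def ev (ħ k : ℂ) (ε : ℤˣ) : Vertex :=
  ((Yv ħ k 1).nmul ((Zv ħ .bar ε).rescale ħ (-sg ε * ((k + 2) / 2)))).nmul
    ((Zv ħ .beta ε).rescale ħ (-sg ε * (k / 2)))

/-- `f_±(z) = : Y^-(z) Z_±(q^(±(k+2)/2) z) W_±(q^(±k/2) z)⁻¹ :`. -/
def fv (ħ k : ℂ) (ε : ℤˣ) : Vertex :=
  ((Yv ħ k (-1)).nmul ((Zv ħ .bar ε).rescale ħ (sg ε * ((k + 2) / 2)))).nmul
    ((Zv ħ .beta ε).rescale ħ (sg ε * (k / 2))).inv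

/-- `K^±(z) = q^(α̃_0) exp ((q - q⁻¹) ∑_{±m > 0} α̃_m z^(-m))`. -/
def Kv (ħ : ℂ) (ε : ℤˣ) : Vertex where
  charge _ := 0
  logz _ := 0
  logq | .tilde => 1 | _ => 0
  osc | .tilde, m => if 0 < (ε : ℤ) * m then qdiff ħ else 0 | _, _ => 0

/-- `: Ṽ^+(q⁻¹ z) Ṽ^-(q z) e_ε(q^(-(k+2)/2) z) f_ε'(q^((k+2)/2) z) :`. -/
def Tv (ħ k : ℂ) (ε ε' : ℤˣ) : Vertex :=
  (((Vt ħ k 1).rescale ħ (-1)).nmul ((Vt ħ k (-1)).rescale ħ 1)).nmul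
    (((ev ħ k ε).rescale ħ (-((k + 2) / 2))).nmul ((fv ħ k ε').rescale ħ ((k + 2) / 2)))

/-- `Ṽ^+(q^(-k-2) z) e_ε(q^(-(3k+4)/2) z)`. -/
def Gpv (ħ k : ℂ) (ε : ℤˣ) : Vertex :=
  ((Vt ħ k 1).rescale ħ (-(k + 2))).nmul ((ev ħ k ε).rescale ħ (-((3 * k + 4) / 2)))

/-- `Ṽ^-(q^(k+2) z) f_ε(q^((3k+4)/2) z)`. -/
def Gmv (ħ k : ℂ) (ε : ℤˣ) : Vertex :=
  ((Vt ħ k (-1)).rescale ħ (k + 2)).nmul ((fv ħ k ε).rescale ħ ((3 * k + 4) / 2))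

/-- The coefficient of `z ^ (-m)` in `K^±(z)`. -/
def Kmode (ħ k : ℂ) (S : Side) (ε : ℤˣ) (m : ℂ) : Module.End ℂ BigFock :=
  (Kv ħ ε).coeff ħ k S (-m)

/-- The coefficient of `z ^ (-m)` in `T(z)`. -/
def Tmode (ħ k : ℂ) (S : Side) (m : ℂ) : Module.End ℂ BigFock :=
  qpow ħ (-1) • (Tv ħ k 1 (-1)).coeff ħ k S (-m)
    - (qnum ħ (k + 2) / qnum ħ (k + 1)) • (Tv ħ k 1 1).coeff ħ k S (-m)
    + qpow ħ 1 • (Tv ħ k (-1) 1).coeff ħ k S (-m)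

/-- The coefficient of `z ^ (-m)` in `G^±(z) = z^(1/2) (G^±_+(z) - G^±_-(z))`, where
`G^+_ε(z) = 1/(q - q⁻¹) Ṽ^+(q^(-k-2) z) e_ε(q^(-(3k+4)/2) z)` and
`G^-_ε(z) = -1/(q - q⁻¹) Ṽ^-(q^(k+2) z) f_ε(q^((3k+4)/2) z)`. -/
def Gmode (ħ k : ℂ) (S : Side) (ε : ℤˣ) (m : ℂ) : Module.End ℂ BigFock :=
  let v : ℤˣ → Vertex := if ε = 1 then Gpv ħ k else Gmv ħ k
  (sg ε / qdiff ħ) •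
    ((v 1).coeff ħ k S (-m - 1 / 2) - (v (-1)).coeff ħ k S (-m - 1 / 2))

/-! ### The Fock spaces of the two sectors -/

/-- The momenta `(ρ + (k+2)n, ρ + 2n, σ)` (NS) and `(k/2 + ρ + (k+2)n, ρ + 2n, σ)` (R). -/
def sectorMom (A : Sector) (k ρ σ : ℂ) (n : ℤ) : Boson → ℂ :=
  match A with
  | .NS => mom3 (ρ + (k + 2) * n) (ρ + 2 * n) σ
  | .R => mom3 (k / 2 + ρ + (k + 2) * n) (ρ + 2 * n) σ

/-- `F_A(q^ρ, q^σ)`, or its dual `F^*_A(q^ρ, q^σ)`: the direct sum over `n ∈ ℤ` of the Fock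
spaces with the momenta `sectorMom A k ρ σ n`. -/
def Fock (A : Sector) (k ρ σ : ℂ) : Submodule ℂ BigFock :=
  Finsupp.supported Osc ℂ (Set.range (sectorMom A k ρ σ))

/-- The highest weight vector. -/
def hwVec (A : Sector) (k ρ σ : ℂ) : Fock A k ρ σ :=
  ⟨vac (sectorMom A k ρ σ 0), by
    refine (Finsupp.mem_supported ℂ _).2 fun p hp => ?_
    have h := Finsupp.support_single_subset hp
    rw [Finset.mem_singleton] at h
    exact ⟨0, h.symm⟩⟩

/-- The operators `X` are the modes of the currents `K^±(z)`, `T(z)`, `G^±(z)`, restricted to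
`F_A` (or its dual). -/
def IsCurrents (ħ k ρ σ : ℂ) (A : Sector) (S : Side) (X : SVirOps (Fock A k ρ σ)) : Prop :=
  ∀ (m : ℤ) (x : Fock A k ρ σ),
    (X.T m x : BigFock) = Tmode ħ k S m x ∧
    ∀ ε : ℤˣ, (X.K ε m x : BigFock) = Kmode ħ k S ε m x ∧
      (X.G ε m x : BigFock) = Gmode ħ k S ε (m + A.shift₂ / 2) x

/-- Twice the `p`-degree of the vector with momentum `sectorMom A k ρ σ n`. -/
def groundDeg₂ : Sector → ℤ → ℤ
  | .NS, n => n ^ 2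
  | .R, n => n * (n + 1)

/-- The total mode number of a monomial in the creation operators. -/
def oscWeight (μ : Boson × ℕ →₀ ℕ) : ℕ := μ.sum fun x r => r * (x.2 + 1)

/-- The subspace of `F_A` (or of its dual) of `p`-degree `N / 2` and `x`-degree `j`: a creation
operator `a_{i,∓m}`, `m > 0`, has the `p`-degree `m` and the `x`-degree `0`, and the vector with
momentum `sectorMom A k ρ σ j` has the `p`-degree `groundDeg₂ A j / 2` and the `x`-degree `j`. -/
def degreePiece (A : Sector) (k ρ σ : ℂ) (N j : ℤ) : Submodule ℂ (Fock A k ρ σ) :=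
  (Submodule.span ℂ {x : BigFock | ∃ μ : Boson × ℕ →₀ ℕ,
    2 * (oscWeight μ : ℤ) + groundDeg₂ A j = N ∧
      x = Finsupp.single (sectorMom A k ρ σ j) (MvPolynomial.monomial μ 1)}).comap
    (Fock A k ρ σ).subtype

/-- The degrees of the generators: `K^±_{-m}`, `T_{-m}`, `G^±_{-m}` raise the `p`-degree of a left
module by `m`, and `K^±_m`, `T_m`, `G^±_m` that of a right module; the `x`-degree changes only
under `G^±`, by `±1` on a left and by `∓1` on a right module. -/
def IsHomogeneous (A : Sector) (S : Side) {k ρ σ : ℂ} (X : SVirOps (Fock A k ρ σ)) : Prop :=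
  ∀ (N j m : ℤ), ∀ x ∈ degreePiece A k ρ σ N j,
    X.T m x ∈ degreePiece A k ρ σ (N - S.sign * (2 * m)) j ∧
    ∀ ε : ℤˣ, X.K ε m x ∈ degreePiece A k ρ σ (N - S.sign * (2 * m)) j ∧
      X.G ε m x ∈ degreePiece A k ρ σ (N - S.sign * (2 * m + A.shift₂)) (j + S.sign * ε)

/-- The character of `F_A` (or of its dual) at `p = s ^ 2` and `x` is `c`. -/
def HasCharacter (A : Sector) (k ρ σ s x c : ℂ) : Prop :=
  (∀ N j, Module.Finite ℂ (degreePiece A k ρ σ N j)) ∧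
  HasSum (fun d : ℕ × ℤ =>
    (Module.finrank ℂ (degreePiece A k ρ σ d.1 d.2) : ℂ) * s ^ d.1 * x ^ d.2) c

/-- `h(u,v) = q u v - [k+2]/[k+1] u² + q⁻¹ u v⁻¹`. -/
def hwt (ħ k u v : ℂ) : ℂ :=
  qpow ħ 1 * u * v - qnum ħ (k + 2) / qnum ħ (k + 1) * u ^ 2 + qpow ħ (-1) * u * v⁻¹

end SVirFock

end

open SVirFock

/-! All currents are linear combinations of normal ordered exponentials, so the relations reduce to
Wick's theorem: a product of a mode of V(z) and a mode of V'(w) is a sum of coefficients of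
:V(z)V'(w):, weighted by the coefficients of a contraction function in w/z (`hasLocSum_vop_mul`).
The contraction is the exponential of a series whose Euler derivative is a difference of sums of
geometric series. It is therefore a quotient of products of factors 1 - a w/z
(`expSeries_mul_prodSeries`), and the needed quotients form a finite table. When the two orders of a
product are the expansions of one rational function in w/z and in z/w, their difference is a
combination of delta functions at its poles, and a delta function at w = q^{-t} z fuses the two
vertex operators into a single one (`hasLocSum_vop_diag`).

The currents K^± contain only one half of the oscillators, so one order of any product with them is
already normal ordered. Their relations come from inverting a contraction (`vop_exchange_creation`,
`vop_exchange_annihilation`). Two currents G of the same sign contract to one linear factor, which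
makes them anticommute (`vop_anticomm`). In G^+G^- the poles at q^{2k+2}, q^{4k+4} and q^{2k+4} have
the residues T, :K^-K^+: and 1 (`residueMode_Gpv_Gmv`, `residueMode_pos_pos`,
`residueMode_neg_neg`).

In W the normal ordering of modes cuts the geometric series off at half height. A truncated series
is a constant plus c_m times the corresponding delta function (`geomValue_eq`); the other terms of W
cancel the delta parts exactly, so W is a combination of four ordinary normal ordered products
(`ops_W`). The commutator [G,T] needs no new operator product: since G_r squares to zero, it
commutes with {G_r,Y}, and this expresses [G,T] through [G,:K^-K^+:]
(`Side.commutator_of_anticommutator`). In [T,T] the delta functions at ratio 1 cancel, and fusion at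
ratio q^{2k+2} yields K^- :G^+G^-: K^+ (`fusedMode_Tv`), which is matched with W coefficient by
coefficient.

Left and right modules are handled together: written with `Side.mul`, the Heisenberg relations have
the same form on both (`heis_side_comm`). No analysis enters this part; all infinite sums are
locally finite, and equalities of operators follow by comparing families with the same sum
(`HasLocSum.unique`).

For the characters, three bosons contribute I^3, where I is the inverse of the product of the 1 -
p^i, and the ground vectors contribute a theta series. Jacobi's triple product, obtained as a limit
of its finite form (`finite_triple_product`), turns I times the theta series into the numerator,
which leaves I^2. -/

noncomputable section

namespace SVirFock

section

/-! ### Calculus of locally finite sums of operators. -/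

section LocallyFiniteSums

variable {V ι κ : Type*} [AddCommGroup V] [Module ℂ V]

/-- `L` is the sum of the locally finite family `f`. -/
def HasLocSum (f : ι → Module.End ℂ V) (L : Module.End ℂ V) : Prop :=
  ∀ v, (Function.support fun i => f i v).Finite ∧ L v = ∑ᶠ i, f i v

namespace HasLocSum

variable {f g : ι → Module.End ℂ V} {L M : Module.End ℂ V}

theorem locSum_eq (h : HasLocSum f L) : locSum f = L := by
  have h' : ∀ v, (Function.support fun i => f i v).Finite := fun v => (h v).1
  ext v
  simp only [locSum, dif_pos h', LinearMap.coe_mk, AddHom.coe_mk]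
  exact (h v).2.symm

theorem unique (h : HasLocSum f L) (h' : HasLocSum f M) : L = M :=
  h.locSum_eq.symm.trans h'.locSum_eq

theorem of_finite (h : ∀ v, (Function.support fun i => f i v).Finite) :
    HasLocSum f (locSum f) := by
  refine fun v => ⟨h v, ?_⟩
  simp only [locSum, dif_pos h, LinearMap.coe_mk, AddHom.coe_mk]

theorem congr (h : HasLocSum f L) (hf : ∀ i, f i = g i) (hL : L = M) : HasLocSum g M := by
  obtain rfl : f = g := funext hf
  exact hL ▸ h

theorem add (h : HasLocSum f L) (h' : HasLocSum g M) :
    HasLocSum (fun i => f i + g i) (L + M) := by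
  refine fun v => ⟨((h v).1.union (h' v).1).subset fun i hi => ?_, ?_⟩
  · by_contra hn
    simp only [Set.mem_union, Function.mem_support, not_or, not_not] at hn
    exact hi (by simp [hn.1, hn.2])
  · simp only [LinearMap.add_apply, (h v).2, (h' v).2]
    exact (finsum_add_distrib (h v).1 (h' v).1).symm

theorem smul (c : ℂ) (h : HasLocSum f L) : HasLocSum (fun i => c • f i) (c • L) := by
  refine fun v => ⟨(h v).1.subset fun i hi => ?_, ?_⟩
  · intro hn
    exact hi (by simp only [LinearMap.smul_apply, hn, smul_zero])
  · simp only [LinearMap.smul_apply, (h v).2]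
    exact smul_finsum' c (h v).1

theorem neg (h : HasLocSum f L) : HasLocSum (fun i => -f i) (-L) :=
  (h.smul (-1)).congr (fun i => by simp) (by simp)

theorem sub (h : HasLocSum f L) (h' : HasLocSum g M) :
    HasLocSum (fun i => f i - g i) (L - M) :=
  (h.add h'.neg).congr (fun i => by rw [sub_eq_add_neg]) (by rw [sub_eq_add_neg])

theorem zero : HasLocSum (fun _ : ι => (0 : Module.End ℂ V)) 0 := by
  intro v
  simp

theorem mul_left (a : Module.End ℂ V) (h : HasLocSum f L) :
    HasLocSum (fun i => a * f i) (a * L) := by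
  refine fun v => ⟨(h v).1.subset fun i hi => ?_, ?_⟩
  · intro hn
    exact hi (by simp only [Module.End.mul_apply, hn, map_zero])
  · simp only [Module.End.mul_apply, (h v).2]
    exact a.toAddMonoidHom.map_finsum (h v).1

theorem mul_right (a : Module.End ℂ V) (h : HasLocSum f L) :
    HasLocSum (fun i => f i * a) (L * a) :=
  fun v => h (a v)

theorem side_mul_left (S : Side) (a : Module.End ℂ V) (h : HasLocSum f L) :
    HasLocSum (fun i => S.mul a (f i)) (S.mul a L) := by
  cases S
  exacts [h.mul_left a, h.mul_right a]

theorem side_mul_right (S : Side) (a : Module.End ℂ V) (h : HasLocSum f L) :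
    HasLocSum (fun i => S.mul (f i) a) (S.mul L a) := by
  cases S
  exacts [h.mul_right a, h.mul_left a]

theorem comp_equiv (e : κ ≃ ι) (h : HasLocSum f L) : HasLocSum (fun j => f (e j)) L := by
  refine fun v => ⟨(h v).1.preimage e.injective.injOn, ?_⟩
  rw [(h v).2]
  exact (finsum_comp_equiv e (f := fun i => f i v)).symm

theorem comp_injective {e : κ → ι} (he : Function.Injective e) (h : HasLocSum f L)
    (h0 : ∀ i, i ∉ Set.range e → f i = 0) : HasLocSum (fun j => f (e j)) L := by
  refine fun v => ⟨(h v).1.preimage he.injOn, ?_⟩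
  rw [(h v).2, ← finsum_mem_range (f := fun i => f i v) he, finsum_mem_def]
  refine finsum_congr fun i => ?_
  by_cases hi : i ∈ Set.range e
  · simp [hi]
  · simp [hi, h0 i hi]

/-- Together with `comp_injective`, this passes between sums over natural numbers, as in the
relations, and sums over all integers with vanishing extra terms, where index shifts are bijections.
-/
theorem of_comp_injective {e : κ → ι} (he : Function.Injective e)
    (h : HasLocSum (fun j => f (e j)) L) (h0 : ∀ i, i ∉ Set.range e → f i = 0) :
    HasLocSum f L := by
  refine fun v => ⟨((h v).1.image e).subset fun i hi => ?_, ?_⟩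
  · by_cases hr : i ∈ Set.range e
    · obtain ⟨j, rfl⟩ := hr
      exact ⟨j, hi, rfl⟩
    · exact absurd (by simp [h0 i hr]) hi
  · rw [(h v).2, ← finsum_mem_range (f := fun i => f i v) he, finsum_mem_def]
    refine (finsum_congr fun i => ?_)
    by_cases hi : i ∈ Set.range e
    · simp [hi]
    · simp [hi, h0 i hi]

theorem iterated {F : ι × κ → Module.End ℂ V} {Fs : ι → Module.End ℂ V}
    (h : HasLocSum F L) (hs : ∀ i, HasLocSum (fun j => F (i, j)) (Fs i)) : HasLocSum Fs L := by
  refine fun v => ⟨((h v).1.image Prod.fst).subset fun i hi => ?_, ?_⟩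
  · by_contra hn
    refine hi ?_
    simp only [(hs i v).2]
    refine finsum_eq_zero_of_forall_eq_zero fun j => ?_
    by_contra hj
    exact hn ⟨(i, j), hj, rfl⟩
  · rw [(h v).2, finsum_curry _ (h v).1]
    exact finsum_congr fun i => (hs i v).2.symm

/-- Fubini in the less innocent direction. Local finiteness of the inner and outer sums does not
imply that of the double family, so it is required separately; the joint sum then exists and
`iterated` identifies it. -/
theorem of_iterated {F : ι × κ → Module.End ℂ V} {Fs : ι → Module.End ℂ V}
    (hF : ∀ v, (Function.support fun x => F x v).Finite)
    (hs : ∀ i, HasLocSum (fun j => F (i, j)) (Fs i)) (h : HasLocSum Fs L) : HasLocSum F L := by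
  have h1 := of_finite hF
  rwa [(h1.iterated hs).unique h] at h1

theorem of_finset [DecidableEq ι] (s : Finset ι) (h0 : ∀ i, i ∉ s → f i = 0) :
    HasLocSum f (∑ i ∈ s, f i) := by
  have hs : ∀ v, (Function.support fun i => f i v) ⊆ s := by
    intro v i hi
    by_contra hn
    exact hi (by simp [h0 i hn])
  refine fun v => ⟨s.finite_toSet.subset (hs v), ?_⟩
  rw [finsum_eq_sum_of_support_subset _ (hs v), LinearMap.sum_apply]

theorem single [DecidableEq ι] (i : ι) (h0 : ∀ j, j ≠ i → f j = 0) : HasLocSum f (f i) := by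
  have h := of_finset (f := f) {i} fun j hj => h0 j (by simpa using hj)
  rwa [Finset.sum_singleton] at h

end HasLocSum

end LocallyFiniteSums

/-! ### Bilinearity of the product read on left or right modules. -/

section SideMul

variable {V : Type*} [AddCommGroup V] [Module ℂ V] (S : Side) (a b c : Module.End ℂ V)

theorem Side.mul_assoc : S.mul (S.mul a b) c = S.mul a (S.mul b c) := by
  cases S <;> simp [Side.mul, _root_.mul_assoc]

theorem Side.one_mul : S.mul 1 a = a := by cases S <;> simp [Side.mul]

theorem Side.mul_one : S.mul a 1 = a := by cases S <;> simp [Side.mul]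

theorem Side.zero_mul : S.mul 0 a = 0 := by cases S <;> simp [Side.mul]

theorem Side.mul_zero : S.mul a 0 = 0 := by cases S <;> simp [Side.mul]

theorem Side.add_mul : S.mul (a + b) c = S.mul a c + S.mul b c := by
  cases S <;> simp [Side.mul, _root_.mul_add, _root_.add_mul]

theorem Side.mul_add : S.mul a (b + c) = S.mul a b + S.mul a c := by
  cases S <;> simp [Side.mul, _root_.mul_add, _root_.add_mul]

theorem Side.sub_mul : S.mul (a - b) c = S.mul a c - S.mul b c := by
  cases S <;> simp [Side.mul, _root_.mul_sub, _root_.sub_mul]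

theorem Side.mul_sub : S.mul a (b - c) = S.mul a b - S.mul a c := by
  cases S <;> simp [Side.mul, _root_.mul_sub, _root_.sub_mul]

theorem Side.smul_mul (x : ℂ) : S.mul (x • a) b = x • S.mul a b := by
  cases S <;> simp [Side.mul]

theorem Side.mul_smul (x : ℂ) : S.mul a (x • b) = x • S.mul a b := by
  cases S <;> simp [Side.mul]

theorem Side.sum_mul {ι : Type*} (s : Finset ι) (f : ι → Module.End ℂ V) :
    S.mul (∑ i ∈ s, f i) a = ∑ i ∈ s, S.mul (f i) a := by
  cases S <;> simp [Side.mul, Finset.sum_mul, Finset.mul_sum]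

theorem Side.mul_sum {ι : Type*} (s : Finset ι) (f : ι → Module.End ℂ V) :
    S.mul a (∑ i ∈ s, f i) = ∑ i ∈ s, S.mul a (f i) := by
  cases S <;> simp [Side.mul, Finset.sum_mul, Finset.mul_sum]

end SideMul

/-! ### Exponentials of power series over a noncommutative algebra. -/

section ExpSeries

open PowerSeries

variable {R : Type*} [Ring R]

/-- The Euler derivation `x d/dx`. -/
def euler (F : PowerSeries R) : PowerSeries R := PowerSeries.mk fun n => (n : R) * coeff n F

theorem coeff_euler (F : PowerSeries R) (n : ℕ) : coeff n (euler F) = (n : R) * coeff n F := by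
  simp [euler]

theorem euler_add (F G : PowerSeries R) : euler (F + G) = euler F + euler G := by
  ext n; simp [coeff_euler, mul_add]

theorem euler_mul (F G : PowerSeries R) : euler (F * G) = euler F * G + F * euler G := by
  ext n
  simp only [coeff_euler, coeff_mul, map_add, ← Finset.sum_add_distrib, Finset.mul_sum]
  refine Finset.sum_congr rfl fun x hx => ?_
  rw [← Finset.HasAntidiagonal.mem_antidiagonal.1 hx]
  push_cast
  rw [add_mul, mul_assoc, ← mul_assoc (coeff x.1 F), ← (Nat.cast_commute x.2 (coeff x.1 F)).eq,
    mul_assoc]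

theorem euler_pow (F : PowerSeries R) (h : Commute F (euler F)) (r : ℕ) :
    euler (F ^ (r + 1)) = (r + 1 : PowerSeries R) * (euler F * F ^ r) := by
  induction r with
  | zero => simp
  | succ r ih =>
    rw [pow_succ (n := r + 1), euler_mul, ih, ((h.pow_left (r + 1)).eq)]
    rw [mul_assoc, mul_assoc, ← pow_succ]
    push_cast
    noncomm_ring

/-- As F has no constant term, comparison of coefficients gives n E_n = ∑ F_i E_{n-i} over i ≥ 1, a
recursion that determines E from its constant term. All identities between exponentials below are
instances of this uniqueness. -/
theorem euler_unique [Algebra ℂ R] {F E E' : PowerSeries R} (h0 : constantCoeff F = 0)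
    (hE : euler E = F * E) (hE' : euler E' = F * E')
    (h : constantCoeff E = constantCoeff E') : E = E' := by
  ext n
  induction n using Nat.strong_induction_on with
  | _ n ih =>
    rcases Nat.eq_zero_or_pos n with rfl | hn
    · simpa using h
    · have h1 := congrArg (coeff n) hE
      have h2 := congrArg (coeff n) hE'
      rw [coeff_euler, coeff_mul] at h1 h2
      have h3 : (n : R) * coeff n E = (n : R) * coeff n E' := by
        rw [h1, h2]
        refine Finset.sum_congr rfl fun x hx => ?_
        rcases Nat.eq_zero_or_pos x.1 with hx0 | hx0
        · rw [hx0, coeff_zero_eq_constantCoeff, h0, zero_mul, zero_mul]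
        · rw [ih x.2 (by have := Finset.HasAntidiagonal.mem_antidiagonal.1 hx; omega)]
      have hn' : (n : ℂ) ≠ 0 := by exact_mod_cast hn.ne'
      have h4 : ∀ y : R, ((n : ℂ)⁻¹) • ((n : R) * y) = y := by
        intro y
        rw [← Nat.cast_smul_eq_nsmul ℂ n y |>.trans (nsmul_eq_mul n y), smul_smul,
          inv_mul_cancel₀ hn', one_smul]
      rw [← h4 (coeff n E), h3, h4]

theorem coeff_pow_eq_zero {F : PowerSeries R} (h0 : constantCoeff F = 0) {n r : ℕ} (h : n < r) :
    coeff n (F ^ r) = 0 := by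
  have hX : F = X * PowerSeries.mk fun p => coeff (p + 1) F := by
    have := PowerSeries.sub_const_eq_X_mul_shift F
    simpa [h0] using this
  have : F ^ r = X ^ r * (PowerSeries.mk fun p => coeff (p + 1) F) ^ r := by
    conv_lhs => rw [hX]
    exact (PowerSeries.commute_X _).symm.mul_pow r
  rw [this, PowerSeries.coeff_X_pow_mul', if_neg (by omega)]

theorem commute_coeff {F : PowerSeries R} {x : R} (h : ∀ n, Commute x (coeff n F)) :
    Commute (C x) F := by
  ext n
  simp [(h n).eq]

theorem coeff_pow_commute {F : PowerSeries R} {x : R} (h : ∀ n, Commute x (coeff n F))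
    (r n : ℕ) : Commute x (coeff n (F ^ r)) := by
  have := congrArg (coeff n) ((commute_coeff h).pow_right r).eq
  rwa [coeff_C_mul, coeff_mul_C] at this

theorem commute_of_coeff {F G : PowerSeries R} (h : ∀ m n, Commute (coeff m F) (coeff n G)) :
    Commute F G := by
  ext n
  rw [coeff_mul, coeff_mul, ← Finset.Nat.sum_antidiagonal_swap]
  exact Finset.sum_congr rfl fun x _ => (h _ _).eq

theorem euler_C (x : R) : euler (C x) = 0 := by
  ext n
  rcases Nat.eq_zero_or_pos n with rfl | hn
  · simp [coeff_euler]
  · simp [coeff_euler, coeff_C, hn.ne']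

theorem euler_map {R' : Type*} [Ring R'] (φ : R →+* R') (F : PowerSeries R) :
    euler (F.map φ) = (euler F).map φ := by
  ext n
  simp [coeff_euler]

theorem constantCoeff_euler (F : PowerSeries R) : constantCoeff (euler F) = 0 := by
  rw [← coeff_zero_eq_constantCoeff_apply, coeff_euler]; simp

variable [Algebra ℂ R]

theorem coeff_csmul (c : ℂ) (F : PowerSeries R) (n : ℕ) : coeff n (c • F) = c • coeff n F := rfl

theorem coeff_expSeries {F : PowerSeries R} (h0 : constantCoeff F = 0) {n N : ℕ} (h : n < N) :
    coeff n (expSeries F) = ∑ r ∈ Finset.range N, ((r.factorial : ℂ)⁻¹) • coeff n (F ^ r) := by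
  rw [expSeries, coeff_mk]
  refine Finset.sum_subset (by intro x; simp; omega) fun r _ hr => ?_
  rw [coeff_pow_eq_zero h0 (by simpa using hr), smul_zero]

theorem constantCoeff_expSeries (F : PowerSeries R) : constantCoeff (expSeries F) = 1 := by
  rw [← coeff_zero_eq_constantCoeff_apply, expSeries, coeff_mk]
  simp

theorem expSeries_commute {F : PowerSeries R} {x : R} (h : ∀ n, Commute x (coeff n F)) (n : ℕ) :
    Commute x (coeff n (expSeries F)) := by
  rw [expSeries, coeff_mk]
  exact Commute.sum_right _ _ _ fun r _ => (coeff_pow_commute h r n).smul_right _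

/-- Commutativity of the coefficients of F permits the rule x d/dx F^{r+1} = (r+1) (x dF/dx) F^r;
division by (r+1)! shifts the exponential series by one term. -/
theorem euler_expSeries {F : PowerSeries R} (h0 : constantCoeff F = 0)
    (h : ∀ m n, Commute (coeff m F) (coeff n F)) :
    euler (expSeries F) = euler F * expSeries F := by
  have hc : Commute F (euler F) := commute_of_coeff fun m n => by
    rw [coeff_euler]
    exact (Nat.cast_commute n _).symm.mul_right (h m n)
  ext n
  -- The left side is truncated after n + 2 terms, one more than needed: once r = 0 has been split
  -- off, the remaining n + 1 terms match those on the right.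
  rw [coeff_euler, coeff_expSeries h0 (Nat.lt_succ_of_lt (Nat.lt_succ_self n)), coeff_mul]
  have h1 : ∀ x ∈ Finset.HasAntidiagonal.antidiagonal n, coeff x.1 (euler F) * coeff x.2 (expSeries F) =
      ∑ r ∈ Finset.range (n + 1),
        ((r.factorial : ℂ)⁻¹) • (coeff x.1 (euler F) * coeff x.2 (F ^ r)) := by
    intro x hx
    rw [coeff_expSeries h0 (N := n + 1) (by have := Finset.HasAntidiagonal.mem_antidiagonal.1 hx; omega),
      Finset.mul_sum]
    exact Finset.sum_congr rfl fun r _ => mul_smul_comm _ _ _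
  rw [Finset.sum_congr rfl h1, Finset.sum_comm, Finset.sum_range_succ']
  have h2 : (n : R) * (((Nat.factorial 0 : ℂ)⁻¹) • coeff n (F ^ 0)) = 0 := by
    rcases Nat.eq_zero_or_pos n with rfl | hn
    · simp
    · simp [coeff_one, hn.ne']
  rw [mul_add, h2, add_zero, Finset.mul_sum]
  refine Finset.sum_congr rfl fun r _ => ?_
  rw [← Finset.smul_sum, ← coeff_mul, mul_smul_comm, ← coeff_euler, euler_pow F hc]
  have h3 : (r + 1 : PowerSeries R) * (euler F * F ^ r) = (r + 1 : ℕ) • (euler F * F ^ r) := by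
    rw [nsmul_eq_mul]; push_cast; rfl
  rw [h3, map_nsmul, ← Nat.cast_smul_eq_nsmul ℂ, smul_smul]
  congr 1
  have : (r.factorial : ℂ) ≠ 0 := by exact_mod_cast r.factorial_ne_zero
  have h' : ((r : ℂ) + 1) ≠ 0 := by exact_mod_cast r.succ_ne_zero
  rw [Nat.factorial_succ]
  push_cast
  field_simp

theorem expSeries_eq_of_euler {F E : PowerSeries R} (h0 : constantCoeff F = 0)
    (h : ∀ m n, Commute (coeff m F) (coeff n F)) (hE : euler E = euler F * E)
    (h1 : constantCoeff E = 1) : E = expSeries F := by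
  refine euler_unique (F := euler F) ?_ hE (euler_expSeries h0 h) ?_
  · rw [← coeff_zero_eq_constantCoeff_apply, coeff_euler]; simp
  · rw [h1, constantCoeff_expSeries]

/-- The product solves the Euler equation of the sum because `expSeries F` can be moved past `euler
G`. -/
theorem expSeries_add {F G : PowerSeries R} (hF : constantCoeff F = 0) (hG : constantCoeff G = 0)
    (hFF : ∀ m n, Commute (coeff m F) (coeff n F)) (hGG : ∀ m n, Commute (coeff m G) (coeff n G))
    (hFG : ∀ m n, Commute (coeff m F) (coeff n G)) :
    expSeries (F + G) = expSeries F * expSeries G := by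
  symm
  refine expSeries_eq_of_euler (by simp [hF, hG]) ?_ ?_ ?_
  · intro m n
    simp only [map_add]
    exact ((hFF m n).add_right (hFG m n)).add_left ((hFG n m).symm.add_right (hGG m n))
  · rw [euler_mul, euler_add, euler_expSeries hF hFF, euler_expSeries hG hGG, add_mul, mul_assoc,
      ← mul_assoc (expSeries F)]
    have : Commute (expSeries F) (euler G) := commute_of_coeff fun m n => by
      rw [coeff_euler]
      exact (Nat.cast_commute n _).symm.mul_right
        (expSeries_commute (fun j => (hFG j n).symm) m).symm
    rw [this.eq, mul_assoc]
  · simp [constantCoeff_expSeries]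

theorem smul_X_pow_commute (c : ℂ) (m : ℕ) (F : PowerSeries R) :
    Commute (c • (X : PowerSeries R) ^ m) F :=
  ((PowerSeries.commute_X F).symm.pow_left m).smul_left c

/-- If [x, G] is the central monomial c X^m, then the defect in [x, exp G] = c X^m exp G satisfies
the Euler equation of exp G. Its constant term vanishes because m ≠ 0, so the defect is zero. -/
theorem C_mul_expSeries {G : PowerSeries R} {x : R} {c : ℂ} {m : ℕ} (hm : m ≠ 0)
    (hG : constantCoeff G = 0)
    (hGG : ∀ m n, Commute (coeff m G) (coeff n G))
    (h : C x * G = G * C x + c • (X : PowerSeries R) ^ m) :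
    C x * expSeries G = expSeries G * C x + c • ((X : PowerSeries R) ^ m * expSeries G) := by
  have hX : euler ((X : PowerSeries R) ^ m) = (m : PowerSeries R) * X ^ m := by
    ext n
    have : (m : PowerSeries R) = C (m : R) := by simp
    rw [coeff_euler, this, coeff_C_mul, coeff_X_pow]
    split_ifs with hn
    · rw [hn]
    · simp
  have hsm : ∀ F : PowerSeries R, euler (c • F) = c • euler F := by
    intro F; ext n; simp [coeff_euler]
  have hxG : C x * euler G = euler G * C x + c • ((m : PowerSeries R) * X ^ m) := by
    have := congrArg euler h
    rwa [euler_mul, euler_C, zero_mul, zero_add, euler_add, euler_mul, euler_C, mul_zero,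
      add_zero, hsm, hX] at this
  have hE := euler_expSeries hG hGG
  have key : C x * expSeries G - expSeries G * C x - c • ((X : PowerSeries R) ^ m * expSeries G)
      = 0 := by
    refine euler_unique (F := euler G) (constantCoeff_euler G) ?_ (by ext n; simp [coeff_euler]) ?_
    · have hs : ∀ F F' : PowerSeries R, euler (F - F') = euler F - euler F' := by
        intro F F'; ext n; simp [coeff_euler, mul_sub]
      rw [hs, hs, hsm, euler_mul, euler_mul, euler_mul, euler_C, hE, hX, zero_mul, zero_add,
        mul_zero, add_zero, ← mul_assoc (C x), hxG, add_mul, mul_sub, mul_sub, mul_assoc, mul_assoc,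
        mul_smul_comm, ← mul_assoc (X ^ m), ← mul_assoc (euler G) (X ^ m),
        ((PowerSeries.commute_X (euler G)).symm.pow_left m).eq, smul_add, smul_mul_assoc]
      abel
    · simp [hm]
      rw [constantCoeff_expSeries]; simp
  rw [sub_sub, sub_eq_zero] at key
  exact key

/-- The commutation of the exponentials of two families with central commutators. -/
theorem expSeries_exchange {F G : PowerSeries R} (γ : PowerSeries ℂ)
    (hF : constantCoeff F = 0) (hG : constantCoeff G = 0) (hγ : constantCoeff γ = 0)
    (hFF : ∀ m n, Commute (coeff m F) (coeff n F)) (hGG : ∀ m n, Commute (coeff m G) (coeff n G))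
    (hFG : ∀ m n, coeff m F * coeff n G = coeff n G * coeff m F +
      if m = n then algebraMap ℂ R (coeff m γ) else 0) (a b : ℕ) :
    coeff b (expSeries F) * coeff a (expSeries G) =
      ∑ l ∈ Finset.range (b + 1), if l ≤ a then
        coeff l (expSeries γ) • (coeff (a - l) (expSeries G) * coeff (b - l) (expSeries F))
      else 0 := by
  -- Generating functions in two variables: the outer variable carries the coefficients of
  -- `expSeries F`, the inner one those of `expSeries G`, and `K` is the exponential of γ evaluated
  -- at the product of the two variables.
  let EF : PowerSeries (PowerSeries R) := (expSeries F).map C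
  let EG : PowerSeries (PowerSeries R) := C (expSeries G)
  let K : PowerSeries (PowerSeries R) :=
    PowerSeries.mk fun l => coeff l (expSeries γ) • (X : PowerSeries R) ^ l
  let Γ : PowerSeries (PowerSeries R) :=
    PowerSeries.mk fun l => coeff l (euler γ) • (X : PowerSeries R) ^ l
  let Φ : PowerSeries (PowerSeries R) := (euler F).map C
  have hK : euler K = Γ * K := by
    have h := euler_expSeries hγ fun m n => Commute.all _ _
    ext1 n
    have hn := congrArg (coeff n) h
    rw [coeff_euler, coeff_mul] at hn
    rw [coeff_euler, coeff_mul]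
    simp only [K, Γ, coeff_mk]
    have e1 : ((n : PowerSeries R) * (coeff n (expSeries γ) • (X : PowerSeries R) ^ n)) =
        ((n : ℂ) * coeff n (expSeries γ)) • (X : PowerSeries R) ^ n := by
      rw [mul_smul, Nat.cast_smul_eq_nsmul ℂ, nsmul_eq_mul]
    rw [e1, hn, Finset.sum_smul]
    refine Finset.sum_congr rfl fun x hx => ?_
    rw [smul_mul_smul_comm, ← pow_add, Finset.HasAntidiagonal.mem_antidiagonal.1 hx]
  have hΓc : ∀ P : PowerSeries (PowerSeries R), Commute Γ P := fun P =>
    commute_of_coeff fun m n => by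
      simp only [Γ, coeff_mk]
      exact smul_X_pow_commute _ _ _
  have hEF : euler EF = Φ * EF := by
    simp only [EF, Φ]
    rw [euler_map, euler_expSeries hF hFF, map_mul]
  have hΦ : Φ * EG = EG * Φ + Γ * EG := by
    ext1 m
    simp only [EG, Φ, Γ, coeff_mul_C, coeff_C_mul, map_add, coeff_map, coeff_mk, coeff_euler]
    rcases Nat.eq_zero_or_pos m with rfl | hm
    · simp
    rw [map_mul, map_natCast, mul_assoc,
      C_mul_expSeries (x := coeff m F) (c := coeff m γ) hm.ne' hG hGG ?_]
    · rw [mul_add, smul_mul_assoc, ← mul_assoc, ← mul_assoc,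
        (Nat.cast_commute m (expSeries G)).eq]
      congr 1
      rw [mul_smul, Nat.cast_smul_eq_nsmul ℂ, nsmul_eq_mul]
    · ext1 n
      rw [coeff_C_mul, hFG, map_add, coeff_mul_C, coeff_csmul, coeff_X_pow]
      congr 1
      by_cases h : m = n
      · simp [h, Algebra.algebraMap_eq_smul_one]
      · simp [h, Ne.symm h]
  -- Both sides solve the same Euler equation in the outer variable: moving Φ through EG produces
  -- exactly the central factor Γ, which is the logarithmic derivative of K.
  have main : EF * EG = EG * EF * K := by
    refine euler_unique (F := Φ) ?_ ?_ ?_ ?_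
    · simp only [Φ]
      rw [← coeff_zero_eq_constantCoeff_apply, coeff_map, coeff_euler]; simp
    · rw [euler_mul, hEF]
      simp only [EG]
      rw [euler_C, mul_zero, add_zero, mul_assoc]
    · have hEG : euler EG = 0 := euler_C _
      rw [euler_mul, euler_mul, hEF, hEG, zero_mul, zero_add, hK, ← mul_assoc EG, ← mul_assoc Φ,
        ← mul_assoc Φ, hΦ, add_mul, add_mul, ← mul_assoc (EG * EF), ← (hΓc (EG * EF)).eq,
        mul_assoc Γ EG EF]
    · simp only [map_mul, EF, EG, K]
      rw [← coeff_zero_eq_constantCoeff_apply, ← coeff_zero_eq_constantCoeff_apply,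
        ← coeff_zero_eq_constantCoeff_apply, coeff_map, coeff_zero_C, coeff_mk,
        coeff_zero_eq_constantCoeff_apply, constantCoeff_expSeries, coeff_zero_eq_constantCoeff_apply,
        constantCoeff_expSeries]
      simp
  have h := congrArg (coeff a) (congrArg (coeff b) main)
  simp only [EF, EG, K] at h
  rw [coeff_mul_C, coeff_map, coeff_C_mul, mul_assoc, coeff_C_mul, coeff_mul b,
    Finset.Nat.sum_antidiagonal_eq_sum_range_succ_mk, Finset.mul_sum, map_sum] at h
  -- The antidiagonal sum runs over the index of EF; reflection replaces it by the number l of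
  -- contracted modes.
  rw [h, ← Finset.sum_range_reflect]
  refine Finset.sum_congr rfl fun l hl => ?_
  have hl' : l ≤ b := by simpa [Nat.lt_succ_iff] using hl
  have e1 : b.succ - 1 - l = b - l := by omega
  have e2 : b - (b - l) = l := by omega
  simp only [coeff_map, coeff_mk, e1, e2]
  rw [mul_smul_comm, mul_smul_comm, coeff_csmul, ← mul_assoc, coeff_mul_X_pow']
  split_ifs with h1
  · rw [coeff_mul_C]
  · rw [smul_zero]

end ExpSeries

end

section

/-! ### Coefficients indexed by all integers. -/

section ZeroExtension

open PowerSeries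

/-- Extension of a sequence by zero to negative indices. -/
def zext {M : Type*} [Zero M] (f : ℕ → M) (i : ℤ) : M := if 0 ≤ i then f i.toNat else 0

variable {M : Type*}

theorem zext_natCast [Zero M] (f : ℕ → M) (n : ℕ) : zext f n = f n := by simp [zext]

theorem zext_of_neg [Zero M] (f : ℕ → M) {i : ℤ} (h : i < 0) : zext f i = 0 := by
  simp [zext, not_le.2 h]

theorem nonneg_of_zext_ne_zero [Zero M] {f : ℕ → M} {i : ℤ} (h : zext f i ≠ 0) : 0 ≤ i := by
  by_contra hn
  exact h (zext_of_neg f (not_le.1 hn))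

variable {V : Type*} [AddCommGroup V] [Module ℂ V]

/-- With coefficients extended by zero, the bounds l ≤ a and l ≤ b need not be written: terms
outside them vanish, and for negative a or b both sides are zero. Later substitutions of indices can
therefore be bijections of ℤ. -/
theorem hasLocSum_zext_exchange {F G : PowerSeries (Module.End ℂ V)} (γ : PowerSeries ℂ)
    (hF : constantCoeff F = 0) (hG : constantCoeff G = 0) (hγ : constantCoeff γ = 0)
    (hFF : ∀ m n, Commute (coeff m F) (coeff n F)) (hGG : ∀ m n, Commute (coeff m G) (coeff n G))
    (hFG : ∀ m n, coeff m F * coeff n G = coeff n G * coeff m F +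
      if m = n then algebraMap ℂ (Module.End ℂ V) (coeff m γ) else 0) (a b : ℤ) :
    HasLocSum (fun l : ℤ => zext (fun n => coeff n (expSeries γ)) l •
        (zext (fun n => coeff n (expSeries G)) (a - l) *
          zext (fun n => coeff n (expSeries F)) (b - l)))
      (zext (fun n => coeff n (expSeries F)) b * zext (fun n => coeff n (expSeries G)) a) := by
  by_cases hab : 0 ≤ a ∧ 0 ≤ b
  · obtain ⟨⟨a, rfl⟩, ⟨b, rfl⟩⟩ := And.intro (Int.eq_ofNat_of_zero_le hab.1)
      (Int.eq_ofNat_of_zero_le hab.2)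
    have h := expSeries_exchange γ hF hG hγ hFF hGG hFG a b
    rw [zext_natCast, zext_natCast, h]
    refine HasLocSum.of_comp_injective (e := ((↑) : ℕ → ℤ)) Nat.cast_injective ?_ ?_
    · refine (HasLocSum.of_finset (Finset.range (b + 1)) fun l hl => ?_).congr (fun l => rfl) ?_
      · rw [zext_of_neg (i := (b : ℤ) - l) _ (by simp at hl; omega), mul_zero, smul_zero]
      · refine Finset.sum_congr rfl fun l hl => ?_
        have hl' : l ≤ b := by simpa [Nat.lt_succ_iff] using hl
        split_ifs with h1
        · rw [zext_natCast, ← Nat.cast_sub hl', ← Nat.cast_sub h1, zext_natCast, zext_natCast]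
        · rw [zext_of_neg (i := (a : ℤ) - l) _ (by omega), zero_mul, smul_zero]
    · intro l hl
      have : l < 0 := by
        by_contra hn
        exact hl ⟨l.toNat, by simp at hn; simpa using hn⟩
      rw [zext_of_neg _ this, zero_smul]
  · have h0 : ∀ l : ℤ, zext (fun n => coeff n (expSeries γ)) l •
        (zext (fun n => coeff n (expSeries G)) (a - l) *
          zext (fun n => coeff n (expSeries F)) (b - l)) = 0 := by
      intro l
      by_cases hl : 0 ≤ l
      · rcases not_and_or.1 hab with h | h
        · rw [zext_of_neg (i := a - l) _ (by omega), zero_mul, smul_zero]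
        · rw [zext_of_neg (i := b - l) _ (by omega), mul_zero, smul_zero]
      · rw [zext_of_neg _ (not_le.1 hl), zero_smul]
    refine HasLocSum.zero.congr (fun l => (h0 l).symm) ?_
    rcases not_and_or.1 hab with h | h
    · rw [zext_of_neg (i := a) _ (by omega), mul_zero]
    · rw [zext_of_neg (i := b) _ (by omega), zero_mul]

theorem hasLocSum_zext_mul (P Q : PowerSeries (Module.End ℂ V)) (n : ℤ) :
    HasLocSum (fun a : ℤ => zext (fun n => coeff n P) a * zext (fun n => coeff n Q) (n - a))
      (zext (fun n => coeff n (P * Q)) n) := by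
  by_cases hn : 0 ≤ n
  · obtain ⟨n, rfl⟩ := Int.eq_ofNat_of_zero_le hn
    rw [zext_natCast, coeff_mul, Finset.Nat.sum_antidiagonal_eq_sum_range_succ_mk]
    refine HasLocSum.of_comp_injective (e := ((↑) : ℕ → ℤ)) Nat.cast_injective ?_ ?_
    · refine (HasLocSum.of_finset (Finset.range (n + 1)) fun l hl => ?_).congr (fun l => rfl) ?_
      · rw [zext_of_neg (i := (n : ℤ) - l) _ (by simp at hl; omega), mul_zero]
      · refine Finset.sum_congr rfl fun l hl => ?_
        have hl' : l ≤ n := by simpa [Nat.lt_succ_iff] using hl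
        rw [zext_natCast, ← Nat.cast_sub hl', zext_natCast]
    · intro l hl
      have : l < 0 := by
        by_contra hn
        exact hl ⟨l.toNat, by simp at hn; simpa using hn⟩
      rw [zext_of_neg _ this, zero_mul]
  · refine HasLocSum.zero.congr (fun l => ?_) (zext_of_neg _ (not_le.1 hn)).symm
    by_cases hl : 0 ≤ l
    · rw [zext_of_neg (i := n - l) _ (by omega), mul_zero]
    · rw [zext_of_neg (i := l) _ (not_le.1 hl), zero_mul]

end ZeroExtension

/-! ### Creation and annihilation parts of vertex operators. -/

section Oscillators

open PowerSeries

variable (ħ k : ℂ) (S : Side)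

theorem heisNeg_commute (i i' : Boson) (j j' : ℕ) :
    Commute (heisNeg ħ k S i j) (heisNeg ħ k S i' j') := by
  cases S
  · refine LinearMap.ext fun f => ?_
    simp only [heisNeg, Module.End.mul_apply, LinearMap.mulLeft_apply]
    exact mul_left_comm _ _ _
  · refine (Commute.smul_left ?_ _).smul_right _
    refine LinearMap.ext fun f => ?_
    -- The commutator of two derivations is a derivation, so it suffices that it kills the
    -- variables.
    have h : ⁅(MvPolynomial.pderiv (i, j) : Derivation ℂ Osc Osc),
        (MvPolynomial.pderiv (i', j') : Derivation ℂ Osc Osc)⁆ = 0 := by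
      refine MvPolynomial.derivation_ext fun x => ?_
      rw [Derivation.commutator_apply, MvPolynomial.pderiv_X, MvPolynomial.pderiv_X,
        Pi.single_apply, Pi.single_apply]
      split_ifs <;> simp
    have h' := congrArg (fun D : Derivation ℂ Osc Osc => D f) h
    simp only [Derivation.commutator_apply, Derivation.zero_apply] at h'
    exact sub_eq_zero.1 h'

/-- Passing to the other side interchanges multiplication and differentiation, so facts about
annihilators are facts about creators on the opposite side. -/
theorem heisPos_eq (S : Side) (i : Boson) (j : ℕ) : heisPos ħ k S i j =
    heisNeg ħ k (match S with | .left => .right | .right => .left) i j := by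
  cases S <;> rfl

theorem heisPos_commute (i i' : Boson) (j j' : ℕ) :
    Commute (heisPos ħ k S i j) (heisPos ħ k S i' j') := by
  rw [heisPos_eq, heisPos_eq]
  exact heisNeg_commute _ _ _ _ _ _ _

theorem pderiv_mulLeft (x y : Boson × ℕ) (c : ℂ) :
    (c • (MvPolynomial.pderiv x).toLinearMap : Module.End ℂ Osc) *
        LinearMap.mulLeft ℂ (MvPolynomial.X y) =
      LinearMap.mulLeft ℂ (MvPolynomial.X y) * (c • (MvPolynomial.pderiv x).toLinearMap) +
        if x = y then algebraMap ℂ (Module.End ℂ Osc) c else 0 := by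
  refine LinearMap.ext fun f => ?_
  simp only [Module.End.mul_apply, LinearMap.smul_apply, LinearMap.mulLeft_apply,
    LinearMap.add_apply, Derivation.coeFn_coe, Derivation.leibniz, MvPolynomial.pderiv_X,
    smul_eq_mul]
  by_cases h : x = y
  · subst h
    simp [Algebra.algebraMap_eq_smul_one]
  · rw [if_neg h, Pi.single_eq_of_ne (Ne.symm h)]
    simp

/-- On a right module the order of composition and the roles of multiplication and differentiation
are reversed simultaneously, so the Heisenberg relation keeps its form. This is what allows one
proof for both sides. -/
theorem heis_side_comm (i i' : Boson) (j j' : ℕ) :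
    S.mul (heisPos ħ k S i j) (heisNeg ħ k S i' j') =
      S.mul (heisNeg ħ k S i' j') (heisPos ħ k S i j) +
        if (i, j) = (i', j') then algebraMap ℂ (Module.End ℂ Osc) (heisComm ħ k i (j + 1))
        else 0 := by
  cases S
  · exact pderiv_mulLeft (i, j) (i', j') _
  · refine (pderiv_mulLeft (i', j') (i, j) _).trans ?_
    congr 1
    by_cases h : (i, j) = (i', j')
    · rw [if_pos h, if_pos h.symm]
      cases h
      rfl
    · rw [if_neg h, if_neg (Ne.symm h)]

/-- The exponent of the creation part of a vertex operator. -/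
def negSeries (A : Vertex) : PowerSeries (Module.End ℂ Osc) := PowerSeries.mk fun
  | 0 => 0
  | j + 1 => ∑ i, A.osc i (-(j + 1)) • heisNeg ħ k S i j

/-- The exponent of the annihilation part of a vertex operator. -/
def posSeries (A : Vertex) : PowerSeries (Module.End ℂ Osc) := PowerSeries.mk fun
  | 0 => 0
  | j + 1 => ∑ i, A.osc i (j + 1) • heisPos ħ k S i j

/-- The coefficients `∑ᵢ [A's coefficient of a_{i,m}, B's coefficient of a_{i,-m}]`. -/
def contrCoeff (A B : Vertex) (j : ℕ) : ℂ :=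
  ∑ i, A.osc i (j + 1) * B.osc i (-(j + 1)) * heisComm ħ k i (j + 1)

/-- A power series without constant term with given coefficients. -/
def shiftSeries (γ : ℕ → ℂ) : PowerSeries ℂ := PowerSeries.mk fun
  | 0 => 0
  | j + 1 => γ j

/-- The contraction function `exp ⟨A(z) B(w)⟩` as a power series in `w / z`. -/
def contr (A B : Vertex) : PowerSeries ℂ := expSeries (shiftSeries (contrCoeff ħ k A B))

theorem constantCoeff_negSeries (A : Vertex) : constantCoeff (negSeries ħ k S A) = 0 := by
  rw [← coeff_zero_eq_constantCoeff_apply, negSeries, coeff_mk]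

theorem constantCoeff_posSeries (A : Vertex) : constantCoeff (posSeries ħ k S A) = 0 := by
  rw [← coeff_zero_eq_constantCoeff_apply, posSeries, coeff_mk]

theorem constantCoeff_shiftSeries (γ : ℕ → ℂ) : constantCoeff (shiftSeries γ) = 0 := by
  rw [← coeff_zero_eq_constantCoeff_apply, shiftSeries, coeff_mk]

theorem negSeries_commute (A B : Vertex) (m n : ℕ) :
    Commute (coeff m (negSeries ħ k S A)) (coeff n (negSeries ħ k S B)) := by
  rcases m with _ | m <;> rcases n with _ | n <;> simp only [negSeries, coeff_mk]
  · exact Commute.zero_left _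
  · exact Commute.zero_left _
  · exact Commute.zero_right _
  · exact Commute.sum_left _ _ _ fun i _ => Commute.sum_right _ _ _ fun i' _ =>
      ((heisNeg_commute ħ k S i i' m n).smul_left _).smul_right _

theorem posSeries_commute (A B : Vertex) (m n : ℕ) :
    Commute (coeff m (posSeries ħ k S A)) (coeff n (posSeries ħ k S B)) := by
  rcases m with _ | m <;> rcases n with _ | n <;> simp only [posSeries, coeff_mk]
  · exact Commute.zero_left _
  · exact Commute.zero_left _
  · exact Commute.zero_right _
  · exact Commute.sum_left _ _ _ fun i _ => Commute.sum_right _ _ _ fun i' _ =>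
      ((heisPos_commute ħ k S i i' m n).smul_left _).smul_right _

theorem series_side_comm (A B : Vertex) (m n : ℕ) :
    S.mul (coeff m (posSeries ħ k S A)) (coeff n (negSeries ħ k S B)) =
      S.mul (coeff n (negSeries ħ k S B)) (coeff m (posSeries ħ k S A)) +
        if m = n then algebraMap ℂ (Module.End ℂ Osc)
          (coeff m (shiftSeries (contrCoeff ħ k A B))) else 0 := by
  rcases m with _ | m <;> rcases n with _ | n <;>
    simp only [negSeries, posSeries, shiftSeries, coeff_mk]
  · simp [Side.zero_mul]
  · simp [Side.zero_mul, Side.mul_zero]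
  · simp [Side.zero_mul, Side.mul_zero]
  · simp only [Side.sum_mul, Side.mul_sum, Side.smul_mul, Side.mul_smul, heis_side_comm]
    simp only [Finset.smul_sum]
    rw [Finset.sum_comm]
    have h : ∀ i i' : Boson, B.osc i' (-(↑n + 1)) • A.osc i (↑m + 1) •
        (S.mul (heisNeg ħ k S i' n) (heisPos ħ k S i m) + if (i, m) = (i', n) then
          algebraMap ℂ (Module.End ℂ Osc) (heisComm ħ k i (↑m + 1)) else 0) =
        A.osc i (↑m + 1) • B.osc i' (-(↑n + 1)) •
          S.mul (heisNeg ħ k S i' n) (heisPos ħ k S i m) +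
        if i = i' then (if m = n then algebraMap ℂ (Module.End ℂ Osc)
          (A.osc i (m + 1) * B.osc i (-(m + 1)) * heisComm ħ k i (m + 1)) else 0) else 0 := by
      intro i i'
      rw [smul_add, smul_add, smul_comm]
      congr 1
      by_cases h1 : i = i'
      · subst h1
        by_cases h2 : m = n
        · subst h2
          simp [Algebra.algebraMap_eq_smul_one, smul_smul, mul_left_comm, mul_assoc]
        · simp [h2]
      · simp [h1]
    simp only [h, Finset.sum_add_distrib, Finset.sum_ite_eq, Finset.mem_univ, if_true]
    congr 1
    by_cases h2 : m = n
    · subst h2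
      simp [contrCoeff]
    · simp [h2]

/-- The creation part of a vertex operator, with integer index. -/
def crZ (A : Vertex) : ℤ → Module.End ℂ Osc := zext (creation ħ k S A)

/-- The annihilation part of a vertex operator, with integer index. -/
def anZ (A : Vertex) : ℤ → Module.End ℂ Osc := zext (annihilation ħ k S A)

/-- The coefficients of the contraction function, with integer index. -/
def contrZ (A B : Vertex) : ℤ → ℂ := zext fun n => coeff n (contr ħ k A B)

theorem crZ_eq (A : Vertex) :
    crZ ħ k S A = zext fun n => coeff n (expSeries (negSeries ħ k S A)) := rfl

theorem anZ_eq (A : Vertex) :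
    anZ ħ k S A = zext fun n => coeff n (expSeries (posSeries ħ k S A)) := rfl

theorem hasLocSum_exchange (A B : Vertex) (a b : ℤ) :
    HasLocSum (fun l : ℤ => contrZ ħ k A B l •
        S.mul (crZ ħ k S B (a - l)) (anZ ħ k S A (b - l)))
      (S.mul (anZ ħ k S A b) (crZ ħ k S B a)) := by
  have h := series_side_comm ħ k S A B
  cases S
  · exact hasLocSum_zext_exchange _ (constantCoeff_posSeries _ _ _ _)
      (constantCoeff_negSeries _ _ _ _) (constantCoeff_shiftSeries _)
      (posSeries_commute _ _ _ _ _) (negSeries_commute _ _ _ _ _) h a b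
  -- For the reversed product the creation series takes the role of F and the annihilation series
  -- that of G; a and b are interchanged accordingly.
  · refine hasLocSum_zext_exchange (shiftSeries (contrCoeff ħ k A B))
      (constantCoeff_negSeries _ _ _ _)
      (constantCoeff_posSeries _ _ _ _) (constantCoeff_shiftSeries _)
      (negSeries_commute _ _ _ _ _) (posSeries_commute _ _ _ _ _) (fun m n => ?_) b a
    refine (h n m).trans ?_
    congr 1
    by_cases hmn : m = n
    · subst hmn; rfl
    · rw [if_neg hmn, if_neg (Ne.symm hmn)]

theorem zext_commute {V : Type*} [AddCommGroup V] [Module ℂ V] {f g : ℕ → Module.End ℂ V}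
    (h : ∀ m n, Commute (f m) (g n)) (i j : ℤ) : Commute (zext f i) (zext g j) := by
  unfold zext
  split_ifs
  exacts [h _ _, Commute.zero_right _, Commute.zero_left _, Commute.zero_left _]

theorem crZ_commute (A B : Vertex) (a b : ℤ) : Commute (crZ ħ k S A a) (crZ ħ k S B b) :=
  zext_commute (fun m n => expSeries_commute (fun n' => (expSeries_commute (fun m' =>
    negSeries_commute ħ k S B A n' m') m).symm) n) a b

theorem anZ_commute (A B : Vertex) (a b : ℤ) : Commute (anZ ħ k S A a) (anZ ħ k S B b) :=
  zext_commute (fun m n => expSeries_commute (fun n' => (expSeries_commute (fun m' =>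
    posSeries_commute ħ k S B A n' m') m).symm) n) a b

theorem Side.mul_comm_of {V : Type*} [AddCommGroup V] [Module ℂ V] {a b : Module.End ℂ V}
    (h : Commute a b) : S.mul a b = S.mul b a := by
  cases S
  exacts [h.eq, h.symm.eq]

theorem Side.mul_eq_of_commute {V : Type*} [AddCommGroup V] [Module ℂ V] {a b : Module.End ℂ V}
    (h : Commute a b) : S.mul a b = a * b := by
  cases S
  exacts [rfl, h.symm.eq]

theorem negSeries_nmul (A B : Vertex) :
    negSeries ħ k S (A.nmul B) = negSeries ħ k S A + negSeries ħ k S B := by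
  ext1 n
  rcases n with _ | n <;> simp [negSeries, Vertex.nmul, add_smul, Finset.sum_add_distrib]

theorem posSeries_nmul (A B : Vertex) :
    posSeries ħ k S (A.nmul B) = posSeries ħ k S A + posSeries ħ k S B := by
  ext1 n
  rcases n with _ | n <;> simp [posSeries, Vertex.nmul, add_smul, Finset.sum_add_distrib]

theorem hasLocSum_crZ_nmul (A B : Vertex) (n : ℤ) :
    HasLocSum (fun a => S.mul (crZ ħ k S A a) (crZ ħ k S B (n - a)))
      (crZ ħ k S (A.nmul B) n) := by
  have h := hasLocSum_zext_mul (expSeries (negSeries ħ k S A)) (expSeries (negSeries ħ k S B)) n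
  rw [← expSeries_add (constantCoeff_negSeries _ _ _ _) (constantCoeff_negSeries _ _ _ _)
    (negSeries_commute _ _ _ _ _) (negSeries_commute _ _ _ _ _) (negSeries_commute _ _ _ _ _),
    ← negSeries_nmul] at h
  exact h.congr (fun a => (S.mul_eq_of_commute (crZ_commute ħ k S A B _ _)).symm) rfl

theorem hasLocSum_anZ_nmul (A B : Vertex) (n : ℤ) :
    HasLocSum (fun a => S.mul (anZ ħ k S A a) (anZ ħ k S B (n - a)))
      (anZ ħ k S (A.nmul B) n) := by
  have h := hasLocSum_zext_mul (expSeries (posSeries ħ k S A)) (expSeries (posSeries ħ k S B)) n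
  rw [← expSeries_add (constantCoeff_posSeries _ _ _ _) (constantCoeff_posSeries _ _ _ _)
    (posSeries_commute _ _ _ _ _) (posSeries_commute _ _ _ _ _) (posSeries_commute _ _ _ _ _),
    ← posSeries_nmul] at h
  exact h.congr (fun a => (S.mul_eq_of_commute (anZ_commute ħ k S A B _ _)).symm) rfl

theorem qpow_add (x y : ℂ) : qpow ħ (x + y) = qpow ħ x * qpow ħ y := by
  rw [qpow, mul_add, Complex.exp_add, qpow, qpow]

theorem qpow_zero : qpow ħ 0 = 1 := by simp [qpow]

theorem qpow_ne_zero (x : ℂ) : qpow ħ x ≠ 0 := Complex.exp_ne_zero _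

theorem qpow_neg (x : ℂ) : qpow ħ (-x) = (qpow ħ x)⁻¹ := by
  rw [qpow, mul_neg, Complex.exp_neg, qpow]

theorem qpow_sub (x y : ℂ) : qpow ħ (x - y) = qpow ħ x / qpow ħ y := by
  rw [sub_eq_add_neg, qpow_add, qpow_neg, div_eq_mul_inv]

theorem qpow_mul_nat (x : ℂ) (n : ℕ) : qpow ħ (x * n) = qpow ħ x ^ n := by
  rw [qpow, qpow, ← Complex.exp_nat_mul]
  ring_nf

theorem qpow_mul_int (x : ℂ) (n : ℤ) : qpow ħ (x * n) = qpow ħ x ^ n := by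
  rw [qpow, qpow, ← Complex.exp_int_mul]
  ring_nf

theorem coeff_expSeries_rescale {R : Type*} [Ring R] [Algebra ℂ R] {F G : PowerSeries R} (c : ℂ)
    (h : ∀ n, coeff n G = c ^ n • coeff n F) (n : ℕ) :
    coeff n (expSeries G) = c ^ n • coeff n (expSeries F) := by
  have hp : ∀ r n, coeff n (G ^ r) = c ^ n • coeff n (F ^ r) := by
    intro r
    induction r with
    | zero =>
      intro n
      rcases Nat.eq_zero_or_pos n with rfl | hn
      · simp
      · simp [coeff_one, hn.ne']
    | succ r ih =>
      intro n
      rw [pow_succ, pow_succ, coeff_mul, coeff_mul, Finset.smul_sum]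
      refine Finset.sum_congr rfl fun x hx => ?_
      rw [ih, h, smul_mul_smul_comm, ← pow_add, Finset.HasAntidiagonal.mem_antidiagonal.1 hx]
  rw [expSeries, expSeries, coeff_mk, coeff_mk, Finset.smul_sum]
  refine Finset.sum_congr rfl fun r _ => ?_
  rw [hp, smul_comm]

theorem crZ_rescale (A : Vertex) (s : ℂ) (a : ℤ) :
    crZ ħ k S (A.rescale ħ s) a = qpow ħ (s * a) • crZ ħ k S A a := by
  by_cases ha : 0 ≤ a
  · obtain ⟨a, rfl⟩ := Int.eq_ofNat_of_zero_le ha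
    rw [crZ, crZ, zext_natCast, zext_natCast, Int.cast_natCast, qpow_mul_nat]
    refine coeff_expSeries_rescale (qpow ħ s) (fun n => ?_) a
    rcases n with _ | n <;> simp only [coeff_mk, smul_zero]
    rw [Finset.smul_sum, ← qpow_mul_nat]
    refine Finset.sum_congr rfl fun i _ => ?_
    rw [smul_smul, Vertex.rescale]
    congr 3
    push_cast
    ring_nf
  · rw [crZ, crZ, zext_of_neg _ (not_le.1 ha), zext_of_neg _ (not_le.1 ha), smul_zero]

theorem anZ_rescale (A : Vertex) (s : ℂ) (a : ℤ) :
    anZ ħ k S (A.rescale ħ s) a = qpow ħ (-(s * a)) • anZ ħ k S A a := by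
  by_cases ha : 0 ≤ a
  · obtain ⟨a, rfl⟩ := Int.eq_ofNat_of_zero_le ha
    rw [anZ, anZ, zext_natCast, zext_natCast, Int.cast_natCast, ← neg_mul, qpow_mul_nat]
    refine coeff_expSeries_rescale (qpow ħ (-s)) (fun n => ?_) a
    rcases n with _ | n <;> simp only [coeff_mk, smul_zero]
    rw [Finset.smul_sum, ← qpow_mul_nat]
    refine Finset.sum_congr rfl fun i _ => ?_
    rw [smul_smul, Vertex.rescale]
    congr 3
  · rw [anZ, anZ, zext_of_neg _ (not_le.1 ha), zext_of_neg _ (not_le.1 ha), smul_zero]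

/-! ### The weight filtration and grading of the oscillator space -/

/-- The span of the monomials with (doubled) weight satisfying `P`. -/
def weightSpan (P : ℤ → Prop) : Submodule ℂ Osc :=
  Submodule.span ℂ {f | ∃ μ : Boson × ℕ →₀ ℕ, P (oscWeight μ) ∧ f = MvPolynomial.monomial μ 1}

theorem monomial_mem_weightSpan {P : ℤ → Prop} {μ : Boson × ℕ →₀ ℕ} (h : P (oscWeight μ)) (c : ℂ) :
    MvPolynomial.monomial μ c ∈ weightSpan P := by
  have : MvPolynomial.monomial μ c = c • MvPolynomial.monomial μ (1 : ℂ) := by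
    rw [MvPolynomial.smul_monomial, smul_eq_mul, mul_one]
  rw [this]
  exact Submodule.smul_mem _ _ (Submodule.subset_span ⟨μ, h, rfl⟩)

theorem weightSpan_mono {P Q : ℤ → Prop} (h : ∀ n, P n → Q n) : weightSpan P ≤ weightSpan Q :=
  Submodule.span_mono fun _ ⟨μ, h1, h2⟩ => ⟨μ, h _ h1, h2⟩

theorem weightSpan_eq_bot {P : ℤ → Prop} (h : ∀ n : ℕ, ¬P n) : weightSpan P = ⊥ := by
  rw [weightSpan, Submodule.span_eq_bot]
  rintro _ ⟨μ, h1, _⟩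
  exact absurd h1 (h _)

theorem exists_mem_weightSpan_le (f : Osc) : ∃ w : ℕ, f ∈ weightSpan (· ≤ (w : ℤ)) := by
  induction f using MvPolynomial.induction_on' with
  | monomial μ a =>
    exact ⟨oscWeight μ, monomial_mem_weightSpan (P := (· ≤ (oscWeight μ : ℤ))) (le_refl _) a⟩
  | add f g hf hg =>
    obtain ⟨⟨w, hw⟩, ⟨w', hw'⟩⟩ := And.intro hf hg
    exact ⟨max w w', add_mem (weightSpan_mono (fun n hn => le_trans hn (by simp)) hw)
      (weightSpan_mono (fun n hn => le_trans hn (by simp)) hw')⟩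

theorem oscWeight_add (μ ν : Boson × ℕ →₀ ℕ) : oscWeight (μ + ν) = oscWeight μ + oscWeight ν :=
  Finsupp.sum_add_index' (by simp) (by intros; ring)

theorem oscWeight_single (x : Boson × ℕ) (r : ℕ) :
    oscWeight (Finsupp.single x r) = r * (x.2 + 1) := by
  simp [oscWeight]

theorem mulLeft_mem_weightSpan {P : ℤ → Prop} {f : Osc} (hf : f ∈ weightSpan P) (x : Boson × ℕ) :
    LinearMap.mulLeft ℂ (MvPolynomial.X x) f ∈ weightSpan fun n => P (n - (x.2 + 1)) := by
  induction hf using Submodule.span_induction with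
  | mem f hf =>
    obtain ⟨μ, h, rfl⟩ := hf
    rw [LinearMap.mulLeft_apply, MvPolynomial.X, MvPolynomial.monomial_mul]
    refine monomial_mem_weightSpan ?_ _
    rw [oscWeight_add, oscWeight_single]
    push_cast
    convert h using 1
    ring
  | zero => rw [map_zero]; exact zero_mem _
  | add f g _ _ h1 h2 => rw [map_add]; exact add_mem h1 h2
  | smul c f _ h => rw [map_smul]; exact Submodule.smul_mem _ _ h

theorem pderiv_mem_weightSpan {P : ℤ → Prop} {f : Osc} (hf : f ∈ weightSpan P) (x : Boson × ℕ) :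
    (MvPolynomial.pderiv x).toLinearMap f ∈ weightSpan fun n => P (n + (x.2 + 1)) := by
  induction hf using Submodule.span_induction with
  | mem f hf =>
    obtain ⟨μ, h, rfl⟩ := hf
    rw [Derivation.coeFn_coe, MvPolynomial.pderiv_monomial]
    by_cases h0 : μ x = 0
    · simp [h0]
    · have hμ : μ - Finsupp.single x 1 + Finsupp.single x 1 = μ :=
        tsub_add_cancel_of_le (by simpa [Finsupp.single_le_iff] using Nat.one_le_iff_ne_zero.2 h0)
      refine monomial_mem_weightSpan ?_ _
      rw [← hμ, oscWeight_add, oscWeight_single] at h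
      push_cast at h
      convert h using 1
      ring
  | zero => rw [map_zero]; exact zero_mem _
  | add f g _ _ h1 h2 => rw [map_add]; exact add_mem h1 h2
  | smul c f _ h => rw [map_smul]; exact Submodule.smul_mem _ _ h

/-- If the n-th coefficient of F shifts a grading by d n, so does the n-th coefficient of each power
of F, because degrees add along antidiagonals, and hence that of the exponential. -/
theorem coeff_expSeries_mem {V : Type*} [AddCommGroup V] [Module ℂ V]
    {F : PowerSeries (Module.End ℂ V)} (W : ℤ → Submodule ℂ V) (d : ℤ)
    (hF : ∀ (n : ℕ) w, ∀ f ∈ W w, coeff n F f ∈ W (w + d * n)) (n : ℕ) (w : ℤ) (f : V) (hf : f ∈ W w) :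
    coeff n (expSeries F) f ∈ W (w + d * n) := by
  have hp : ∀ (r n : ℕ) w, ∀ f ∈ W w, coeff n (F ^ r) f ∈ W (w + d * n) := by
    intro r
    induction r with
    | zero =>
      intro n w f hf
      rcases Nat.eq_zero_or_pos n with rfl | hn
      · simpa using hf
      · simp [coeff_one, hn.ne']
    | succ r ih =>
      intro n w f hf
      rw [pow_succ, coeff_mul, LinearMap.sum_apply]
      refine sum_mem fun x hx => ?_
      have := ih x.1 _ _ (hF x.2 w f hf)
      have e : w + d * x.2 + d * x.1 = w + d * n := by
        rw [← Finset.HasAntidiagonal.mem_antidiagonal.1 hx]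
        push_cast
        ring
      rwa [e] at this
  rw [expSeries, coeff_mk, LinearMap.sum_apply]
  exact sum_mem fun r _ => Submodule.smul_mem _ _ (hp r n w f hf)

/-- A translation invariant predicate covers two uses at once: the filtration n ≤ w, which yields
local finiteness, and an equation for n, which yields homogeneity. -/
theorem heisNeg_mem (i : Boson) (j : ℕ) (P : ℤ → ℤ → Prop)
    (hP : ∀ w d n, P w n ↔ P (w + d) (n + d)) (w : ℤ) {f : Osc} (hf : f ∈ weightSpan (P w)) :
    heisNeg ħ k S i j f ∈ weightSpan (P (w + S.sign * (j + 1))) := by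
  cases S
  · refine weightSpan_mono (fun n hn => ?_) (mulLeft_mem_weightSpan hf (i, j))
    have := (hP w (j + 1) _).1 hn
    simpa [Side.sign] using this
  · rw [heisNeg, LinearMap.smul_apply]
    refine Submodule.smul_mem _ _ (weightSpan_mono (fun n hn => ?_)
      (pderiv_mem_weightSpan hf (i, j)))
    have := (hP w (-(j + 1)) _).1 hn
    rw [add_neg_cancel_right] at this
    rwa [Side.sign, neg_one_mul]

theorem heisPos_mem (i : Boson) (j : ℕ) (P : ℤ → ℤ → Prop)
    (hP : ∀ w d n, P w n ↔ P (w + d) (n + d)) (w : ℤ) {f : Osc} (hf : f ∈ weightSpan (P w)) :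
    heisPos ħ k S i j f ∈ weightSpan (P (w + -S.sign * (j + 1))) := by
  rw [heisPos_eq]
  have h := heisNeg_mem ħ k (match S with | .left => .right | .right => .left) i j P hP w hf
  cases S <;> simpa [Side.sign] using h

theorem crZ_mem (A : Vertex) (P : ℤ → ℤ → Prop) (hP : ∀ w d n, P w n ↔ P (w + d) (n + d))
    (a w : ℤ) {f : Osc} (hf : f ∈ weightSpan (P w)) :
    crZ ħ k S A a f ∈ weightSpan (P (w + S.sign * a)) := by
  by_cases ha : 0 ≤ a
  · obtain ⟨a, rfl⟩ := Int.eq_ofNat_of_zero_le ha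
    rw [crZ, zext_natCast]
    refine coeff_expSeries_mem (fun w => weightSpan (P w)) S.sign (fun n w f hf => ?_) a w f hf
    rcases n with _ | n
    · simp
    · rw [coeff_mk, LinearMap.sum_apply]
      refine sum_mem fun i _ => Submodule.smul_mem _ _ ?_
      push_cast
      exact heisNeg_mem ħ k S i n P hP w hf
  · rw [crZ, zext_of_neg _ (not_le.1 ha)]
    exact zero_mem _

theorem anZ_mem (A : Vertex) (P : ℤ → ℤ → Prop) (hP : ∀ w d n, P w n ↔ P (w + d) (n + d))
    (a w : ℤ) {f : Osc} (hf : f ∈ weightSpan (P w)) :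
    anZ ħ k S A a f ∈ weightSpan (P (w - S.sign * a)) := by
  rw [sub_eq_add_neg, ← neg_mul]
  by_cases ha : 0 ≤ a
  · obtain ⟨a, rfl⟩ := Int.eq_ofNat_of_zero_le ha
    rw [anZ, zext_natCast]
    refine coeff_expSeries_mem (fun w => weightSpan (P w)) (-S.sign) (fun n w f hf => ?_) a w f hf
    rcases n with _ | n
    · simp
    · rw [coeff_mk, LinearMap.sum_apply]
      refine sum_mem fun i _ => Submodule.smul_mem _ _ ?_
      push_cast
      exact heisPos_mem ħ k S i n P hP w hf
  · rw [anZ, zext_of_neg _ (not_le.1 ha)]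
    exact zero_mem _

end Oscillators

end

section

/-! ### Wick's theorem on the oscillator space. -/

section NormalOrderedProducts

variable (ħ k : ℂ) (S : Side)

/-- The summands of a normal ordered product of two vertex operators. -/
def quad (A B : Vertex) (a a' b b' : ℤ) : Module.End ℂ Osc :=
  S.mul (S.mul (crZ ħ k S A a) (crZ ħ k S B a')) (S.mul (anZ ħ k S A b) (anZ ħ k S B b'))

theorem le_shift (w d n : ℤ) : n ≤ w ↔ n + d ≤ w + d := by omega

theorem crZ_right_mem {A : Vertex} {a w : ℤ} {f : Osc} (hf : f ∈ weightSpan (· ≤ w)) :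
    crZ ħ k .right A a f ∈ weightSpan (· ≤ w) := by
  by_cases ha : 0 ≤ a
  · have h := crZ_mem ħ k .right A (fun w n => n ≤ w) le_shift a w hf
    exact weightSpan_mono (fun n hn => hn.trans (by simp [Side.sign]; omega)) h
  · rw [crZ, zext_of_neg _ (not_le.1 ha)]
    exact zero_mem _

theorem crZ_right_eq_zero {A : Vertex} {a w : ℤ} {f : Osc} (hf : f ∈ weightSpan (· ≤ w))
    (ha : w < a) : crZ ħ k .right A a f = 0 := by
  have h := crZ_mem ħ k .right A (fun w n => n ≤ w) le_shift a w hf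
  rwa [weightSpan_eq_bot (fun n hn => by simp [Side.sign] at hn; omega), Submodule.mem_bot] at h

theorem anZ_left_mem {A : Vertex} {a w : ℤ} {f : Osc} (hf : f ∈ weightSpan (· ≤ w)) :
    anZ ħ k .left A a f ∈ weightSpan (· ≤ w) := by
  by_cases ha : 0 ≤ a
  · have h := anZ_mem ħ k .left A (fun w n => n ≤ w) le_shift a w hf
    exact weightSpan_mono (fun n hn => hn.trans (by simp [Side.sign]; omega)) h
  · rw [anZ, zext_of_neg _ (not_le.1 ha)]
    exact zero_mem _

theorem anZ_left_eq_zero {A : Vertex} {a w : ℤ} {f : Osc} (hf : f ∈ weightSpan (· ≤ w))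
    (ha : w < a) : anZ ħ k .left A a f = 0 := by
  have h := anZ_mem ħ k .left A (fun w n => n ≤ w) le_shift a w hf
  rwa [weightSpan_eq_bot (fun n hn => by simp [Side.sign] at hn; omega), Submodule.mem_bot] at h

/-- The derivatives act first and cannot lower the weight below zero. They are the annihilators on
the left and the creators on the right, so one pair of indices is bounded by w; fixing the total
powers of z and w then bounds the other pair. -/
theorem quad_bounds {A B : Vertex} {a a' b b' w : ℤ} {f : Osc} (hf : f ∈ weightSpan (· ≤ w))
    (h : quad ħ k S A B a a' b b' f ≠ 0) : 0 ≤ a ∧ 0 ≤ a' ∧ 0 ≤ b ∧ 0 ≤ b' ∧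
      match S with | .left => b ≤ w ∧ b' ≤ w | .right => a ≤ w ∧ a' ≤ w := by
  have hz : quad ħ k S A B a a' b b' ≠ 0 := fun hn => h (by rw [hn, LinearMap.zero_apply])
  refine ⟨?_, ?_, ?_, ?_, ?_⟩
  · refine nonneg_of_zext_ne_zero (f := creation ħ k S A) fun hn => hz ?_
    rw [quad, crZ, hn]; simp [Side.zero_mul]
  · refine nonneg_of_zext_ne_zero (f := creation ħ k S B) fun hn => hz ?_
    rw [quad, crZ, crZ, hn]; simp [Side.zero_mul, Side.mul_zero]
  · refine nonneg_of_zext_ne_zero (f := annihilation ħ k S A) fun hn => hz ?_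
    rw [quad, anZ, hn]; simp [Side.zero_mul, Side.mul_zero]
  · refine nonneg_of_zext_ne_zero (f := annihilation ħ k S B) fun hn => hz ?_
    rw [quad, anZ, anZ, hn]; simp [Side.mul_zero]
  · cases S
    · refine ⟨?_, ?_⟩ <;> by_contra! hn <;> refine h ?_ <;>
        simp only [quad, Side.mul, Module.End.mul_apply]
      · rw [anZ_left_eq_zero ħ k (anZ_left_mem ħ k hf) hn, map_zero, map_zero]
      · rw [anZ_left_eq_zero ħ k hf hn, map_zero, map_zero, map_zero]
    · refine ⟨?_, ?_⟩ <;> by_contra! hn <;> refine h ?_ <;>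
        simp only [quad, Side.mul, Module.End.mul_apply]
      · rw [crZ_right_eq_zero ħ k hf hn, map_zero, map_zero, map_zero]
      · rw [crZ_right_eq_zero ħ k (crZ_right_mem ħ k hf) hn, map_zero, map_zero]

theorem pair_bounds {A : Vertex} {a b w : ℤ} {f : Osc} (hf : f ∈ weightSpan (· ≤ w))
    (h : S.mul (crZ ħ k S A a) (anZ ħ k S A b) f ≠ 0) : 0 ≤ a ∧ 0 ≤ b ∧
      match S with | .left => b ≤ w | .right => a ≤ w := by
  have hz : S.mul (crZ ħ k S A a) (anZ ħ k S A b) ≠ 0 :=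
    fun hn => h (by rw [hn, LinearMap.zero_apply])
  refine ⟨?_, ?_, ?_⟩
  · refine nonneg_of_zext_ne_zero (f := creation ħ k S A) fun hn => hz ?_
    rw [crZ, hn]; simp [Side.zero_mul]
  · refine nonneg_of_zext_ne_zero (f := annihilation ħ k S A) fun hn => hz ?_
    rw [anZ, hn]; simp [Side.mul_zero]
  · cases S <;> by_contra! hn <;> refine h ?_ <;> simp only [Side.mul, Module.End.mul_apply]
    · rw [anZ_left_eq_zero ħ k hf hn, map_zero]
    · rw [crZ_right_eq_zero ħ k hf hn, map_zero]

/-- The coefficient of `z ^ i` in the oscillator part of a vertex operator. -/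
def oscOp (A : Vertex) (i : ℤ) : Module.End ℂ Osc :=
  locSum fun b : ℤ => S.mul (crZ ħ k S A (i + b)) (anZ ħ k S A b)

/-- The coefficient of `z ^ i w ^ j` in the oscillator part of `: A(z) B(w) :`. -/
def oscOp₂ (A B : Vertex) (i j : ℤ) : Module.End ℂ Osc :=
  locSum fun x : ℤ × ℤ => quad ħ k S A B (i + x.1) (j + x.2) x.1 x.2

theorem hasLocSum_oscOp (A : Vertex) (i : ℤ) :
    HasLocSum (fun b : ℤ => S.mul (crZ ħ k S A (i + b)) (anZ ħ k S A b)) (oscOp ħ k S A i) := by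
  refine HasLocSum.of_finite fun f => ?_
  obtain ⟨w, hw⟩ := exists_mem_weightSpan_le f
  refine (Set.finite_Icc (-(|i| + w)) (|i| + w)).subset fun b hb => ?_
  have h := pair_bounds ħ k S hw hb
  have := abs_nonneg i
  have h1 := le_abs_self i
  have h2 := neg_abs_le i
  rw [Set.mem_Icc]
  cases S <;> simp only at h <;> omega

theorem hasLocSum_oscOp₂ (A B : Vertex) (i j : ℤ) :
    HasLocSum (fun x : ℤ × ℤ => quad ħ k S A B (i + x.1) (j + x.2) x.1 x.2)
      (oscOp₂ ħ k S A B i j) := by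
  refine HasLocSum.of_finite fun f => ?_
  obtain ⟨w, hw⟩ := exists_mem_weightSpan_le f
  refine ((Set.finite_Icc (-(|i| + w)) (|i| + w)).prod
    (Set.finite_Icc (-(|j| + w)) (|j| + w))).subset fun x hb => ?_
  have h := quad_bounds ħ k S hw hb
  have := abs_nonneg i
  have h1 := le_abs_self i
  have h2 := neg_abs_le i
  have := abs_nonneg j
  have h3 := le_abs_self j
  have h4 := neg_abs_le j
  rw [Set.mem_prod, Set.mem_Icc, Set.mem_Icc]
  cases S <;> simp only at h <;> omega

theorem oscOp_eq_zero {A : Vertex} {i w : ℤ} {f : Osc} (hf : f ∈ weightSpan (· ≤ w))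
    (hi : S.sign * i < -w) : oscOp ħ k S A i f = 0 := by
  rw [(hasLocSum_oscOp ħ k S A i f).2]
  refine finsum_eq_zero_of_forall_eq_zero fun b => ?_
  by_contra hb
  have h := pair_bounds ħ k S hf hb
  cases S <;> simp only [Side.sign] at h hi <;> omega

theorem oscOp_mem (A : Vertex) (i : ℤ) (P : ℤ → ℤ → Prop)
    (hP : ∀ w d n, P w n ↔ P (w + d) (n + d)) (w : ℤ) {f : Osc} (hf : f ∈ weightSpan (P w)) :
    oscOp ħ k S A i f ∈ weightSpan (P (w + S.sign * i)) := by
  rw [(hasLocSum_oscOp ħ k S A i f).2]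
  refine finsum_induction (· ∈ weightSpan (P (w + S.sign * i))) (zero_mem _)
    (fun _ _ h1 h2 => add_mem h1 h2) fun b => ?_
  cases S
  · have := crZ_mem ħ k .left A P hP (i + b) _ (anZ_mem ħ k .left A P hP b w hf)
    have e : w - Side.left.sign * b + Side.left.sign * (i + b) = w + Side.left.sign * i := by ring
    rwa [e] at this
  · have := anZ_mem ħ k .right A P hP b _ (crZ_mem ħ k .right A P hP (i + b) w hf)
    have e : w + Side.right.sign * (i + b) - Side.right.sign * b = w + Side.right.sign * i := by
      ring
    rwa [e] at this

theorem oscOp₂_swap (A B : Vertex) (i j : ℤ) : oscOp₂ ħ k S A B i j = oscOp₂ ħ k S B A j i := by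
  refine ((hasLocSum_oscOp₂ ħ k S A B i j).comp_equiv (Equiv.prodComm ℤ ℤ)).congr
    (fun x => ?_) rfl |>.unique (hasLocSum_oscOp₂ ħ k S B A j i)
  simp only [quad, Equiv.prodComm_apply, Prod.fst_swap, Prod.snd_swap]
  rw [S.mul_comm_of (crZ_commute ħ k S A B _ _), S.mul_comm_of (anZ_commute ħ k S A B _ _)]

theorem oscOp_rescale (A : Vertex) (s : ℂ) (i : ℤ) :
    oscOp ħ k S (A.rescale ħ s) i = qpow ħ (s * i) • oscOp ħ k S A i := by
  refine (hasLocSum_oscOp ħ k S _ i).unique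
    (((hasLocSum_oscOp ħ k S A i).smul (qpow ħ (s * i))).congr (fun b => ?_) rfl)
  rw [crZ_rescale, anZ_rescale, Side.smul_mul, Side.mul_smul, smul_smul, ← qpow_add]
  congr 2
  push_cast
  ring

theorem oscOp₂_rescale (A B : Vertex) (s : ℂ) (i j : ℤ) :
    oscOp₂ ħ k S A (B.rescale ħ s) i j = qpow ħ (s * j) • oscOp₂ ħ k S A B i j := by
  refine (hasLocSum_oscOp₂ ħ k S _ _ i j).unique
    (((hasLocSum_oscOp₂ ħ k S A B i j).smul (qpow ħ (s * j))).congr (fun b => ?_) rfl)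
  simp only [quad]
  rw [crZ_rescale, anZ_rescale, Side.mul_smul, Side.smul_mul, Side.mul_smul, Side.mul_smul,
    smul_smul, ← qpow_add]
  congr 2
  push_cast
  ring

/-- Wick's theorem in modes. One locally finite triple family, indexed by the number l of contracted
modes and the two annihilation indices, is summed in two orders: with l outermost it gives the
normal ordered coefficients, with the annihilation indices outermost it gives the product. -/
theorem hasLocSum_oscOp_mul (A B : Vertex) (i j : ℤ) :
    HasLocSum (fun l : ℤ => contrZ ħ k A B l • oscOp₂ ħ k S A B (i + l) (j - l))
      (S.mul (oscOp ħ k S A i) (oscOp ħ k S B j)) := by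
  have hfin : ∀ f, (Function.support fun x : ℤ × (ℤ × ℤ) =>
      (contrZ ħ k A B x.1 • quad ħ k S A B (i + x.1 + x.2.1) (j - x.1 + x.2.2) x.2.1 x.2.2)
        f).Finite := by
    intro f
    obtain ⟨w, hw⟩ := exists_mem_weightSpan_le f
    have hJ := Set.finite_Icc (-(|i| + |j| + w + w)) (|i| + |j| + w + w)
    refine (hJ.prod (hJ.prod hJ)).subset fun x hx => ?_
    have hx1 : contrZ ħ k A B x.1 ≠ 0 := fun h0 => hx (by simp [h0])
    have hx2 := nonneg_of_zext_ne_zero hx1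
    have hx3 : quad ħ k S A B (i + x.1 + x.2.1) (j - x.1 + x.2.2) x.2.1 x.2.2 f ≠ 0 :=
      fun h0 => hx (by simp [h0])
    have h := quad_bounds ħ k S hw hx3
    have := abs_nonneg i
    have h1 := le_abs_self i
    have h2 := neg_abs_le i
    have := abs_nonneg j
    have h3 := le_abs_self j
    have h4 := neg_abs_le j
    rw [Set.mem_prod, Set.mem_prod, Set.mem_Icc, Set.mem_Icc, Set.mem_Icc]
    cases S <;> simp only at h <;> omega
  have h1 := HasLocSum.of_finite hfin
  have h2 := h1.iterated fun l => (hasLocSum_oscOp₂ ħ k S A B (i + l) (j - l)).smul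
    (contrZ ħ k A B l)
  -- The new coordinates are (b, c, l), where b and c are the annihilation indices before
  -- contraction; contraction lowers b to b - l, and for fixed b and c the sum over l is the
  -- exchange relation.
  let e : ℤ × (ℤ × ℤ) ≃ ℤ × (ℤ × ℤ) :=
    { toFun := fun x => (x.2.2, (x.1 - x.2.2, x.2.1))
      invFun := fun x => (x.2.1 + x.1, (x.2.2, x.1))
      left_inv := fun x => by simp
      right_inv := fun x => by simp }
  have h3 := (h1.comp_equiv e).congr (g := fun x : ℤ × (ℤ × ℤ) => contrZ ħ k A B x.2.2 •
    S.mul (crZ ħ k S A (i + x.1)) (S.mul (S.mul (crZ ħ k S B (j + x.2.1 - x.2.2))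
      (anZ ħ k S A (x.1 - x.2.2))) (anZ ħ k S B x.2.1))) (fun x => by
      have e1 : i + x.2.2 + (x.1 - x.2.2) = i + x.1 := by ring
      have e2 : j - x.2.2 + x.2.1 = j + x.2.1 - x.2.2 := by ring
      simp only [e, Equiv.coe_fn_mk, quad, Side.mul_assoc, e1, e2]) rfl
  have h4 : ∀ b, HasLocSum (fun y : ℤ × ℤ => contrZ ħ k A B y.2 •
      S.mul (crZ ħ k S A (i + b)) (S.mul (S.mul (crZ ħ k S B (j + y.1 - y.2))
        (anZ ħ k S A (b - y.2))) (anZ ħ k S B y.1)))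
      (S.mul (crZ ħ k S A (i + b)) (S.mul (anZ ħ k S A b) (oscOp ħ k S B j))) := by
    intro b
    refine HasLocSum.of_iterated (fun v => ?_) (fun c => ?_)
      (((hasLocSum_oscOp ħ k S B j).side_mul_left S (anZ ħ k S A b)).side_mul_left S _)
    · exact ((h3 v).1.preimage (Prod.mk_right_injective b).injOn)
    · refine ((((hasLocSum_exchange ħ k S A B (j + c) b).side_mul_right S
        (anZ ħ k S B c)).side_mul_left S (crZ ħ k S A (i + b)))).congr (fun l => ?_) ?_
      · rw [Side.smul_mul, Side.mul_smul]
      · rw [Side.mul_assoc]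
  have h5 := h3.iterated h4
  have h6 := (hasLocSum_oscOp ħ k S A i).side_mul_right S (oscOp ħ k S B j)
  have h7 := h5.unique (h6.congr (fun b => Side.mul_assoc _ _ _ _) rfl)
  exact h7 ▸ h2

theorem hasLocSum_oscOp_nmul (A B : Vertex) (i j : ℤ) :
    HasLocSum (fun l : ℤ => oscOp₂ ħ k S A B (i + l) (j - l))
      (oscOp ħ k S (A.nmul B) (i + j)) := by
  have hfin : ∀ f, (Function.support fun x : ℤ × (ℤ × ℤ) =>
      (quad ħ k S A B (i + x.1 + x.2.1) (j - x.1 + x.2.2) x.2.1 x.2.2) f).Finite := by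
    intro f
    obtain ⟨w, hw⟩ := exists_mem_weightSpan_le f
    have hJ := Set.finite_Icc (-(|i| + |j| + w + w)) (|i| + |j| + w + w)
    refine (hJ.prod (hJ.prod hJ)).subset fun x hx => ?_
    have h := quad_bounds ħ k S hw hx
    have := abs_nonneg i
    have h1 := le_abs_self i
    have h2 := neg_abs_le i
    have := abs_nonneg j
    have h3 := le_abs_self j
    have h4 := neg_abs_le j
    rw [Set.mem_prod, Set.mem_prod, Set.mem_Icc, Set.mem_Icc, Set.mem_Icc]
    cases S <;> simp only at h <;> omega
  have h1 := HasLocSum.of_finite hfin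
  have h2 := h1.iterated fun l => hasLocSum_oscOp₂ ħ k S A B (i + l) (j - l)
  -- The outermost new index is the total annihilation degree; for a fixed value the remaining
  -- double sum factors into the product formulas for the creation and annihilation parts.
  let e : ℤ × (ℤ × ℤ) ≃ ℤ × (ℤ × ℤ) :=
    { toFun := fun x => (x.2.1 - i - x.2.2, (x.2.2, x.1 - x.2.2))
      invFun := fun x => (x.2.1 + x.2.2, (i + x.1 + x.2.1, x.2.1))
      left_inv := fun x => by
        refine Prod.ext (by simp) (Prod.ext ?_ (by simp))
        change i + (x.2.1 - i - x.2.2) + x.2.2 = x.2.1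
        ring
      right_inv := fun x => by
        refine Prod.ext ?_ (Prod.ext (by simp) (by simp))
        change i + x.1 + x.2.1 - i - x.2.1 = x.1
        ring }
  have h3 := (h1.comp_equiv e).congr (g := fun x : ℤ × (ℤ × ℤ) =>
    S.mul (S.mul (crZ ħ k S A x.2.1) (crZ ħ k S B (i + j + x.1 - x.2.1)))
      (S.mul (anZ ħ k S A x.2.2) (anZ ħ k S B (x.1 - x.2.2)))) (fun x => by
      have e1 : i + (x.2.1 - i - x.2.2) + x.2.2 = x.2.1 := by ring
      have e2 : j - (x.2.1 - i - x.2.2) + (x.1 - x.2.2) = i + j + x.1 - x.2.1 := by ring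
      simp only [e, Equiv.coe_fn_mk, quad, e1, e2]) rfl
  have h4 : ∀ b, HasLocSum (fun y : ℤ × ℤ =>
      S.mul (S.mul (crZ ħ k S A y.1) (crZ ħ k S B (i + j + b - y.1)))
        (S.mul (anZ ħ k S A y.2) (anZ ħ k S B (b - y.2))))
      (S.mul (crZ ħ k S (A.nmul B) (i + j + b)) (anZ ħ k S (A.nmul B) b)) := by
    intro b
    refine HasLocSum.of_iterated (fun v => ?_) (fun a => ?_)
      ((hasLocSum_crZ_nmul ħ k S A B (i + j + b)).side_mul_right S (anZ ħ k S (A.nmul B) b))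
    · exact ((h3 v).1.preimage (Prod.mk_right_injective b).injOn)
    · exact (hasLocSum_anZ_nmul ħ k S A B b).side_mul_left S
        (S.mul (crZ ħ k S A a) (crZ ħ k S B (i + j + b - a)))
  exact ((h3.iterated h4).unique (hasLocSum_oscOp ħ k S (A.nmul B) (i + j))) ▸ h2

end NormalOrderedProducts

end

section

/-! ### The Fock space of a sector as a direct sum over the x-degree. -/

section FockSpace

variable {A : Sector} {k ρ σ : ℂ}

theorem sectorMom_injective (A : Sector) (k ρ σ : ℂ) : Function.Injective (sectorMom A k ρ σ) := by
  intro m n h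
  have h1 := congrFun h .bar
  cases A <;> simpa [sectorMom, mom3] using h1

/-- The Fock space of a sector, as a vector space. -/
def FockSpace (A : Sector) (k ρ σ : ℂ) : Type := Fock A k ρ σ

instance : AddCommGroup (FockSpace A k ρ σ) := inferInstanceAs (AddCommGroup (Fock A k ρ σ))

instance : Module ℂ (FockSpace A k ρ σ) := inferInstanceAs (Module ℂ (Fock A k ρ σ))

variable (A k ρ σ) in
/-- The inclusion of the Fock space of a sector into the sum of all Fock spaces. -/
def toBig : FockSpace A k ρ σ →ₗ[ℂ] BigFock := (Fock A k ρ σ).subtype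

variable (A k ρ σ) in
/-- The inclusion of the `n`-th summand. -/
def sv (n : ℤ) : Osc →ₗ[ℂ] FockSpace A k ρ σ :=
  (Finsupp.lsingle (sectorMom A k ρ σ n)).codRestrict _ fun f =>
    Finsupp.single_mem_supported ℂ f ⟨n, rfl⟩

theorem toBig_sv (n : ℤ) (f : Osc) :
    toBig A k ρ σ (sv A k ρ σ n f) = Finsupp.single (sectorMom A k ρ σ n) f := rfl

variable (A k ρ σ) in
/-- The decomposition of the Fock space. -/
def fockEquiv : (ℤ →₀ Osc) ≃ₗ[ℂ] FockSpace A k ρ σ :=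
  (Finsupp.domLCongr (Equiv.ofInjective _ (sectorMom_injective A k ρ σ))).trans
    (Finsupp.supportedEquivFinsupp (Set.range (sectorMom A k ρ σ))).symm

theorem fockEquiv_single (n : ℤ) (f : Osc) :
    fockEquiv A k ρ σ (Finsupp.single n f) = sv A k ρ σ n f := by
  let s : Finsupp.supported Osc ℂ (Set.range (sectorMom A k ρ σ)) :=
    ⟨Finsupp.single (sectorMom A k ρ σ n) f, Finsupp.single_mem_supported ℂ f ⟨n, rfl⟩⟩
  have h : Finsupp.domLCongr (R := ℂ) (Equiv.ofInjective _ (sectorMom_injective A k ρ σ))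
      (Finsupp.single n f) = Finsupp.supportedEquivFinsupp (Set.range (sectorMom A k ρ σ)) s := by
    rw [Finsupp.domLCongr_single]
    ext1 x
    rw [Finsupp.supportedEquivFinsupp_apply_apply]
    simp only [s, Finsupp.single_apply, Equiv.ofInjective_apply, Subtype.ext_iff]
  exact (LinearEquiv.symm_apply_eq (Finsupp.supportedEquivFinsupp _)).2 h

theorem fock_induction {P : FockSpace A k ρ σ → Prop} (h0 : P 0) (hadd : ∀ x y, P x → P y → P (x + y))
    (hs : ∀ n f, P (sv A k ρ σ n f)) (x : FockSpace A k ρ σ) : P x := by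
  obtain ⟨y, rfl⟩ := (fockEquiv A k ρ σ).surjective x
  induction y using Finsupp.induction_linear with
  | zero => rwa [map_zero]
  | add x y hx hy => rw [map_add]; exact hadd _ _ hx hy
  | single n f => rw [fockEquiv_single]; exact hs n f

theorem fock_ext {M : Type*} [AddCommGroup M] [Module ℂ M] {L L' : FockSpace A k ρ σ →ₗ[ℂ] M}
    (h : ∀ n f, L (sv A k ρ σ n f) = L' (sv A k ρ σ n f)) : L = L' :=
  LinearMap.ext fun x => fock_induction (P := fun x => L x = L' x) (by rw [map_zero, map_zero])
    (fun x y hx hy => by rw [map_add, map_add, hx, hy]) h x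

/-- The linear map with given restrictions to the summands. -/
def fockLift (g : ℤ → Osc →ₗ[ℂ] FockSpace A k ρ σ) : Module.End ℂ (FockSpace A k ρ σ) :=
  (Finsupp.lsum ℂ g).comp (fockEquiv A k ρ σ).symm.toLinearMap

theorem fockLift_sv (g : ℤ → Osc →ₗ[ℂ] FockSpace A k ρ σ) (n : ℤ) (f : Osc) :
    fockLift g (sv A k ρ σ n f) = g n f := by
  rw [fockLift, LinearMap.comp_apply, LinearEquiv.coe_coe, ← fockEquiv_single,
    LinearEquiv.symm_apply_apply, Finsupp.lsum_single]

/-- Finiteness is required vector by vector and every vector is a finite sum of components, so a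
locally finite sum may be checked on each summand, provided that all members of the family map the
n-th summand into a common one. -/
theorem HasLocSum.of_sv {ι : Type*} {F : ι → Module.End ℂ (FockSpace A k ρ σ)}
    {L : Module.End ℂ (FockSpace A k ρ σ)} (n' : ℤ → ℤ) (T : ℤ → ι → Module.End ℂ Osc)
    (T₀ : ℤ → Module.End ℂ Osc) (hT : ∀ n, HasLocSum (T n) (T₀ n))
    (hF : ∀ n i f, F i (sv A k ρ σ n f) = sv A k ρ σ (n' n) (T n i f))
    (hL : ∀ n f, L (sv A k ρ σ n f) = sv A k ρ σ (n' n) (T₀ n f)) : HasLocSum F L := by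
  have key : ∀ v, (Function.support fun i => F i v).Finite ∧ L v = ∑ᶠ i, F i v := by
    intro v
    induction v using fock_induction with
    | h0 => simp
    | hadd x y hx hy =>
      simp only [map_add]
      refine ⟨(hx.1.union hy.1).subset (Function.support_add _ _), ?_⟩
      rw [finsum_add_distrib hx.1 hy.1, hx.2, hy.2]
    | hs n f =>
      simp only [hF, hL]
      refine ⟨(hT n f).1.subset fun i hi h0 => hi ?_, ?_⟩
      · simp only [h0, map_zero]
      · rw [(hT n f).2]
        exact (sv A k ρ σ (n' n)).toAddMonoidHom.map_finsum (hT n f).1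
  exact key

end FockSpace

/-! ### Modes of vertex operators on the Fock space of a sector. -/

section VertexModes

variable (ħ k ρ σ : ℂ) (A : Sector) (S : Side)

/-- The summand on whose momentum the zero modes of an operator of `x`-charge `c` act. -/
def Side.zeroIdx (S : Side) (c n : ℤ) : ℤ :=
  match S with
  | .left => n
  | .right => n - c

/-- The exponent of `q` produced by the zero modes. -/
def Vertex.zeroExp (V : Vertex) (n : ℤ) : ℂ :=
  ∑ i, V.logq i * (zeroSign i * sectorMom A k ρ σ n i)

/-- The exponent of `q` from moving the zero modes of `V` past a charge `c`. -/
def Vertex.zeroComm (V : Vertex) (c : ℤ) : ℂ :=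
  c * (V.logq .tilde * (k + 2) - 2 * V.logq .bar)

/-- Raising n by c changes the momenta by (k+2)c and 2c, and the second enters with the sign of
[ᾱ_0, Q]. -/
theorem zeroExp_add (V : Vertex) (n c : ℤ) :
    V.zeroExp k ρ σ A (n + c) = V.zeroExp k ρ σ A n + V.zeroComm k c := by
  simp only [Vertex.zeroExp, Vertex.zeroComm]
  have : (Finset.univ : Finset Boson) = {.tilde, .bar, .beta} := rfl
  rw [this]
  cases A <;> simp [sectorMom, mom3, zeroSign] <;> ring

theorem zeroExp_nmul (V V' : Vertex) (n : ℤ) :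
    (V.nmul V').zeroExp k ρ σ A n = V.zeroExp k ρ σ A n + V'.zeroExp k ρ σ A n := by
  simp [Vertex.zeroExp, Vertex.nmul, add_mul, Finset.sum_add_distrib]

/-- The modes of a vertex operator of `x`-charge `c` on the Fock space. -/
def vop (V : Vertex) (c E : ℤ) : Module.End ℂ (FockSpace A k ρ σ) :=
  fockLift fun n => (sv A k ρ σ (n + S.sign * c)).comp
    (qpow ħ (V.zeroExp k ρ σ A (S.zeroIdx c n)) • oscOp ħ k S V (E - c * S.zeroIdx c n))

/-- The modes of a normal ordered product of two vertex operators on the Fock space. -/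
def vop₂ (V : Vertex) (c : ℤ) (V' : Vertex) (c' E E' : ℤ) : Module.End ℂ (FockSpace A k ρ σ) :=
  fockLift fun n => (sv A k ρ σ (n + S.sign * (c + c'))).comp
    (qpow ħ (V.zeroExp k ρ σ A (S.zeroIdx (c + c') n) + V'.zeroExp k ρ σ A (S.zeroIdx (c + c') n)) •
      oscOp₂ ħ k S V V' (E - c * S.zeroIdx (c + c') n) (E' - c' * S.zeroIdx (c + c') n))

theorem vop_sv (V : Vertex) (c E n : ℤ) (f : Osc) :
    vop ħ k ρ σ A S V c E (sv A k ρ σ n f) = sv A k ρ σ (n + S.sign * c)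
      ((qpow ħ (V.zeroExp k ρ σ A (S.zeroIdx c n)) •
        oscOp ħ k S V (E - c * S.zeroIdx c n) : Module.End ℂ Osc) f) := by
  rw [vop, fockLift_sv]; rfl

theorem vop₂_sv (V : Vertex) (c : ℤ) (V' : Vertex) (c' E E' n : ℤ) (f : Osc) :
    vop₂ ħ k ρ σ A S V c V' c' E E' (sv A k ρ σ n f) = sv A k ρ σ (n + S.sign * (c + c'))
      ((qpow ħ (V.zeroExp k ρ σ A (S.zeroIdx (c + c') n) +
        V'.zeroExp k ρ σ A (S.zeroIdx (c + c') n)) •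
        oscOp₂ ħ k S V V' (E - c * S.zeroIdx (c + c') n) (E' - c' * S.zeroIdx (c + c') n) :
          Module.End ℂ Osc) f) := by
  rw [vop₂, fockLift_sv]; rfl

theorem vop₂_swap (V : Vertex) (c : ℤ) (V' : Vertex) (c' E E' : ℤ) :
    vop₂ ħ k ρ σ A S V c V' c' E E' = vop₂ ħ k ρ σ A S V' c' V c E' E := by
  refine fock_ext fun n f => ?_
  rw [vop₂_sv, vop₂_sv, oscOp₂_swap, add_comm c' c, add_comm (V.zeroExp _ _ _ _ _)]

/-- Wick's theorem including zero modes. Besides the contraction, the zero modes of V pass the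
charge c' of V'; this produces the constant `qpow ħ (V.zeroComm k c')` and the power z^{c c'}, hence
the shift of E by c c'. -/
theorem hasLocSum_vop_mul (V : Vertex) (c : ℤ) (V' : Vertex) (c' E E' : ℤ) :
    HasLocSum (fun l : ℤ => (qpow ħ (V.zeroComm k c') * contrZ ħ k V V' l) •
        vop₂ ħ k ρ σ A S V c V' c' (E - c * c' + l) (E' - l))
      (S.mul (vop ħ k ρ σ A S V c E) (vop ħ k ρ σ A S V' c' E')) := by
  refine HasLocSum.of_sv (fun n => n + S.sign * (c + c'))
    (fun n l => (qpow ħ (V.zeroComm k c') * qpow ħ (V.zeroExp k ρ σ A (S.zeroIdx (c + c') n) +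
        V'.zeroExp k ρ σ A (S.zeroIdx (c + c') n))) • contrZ ħ k V V' l •
      oscOp₂ ħ k S V V' (E - c * c' - c * S.zeroIdx (c + c') n + l)
        (E' - c' * S.zeroIdx (c + c') n - l)) _
    (fun n => (hasLocSum_oscOp_mul ħ k S V V' _ _).smul _) (fun n l f => ?_) (fun n f => ?_)
  · rw [LinearMap.smul_apply, vop₂_sv, ← map_smul, ← LinearMap.smul_apply, smul_smul, smul_smul]
    congr 3
    · ring
    · congr 1 <;> ring
  · cases S
    · simp only [Side.mul, Module.End.mul_apply, vop_sv, Side.zeroIdx, Side.sign, one_mul,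
        LinearMap.smul_apply, map_smul, smul_smul, ← qpow_add]
      have e1 : n + c' + c = n + (c + c') := by ring
      have e2 : E - c * (n + c') = E - c * c' - c * n := by ring
      rw [zeroExp_add, e1, e2]
      congr 2
      ring
    · simp only [Side.mul, Module.End.mul_apply, vop_sv, Side.zeroIdx, Side.sign,
        LinearMap.smul_apply, map_smul, smul_smul, ← qpow_add]
      have e1 : n + -1 * c + -1 * c' = n + -1 * (c + c') := by ring
      have e2 : n - c = n - (c + c') + c' := by ring
      have e3 : n + -1 * c - c' = n - (c + c') := by ring
      have e4 : E - c * (n - (c + c') + c') = E - c * c' - c * (n - (c + c')) := by ring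
      rw [e1, e3, e2, zeroExp_add, e4]
      congr 2
      ring

theorem hasLocSum_vop_nmul (V : Vertex) (c : ℤ) (V' : Vertex) (c' E E' : ℤ) :
    HasLocSum (fun l : ℤ => vop₂ ħ k ρ σ A S V c V' c' (E + l) (E' - l))
      (vop ħ k ρ σ A S (V.nmul V') (c + c') (E + E')) := by
  refine HasLocSum.of_sv (fun n => n + S.sign * (c + c'))
    (fun n l => (qpow ħ (V.zeroExp k ρ σ A (S.zeroIdx (c + c') n) +
        V'.zeroExp k ρ σ A (S.zeroIdx (c + c') n))) •
      oscOp₂ ħ k S V V' (E - c * S.zeroIdx (c + c') n + l)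
        (E' - c' * S.zeroIdx (c + c') n - l)) _
    (fun n => (hasLocSum_oscOp_nmul ħ k S V V' _ _).smul _) (fun n l f => ?_) (fun n f => ?_)
  · rw [vop₂_sv]
    congr 3
    congr 1 <;> ring
  · rw [vop_sv, zeroExp_nmul]
    congr 4
    ring

/-- The fractional part of the powers of `z` in the operators of `x`-charge one. -/
def Sector.frac : Sector → ℂ
  | .NS => 0
  | .R => 1 / 2

/-- The vertex operators with the `Q`-part and the powers of `z` of `x`-charge `c`. -/
structure HasCharge (V : Vertex) (c : ℤ) : Prop where
  charge_tilde : V.charge .tilde = c * (k + 2)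
  charge_bar : V.charge .bar = c * 2
  charge_beta : V.charge .beta = 0
  logz_tilde : V.logz .tilde = c * (1 / k)
  logz_bar : V.logz .bar = c * (1 / k)
  logz_beta : V.logz .beta = 0

variable {k}

theorem HasCharge.nmul {V V' : Vertex} {c c' : ℤ} (h : HasCharge k V c) (h' : HasCharge k V' c') :
    HasCharge k (V.nmul V') (c + c') := by
  obtain ⟨h1, h2, h3, h4, h5, h6⟩ := h
  obtain ⟨g1, g2, g3, g4, g5, g6⟩ := h'
  constructor <;> simp only [Vertex.nmul, h1, h2, h3, h4, h5, h6, g1, g2, g3, g4, g5, g6] <;>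
    push_cast <;> ring

theorem HasCharge.rescale {V : Vertex} {c : ℤ} (h : HasCharge k V c) (s : ℂ) :
    HasCharge k (V.rescale ħ s) c :=
  ⟨h.1, h.2, h.3, h.4, h.5, h.6⟩

/-- The momentum ρ cancels between α̃ and ᾱ, and ((k+2)n - 2n)/k = n. In the Ramond sector the extra
momentum k/2 adds 1/2. Hence the powers of z are integers up to the fixed shift c · `A.frac`,
whatever ρ is. -/
theorem HasCharge.logz_sum {V : Vertex} {c : ℤ} (h : HasCharge k V c) (hk : k ≠ 0) (n : ℤ) :
    ∑ i, V.logz i * (zeroSign i * sectorMom A k ρ σ n i) = c * (n + A.frac) := by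
  have : (Finset.univ : Finset Boson) = {.tilde, .bar, .beta} := rfl
  rw [this]
  cases A <;> simp [sectorMom, mom3, zeroSign, h.logz_tilde, h.logz_bar, h.logz_beta,
    Sector.frac] <;> field_simp <;> ring

theorem HasCharge.shift_eq {V : Vertex} {c : ℤ} (h : HasCharge k V c) (n : ℤ) :
    V.shift S (sectorMom A k ρ σ n) = sectorMom A k ρ σ (n + S.sign * c) := by
  funext i
  cases S <;> cases A <;> cases i <;>
    simp [sectorMom, mom3, Vertex.shift, h.charge_tilde, h.charge_bar, h.charge_beta, Side.sign] <;>
    ring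

theorem HasCharge.zeroMom_eq {V : Vertex} {c : ℤ} (h : HasCharge k V c) (n : ℤ) :
    V.zeroMom S (sectorMom A k ρ σ n) = sectorMom A k ρ σ (S.zeroIdx c n) := by
  cases S
  · rfl
  · rw [Vertex.zeroMom, h.shift_eq]
    simp [Side.zeroIdx, Side.sign, sub_eq_add_neg]

theorem zeroExp_rescale {V : Vertex} {c : ℤ} (h : HasCharge k V c) (hk : k ≠ 0) (s : ℂ) (n : ℤ) :
    (V.rescale ħ s).zeroExp k ρ σ A n = V.zeroExp k ρ σ A n + s * (c * (n + A.frac)) := by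
  rw [← h.logz_sum ρ σ A hk n]
  simp only [Vertex.zeroExp, Vertex.rescale, add_mul, Finset.sum_add_distrib, Finset.mul_sum,
    mul_assoc]

theorem vop_rescale {V : Vertex} {c : ℤ} (h : HasCharge k V c) (hk : k ≠ 0) (s : ℂ) (E : ℤ) :
    vop ħ k ρ σ A S (V.rescale ħ s) c E = qpow ħ (s * (E + c * A.frac)) •
      vop ħ k ρ σ A S V c E := by
  refine fock_ext fun n f => ?_
  rw [LinearMap.smul_apply, vop_sv, vop_sv, ← map_smul, oscOp_rescale,
    zeroExp_rescale ħ ρ σ A h hk, smul_smul, ← LinearMap.smul_apply, smul_smul, ← qpow_add,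
    ← qpow_add]
  congr 4
  push_cast
  ring

theorem vop₂_rescale (V : Vertex) (c : ℤ) {V' : Vertex} {c' : ℤ} (h : HasCharge k V' c')
    (hk : k ≠ 0) (s : ℂ) (E E' : ℤ) :
    vop₂ ħ k ρ σ A S V c (V'.rescale ħ s) c' E E' = qpow ħ (s * (E' + c' * A.frac)) •
      vop₂ ħ k ρ σ A S V c V' c' E E' := by
  refine fock_ext fun n f => ?_
  rw [LinearMap.smul_apply, vop₂_sv, vop₂_sv, ← map_smul, oscOp₂_rescale,
    zeroExp_rescale ħ ρ σ A h hk, smul_smul, ← LinearMap.smul_apply, smul_smul, ← qpow_add,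
    ← qpow_add]
  congr 4
  push_cast
  ring

/-- Summing the coefficients of :V(z)V'(w): against q^{t l} multiplies by the delta function that
sets w = q^{-t} z, so the result is a mode of one fused vertex operator. -/
theorem hasLocSum_vop_diag (V : Vertex) (c : ℤ) {V' : Vertex} {c' : ℤ} (h : HasCharge k V' c')
    (hk : k ≠ 0) (t : ℂ) (E E' : ℤ) :
    HasLocSum (fun l : ℤ => qpow ħ (t * l) • vop₂ ħ k ρ σ A S V c V' c' (E + l) (E' - l))
      (qpow ħ (t * (E' + c' * A.frac)) •
        vop ħ k ρ σ A S (V.nmul (V'.rescale ħ (-t))) (c + c') (E + E')) := by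
  refine ((hasLocSum_vop_nmul ħ k ρ σ A S V c (V'.rescale ħ (-t)) c' E E').smul _).congr
    (fun l => ?_) rfl
  rw [vop₂_rescale ħ ρ σ A S V c h hk, smul_smul, ← qpow_add]
  congr 2
  push_cast
  ring

open scoped Classical in
theorem hasLocSum_oscOp_nat (V : Vertex) (i : ℤ) (z e : ℂ) (he : e = z + i) :
    HasLocSum (fun x : ℕ × ℕ => if z + x.1 - x.2 = e then
      S.mul (creation ħ k S V x.1) (annihilation ħ k S V x.2) else 0) (oscOp ħ k S V i) := by
  have h1 : HasLocSum (fun x : ℤ × ℤ => if x.2 = i + x.1 then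
      S.mul (crZ ħ k S V x.2) (anZ ħ k S V x.1) else 0) (oscOp ħ k S V i) := by
    refine HasLocSum.of_comp_injective (e := fun b : ℤ => (b, i + b))
      (fun a b hab => congrArg Prod.fst hab) ?_ ?_
    · simpa using hasLocSum_oscOp ħ k S V i
    · rintro ⟨b, a⟩ hx
      refine if_neg fun hab => hx ⟨b, ?_⟩
      simp only at hab
      rw [hab]
  refine (h1.comp_injective (e := fun x : ℕ × ℕ => ((x.2 : ℤ), (x.1 : ℤ))) ?_ ?_).congr ?_ rfl
  · rintro ⟨a, b⟩ ⟨a', b'⟩ hab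
    simpa [and_comm] using hab
  · rintro ⟨b, a⟩ hx
    split_ifs
    · by_cases hb : 0 ≤ b
      · by_cases ha : 0 ≤ a
        · exact absurd ⟨(a.toNat, b.toNat), by simp [ha, hb]⟩ hx
        · rw [crZ, zext_of_neg _ (not_le.1 ha), Side.zero_mul]
      · rw [anZ, zext_of_neg _ (not_le.1 hb), Side.mul_zero]
    · rfl
  · rintro ⟨a, b⟩
    have : z + (a : ℂ) - b = e ↔ (a : ℤ) = i + b := by
      rw [he]
      constructor
      · intro h
        have h' : (a : ℂ) = i + b := by linear_combination h
        exact_mod_cast h'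
      · intro h
        have h' : (a : ℂ) = i + b := by exact_mod_cast h
        linear_combination h'
    by_cases hab : (a : ℤ) = i + b
    · simp only [hab, this.2 hab, if_true]
      rw [← hab, crZ, anZ, zext_natCast, zext_natCast]
    · rw [if_neg hab, if_neg (fun h => hab (this.1 h))]

/-- The link with the modes of the statement, which are indexed by complex exponents: the zero modes
account for c(n + `A.frac`), and the remaining condition on the oscillators is an equation between
integers. -/
theorem toBig_vop {V : Vertex} {c : ℤ} (h : HasCharge k V c) (hk : k ≠ 0) (E : ℤ)
    (x : FockSpace A k ρ σ) :
    toBig A k ρ σ (vop ħ k ρ σ A S V c E x) =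
      V.coeff ħ k S (E + c * A.frac) (toBig A k ρ σ x) := by
  induction x using fock_induction with
  | h0 => simp
  | hadd x y hx hy => simp only [map_add, hx, hy]
  | hs n f =>
    rw [vop_sv, toBig_sv, toBig_sv, Vertex.coeff, Finsupp.lsum_single, LinearMap.comp_apply,
      Finsupp.lsingle_apply, h.shift_eq, h.zeroMom_eq,
      (hasLocSum_oscOp_nat ħ S V (E - c * S.zeroIdx c n) _ _ ?_).locSum_eq]
    · rfl
    · rw [h.logz_sum ρ σ A hk]
      push_cast
      ring

end VertexModes

end

section

/-! ### Contraction functions as rational functions. -/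

section PowerSeriesTools

open PowerSeries

/-- The power series `∏ (1 - a x)`. -/
def prodSeries (L : List ℂ) : PowerSeries ℂ := (L.map fun a => 1 - C a * X).prod

/-- The power series `∑ₙ (∑ aⁿ) xⁿ`, `n > 0`. -/
def powerSums (L : List ℂ) : PowerSeries ℂ :=
  PowerSeries.mk fun n => if n = 0 then 0 else (L.map fun a => a ^ n).sum

theorem prodSeries_cons (a : ℂ) (L : List ℂ) :
    prodSeries (a :: L) = (1 - C a * X) * prodSeries L := by simp [prodSeries]

theorem prodSeries_nil : prodSeries [] = 1 := rfl

theorem constantCoeff_prodSeries (L : List ℂ) : constantCoeff (prodSeries L) = 1 := by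
  induction L with
  | nil => simp [prodSeries]
  | cons a L ih => simp [prodSeries_cons, ih]

theorem prodSeries_ne_zero (L : List ℂ) : prodSeries L ≠ 0 := by
  intro h
  have := constantCoeff_prodSeries L
  rw [h] at this
  simp at this

theorem geom_mul (a : ℂ) : (PowerSeries.mk fun n => a ^ n) * (1 - C a * X) = 1 := by
  ext n
  rw [mul_sub, mul_one, ← mul_assoc, map_sub]
  rcases n with _ | n
  · simp
  · rw [coeff_succ_mul_X, coeff_mul_C, coeff_mk, coeff_mk, coeff_one, if_neg (by omega), pow_succ,
      sub_self]

theorem euler_prodSeries (L : List ℂ) :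
    euler (prodSeries L) = -powerSums L * prodSeries L := by
  induction L with
  | nil =>
    have h1 : powerSums [] = 0 := by ext n; simp [powerSums]
    rw [h1, prodSeries_nil]
    have h2 := euler_C (1 : ℂ)
    rw [map_one] at h2
    rw [h2]
    simp
  | cons a L ih =>
    have h1 : powerSums (a :: L) = (PowerSeries.mk fun n => a ^ n) - 1 + powerSums L := by
      ext n
      rcases n with _ | n <;> simp [powerSums, coeff_one]
    have h2 : euler (1 - C a * X : PowerSeries ℂ) = -(C a * X) := by
      ext n
      rw [coeff_euler]
      rcases n with _ | _ | n <;> simp [coeff_one]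
    rw [prodSeries_cons, euler_mul, ih, h2, h1]
    linear_combination (prodSeries L) * geom_mul a

/-- The logarithmic Euler derivative of 1 - a x is minus the sum of the a^n x^n over n > 0. The
hypothesis therefore says that both sides solve the same Euler equation with constant term 1. -/
theorem expSeries_mul_prodSeries {γ : ℕ → ℂ} (L₁ L₂ : List ℂ)
    (h : ∀ j : ℕ, ((j : ℂ) + 1) * γ j =
      (L₁.map fun a => a ^ (j + 1)).sum - (L₂.map fun a => a ^ (j + 1)).sum) :
    expSeries (shiftSeries γ) * prodSeries L₁ = prodSeries L₂ := by
  have h1 : euler (shiftSeries γ) = powerSums L₁ - powerSums L₂ := by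
    ext n
    rw [coeff_euler]
    rcases n with _ | n
    · simp [powerSums]
    · rw [shiftSeries, coeff_mk]
      simpa [powerSums] using h n
  refine euler_unique (F := -powerSums L₂) ?_ ?_ (euler_prodSeries L₂) ?_
  · rw [← coeff_zero_eq_constantCoeff_apply]; simp [powerSums]
  · rw [euler_mul, euler_expSeries (constantCoeff_shiftSeries γ) fun _ _ => Commute.all _ _,
      euler_prodSeries, h1]
    ring
  · rw [map_mul, constantCoeff_expSeries, constantCoeff_prodSeries, constantCoeff_prodSeries,
      one_mul]

theorem mul_eq_one_of_prodSeries {P Q : PowerSeries ℂ} {L₁ L₂ : List ℂ}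
    (h : P * prodSeries L₁ = prodSeries L₂) (h' : Q * prodSeries L₂ = prodSeries L₁) :
    Q * P = 1 := by
  refine mul_right_cancel₀ (prodSeries_ne_zero L₁) ?_
  rw [mul_assoc, h, h', one_mul]

/-- The expansion of `(1 - b x) (1 - d x) / ((1 - a x) (1 - c x))`. -/
theorem partialFractions_mul {a b c d : ℂ} (ha : a ≠ 0) (hc : c ≠ 0) (hac : a ≠ c) :
    (PowerSeries.mk fun n => (a - b) * (a - d) / (a * (a - c)) * a ^ n +
      (c - b) * (c - d) / (c * (c - a)) * c ^ n + if n = 0 then b * d / (a * c) else 0) *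
        prodSeries [a, c] = prodSeries [b, d] := by
  have h1 : (PowerSeries.mk fun n => (a - b) * (a - d) / (a * (a - c)) * a ^ n +
      (c - b) * (c - d) / (c * (c - a)) * c ^ n + if n = 0 then b * d / (a * c) else 0) =
      C ((a - b) * (a - d) / (a * (a - c))) * (PowerSeries.mk fun n => a ^ n) +
      C ((c - b) * (c - d) / (c * (c - a))) * (PowerSeries.mk fun n => c ^ n) +
      C (b * d / (a * c)) := by
    ext n
    rcases n with _ | n
    · simp
    · simp
  have hac' : a - c ≠ 0 := sub_ne_zero.2 hac
  have hca : c - a ≠ 0 := sub_ne_zero.2 hac.symm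
  -- `e1`, `e2` and `e3` compare the coefficients of 1, x and x² after multiplication by the
  -- denominator.
  have e1 : (a - b) * (a - d) / (a * (a - c)) + (c - b) * (c - d) / (c * (c - a)) +
      b * d / (a * c) = 1 := by
    have : c - a = -(a - c) := by ring
    rw [this] at hca ⊢
    field_simp
    ring
  have e2 : (a - b) * (a - d) / (a * (a - c)) * c + (c - b) * (c - d) / (c * (c - a)) * a +
      b * d / (a * c) * (a + c) = b + d := by
    have : c - a = -(a - c) := by ring
    rw [this] at hca ⊢
    field_simp
    ring
  have e3 : b * d / (a * c) * (a * c) = b * d := by field_simp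
  have f1 := congrArg (C (R := ℂ)) e1
  have f2 := congrArg (C (R := ℂ)) e2
  have f3 := congrArg (C (R := ℂ)) e3
  simp only [map_add, map_mul, map_one] at f1 f2 f3
  rw [h1]
  simp only [prodSeries_cons, prodSeries_nil]
  have g1 := geom_mul a
  have g2 := geom_mul c
  linear_combination (C ((a - b) * (a - d) / (a * (a - c))) * (1 - C c * X)) * g1 +
    (C ((c - b) * (c - d) / (c * (c - a))) * (1 - C a * X)) * g2 + f1 - X * f2 + X ^ 2 * f3

theorem coeff_of_mul_prodSeries {P : PowerSeries ℂ} {a b c d : ℂ} (ha : a ≠ 0) (hc : c ≠ 0)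
    (hac : a ≠ c) (h : P * prodSeries [a, c] = prodSeries [b, d]) (n : ℕ) :
    coeff n P = (a - b) * (a - d) / (a * (a - c)) * a ^ n +
      (c - b) * (c - d) / (c * (c - a)) * c ^ n + if n = 0 then b * d / (a * c) else 0 := by
  have := mul_right_cancel₀ (prodSeries_ne_zero _) (h.trans (partialFractions_mul ha hc hac).symm)
  rw [this, coeff_mk]

theorem coeff_of_mul_prodSeries_single {P : PowerSeries ℂ} {a : ℂ}
    (h : P * prodSeries [a] = prodSeries []) (n : ℕ) : coeff n P = a ^ n := by
  have h1 : prodSeries [a] = 1 - C a * X := by simp [prodSeries]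
  have := mul_right_cancel₀ (prodSeries_ne_zero [a])
    (h.trans (show prodSeries [] = (PowerSeries.mk fun n => a ^ n) * prodSeries [a] by
      rw [h1, geom_mul, prodSeries_nil]))
  rw [this, coeff_mk]

theorem expSeries_shiftSeries_zero {γ : ℕ → ℂ} (h : ∀ j, γ j = 0) :
    expSeries (shiftSeries γ) = 1 := by
  simpa [prodSeries] using expSeries_mul_prodSeries (γ := γ) [] [] fun j => by simp [h]

end PowerSeriesTools

/-! ### Inverting triangular systems of relations. -/

section Chains

variable {V : Type*} [AddCommGroup V] [Module ℂ V]

open PowerSeries in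
/-- Inversion of a system of relations with a power series of coefficients. -/
theorem eq_sum_of_hasLocSum_chain (N P : ℤ → Module.End ℂ V) (M : ℕ) {F D : PowerSeries ℂ}
    (hDF : D * F = 1)
    (hP : ∀ l, HasLocSum (fun j : ℤ => zext (fun n => coeff n F) j • N (l + j)) (P l))
    (hN : ∀ l : ℤ, M < l → N l = 0) :
    N 0 = ∑ l ∈ Finset.range (M + 1), coeff l D • P l := by
  -- Since N vanishes beyond M, the relations form a finite upper triangular Toeplitz system with
  -- symbol F.
  have h1 : ∀ l : ℕ, P l = ∑ s ∈ Finset.range (M + 1),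
      (if l ≤ s then coeff (s - l) F else 0) • N s := by
    intro l
    have h2 := (hP l).comp_equiv (Equiv.subRight (l : ℤ))
    have h3 : HasLocSum (fun s : ℤ => zext (fun n => coeff n F) (s - l) • N s) (P l) :=
      h2.congr (fun s => by simp) rfl
    refine h3.unique (HasLocSum.of_comp_injective (e := ((↑) : ℕ → ℤ)) Nat.cast_injective ?_ ?_)
    · refine (HasLocSum.of_finset (Finset.range (M + 1)) fun s hs => ?_).congr (fun l => rfl) ?_
      · rw [hN _ (by simp at hs; omega), smul_zero]
      · refine Finset.sum_congr rfl fun s _ => ?_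
        split_ifs with h
        · rw [← Nat.cast_sub h, zext_natCast]
        · rw [zext_of_neg _ (by omega)]
    · intro s hs
      have : s < 0 := by
        by_contra hn
        exact hs ⟨s.toNat, by simp at hn; simpa using hn⟩
      rw [zext_of_neg _ (by omega), zero_smul]
  -- The coefficients of D form the row vector that inverts the system: this is the coefficient of
  -- x^s in D F = 1.
  have h4 : ∀ s ∈ Finset.range (M + 1), ∑ l ∈ Finset.range (M + 1),
      coeff l D * (if l ≤ s then coeff (s - l) F else 0) = if s = 0 then 1 else 0 := by
    intro s hs
    have h5 := congrArg (coeff s) hDF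
    rw [coeff_mul, Finset.Nat.sum_antidiagonal_eq_sum_range_succ_mk, coeff_one] at h5
    rw [← h5, ← Finset.sum_subset (s₁ := Finset.range (s + 1))]
    · refine Finset.sum_congr rfl fun l hl => ?_
      rw [if_pos (by simpa [Nat.lt_succ_iff] using hl)]
    · intro l
      simp at hs ⊢
      omega
    · intro l _ hl
      rw [if_neg (by simpa using hl), mul_zero]
  simp only [h1, Finset.smul_sum, smul_smul]
  rw [Finset.sum_comm]
  simp only [← Finset.sum_smul]
  rw [Finset.sum_congr rfl fun s hs => by rw [h4 s hs]]
  simp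

end Chains

/-! ### Exchange relations for modes of vertex operators. -/

section VertexAlgebra

open PowerSeries

variable (ħ k ρ σ : ℂ) (A : Sector) (S : Side)

theorem contr_eq_one_of_neg {V V' : Vertex} (h : ∀ i (j : ℕ), V'.osc i (-(j + 1)) = 0) :
    contr ħ k V V' = 1 :=
  expSeries_shiftSeries_zero fun j => Finset.sum_eq_zero fun i _ => by
    rw [h, mul_zero, zero_mul]

theorem contr_eq_one_of_pos {V V' : Vertex} (h : ∀ i (j : ℕ), V.osc i (j + 1) = 0) :
    contr ħ k V V' = 1 :=
  expSeries_shiftSeries_zero fun j => Finset.sum_eq_zero fun i _ => by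
    rw [h, zero_mul, zero_mul]

theorem expSeries_zero {R : Type*} [Ring R] [Algebra ℂ R] : expSeries (0 : PowerSeries R) = 1 :=
  (expSeries_eq_of_euler (by simp) (by simp) (by
    have := euler_C (1 : R)
    rw [map_one] at this
    rw [this]
    ext n
    simp [coeff_euler]) (by simp)).symm

theorem oscOp_of_neg {V : Vertex} (h : ∀ i (j : ℕ), V.osc i (-(j + 1)) = 0) (i : ℤ) :
    oscOp ħ k S V i = anZ ħ k S V (-i) := by
  have h0 : negSeries ħ k S V = 0 := by
    ext1 n
    rcases n with _ | n <;> simp only [negSeries, coeff_mk, map_zero]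
    exact Finset.sum_eq_zero fun i _ => by rw [h, zero_smul]
  have h1 : ∀ a, crZ ħ k S V a = if a = 0 then 1 else 0 := by
    intro a
    rw [crZ_eq, h0, expSeries_zero]
    by_cases ha : 0 ≤ a
    · obtain ⟨a, rfl⟩ := Int.eq_ofNat_of_zero_le ha
      rw [zext_natCast, coeff_one]
      simp
    · rw [zext_of_neg _ (not_le.1 ha), if_neg (by omega)]
  refine (hasLocSum_oscOp ħ k S V i).unique ((HasLocSum.single (-i) fun b hb => ?_).congr
    (fun b => rfl) ?_)
  · rw [h1, if_neg (by omega), Side.zero_mul]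
  · rw [h1, if_pos (by omega), Side.one_mul]

theorem oscOp_of_pos {V : Vertex} (h : ∀ i (j : ℕ), V.osc i (j + 1) = 0) (i : ℤ) :
    oscOp ħ k S V i = crZ ħ k S V i := by
  have h0 : posSeries ħ k S V = 0 := by
    ext1 n
    rcases n with _ | n <;> simp only [posSeries, coeff_mk, map_zero]
    exact Finset.sum_eq_zero fun i _ => by rw [h, zero_smul]
  have h1 : ∀ a, anZ ħ k S V a = if a = 0 then 1 else 0 := by
    intro a
    rw [anZ_eq, h0, expSeries_zero]
    by_cases ha : 0 ≤ a
    · obtain ⟨a, rfl⟩ := Int.eq_ofNat_of_zero_le ha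
      rw [zext_natCast, coeff_one]
      simp
    · rw [zext_of_neg _ (not_le.1 ha), if_neg (by omega)]
  refine (hasLocSum_oscOp ħ k S V i).unique ((HasLocSum.single 0 fun b hb => ?_).congr
    (fun b => rfl) ?_)
  · rw [h1, if_neg hb, Side.mul_zero]
  · rw [h1, if_pos rfl, Side.mul_one, add_zero]

theorem creation_zero (V : Vertex) : creation ħ k S V 0 = 1 := by
  rw [creation, coeff_zero_eq_constantCoeff_apply, constantCoeff_expSeries]

theorem annihilation_zero (V : Vertex) : annihilation ħ k S V 0 = 1 := by
  rw [annihilation, coeff_zero_eq_constantCoeff_apply, constantCoeff_expSeries]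

theorem vop_eq_zero_of_neg {V : Vertex} (h : ∀ i (j : ℕ), V.osc i (-(j + 1)) = 0) {E : ℤ}
    (hE : 0 < E) : vop ħ k ρ σ A S V 0 E = 0 := by
  refine fock_ext fun n f => ?_
  rw [vop_sv, oscOp_of_neg ħ k S h, zero_mul, sub_zero, anZ, zext_of_neg _ (by omega), smul_zero,
    LinearMap.zero_apply, map_zero, LinearMap.zero_apply]

theorem vop_eq_zero_of_pos {V : Vertex} (h : ∀ i (j : ℕ), V.osc i (j + 1) = 0) {E : ℤ}
    (hE : E < 0) : vop ħ k ρ σ A S V 0 E = 0 := by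
  refine fock_ext fun n f => ?_
  rw [vop_sv, oscOp_of_pos ħ k S h, zero_mul, sub_zero, crZ, zext_of_neg _ (by omega), smul_zero,
    LinearMap.zero_apply, map_zero, LinearMap.zero_apply]

theorem vop_smooth (V : Vertex) (c : ℤ) (x : FockSpace A k ρ σ) :
    ∃ N : ℤ, ∀ E, S.sign * E < N → vop ħ k ρ σ A S V c E x = 0 := by
  induction x using fock_induction with
  | h0 => exact ⟨0, fun E _ => map_zero _⟩
  | hadd x y hx hy =>
    obtain ⟨N, hN⟩ := hx
    obtain ⟨M, hM⟩ := hy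
    exact ⟨min N M, fun E hE => by
      rw [map_add, hN E (hE.trans_le (min_le_left _ _)), hM E (hE.trans_le (min_le_right _ _)),
        add_zero]⟩
  | hs n f =>
    obtain ⟨w, hw⟩ := exists_mem_weightSpan_le f
    refine ⟨S.sign * (c * S.zeroIdx c n) - w, fun E hE => ?_⟩
    rw [vop_sv, LinearMap.smul_apply, oscOp_eq_zero ħ k S hw (by rw [mul_sub]; linarith), smul_zero,
      map_zero]

/-- The substitution l ↦ c c' - l in the opposite product makes both orders run over the same
coefficients of :V V':, so a (anti)commutator is governed by one scalar sequence. It is used with η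
= 1 and η = -1. -/
theorem hasLocSum_vop_comm (V : Vertex) (c : ℤ) (V' : Vertex) (c' E E' : ℤ) (η : ℂ) :
    HasLocSum (fun l : ℤ => (qpow ħ (V.zeroComm k c') * contrZ ħ k V V' l +
        η * (qpow ħ (V'.zeroComm k c) * contrZ ħ k V' V (c * c' - l))) •
        vop₂ ħ k ρ σ A S V c V' c' (E - c * c' + l) (E' - l))
      (S.mul (vop ħ k ρ σ A S V c E) (vop ħ k ρ σ A S V' c' E') +
        η • S.mul (vop ħ k ρ σ A S V' c' E') (vop ħ k ρ σ A S V c E)) := by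
  have h1 := hasLocSum_vop_mul ħ k ρ σ A S V c V' c' E E'
  have h2 := ((hasLocSum_vop_mul ħ k ρ σ A S V' c' V c E' E).comp_equiv
    (Equiv.subLeft (c * c'))).smul η
  refine (h1.add h2).congr (fun l => ?_) rfl
  rw [add_smul, mul_smul η, Equiv.subLeft_apply, vop₂_swap ħ k ρ σ A S V' c' V c]
  congr 4 <;> ring

theorem vop_mul_of_contr_eq_one {V V' : Vertex} (h : contr ħ k V V' = 1) (c c' E E' : ℤ) :
    S.mul (vop ħ k ρ σ A S V c E) (vop ħ k ρ σ A S V' c' E') =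
      qpow ħ (V.zeroComm k c') • vop₂ ħ k ρ σ A S V c V' c' (E - c * c') E' := by
  have h1 : ∀ l, contrZ ħ k V V' l = if l = 0 then 1 else 0 := by
    intro l
    rw [contrZ, h]
    by_cases hl : 0 ≤ l
    · obtain ⟨l, rfl⟩ := Int.eq_ofNat_of_zero_le hl
      rw [zext_natCast, coeff_one]
      simp
    · rw [zext_of_neg _ (not_le.1 hl), if_neg (by omega)]
  refine (hasLocSum_vop_mul ħ k ρ σ A S V c V' c' E E').unique
    ((HasLocSum.single 0 fun l hl => ?_).congr (fun l => rfl) ?_)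
  · rw [h1, if_neg hl, mul_zero, zero_smul]
  · rw [h1, if_pos rfl, mul_one, add_zero, sub_zero]

theorem zeroComm_zero (V : Vertex) : V.zeroComm k 0 = 0 := by simp [Vertex.zeroComm]

/-- Moving an operator with creation part only to the right. -/
theorem vop_exchange_creation {K V : Vertex} (hK : ∀ i (j : ℕ), K.osc i (j + 1) = 0)
    {D : PowerSeries ℂ} (hD : D * contr ħ k V K = 1) (c : ℤ) (M : ℕ) (E : ℤ) :
    S.mul (vop ħ k ρ σ A S K 0 M) (vop ħ k ρ σ A S V c E) =
      qpow ħ (K.zeroComm k c) • ∑ l ∈ Finset.range (M + 1), coeff l D •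
        S.mul (vop ħ k ρ σ A S V c (E + l)) (vop ħ k ρ σ A S K 0 (M - l)) := by
  have hKV : ∀ M' E', S.mul (vop ħ k ρ σ A S K 0 M') (vop ħ k ρ σ A S V c E') =
      qpow ħ (K.zeroComm k c) • vop₂ ħ k ρ σ A S V c K 0 E' M' := by
    intro M' E'
    rw [vop_mul_of_contr_eq_one ħ k ρ σ A S (contr_eq_one_of_pos ħ k hK), vop₂_swap, zero_mul,
      sub_zero]
  -- In the order K V there is no contraction, so K V is a normal ordered coefficient; the products
  -- V K are given by a chain of such coefficients. The chain ends at l = M because K has no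
  -- negative powers of z.
  have h := eq_sum_of_hasLocSum_chain (fun l => vop₂ ħ k ρ σ A S V c K 0 (E + l) (M - l))
    (fun l => S.mul (vop ħ k ρ σ A S V c (E + l)) (vop ħ k ρ σ A S K 0 (M - l))) M hD
    (fun l => (hasLocSum_vop_mul ħ k ρ σ A S V c K 0 (E + l) (M - l)).congr (fun j => by
      rw [zeroComm_zero, qpow_zero, one_mul, mul_zero, sub_zero]
      change contrZ ħ k V K j • _ = contrZ ħ k V K j • _
      congr 2 <;> ring) rfl)
    (fun l hl => by
      have h1 := hKV (M - l) (E + l)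
      rw [vop_eq_zero_of_pos ħ k ρ σ A S hK (by omega), Side.zero_mul] at h1
      exact (smul_eq_zero.1 h1.symm).resolve_left (qpow_ne_zero _ _))
  rw [hKV, ← h, add_zero, sub_zero]

/-- Moving an operator with annihilation part only to the left. -/
theorem vop_exchange_annihilation {K V : Vertex} (hK : ∀ i (j : ℕ), K.osc i (-(j + 1)) = 0)
    {D : PowerSeries ℂ} (hD : D * contr ħ k K V = 1) (c : ℤ) (M : ℕ) (E : ℤ) :
    S.mul (vop ħ k ρ σ A S V c E) (vop ħ k ρ σ A S K 0 (-M)) =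
      qpow ħ (-K.zeroComm k c) • ∑ l ∈ Finset.range (M + 1), coeff l D •
        S.mul (vop ħ k ρ σ A S K 0 (-M + l)) (vop ħ k ρ σ A S V c (E - l)) := by
  have hKV : ∀ M' E', S.mul (vop ħ k ρ σ A S V c E') (vop ħ k ρ σ A S K 0 M') =
      vop₂ ħ k ρ σ A S K 0 V c M' E' := by
    intro M' E'
    rw [vop_mul_of_contr_eq_one ħ k ρ σ A S (contr_eq_one_of_neg ħ k hK), vop₂_swap, mul_zero,
      sub_zero, zeroComm_zero, qpow_zero, one_smul]
  have h := eq_sum_of_hasLocSum_chain (fun l => vop₂ ħ k ρ σ A S K 0 V c (-M + l) (E - l))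
    (fun l => qpow ħ (-K.zeroComm k c) •
      S.mul (vop ħ k ρ σ A S K 0 (-M + l)) (vop ħ k ρ σ A S V c (E - l))) M hD
    (fun l => ((hasLocSum_vop_mul ħ k ρ σ A S K 0 V c (-M + l) (E - l)).smul
      (qpow ħ (-K.zeroComm k c))).congr (fun j => by
      rw [smul_smul, ← mul_assoc, ← qpow_add, neg_add_cancel, qpow_zero, one_mul, zero_mul,
        sub_zero]
      change contrZ ħ k K V j • _ = contrZ ħ k K V j • _
      congr 2 <;> ring) rfl)
    (fun l hl => by
      have h1 := hKV (-M + l) (E - l)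
      rw [vop_eq_zero_of_neg ħ k ρ σ A S hK (by omega), Side.mul_zero] at h1
      exact h1.symm)
  rw [hKV, Finset.smul_sum]
  simp only [add_zero, sub_zero] at h
  rw [h]
  exact Finset.sum_congr rfl fun l _ => smul_comm _ _ _

theorem hasLocSum_vop_mul_annihilation {K : Vertex} (hK : ∀ i (j : ℕ), K.osc i (-(j + 1)) = 0)
    (V : Vertex) (c E : ℤ) :
    HasLocSum (fun b : ℕ => S.mul (vop ħ k ρ σ A S V c (E + b)) (vop ħ k ρ σ A S K 0 (-b)))
      (vop ħ k ρ σ A S (V.nmul K) c E) := by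
  have h : ∀ l : ℤ, S.mul (vop ħ k ρ σ A S V c (E + l)) (vop ħ k ρ σ A S K 0 (-l)) =
      vop₂ ħ k ρ σ A S V c K 0 (E + l) (0 - l) := by
    intro l
    rw [vop_mul_of_contr_eq_one ħ k ρ σ A S (contr_eq_one_of_neg ħ k hK), zeroComm_zero, qpow_zero,
      one_smul, mul_zero, sub_zero, zero_sub]
  have h1 := (hasLocSum_vop_nmul ħ k ρ σ A S V c K 0 E 0).congr (fun l => (h l).symm)
    (by rw [add_zero, add_zero])
  refine (h1.comp_injective (e := ((↑) : ℕ → ℤ)) Nat.cast_injective fun l hl => ?_)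
  have : l < 0 := by
    by_contra hn
    exact hl ⟨l.toNat, by simp at hn; simpa using hn⟩
  rw [vop_eq_zero_of_neg ħ k ρ σ A S hK (by omega), Side.mul_zero]

theorem hasLocSum_creation_mul_vop {K : Vertex} (hK : ∀ i (j : ℕ), K.osc i (j + 1) = 0)
    (V : Vertex) (c E : ℤ) :
    HasLocSum (fun a : ℕ => S.mul (vop ħ k ρ σ A S K 0 a) (vop ħ k ρ σ A S V c (E - a)))
      (qpow ħ (K.zeroComm k c) • vop ħ k ρ σ A S (K.nmul V) c E) := by
  have h : ∀ l : ℤ, S.mul (vop ħ k ρ σ A S K 0 l) (vop ħ k ρ σ A S V c (E - l)) =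
      qpow ħ (K.zeroComm k c) • vop₂ ħ k ρ σ A S K 0 V c (0 + l) (E - l) := by
    intro l
    rw [vop_mul_of_contr_eq_one ħ k ρ σ A S (contr_eq_one_of_pos ħ k hK), zero_mul, sub_zero,
      zero_add]
  have h1 := ((hasLocSum_vop_nmul ħ k ρ σ A S K 0 V c 0 E).smul (qpow ħ (K.zeroComm k c))).congr
    (fun l => (h l).symm) (by rw [zero_add, zero_add])
  refine (h1.comp_injective (e := ((↑) : ℕ → ℤ)) Nat.cast_injective fun l hl => ?_)
  have : l < 0 := by
    by_contra hn
    exact hl ⟨l.toNat, by simp at hn; simpa using hn⟩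
  rw [vop_eq_zero_of_pos ħ k ρ σ A S hK (by omega), Side.zero_mul]

/-- The sum `∑ K_{-α} V K'_β` is a vertex operator. -/
theorem hasLocSum_sandwich {K K' : Vertex} (hK : ∀ i (j : ℕ), K.osc i (j + 1) = 0)
    (hK' : ∀ i (j : ℕ), K'.osc i (-(j + 1)) = 0) (V : Vertex) (c E : ℤ) :
    HasLocSum (fun x : ℕ × ℕ => S.mul (vop ħ k ρ σ A S K 0 x.1)
        (S.mul (vop ħ k ρ σ A S V c (E - x.1 + x.2)) (vop ħ k ρ σ A S K' 0 (-x.2))))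
      (qpow ħ (K.zeroComm k c) • vop ħ k ρ σ A S (K.nmul (V.nmul K')) c E) := by
  refine HasLocSum.of_iterated (fun v => ?_) (fun a =>
    (hasLocSum_vop_mul_annihilation ħ k ρ σ A S hK' V c (E - a)).side_mul_left S
      (vop ħ k ρ σ A S K 0 a))
    (hasLocSum_creation_mul_vop ħ k ρ σ A S hK (V.nmul K') c E)
  cases S
  -- Joint finiteness is obtained in the order of action: the operator that acts first leaves
  -- finitely many values of its own index, and for each of them the smoothness of V bounds the
  -- other index.
  · obtain ⟨N, hN⟩ := vop_smooth ħ k ρ σ A .left K' 0 v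
    have h1 : ∀ b : ℕ, ∃ M : ℕ, ∀ a : ℕ, M ≤ a →
        vop ħ k ρ σ A .left V c (E - a + b) (vop ħ k ρ σ A .left K' 0 (-b) v) = 0 := by
      intro b
      obtain ⟨M, hM⟩ := vop_smooth ħ k ρ σ A .left V c (vop ħ k ρ σ A .left K' 0 (-b) v)
      refine ⟨(E + b - M + 1).toNat, fun a ha => hM _ ?_⟩
      simp only [Side.sign]
      omega
    choose M hM using h1
    refine (Set.Finite.biUnion (Set.finite_Iio ((1 - N).toNat)) (t := fun b =>
      (Set.finite_Iio (M b)).toFinset.image (fun a => (a, b))) fun b _ =>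
      Finset.finite_toSet _).subset ?_
    rintro ⟨a, b⟩ hx
    simp only [Set.mem_iUnion, Finset.coe_image, Set.mem_image, Set.Finite.coe_toFinset,
      Set.mem_Iio, Prod.mk.injEq, exists_prop]
    refine ⟨b, ?_, a, ?_, rfl, rfl⟩
    · by_contra hb
      refine hx ?_
      simp only [Side.mul, Module.End.mul_apply]
      rw [hN (-b) (by simp only [Side.sign]; omega), map_zero, map_zero]
    · by_contra ha
      refine hx ?_
      simp only [Side.mul, Module.End.mul_apply]
      rw [hM b a (by omega), map_zero]
  · obtain ⟨N, hN⟩ := vop_smooth ħ k ρ σ A .right K 0 v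
    have h1 : ∀ a : ℕ, ∃ M : ℕ, ∀ b : ℕ, M ≤ b →
        vop ħ k ρ σ A .right V c (E - a + b) (vop ħ k ρ σ A .right K 0 a v) = 0 := by
      intro a
      obtain ⟨M, hM⟩ := vop_smooth ħ k ρ σ A .right V c (vop ħ k ρ σ A .right K 0 a v)
      refine ⟨(a - E - M + 1).toNat, fun b hb => hM _ ?_⟩
      simp only [Side.sign]
      omega
    choose M hM using h1
    refine (Set.Finite.biUnion (Set.finite_Iio ((1 - N).toNat)) (t := fun a =>
      (Set.finite_Iio (M a)).toFinset.image (fun b => (a, b))) fun b _ =>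
      Finset.finite_toSet _).subset ?_
    rintro ⟨a, b⟩ hx
    simp only [Set.mem_iUnion, Finset.coe_image, Set.mem_image, Set.Finite.coe_toFinset,
      Set.mem_Iio, Prod.mk.injEq, exists_prop]
    refine ⟨a, ?_, b, ?_, rfl, rfl⟩
    · by_contra hb
      refine hx ?_
      simp only [Side.mul, Module.End.mul_apply]
      rw [hN a (by simp only [Side.sign]; omega), map_zero, map_zero]
    · by_contra ha
      refine hx ?_
      simp only [Side.mul, Module.End.mul_apply]
      rw [hM a b (by omega), map_zero]

end VertexAlgebra

end

section

/-! ### Oscillator coefficients as rational functions of t = q^{km/2} and y = q^m. -/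

section Contractions

variable (ħ k : ℂ)

/-- `q ^ m` for `m = j + 1`. -/
def yPow (j : ℕ) : ℂ := qpow ħ (j + 1)

/-- `q ^ (k m / 2)` for `m = j + 1`. -/
def tPow (j : ℕ) : ℂ := qpow ħ (k / 2 * (j + 1))

theorem yPow_ne_zero (j : ℕ) : yPow ħ j ≠ 0 := qpow_ne_zero _ _

theorem tPow_ne_zero (j : ℕ) : tPow ħ k j ≠ 0 := qpow_ne_zero _ _

theorem qpow_eq_yt {x : ℂ} (j : ℕ) (a b : ℤ) (h : x = (a * (k / 2) + b) * (j + 1)) :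
    qpow ħ x = tPow ħ k j ^ a * yPow ħ j ^ b := by
  rw [h, tPow, yPow, ← qpow_mul_int, ← qpow_mul_int, ← qpow_add]
  congr 1
  ring

theorem qnum_neg (x : ℂ) : qnum ħ (-x) = -qnum ħ x := by
  rw [qnum, qnum, neg_neg, ← neg_div, neg_sub]

theorem qnum_k_mul (j : ℕ) : qnum ħ (k * (j + 1)) =
    (tPow ħ k j ^ 2 - (tPow ħ k j ^ 2)⁻¹) / qdiff ħ := by
  rw [qnum, qpow_eq_yt ħ k j 2 0 (by push_cast; ring), qpow_eq_yt ħ k j (-2) 0 (by push_cast; ring)]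
  simp [zpow_ofNat]
  
theorem qnum_k_add_two_mul (j : ℕ) : qnum ħ ((k + 2) * (j + 1)) =
    (tPow ħ k j ^ 2 * yPow ħ j ^ 2 - (tPow ħ k j ^ 2 * yPow ħ j ^ 2)⁻¹) / qdiff ħ := by
  rw [qnum, qpow_eq_yt ħ k j 2 2 (by push_cast; ring),
    qpow_eq_yt ħ k j (-2) (-2) (by push_cast; ring)]
  simp [zpow_ofNat, mul_comm]

theorem qnum_natural (j : ℕ) : qnum ħ (j + 1) = (yPow ħ j - (yPow ħ j)⁻¹) / qdiff ħ := by
  rw [qnum, qpow_neg]; rfl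

theorem qnum_two_mul (j : ℕ) : qnum ħ (2 * (j + 1)) =
    (yPow ħ j ^ 2 - (yPow ħ j ^ 2)⁻¹) / qdiff ħ := by
  rw [qnum, qpow_eq_yt ħ 0 j 0 2 (by push_cast; ring), qpow_eq_yt ħ 0 j 0 (-2) (by push_cast; ring)]
  simp [zpow_ofNat]

/-- `1 / (q - q⁻¹) [k m]`. -/
def rFrac (j : ℕ) : ℂ := (tPow ħ k j ^ 2 - (tPow ħ k j ^ 2)⁻¹)⁻¹

/-- `[m] / [2 m]`. -/
def wFrac (j : ℕ) : ℂ := (yPow ħ j - (yPow ħ j)⁻¹) / (yPow ħ j ^ 2 - (yPow ħ j ^ 2)⁻¹)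

variable (hD : qdiff ħ ≠ 0)

include hD in
theorem qnum_div_qnum (j : ℕ) : qnum ħ (j + 1) / qnum ħ (2 * (j + 1)) = wFrac ħ j := by
  rw [qnum_natural, qnum_two_mul, div_div_div_cancel_right₀ hD]; rfl

theorem inv_qnum_k (j : ℕ) : (qnum ħ (k * (j + 1)))⁻¹ = qdiff ħ * rFrac ħ k j := by
  rw [qnum_k_mul, inv_div]; rfl

theorem Vt_osc_pos (ε : ℤˣ) (j : ℕ) :
    (Vt ħ k ε).osc .tilde (j + 1) = -sg ε * (qdiff ħ * rFrac ħ k j) := by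
  rw [← inv_qnum_k, ← div_eq_mul_inv]
  simp [Vt]

theorem Vt_osc_neg (ε : ℤˣ) (j : ℕ) :
    (Vt ħ k ε).osc .tilde (-(j + 1)) = sg ε * (qdiff ħ * rFrac ħ k j) := by
  rw [← inv_qnum_k, ← div_eq_mul_inv]
  simp only [Vt]
  push_cast
  rw [mul_neg, qnum_neg, neg_div_neg_eq]

theorem Yv_osc_pos (ε : ℤˣ) (j : ℕ) :
    (Yv ħ k ε).osc .bar (j + 1) = -sg ε * (tPow ħ k j ^ (-(ε : ℤ)) * (qdiff ħ * rFrac ħ k j)) := by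
  rw [← inv_qnum_k, ← div_eq_mul_inv]
  have h1 : ((j : ℤ) + 1).natAbs = j + 1 := by omega
  simp only [Yv, h1]
  rw [qpow_eq_yt ħ k j (-(ε : ℤ)) 0 (by simp [sg])]
  push_cast
  rw [zpow_zero, mul_one]

theorem Yv_osc_neg (ε : ℤˣ) (j : ℕ) :
    (Yv ħ k ε).osc .bar (-(j + 1)) = sg ε * (tPow ħ k j ^ (-(ε : ℤ)) * (qdiff ħ * rFrac ħ k j)) := by
  rw [← inv_qnum_k, ← div_eq_mul_inv]
  have h1 : (-((j : ℤ) + 1)).natAbs = j + 1 := by omega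
  simp only [Yv, h1]
  rw [qpow_eq_yt ħ k j (-(ε : ℤ)) 0 (by simp [sg])]
  push_cast
  rw [zpow_zero, mul_one, mul_neg, qnum_neg, div_neg, neg_mul_neg]

include hD in
theorem Zv_osc_pos (i : Boson) (ε : ℤˣ) (j : ℕ) :
    (Zv ħ i ε).osc i (j + 1) = if ε = 1 then -(qdiff ħ * wFrac ħ j) else 0 := by
  rw [← qnum_div_qnum ħ hD]
  have h1 : ((j : ℤ) + 1).natAbs = j + 1 := by omega
  rcases Int.units_eq_one_or ε with rfl | rfl
  · have h2 : (0 : ℤ) < j + 1 := by omega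
    simp only [Zv, h1, Units.val_one, one_mul, h2, and_self, if_true, sg]
    push_cast
    ring
  · have h2 : ¬ (0 : ℤ) < -1 * (j + 1) := by omega
    have h3 : (-1 : ℤˣ) ≠ 1 := by decide
    simp only [Zv, Units.val_neg, Units.val_one, h2, and_false, h3, if_false]

include hD in
theorem Zv_osc_neg (i : Boson) (ε : ℤˣ) (j : ℕ) :
    (Zv ħ i ε).osc i (-(j + 1)) = if ε = 1 then 0 else qdiff ħ * wFrac ħ j := by
  rw [← qnum_div_qnum ħ hD]
  have h1 : (-((j : ℤ) + 1)).natAbs = j + 1 := by omega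
  rcases Int.units_eq_one_or ε with rfl | rfl
  · have h2 : ¬ (0 : ℤ) < -(j + 1) := by omega
    simp only [Zv, Units.val_one, one_mul, h2, and_false, if_true, if_false]
  · have h2 : (0 : ℤ) < j + 1 := by omega
    have h3 : (-1 : ℤˣ) ≠ 1 := by decide
    simp only [Zv, h1, Units.val_neg, Units.val_one, neg_mul_neg, one_mul, h2, and_self, if_true,
      h3, if_false, sg]
    push_cast
    ring

theorem rescale_osc_pos (V : Vertex) (s : ℂ) (i : Boson) (j : ℕ) (a b : ℤ)
    (h : -s = a * (k / 2) + b) :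
    (V.rescale ħ s).osc i (j + 1) = tPow ħ k j ^ a * yPow ħ j ^ b * V.osc i (j + 1) := by
  simp only [Vertex.rescale]
  rw [qpow_eq_yt ħ k j a b (by rw [h]; push_cast; ring)]

theorem rescale_osc_neg (V : Vertex) (s : ℂ) (i : Boson) (j : ℕ) (a b : ℤ)
    (h : s = a * (k / 2) + b) :
    (V.rescale ħ s).osc i (-(j + 1)) = tPow ħ k j ^ a * yPow ħ j ^ b * V.osc i (-(j + 1)) := by
  simp only [Vertex.rescale]
  rw [qpow_eq_yt ħ k j a b (by rw [h]; push_cast; ring)]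

theorem rescale_osc_eq_zero {V : Vertex} {i : Boson} (h : ∀ m, V.osc i m = 0) (s : ℂ) (m : ℤ) :
    (V.rescale ħ s).osc i m = 0 := by simp [Vertex.rescale, h]

theorem Zv_osc_of_ne {i i' : Boson} (h : i' ≠ i) (ε : ℤˣ) (m : ℤ) : (Zv ħ i ε).osc i' m = 0 := by
  simp [Zv, h]

theorem nmul_osc (V V' : Vertex) (i : Boson) (m : ℤ) :
    (V.nmul V').osc i m = V.osc i m + V'.osc i m := rfl

theorem Yv_osc_beta (ε : ℤˣ) (m : ℤ) : (Yv ħ k ε).osc .beta m = 0 := rfl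

theorem ev_osc_tilde (ε : ℤˣ) (m : ℤ) : (ev ħ k ε).osc .tilde m = 0 := by
  simp [ev, nmul_osc, Vertex.rescale, Zv, Yv]

theorem fv_osc_tilde (ε : ℤˣ) (m : ℤ) : (fv ħ k ε).osc .tilde m = 0 := by
  simp [fv, nmul_osc, Vertex.rescale, Zv, Yv, Vertex.inv]

-- The factor Z_ε has only modes of the sign of ε, which is the source of the case distinction here
-- and in the companions below.
include hD in
theorem ev_osc_bar_pos (ε : ℤˣ) (j : ℕ) : (ev ħ k ε).osc .bar (j + 1) =
    -qdiff ħ * (rFrac ħ k j / tPow ħ k j +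
      if ε = 1 then tPow ħ k j * yPow ħ j * wFrac ħ j else 0) := by
  rw [ev, nmul_osc, nmul_osc, rescale_osc_eq_zero ħ (Zv_osc_of_ne ħ (i := .beta) (by simp) ε), Yv_osc_pos,
    rescale_osc_pos ħ k _ _ _ j (ε : ℤ) (ε : ℤ) (by simp [sg]; ring), Zv_osc_pos ħ hD]
  rcases Int.units_eq_one_or ε with rfl | rfl <;> simp [sg] <;> ring

include hD in
theorem ev_osc_bar_neg (ε : ℤˣ) (j : ℕ) : (ev ħ k ε).osc .bar (-(j + 1)) =
    qdiff ħ * (rFrac ħ k j / tPow ħ k j +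
      if ε = 1 then 0 else tPow ħ k j * yPow ħ j * wFrac ħ j) := by
  rw [ev, nmul_osc, nmul_osc, rescale_osc_eq_zero ħ (Zv_osc_of_ne ħ (i := .beta) (by simp) ε), Yv_osc_neg,
    rescale_osc_neg ħ k _ _ _ j (-(ε : ℤ)) (-(ε : ℤ)) (by simp [sg]; ring), Zv_osc_neg ħ hD]
  rcases Int.units_eq_one_or ε with rfl | rfl <;> simp [sg] <;> ring

include hD in
theorem ev_osc_beta_pos (ε : ℤˣ) (j : ℕ) : (ev ħ k ε).osc .beta (j + 1) =
    if ε = 1 then -qdiff ħ * (tPow ħ k j * wFrac ħ j) else 0 := by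
  rw [ev, nmul_osc, nmul_osc, rescale_osc_eq_zero ħ (Zv_osc_of_ne ħ (by simp) ε), Yv_osc_beta,
    rescale_osc_pos ħ k _ _ _ j (ε : ℤ) 0 (by simp [sg]), Zv_osc_pos ħ hD]
  rcases Int.units_eq_one_or ε with rfl | rfl <;> simp; ring

include hD in
theorem ev_osc_beta_neg (ε : ℤˣ) (j : ℕ) : (ev ħ k ε).osc .beta (-(j + 1)) =
    if ε = 1 then 0 else qdiff ħ * (tPow ħ k j * wFrac ħ j) := by
  rw [ev, nmul_osc, nmul_osc, rescale_osc_eq_zero ħ (Zv_osc_of_ne ħ (by simp) ε), Yv_osc_beta,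
    rescale_osc_neg ħ k _ _ _ j (-(ε : ℤ)) 0 (by simp [sg]), Zv_osc_neg ħ hD]
  rcases Int.units_eq_one_or ε with rfl | rfl <;> simp; ring

theorem rescale_inv (V : Vertex) (s : ℂ) (i : Boson) (m : ℤ) :
    ((V.rescale ħ s).inv).osc i m = -(V.rescale ħ s).osc i m := rfl

include hD in
theorem fv_osc_bar_pos (ε : ℤˣ) (j : ℕ) : (fv ħ k ε).osc .bar (j + 1) =
    qdiff ħ * (tPow ħ k j * rFrac ħ k j -
      if ε = 1 then wFrac ħ j / (tPow ħ k j * yPow ħ j) else 0) := by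
  rw [fv, nmul_osc, nmul_osc, rescale_inv, rescale_osc_eq_zero ħ (Zv_osc_of_ne ħ (i := .beta) (by simp) ε),
    Yv_osc_pos, rescale_osc_pos ħ k _ _ _ j (-(ε : ℤ)) (-(ε : ℤ)) (by simp [sg]; ring),
    Zv_osc_pos ħ hD]
  rcases Int.units_eq_one_or ε with rfl | rfl <;> simp [sg] <;> ring

include hD in
theorem fv_osc_bar_neg (ε : ℤˣ) (j : ℕ) : (fv ħ k ε).osc .bar (-(j + 1)) =
    -qdiff ħ * (tPow ħ k j * rFrac ħ k j -
      if ε = 1 then 0 else wFrac ħ j / (tPow ħ k j * yPow ħ j)) := by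
  rw [fv, nmul_osc, nmul_osc, rescale_inv, rescale_osc_eq_zero ħ (Zv_osc_of_ne ħ (i := .beta) (by simp) ε),
    Yv_osc_neg, rescale_osc_neg ħ k _ _ _ j (ε : ℤ) (ε : ℤ) (by simp [sg]; ring),
    Zv_osc_neg ħ hD]
  rcases Int.units_eq_one_or ε with rfl | rfl <;> simp [sg] <;> ring

include hD in
theorem fv_osc_beta_pos (ε : ℤˣ) (j : ℕ) : (fv ħ k ε).osc .beta (j + 1) =
    if ε = 1 then qdiff ħ * (wFrac ħ j / tPow ħ k j) else 0 := by
  rw [fv, nmul_osc, nmul_osc, rescale_inv, rescale_osc_eq_zero ħ (Zv_osc_of_ne ħ (by simp) ε),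
    Yv_osc_beta, rescale_osc_pos ħ k _ _ _ j (-(ε : ℤ)) 0 (by simp [sg]), Zv_osc_pos ħ hD]
  rcases Int.units_eq_one_or ε with rfl | rfl <;> simp; ring

include hD in
theorem fv_osc_beta_neg (ε : ℤˣ) (j : ℕ) : (fv ħ k ε).osc .beta (-(j + 1)) =
    if ε = 1 then 0 else -qdiff ħ * (wFrac ħ j / tPow ħ k j) := by
  rw [fv, nmul_osc, nmul_osc, rescale_inv, rescale_osc_eq_zero ħ (Zv_osc_of_ne ħ (by simp) ε),
    Yv_osc_beta, rescale_osc_neg ħ k _ _ _ j (ε : ℤ) 0 (by simp [sg]), Zv_osc_neg ħ hD]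
  rcases Int.units_eq_one_or ε with rfl | rfl <;> simp; ring

theorem Gpv_osc_tilde_pos (ε : ℤˣ) (j : ℕ) : (Gpv ħ k ε).osc .tilde (j + 1) =
    -qdiff ħ * (tPow ħ k j ^ 2 * yPow ħ j ^ 2 * rFrac ħ k j) := by
  rw [Gpv, nmul_osc, rescale_osc_eq_zero ħ (ev_osc_tilde ħ k ε),
    rescale_osc_pos ħ k _ _ _ j 2 2 (by push_cast; ring), Vt_osc_pos]
  simp [sg, zpow_ofNat]; ring

theorem Gpv_osc_tilde_neg (ε : ℤˣ) (j : ℕ) : (Gpv ħ k ε).osc .tilde (-(j + 1)) =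
    qdiff ħ * (rFrac ħ k j / (tPow ħ k j ^ 2 * yPow ħ j ^ 2)) := by
  rw [Gpv, nmul_osc, rescale_osc_eq_zero ħ (ev_osc_tilde ħ k ε),
    rescale_osc_neg ħ k _ _ _ j (-2) (-2) (by push_cast; ring), Vt_osc_neg]
  simp [sg, zpow_ofNat]; ring

theorem Gmv_osc_tilde_pos (ε : ℤˣ) (j : ℕ) : (Gmv ħ k ε).osc .tilde (j + 1) =
    qdiff ħ * (rFrac ħ k j / (tPow ħ k j ^ 2 * yPow ħ j ^ 2)) := by
  rw [Gmv, nmul_osc, rescale_osc_eq_zero ħ (fv_osc_tilde ħ k ε),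
    rescale_osc_pos ħ k _ _ _ j (-2) (-2) (by push_cast; ring), Vt_osc_pos]
  simp [sg, zpow_ofNat]; ring

theorem Gmv_osc_tilde_neg (ε : ℤˣ) (j : ℕ) : (Gmv ħ k ε).osc .tilde (-(j + 1)) =
    -qdiff ħ * (tPow ħ k j ^ 2 * yPow ħ j ^ 2 * rFrac ħ k j) := by
  rw [Gmv, nmul_osc, rescale_osc_eq_zero ħ (fv_osc_tilde ħ k ε),
    rescale_osc_neg ħ k _ _ _ j 2 2 (by push_cast; ring), Vt_osc_neg]
  simp [sg, zpow_ofNat]; ring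

theorem Gpv_osc_pos {i : Boson} (hi : i ≠ .tilde) (ε : ℤˣ) (j : ℕ) : (Gpv ħ k ε).osc i (j + 1) =
    tPow ħ k j ^ 3 * yPow ħ j ^ 2 * (ev ħ k ε).osc i (j + 1) := by
  rw [Gpv, nmul_osc, rescale_osc_eq_zero ħ (by cases i <;> first | exact absurd rfl hi | exact fun _ => rfl),
    rescale_osc_pos ħ k _ _ _ j 3 2 (by push_cast; ring), zero_add]
  rfl

theorem Gpv_osc_neg {i : Boson} (hi : i ≠ .tilde) (ε : ℤˣ) (j : ℕ) :
    (Gpv ħ k ε).osc i (-(j + 1)) =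
      (ev ħ k ε).osc i (-(j + 1)) / (tPow ħ k j ^ 3 * yPow ħ j ^ 2) := by
  rw [Gpv, nmul_osc, rescale_osc_eq_zero ħ (by cases i <;> first | exact absurd rfl hi | exact fun _ => rfl),
    rescale_osc_neg ħ k _ _ _ j (-3) (-2) (by push_cast; ring), zero_add]
  simp [zpow_ofNat]; ring

theorem Gmv_osc_pos {i : Boson} (hi : i ≠ .tilde) (ε : ℤˣ) (j : ℕ) : (Gmv ħ k ε).osc i (j + 1) =
    (fv ħ k ε).osc i (j + 1) / (tPow ħ k j ^ 3 * yPow ħ j ^ 2) := by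
  rw [Gmv, nmul_osc, rescale_osc_eq_zero ħ (by cases i <;> first | exact absurd rfl hi | exact fun _ => rfl),
    rescale_osc_pos ħ k _ _ _ j (-3) (-2) (by push_cast; ring), zero_add]
  simp [zpow_ofNat]; ring

theorem Gmv_osc_neg {i : Boson} (hi : i ≠ .tilde) (ε : ℤˣ) (j : ℕ) :
    (Gmv ħ k ε).osc i (-(j + 1)) =
      tPow ħ k j ^ 3 * yPow ħ j ^ 2 * (fv ħ k ε).osc i (-(j + 1)) := by
  rw [Gmv, nmul_osc, rescale_osc_eq_zero ħ (by cases i <;> first | exact absurd rfl hi | exact fun _ => rfl),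
    rescale_osc_neg ħ k _ _ _ j 3 2 (by push_cast; ring), zero_add]
  rfl

theorem Tv_osc_tilde_pos (ε ε' : ℤˣ) (j : ℕ) : (Tv ħ k ε ε').osc .tilde (j + 1) =
    -qdiff ħ * ((yPow ħ j - (yPow ħ j)⁻¹) * rFrac ħ k j) := by
  rw [Tv, nmul_osc, nmul_osc, nmul_osc, rescale_osc_eq_zero ħ (ev_osc_tilde ħ k ε),
    rescale_osc_eq_zero ħ (fv_osc_tilde ħ k ε'),
    rescale_osc_pos ħ k _ _ _ j 0 1 (by push_cast; ring),
    rescale_osc_pos ħ k _ _ _ j 0 (-1) (by push_cast; ring), Vt_osc_pos, Vt_osc_pos]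
  simp [sg]; ring

theorem Tv_osc_tilde_neg (ε ε' : ℤˣ) (j : ℕ) : (Tv ħ k ε ε').osc .tilde (-(j + 1)) =
    -qdiff ħ * ((yPow ħ j - (yPow ħ j)⁻¹) * rFrac ħ k j) := by
  rw [Tv, nmul_osc, nmul_osc, nmul_osc, rescale_osc_eq_zero ħ (ev_osc_tilde ħ k ε),
    rescale_osc_eq_zero ħ (fv_osc_tilde ħ k ε'),
    rescale_osc_neg ħ k _ _ _ j 0 (-1) (by push_cast; ring),
    rescale_osc_neg ħ k _ _ _ j 0 1 (by push_cast; ring), Vt_osc_neg, Vt_osc_neg]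
  simp [sg]; ring

theorem Tv_osc_pos {i : Boson} (hi : i ≠ .tilde) (ε ε' : ℤˣ) (j : ℕ) :
    (Tv ħ k ε ε').osc i (j + 1) = tPow ħ k j * yPow ħ j * (ev ħ k ε).osc i (j + 1) +
      (fv ħ k ε').osc i (j + 1) / (tPow ħ k j * yPow ħ j) := by
  have h : ∀ ε m, (Vt ħ k ε).osc i m = 0 := by
    cases i <;> first | exact absurd rfl hi | exact fun _ _ => rfl
  rw [Tv, nmul_osc, nmul_osc, nmul_osc, rescale_osc_eq_zero ħ (h _), rescale_osc_eq_zero ħ (h _),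
    rescale_osc_pos ħ k _ _ _ j 1 1 (by push_cast; ring),
    rescale_osc_pos ħ k _ _ _ j (-1) (-1) (by push_cast; ring)]
  simp; ring

theorem Tv_osc_neg {i : Boson} (hi : i ≠ .tilde) (ε ε' : ℤˣ) (j : ℕ) :
    (Tv ħ k ε ε').osc i (-(j + 1)) = (ev ħ k ε).osc i (-(j + 1)) / (tPow ħ k j * yPow ħ j) +
      tPow ħ k j * yPow ħ j * (fv ħ k ε').osc i (-(j + 1)) := by
  have h : ∀ ε m, (Vt ħ k ε).osc i m = 0 := by
    cases i <;> first | exact absurd rfl hi | exact fun _ _ => rfl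
  rw [Tv, nmul_osc, nmul_osc, nmul_osc, rescale_osc_eq_zero ħ (h _), rescale_osc_eq_zero ħ (h _),
    rescale_osc_neg ħ k _ _ _ j (-1) (-1) (by push_cast; ring),
    rescale_osc_neg ħ k _ _ _ j 1 1 (by push_cast; ring)]
  simp; ring

theorem Kv_osc_of_ne {i : Boson} (hi : i ≠ .tilde) (ε : ℤˣ) (m : ℤ) : (Kv ħ ε).osc i m = 0 := by
  cases i <;> first | exact absurd rfl hi | rfl

theorem Kv_osc_pos (ε : ℤˣ) (j : ℕ) :
    (Kv ħ ε).osc .tilde (j + 1) = if ε = 1 then qdiff ħ else 0 := by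
  have h1 : (0 : ℤ) < j + 1 := by omega
  have h2 : ¬ (0 : ℤ) < -(j + 1) := by omega
  rcases Int.units_eq_one_or ε with rfl | rfl
  · simp only [Kv, Units.val_one, one_mul, h1, if_true]
  · have h3 : (-1 : ℤˣ) ≠ 1 := by decide
    simp only [Kv, Units.val_neg, Units.val_one, neg_one_mul, h2, h3, if_false]

theorem Kv_osc_neg (ε : ℤˣ) (j : ℕ) :
    (Kv ħ ε).osc .tilde (-(j + 1)) = if ε = 1 then 0 else qdiff ħ := by
  have h1 : (0 : ℤ) < j + 1 := by omega
  have h2 : ¬ (0 : ℤ) < -(j + 1) := by omega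
  rcases Int.units_eq_one_or ε with rfl | rfl
  · simp only [Kv, Units.val_one, one_mul, h2, if_true, if_false]
  · have h3 : (-1 : ℤˣ) ≠ 1 := by decide
    simp only [Kv, Units.val_neg, Units.val_one, neg_one_mul, neg_neg, h1, h3, if_false, if_true]

end Contractions

end

/-! ### Table of contraction functions. -/

section

/-- The parameters `q` and `q ^ k` are not roots of unity. -/
structure Generic (ħ k : ℂ) : Prop where
  q_pow : ∀ n : ℕ, 0 < n → qpow ħ n ≠ 1
  qk_pow : ∀ n : ℕ, 0 < n → qpow ħ (k * n) ≠ 1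

section Contractions

variable {ħ k : ℂ} (h : Generic ħ k)

include h

theorem Generic.qdiff_ne_zero : qdiff ħ ≠ 0 := by
  intro h0
  refine h.q_pow 2 two_pos ?_
  have h1 : qpow ħ 1 = qpow ħ (-1) := sub_eq_zero.1 h0
  have h2 : qpow ħ 2 = qpow ħ 1 * qpow ħ 1 := by rw [← qpow_add]; norm_num
  push_cast
  rw [h2]
  nth_rewrite 1 [h1]
  rw [← qpow_add, neg_add_cancel, qpow_zero]

theorem Generic.k_ne_zero : k ≠ 0 := by
  rintro rfl
  exact h.qk_pow 1 one_pos (by simp [qpow])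

theorem Generic.yPow_pow_ne (j : ℕ) : yPow ħ j ^ 4 ≠ 1 := by
  rw [yPow, ← qpow_mul_nat]
  have := h.q_pow ((j + 1) * 4) (by omega)
  push_cast at this ⊢
  exact this

theorem Generic.tPow_pow_ne (j : ℕ) : tPow ħ k j ^ 4 ≠ 1 := by
  rw [tPow, ← qpow_mul_nat]
  have := h.qk_pow ((j + 1) * 2) (by omega)
  push_cast at this ⊢
  convert this using 2
  ring

theorem Generic.tPow_sub_ne (j : ℕ) : tPow ħ k j ^ 4 - 1 ≠ 0 :=
  sub_ne_zero.2 (h.tPow_pow_ne j)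

theorem Generic.yPow_add_ne (j : ℕ) : yPow ħ j ^ 2 + 1 ≠ 0 := fun h0 =>
  h.yPow_pow_ne j (by linear_combination (yPow ħ j ^ 2 - 1) * h0)

theorem Generic.yPow_sub_ne (j : ℕ) : yPow ħ j ^ 2 - 1 ≠ 0 := fun h0 =>
  h.yPow_pow_ne j (by linear_combination (yPow ħ j ^ 2 + 1) * h0)

theorem Generic.rFrac_eq (j : ℕ) : rFrac ħ k j = tPow ħ k j ^ 2 / (tPow ħ k j ^ 4 - 1) := by
  have h1 := h.tPow_sub_ne j
  have h2 := tPow_ne_zero ħ k j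
  rw [rFrac, inv_eq_iff_eq_inv, inv_div]
  field_simp

theorem Generic.wFrac_eq (j : ℕ) : wFrac ħ j = yPow ħ j / (yPow ħ j ^ 2 + 1) := by
  have h1 := h.yPow_add_ne j
  have h2 := h.yPow_sub_ne j
  have h3 := yPow_ne_zero ħ j
  have h4 := h.yPow_pow_ne j
  have h5 : yPow ħ j ^ 2 - (yPow ħ j ^ 2)⁻¹ ≠ 0 := by
    intro h0
    refine h4 ?_
    field_simp at h0
    linear_combination h0
  rw [wFrac, div_eq_div_iff h5 h1]
  field_simp
  ring

-- Multiplication by m = j + 1 cancels the denominator of the Heisenberg commutators and leaves the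
-- coefficient of the Euler derivative, a rational function of t and y.
omit h in
theorem mul_contrCoeff (V V' : Vertex) (j : ℕ) : ((j : ℂ) + 1) * contrCoeff ħ k V V' j =
    (V.osc .tilde (j + 1) * V'.osc .tilde (-(j + 1)) *
        ((tPow ħ k j ^ 2 * yPow ħ j ^ 2 - (tPow ħ k j ^ 2 * yPow ħ j ^ 2)⁻¹) *
          (tPow ħ k j ^ 2 - (tPow ħ k j ^ 2)⁻¹)) -
      V.osc .bar (j + 1) * V'.osc .bar (-(j + 1)) *
        ((yPow ħ j ^ 2 - (yPow ħ j ^ 2)⁻¹) * (tPow ħ k j ^ 2 - (tPow ħ k j ^ 2)⁻¹)) +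
      V.osc .beta (j + 1) * V'.osc .beta (-(j + 1)) *
        ((yPow ħ j ^ 2 - (yPow ħ j ^ 2)⁻¹) *
          (tPow ħ k j ^ 2 * yPow ħ j ^ 2 - (tPow ħ k j ^ 2 * yPow ħ j ^ 2)⁻¹))) / qdiff ħ ^ 2 := by
  have h0 : (Finset.univ : Finset Boson) = {.tilde, .bar, .beta} := rfl
  have h1 : (j : ℂ) + 1 ≠ 0 := by exact_mod_cast Nat.succ_ne_zero j
  rw [contrCoeff, h0, Finset.sum_insert (by simp), Finset.sum_insert (by simp),
    Finset.sum_singleton]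
  simp only [heisComm, qnum_k_mul ħ k j, qnum_k_add_two_mul ħ k j, qnum_two_mul ħ j]
  field_simp
  ring

omit h in
theorem qpow_pow_eq {x : ℂ} (a b : ℤ) (hx : x = a * (k / 2) + b) (j : ℕ) :
    qpow ħ x ^ (j + 1) = tPow ħ k j ^ a * yPow ħ j ^ b := by
  rw [← qpow_mul_nat]
  exact qpow_eq_yt ħ k j a b (by rw [hx]; push_cast; ring)

omit h in
theorem qpow_pow_two (j : ℕ) : qpow ħ 2 ^ (j + 1) = yPow ħ j ^ 2 := by
  rw [qpow_pow_eq (k := 0) 0 2 (by norm_num), zpow_zero, one_mul]; rfl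

omit h in
theorem qpow_pow_s (j : ℕ) : qpow ħ (2 * k + 2) ^ (j + 1) = tPow ħ k j ^ 4 * yPow ħ j ^ 2 :=
  qpow_pow_eq 4 2 (by push_cast; ring) j

omit h in
theorem qpow_pow_p (j : ℕ) : qpow ħ (2 * k + 4) ^ (j + 1) = tPow ħ k j ^ 4 * yPow ħ j ^ 4 :=
  qpow_pow_eq 4 4 (by push_cast; ring) j

omit h in
theorem qpow_pow_s_sq (j : ℕ) : qpow ħ (4 * k + 4) ^ (j + 1) = tPow ħ k j ^ 8 * yPow ħ j ^ 4 :=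
  qpow_pow_eq 8 4 (by push_cast; ring) j

omit h in
theorem qpow_pow_q_s_sq (j : ℕ) : qpow ħ (4 * k + 6) ^ (j + 1) = tPow ħ k j ^ 8 * yPow ħ j ^ 6 :=
  qpow_pow_eq 8 6 (by push_cast; ring) j

omit h in
theorem qpow_pow_k_one (j : ℕ) : qpow ħ (k + 1) ^ (j + 1) = tPow ħ k j ^ 2 * yPow ħ j :=
  (qpow_pow_eq 2 1 (by push_cast; ring) j).trans (by rw [zpow_one]; rfl)

omit h in
theorem qpow_pow_k_three (j : ℕ) : qpow ħ (k + 3) ^ (j + 1) = tPow ħ k j ^ 2 * yPow ħ j ^ 3 :=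
  qpow_pow_eq 2 3 (by push_cast; ring) j

/-- Each table entry becomes a field identity in t, y and q - q⁻¹. Genericity supplies the only
non-vanishing facts needed: t⁴ ≠ 1 from q^k, and y² ≠ -1 from q. -/
theorem contr_mul_prodSeries {V V' : Vertex} (L₁ L₂ : List ℂ)
    (H : ∀ j : ℕ, qdiff ħ ≠ 0 → tPow ħ k j ≠ 0 → yPow ħ j ≠ 0 → tPow ħ k j ^ 4 - 1 ≠ 0 →
      yPow ħ j ^ 2 + 1 ≠ 0 → ((j : ℂ) + 1) * contrCoeff ħ k V V' j =
        (L₁.map fun a => a ^ (j + 1)).sum - (L₂.map fun a => a ^ (j + 1)).sum) :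
    contr ħ k V V' * prodSeries L₁ = prodSeries L₂ :=
  expSeries_mul_prodSeries L₁ L₂ fun j => H j h.qdiff_ne_zero (tPow_ne_zero ħ k j)
    (yPow_ne_zero ħ j) (h.tPow_sub_ne j) (h.yPow_add_ne j)

/-- The poles at q^{2k+2}, q^{4k+4} and q^{2k+4} will produce T, :K^-K^+: and the identity. The
entry 0 stands for a factor 1 and brings the quotient with two poles into the shape of the partial
fraction lemma. -/
theorem contr_Gpv_Gmv :
    contr ħ k (Gpv ħ k 1) (Gmv ħ k 1) * prodSeries [qpow ħ (2 * k + 2), qpow ħ (4 * k + 4)] = prodSeries [qpow ħ (4 * k + 6), 0] ∧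
    contr ħ k (Gpv ħ k 1) (Gmv ħ k (-1)) * prodSeries [qpow ħ (2 * k + 2)] = prodSeries [] ∧
    contr ħ k (Gpv ħ k (-1)) (Gmv ħ k 1) * prodSeries [qpow ħ (2 * k + 2)] = prodSeries [] ∧
    contr ħ k (Gpv ħ k (-1)) (Gmv ħ k (-1)) * prodSeries [qpow ħ (2 * k + 4)] = prodSeries [] := by
  have hne : (-1 : ℤˣ) ≠ 1 := by decide
  refine ⟨?_, ?_, ?_, ?_⟩ <;>
  refine contr_mul_prodSeries h _ _ fun j hD ht hy ht4 hy2 => ?_ <;>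
  simp only [mul_contrCoeff, Gpv_osc_tilde_pos, Gpv_osc_pos ħ k (i := .bar) (by simp),
    Gpv_osc_pos ħ k (i := .beta) (by simp), ev_osc_bar_pos ħ k hD, ev_osc_beta_pos ħ k hD,
    Gmv_osc_tilde_neg, Gmv_osc_neg ħ k (i := .bar) (by simp), Gmv_osc_neg ħ k (i := .beta) (by
    simp), fv_osc_bar_neg ħ k hD, fv_osc_beta_neg ħ k hD, if_true, hne, if_false, h.rFrac_eq,
    h.wFrac_eq, List.map_cons, List.map_nil, List.sum_cons, List.sum_nil, qpow_pow_s,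
    qpow_pow_p, qpow_pow_s_sq, qpow_pow_q_s_sq, zero_pow (Nat.succ_ne_zero j)] <;>
  field_simp <;>
  ring

theorem contr_Gmv_Gpv :
    contr ħ k (Gmv ħ k 1) (Gpv ħ k 1) * prodSeries [(qpow ħ (2 * k + 2))⁻¹, (qpow ħ (4 * k + 4))⁻¹] = prodSeries [(qpow ħ (4 * k + 6))⁻¹, 0] ∧
    contr ħ k (Gmv ħ k (-1)) (Gpv ħ k 1) * prodSeries [(qpow ħ (2 * k + 2))⁻¹] = prodSeries [] ∧
    contr ħ k (Gmv ħ k 1) (Gpv ħ k (-1)) * prodSeries [(qpow ħ (2 * k + 2))⁻¹] = prodSeries [] ∧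
    contr ħ k (Gmv ħ k (-1)) (Gpv ħ k (-1)) * prodSeries [(qpow ħ (2 * k + 4))⁻¹] = prodSeries [] := by
  have hne : (-1 : ℤˣ) ≠ 1 := by decide
  refine ⟨?_, ?_, ?_, ?_⟩ <;>
  refine contr_mul_prodSeries h _ _ fun j hD ht hy ht4 hy2 => ?_ <;>
  simp only [mul_contrCoeff, Gmv_osc_tilde_pos, Gmv_osc_pos ħ k (i := .bar) (by simp),
    Gmv_osc_pos ħ k (i := .beta) (by simp), fv_osc_bar_pos ħ k hD, fv_osc_beta_pos ħ k hD,
    Gpv_osc_tilde_neg, Gpv_osc_neg ħ k (i := .bar) (by simp), Gpv_osc_neg ħ k (i := .beta) (by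
    simp), ev_osc_bar_neg ħ k hD, ev_osc_beta_neg ħ k hD, if_true, hne, if_false, h.rFrac_eq,
    h.wFrac_eq, List.map_cons, List.map_nil, List.sum_cons, List.sum_nil, qpow_pow_s,
    qpow_pow_p, qpow_pow_s_sq, qpow_pow_q_s_sq, inv_pow, zero_pow (Nat.succ_ne_zero j)] <;>
  field_simp <;>
  ring

/-- There are no poles: the factors attached to the oscillators cancel down to one linear factor. -/
theorem contr_Gpv_Gpv :
    contr ħ k (Gpv ħ k 1) (Gpv ħ k 1) * prodSeries [] = prodSeries [1] ∧
    contr ħ k (Gpv ħ k 1) (Gpv ħ k (-1)) * prodSeries [] = prodSeries [(qpow ħ 2)⁻¹] ∧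
    contr ħ k (Gpv ħ k (-1)) (Gpv ħ k 1) * prodSeries [] = prodSeries [qpow ħ 2] ∧
    contr ħ k (Gpv ħ k (-1)) (Gpv ħ k (-1)) * prodSeries [] = prodSeries [1] := by
  have hne : (-1 : ℤˣ) ≠ 1 := by decide
  refine ⟨?_, ?_, ?_, ?_⟩ <;>
  refine contr_mul_prodSeries h _ _ fun j hD ht hy ht4 hy2 => ?_ <;>
  simp only [mul_contrCoeff, Gpv_osc_tilde_pos, Gpv_osc_pos ħ k (i := .bar) (by simp),
    Gpv_osc_pos ħ k (i := .beta) (by simp), ev_osc_bar_pos ħ k hD, ev_osc_beta_pos ħ k hD,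
    Gpv_osc_tilde_neg, Gpv_osc_neg ħ k (i := .bar) (by simp), Gpv_osc_neg ħ k (i := .beta) (by
    simp), ev_osc_bar_neg ħ k hD, ev_osc_beta_neg ħ k hD, if_true, hne, if_false, h.rFrac_eq,
    h.wFrac_eq, List.map_cons, List.map_nil, List.sum_cons, List.sum_nil, qpow_pow_two,
    inv_pow, one_pow] <;>
  field_simp <;>
  ring

theorem contr_Gmv_Gmv :
    contr ħ k (Gmv ħ k 1) (Gmv ħ k 1) * prodSeries [] = prodSeries [1] ∧
    contr ħ k (Gmv ħ k 1) (Gmv ħ k (-1)) * prodSeries [] = prodSeries [qpow ħ 2] ∧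
    contr ħ k (Gmv ħ k (-1)) (Gmv ħ k 1) * prodSeries [] = prodSeries [(qpow ħ 2)⁻¹] ∧
    contr ħ k (Gmv ħ k (-1)) (Gmv ħ k (-1)) * prodSeries [] = prodSeries [1] := by
  have hne : (-1 : ℤˣ) ≠ 1 := by decide
  refine ⟨?_, ?_, ?_, ?_⟩ <;>
  refine contr_mul_prodSeries h _ _ fun j hD ht hy ht4 hy2 => ?_ <;>
  simp only [mul_contrCoeff, Gmv_osc_tilde_pos, Gmv_osc_pos ħ k (i := .bar) (by simp),
    Gmv_osc_pos ħ k (i := .beta) (by simp), fv_osc_bar_pos ħ k hD, fv_osc_beta_pos ħ k hD,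
    Gmv_osc_tilde_neg, Gmv_osc_neg ħ k (i := .bar) (by simp), Gmv_osc_neg ħ k (i := .beta) (by
    simp), fv_osc_bar_neg ħ k hD, fv_osc_beta_neg ħ k hD, if_true, hne, if_false, h.rFrac_eq,
    h.wFrac_eq, List.map_cons, List.map_nil, List.sum_cons, List.sum_nil, qpow_pow_two,
    inv_pow, one_pow] <;>
  field_simp <;>
  ring

/-- Only α̃ contributes and it enters G^+ in the same way for both ε, so both terms of G^+ obey the
same exchange relation. -/
theorem contr_Gpv_Kv (ε : ℤˣ) :
    contr ħ k (Gpv ħ k ε) (Kv ħ (-1)) * prodSeries [1] = prodSeries [qpow ħ (2 * k + 4)] := by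
  have hne : (-1 : ℤˣ) ≠ 1 := by decide
  rcases Int.units_eq_one_or ε with rfl | rfl <;>
  refine contr_mul_prodSeries h _ _ fun j hD ht hy ht4 hy2 => ?_ <;>
  simp only [mul_contrCoeff, Gpv_osc_tilde_pos, Gpv_osc_pos ħ k (i := .bar) (by simp),
    Gpv_osc_pos ħ k (i := .beta) (by simp), ev_osc_bar_pos ħ k hD, ev_osc_beta_pos ħ k hD,
    Kv_osc_neg, Kv_osc_of_ne ħ (i := .bar) (by simp), Kv_osc_of_ne ħ (i := .beta) (by simp),
    if_true, hne, if_false, h.rFrac_eq, h.wFrac_eq, List.map_cons, List.map_nil, List.sum_cons,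
    List.sum_nil, qpow_pow_p, one_pow] <;>
  field_simp <;>
  ring

theorem contr_Gmv_Kv (ε : ℤˣ) :
    contr ħ k (Gmv ħ k ε) (Kv ħ (-1)) * prodSeries [1] = prodSeries [(qpow ħ (2 * k + 4))⁻¹] := by
  have hne : (-1 : ℤˣ) ≠ 1 := by decide
  rcases Int.units_eq_one_or ε with rfl | rfl <;>
  refine contr_mul_prodSeries h _ _ fun j hD ht hy ht4 hy2 => ?_ <;>
  simp only [mul_contrCoeff, Gmv_osc_tilde_pos, Gmv_osc_pos ħ k (i := .bar) (by simp),
    Gmv_osc_pos ħ k (i := .beta) (by simp), fv_osc_bar_pos ħ k hD, fv_osc_beta_pos ħ k hD,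
    Kv_osc_neg, Kv_osc_of_ne ħ (i := .bar) (by simp), Kv_osc_of_ne ħ (i := .beta) (by simp),
    if_true, hne, if_false, h.rFrac_eq, h.wFrac_eq, List.map_cons, List.map_nil, List.sum_cons,
    List.sum_nil, qpow_pow_p, inv_pow, one_pow] <;>
  field_simp <;>
  ring

theorem contr_Kv_Gpv (ε : ℤˣ) :
    contr ħ k (Kv ħ 1) (Gpv ħ k ε) * prodSeries [1] = prodSeries [(qpow ħ (2 * k + 4))⁻¹] := by
  have hne : (-1 : ℤˣ) ≠ 1 := by decide
  rcases Int.units_eq_one_or ε with rfl | rfl <;>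
  refine contr_mul_prodSeries h _ _ fun j hD ht hy ht4 hy2 => ?_ <;>
  simp only [mul_contrCoeff, Kv_osc_pos, Kv_osc_of_ne ħ (i := .bar) (by simp), Kv_osc_of_ne ħ (i
    := .beta) (by simp), Gpv_osc_tilde_neg, Gpv_osc_neg ħ k (i := .bar) (by simp), Gpv_osc_neg
    ħ k (i := .beta) (by simp), ev_osc_bar_neg ħ k hD, ev_osc_beta_neg ħ k hD, if_true, hne,
    if_false, h.rFrac_eq, h.wFrac_eq, List.map_cons, List.map_nil, List.sum_cons, List.sum_nil,
    qpow_pow_p, inv_pow, one_pow] <;>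
  field_simp <;>
  ring

theorem contr_Kv_Gmv (ε : ℤˣ) :
    contr ħ k (Kv ħ 1) (Gmv ħ k ε) * prodSeries [1] = prodSeries [qpow ħ (2 * k + 4)] := by
  have hne : (-1 : ℤˣ) ≠ 1 := by decide
  rcases Int.units_eq_one_or ε with rfl | rfl <;>
  refine contr_mul_prodSeries h _ _ fun j hD ht hy ht4 hy2 => ?_ <;>
  simp only [mul_contrCoeff, Kv_osc_pos, Kv_osc_of_ne ħ (i := .bar) (by simp), Kv_osc_of_ne ħ (i
    := .beta) (by simp), Gmv_osc_tilde_neg, Gmv_osc_neg ħ k (i := .bar) (by simp), Gmv_osc_neg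
    ħ k (i := .beta) (by simp), fv_osc_bar_neg ħ k hD, fv_osc_beta_neg ħ k hD, if_true, hne,
    if_false, h.rFrac_eq, h.wFrac_eq, List.map_cons, List.map_nil, List.sum_cons, List.sum_nil,
    qpow_pow_p, one_pow] <;>
  field_simp <;>
  ring

theorem contr_Kv_Kv :
    contr ħ k (Kv ħ 1) (Kv ħ (-1)) * prodSeries [qpow ħ (2 * k + 2), (qpow ħ (2 * k + 2))⁻¹] = prodSeries [qpow ħ 2, (qpow ħ 2)⁻¹] := by
  have hne : (-1 : ℤˣ) ≠ 1 := by decide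
  refine contr_mul_prodSeries h _ _ fun j hD ht hy ht4 hy2 => ?_
  simp only [mul_contrCoeff, Kv_osc_pos, Kv_osc_neg, Kv_osc_of_ne ħ (i := .bar) (by simp),
    Kv_osc_of_ne ħ (i := .beta) (by simp), if_true, hne, if_false, List.map_cons, List.map_nil,
    List.sum_cons, List.sum_nil, qpow_pow_s, qpow_pow_two, inv_pow]
  field_simp
  ring

/-- Independence of ε and ε' is what makes the relation between K and T hold for each of the three
terms of T. -/
theorem contr_Tv_Kv (ε ε' : ℤˣ) :
    contr ħ k (Tv ħ k ε ε') (Kv ħ (-1)) * prodSeries [qpow ħ (k + 1), (qpow ħ (k + 1))⁻¹] = prodSeries [qpow ħ (k + 3), (qpow ħ (k + 3))⁻¹] := by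
  have hne : (-1 : ℤˣ) ≠ 1 := by decide
  rcases Int.units_eq_one_or ε with rfl | rfl <;>
  rcases Int.units_eq_one_or ε' with rfl | rfl <;>
  refine contr_mul_prodSeries h _ _ fun j hD ht hy ht4 hy2 => ?_ <;>
  simp only [mul_contrCoeff, Tv_osc_tilde_pos, Tv_osc_pos ħ k (i := .bar) (by simp), Tv_osc_pos ħ
    k (i := .beta) (by simp), ev_osc_bar_pos ħ k hD, ev_osc_beta_pos ħ k hD, fv_osc_bar_pos ħ k
    hD, fv_osc_beta_pos ħ k hD, Kv_osc_neg, Kv_osc_of_ne ħ (i := .bar) (by simp), Kv_osc_of_ne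
    ħ (i := .beta) (by simp), if_true, hne, if_false, h.rFrac_eq, h.wFrac_eq, List.map_cons,
    List.map_nil, List.sum_cons, List.sum_nil, qpow_pow_k_one, qpow_pow_k_three, inv_pow] <;>
  field_simp <;>
  ring

theorem contr_Kv_Tv (ε ε' : ℤˣ) :
    contr ħ k (Kv ħ 1) (Tv ħ k ε ε') * prodSeries [qpow ħ (k + 1), (qpow ħ (k + 1))⁻¹] = prodSeries [qpow ħ (k + 3), (qpow ħ (k + 3))⁻¹] := by
  have hne : (-1 : ℤˣ) ≠ 1 := by decide
  rcases Int.units_eq_one_or ε with rfl | rfl <;>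
  rcases Int.units_eq_one_or ε' with rfl | rfl <;>
  refine contr_mul_prodSeries h _ _ fun j hD ht hy ht4 hy2 => ?_ <;>
  simp only [mul_contrCoeff, Kv_osc_pos, Kv_osc_of_ne ħ (i := .bar) (by simp), Kv_osc_of_ne ħ (i
    := .beta) (by simp), Tv_osc_tilde_neg, Tv_osc_neg ħ k (i := .bar) (by simp), Tv_osc_neg ħ k
    (i := .beta) (by simp), ev_osc_bar_neg ħ k hD, ev_osc_beta_neg ħ k hD, fv_osc_bar_neg ħ k
    hD, fv_osc_beta_neg ħ k hD, if_true, hne, if_false, h.rFrac_eq, h.wFrac_eq, List.map_cons,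
    List.map_nil, List.sum_cons, List.sum_nil, qpow_pow_k_one, qpow_pow_k_three, inv_pow] <;>
  field_simp <;>
  ring

/-- In the order (1,-1), (1,1), (-1,1) of the terms of T, every pair of distinct terms has the same
contraction, as in the free field realization of a q-deformed Virasoro current. -/
theorem contr_Tv_Tv_lt :
    contr ħ k (Tv ħ k 1 (-1)) (Tv ħ k 1 1) * prodSeries [1, qpow ħ (2 * k + 2)] = prodSeries [(qpow ħ 2)⁻¹, qpow ħ (2 * k + 4)] ∧
    contr ħ k (Tv ħ k 1 (-1)) (Tv ħ k (-1) 1) * prodSeries [1, qpow ħ (2 * k + 2)] = prodSeries [(qpow ħ 2)⁻¹, qpow ħ (2 * k + 4)] ∧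
    contr ħ k (Tv ħ k 1 1) (Tv ħ k (-1) 1) * prodSeries [1, qpow ħ (2 * k + 2)] = prodSeries [(qpow ħ 2)⁻¹, qpow ħ (2 * k + 4)] := by
  have hne : (-1 : ℤˣ) ≠ 1 := by decide
  refine ⟨?_, ?_, ?_⟩ <;>
  refine contr_mul_prodSeries h _ _ fun j hD ht hy ht4 hy2 => ?_ <;>
  simp only [mul_contrCoeff, Tv_osc_tilde_pos, Tv_osc_pos ħ k (i := .bar) (by simp), Tv_osc_pos ħ
    k (i := .beta) (by simp), ev_osc_bar_pos ħ k hD, ev_osc_beta_pos ħ k hD, fv_osc_bar_pos ħ k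
    hD, fv_osc_beta_pos ħ k hD, Tv_osc_tilde_neg, Tv_osc_neg ħ k (i := .bar) (by simp),
    Tv_osc_neg ħ k (i := .beta) (by simp), ev_osc_bar_neg ħ k hD, ev_osc_beta_neg ħ k hD,
    fv_osc_bar_neg ħ k hD, fv_osc_beta_neg ħ k hD, if_true, hne, if_false, h.rFrac_eq,
    h.wFrac_eq, List.map_cons, List.map_nil, List.sum_cons, List.sum_nil, qpow_pow_s,
    qpow_pow_p, qpow_pow_two, inv_pow, one_pow] <;>
  field_simp <;>
  ring

theorem contr_Tv_Tv_gt :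
    contr ħ k (Tv ħ k 1 1) (Tv ħ k 1 (-1)) * prodSeries [1, (qpow ħ (2 * k + 2))⁻¹] = prodSeries [qpow ħ 2, (qpow ħ (2 * k + 4))⁻¹] ∧
    contr ħ k (Tv ħ k (-1) 1) (Tv ħ k 1 (-1)) * prodSeries [1, (qpow ħ (2 * k + 2))⁻¹] = prodSeries [qpow ħ 2, (qpow ħ (2 * k + 4))⁻¹] ∧
    contr ħ k (Tv ħ k (-1) 1) (Tv ħ k 1 1) * prodSeries [1, (qpow ħ (2 * k + 2))⁻¹] = prodSeries [qpow ħ 2, (qpow ħ (2 * k + 4))⁻¹] := by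
  have hne : (-1 : ℤˣ) ≠ 1 := by decide
  refine ⟨?_, ?_, ?_⟩ <;>
  refine contr_mul_prodSeries h _ _ fun j hD ht hy ht4 hy2 => ?_ <;>
  simp only [mul_contrCoeff, Tv_osc_tilde_pos, Tv_osc_pos ħ k (i := .bar) (by simp), Tv_osc_pos ħ
    k (i := .beta) (by simp), ev_osc_bar_pos ħ k hD, ev_osc_beta_pos ħ k hD, fv_osc_bar_pos ħ k
    hD, fv_osc_beta_pos ħ k hD, Tv_osc_tilde_neg, Tv_osc_neg ħ k (i := .bar) (by simp),
    Tv_osc_neg ħ k (i := .beta) (by simp), ev_osc_bar_neg ħ k hD, ev_osc_beta_neg ħ k hD,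
    fv_osc_bar_neg ħ k hD, fv_osc_beta_neg ħ k hD, if_true, hne, if_false, h.rFrac_eq,
    h.wFrac_eq, List.map_cons, List.map_nil, List.sum_cons, List.sum_nil, qpow_pow_s,
    qpow_pow_p, qpow_pow_two, inv_pow, one_pow] <;>
  field_simp <;>
  ring

/-- The two outer terms of T do not contract with themselves; only the middle one does, with poles
at both q^{±(2k+2)}. -/
theorem contr_Tv_Tv_diag :
    contr ħ k (Tv ħ k 1 (-1)) (Tv ħ k 1 (-1)) * prodSeries [] = prodSeries [] ∧
    contr ħ k (Tv ħ k 1 1) (Tv ħ k 1 1) * prodSeries [qpow ħ (2 * k + 2), (qpow ħ (2 * k + 2))⁻¹] = prodSeries [qpow ħ (2 * k + 4), (qpow ħ (2 * k + 4))⁻¹] ∧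
    contr ħ k (Tv ħ k (-1) 1) (Tv ħ k (-1) 1) * prodSeries [] = prodSeries [] := by
  have hne : (-1 : ℤˣ) ≠ 1 := by decide
  refine ⟨?_, ?_, ?_⟩ <;>
  refine contr_mul_prodSeries h _ _ fun j hD ht hy ht4 hy2 => ?_ <;>
  simp only [mul_contrCoeff, Tv_osc_tilde_pos, Tv_osc_pos ħ k (i := .bar) (by simp), Tv_osc_pos ħ
    k (i := .beta) (by simp), ev_osc_bar_pos ħ k hD, ev_osc_beta_pos ħ k hD, fv_osc_bar_pos ħ k
    hD, fv_osc_beta_pos ħ k hD, Tv_osc_tilde_neg, Tv_osc_neg ħ k (i := .bar) (by simp),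
    Tv_osc_neg ħ k (i := .beta) (by simp), ev_osc_bar_neg ħ k hD, ev_osc_beta_neg ħ k hD,
    fv_osc_bar_neg ħ k hD, fv_osc_beta_neg ħ k hD, if_true, hne, if_false, h.rFrac_eq,
    h.wFrac_eq, List.map_cons, List.map_nil, List.sum_cons, List.sum_nil, qpow_pow_s,
    qpow_pow_p, inv_pow] <;>
  field_simp <;>
  ring

end Contractions

end

/-! ### Explicit inverses of contraction functions. -/

section

open PowerSeries in
theorem partialFractions_single {a b : ℂ} (ha : a ≠ 0) :
    (PowerSeries.mk fun n => (a - b) / a * a ^ n + if n = 0 then b / a else 0) *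
      prodSeries [a] = prodSeries [b] := by
  have h1 : (PowerSeries.mk fun n => (a - b) / a * a ^ n + if n = 0 then b / a else 0) =
      C ((a - b) / a) * (PowerSeries.mk fun n => a ^ n) + C (b / a) := by
    ext n
    rcases n with _ | n <;> simp
  have f1 := congrArg (C (R := ℂ)) (show (a - b) / a + b / a = 1 by field_simp; ring)
  have f2 := congrArg (C (R := ℂ)) (show b / a * a = b by field_simp)
  simp only [map_add, map_mul, map_one] at f1 f2
  rw [h1]
  simp only [prodSeries_cons, prodSeries_nil]
  linear_combination C ((a - b) / a) * geom_mul a + f1 - X * f2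

open PowerSeries in
theorem exists_inverse_single {F : PowerSeries ℂ} {a : ℂ} (ha : a ≠ 0)
    (h : F * prodSeries [1] = prodSeries [a]) : ∃ D : PowerSeries ℂ, D * F = 1 ∧
      coeff 0 D = 1 ∧ ∀ n, n ≠ 0 → coeff n D = (a - 1) / a * a ^ n := by
  refine ⟨_, mul_eq_one_of_prodSeries h (partialFractions_single ha), ?_, fun n hn => ?_⟩
  · rw [coeff_mk, if_pos rfl, pow_zero]
    field_simp
    ring
  · rw [coeff_mk, if_neg hn, add_zero]

-- Partial fractions at y and y⁻¹ have opposite residues, so the coefficients are multiples of y^n -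
-- y^{-n}. This is the origin of [2l]/[2] and [(k+3)l]/[k+3] in the relations with K.
open PowerSeries in
theorem exists_inverse_reciprocal {F : PowerSeries ℂ} {y z : ℂ} (hy : y ≠ 0) (hz : z ≠ 0)
    (hy' : y - y⁻¹ ≠ 0) (h : F * prodSeries [z, z⁻¹] = prodSeries [y, y⁻¹]) :
    ∃ D : PowerSeries ℂ, D * F = 1 ∧ coeff 0 D = 1 ∧ ∀ n, n ≠ 0 →
      coeff n D = (y + y⁻¹ - z - z⁻¹) / (y - y⁻¹) * (y ^ n - (y ^ n)⁻¹) := by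
  have hy2 : y ^ 2 - 1 ≠ 0 := by
    intro h0
    apply hy'
    field_simp
    linear_combination h0
  have hy3 : 1 - y ^ 2 ≠ 0 := fun h0 => hy2 (by linear_combination -h0)
  refine ⟨_, mul_eq_one_of_prodSeries h (partialFractions_mul hy (inv_ne_zero hy)
    (sub_ne_zero.1 hy')), ?_, fun n hn => ?_⟩
  · rw [coeff_mk, if_pos rfl, pow_zero, pow_zero]
    have : y⁻¹ - y = -(y - y⁻¹) := by ring
    rw [this]
    field_simp
    ring
  · rw [coeff_mk, if_neg hn, add_zero, inv_pow]
    have : y⁻¹ - y = -(y - y⁻¹) := by ring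
    rw [this]
    field_simp
    ring

theorem sum_range_succ_eq_Icc {M : Type*} [AddCommMonoid M] (f : ℤ → M) (n : ℕ) :
    ∑ l ∈ Finset.range (n + 1), f l = f 0 + ∑ l ∈ Finset.Icc 1 (n : ℤ), f l := by
  rw [Finset.sum_range_succ', add_comm]
  congr 1
  refine Finset.sum_bij' (fun l _ => (l : ℤ) + 1) (fun l _ => (l - 1).toNat) ?_ ?_ ?_ ?_ ?_
  · intro l hl; simp at hl ⊢; omega
  · intro l hl; simp at hl ⊢; omega
  · intro l hl; simp
  · intro l hl; simp at hl ⊢; omega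
  · intro l hl; push_cast; rfl

/-! ### The generators as operators, and the relations that involve K^±. -/

section Operators

variable (ħ k ρ σ : ℂ) (A : Sector) (S : Side)

/-- The vertex operators in `G^±(z)`. -/
def Gv (ε : ℤˣ) : ℤˣ → Vertex := if ε = 1 then Gpv ħ k else Gmv ħ k

/-- The integer part of the power of `z` at the mode `r` of `G^±(z)`. -/
def Sector.expo (A : Sector) (ε : ℤˣ) (r : ℤ) : ℤ := if ε = 1 then -r - 1 else -r - A.shift₂

theorem Sector.expo_add (A : Sector) (ε : ℤˣ) (r l : ℤ) : A.expo ε (r + l) = A.expo ε r - l := by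
  unfold Sector.expo
  split_ifs <;> ring

/-- With this value `A.expo ε r + ε * A.frac` equals -(r + shift₂/2) - 1/2 for both signs ε, which
is the exponent of z in the definition of the modes of G^±. -/
theorem Sector.frac_eq (A : Sector) : A.frac = (1 - A.shift₂) / 2 := by
  cases A <;> simp [Sector.frac, Sector.shift₂]

/-- The modes of the currents on the Fock space. -/
def ops : SVirOps (FockSpace A k ρ σ) where
  K ε m := vop ħ k ρ σ A S (Kv ħ ε) 0 (-m)
  T m := qpow ħ (-1) • vop ħ k ρ σ A S (Tv ħ k 1 (-1)) 0 (-m)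
    - (qnum ħ (k + 2) / qnum ħ (k + 1)) • vop ħ k ρ σ A S (Tv ħ k 1 1) 0 (-m)
    + qpow ħ 1 • vop ħ k ρ σ A S (Tv ħ k (-1) 1) 0 (-m)
  G ε r := (sg ε / qdiff ħ) • (vop ħ k ρ σ A S (Gv ħ k ε 1) ε (A.expo ε r) -
    vop ħ k ρ σ A S (Gv ħ k ε (-1)) ε (A.expo ε r))

theorem Kv_osc_one_neg (i : Boson) (j : ℕ) : (Kv ħ 1).osc i (-(j + 1)) = 0 := by
  cases i
  · rw [Kv_osc_neg, if_pos rfl]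
  · rfl
  · rfl

theorem Kv_osc_neg_one_pos (i : Boson) (j : ℕ) : (Kv ħ (-1)).osc i (j + 1) = 0 := by
  cases i
  · rw [Kv_osc_pos, if_neg (by decide)]
  · rfl
  · rfl

theorem zeroComm_Kv (ε : ℤˣ) (c : ℤ) : (Kv ħ ε).zeroComm k c = c * (k + 2) := by
  simp [Vertex.zeroComm, Kv]

theorem ops_K_zero (ε : ℤˣ) (m : ℤ) (hm : (ε : ℤ) * m < 0) : (ops ħ k ρ σ A S).K ε m = 0 := by
  rcases Int.units_eq_one_or ε with rfl | rfl
  · exact vop_eq_zero_of_neg ħ k ρ σ A S (Kv_osc_one_neg ħ) (by simp at hm; omega)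
  · exact vop_eq_zero_of_pos ħ k ρ σ A S (Kv_osc_neg_one_pos ħ) (by simp at hm; omega)

theorem ops_smooth (v : FockSpace A k ρ σ) : ∃ N : ℤ, ∀ m : ℤ, N < S.sign * m →
    (ops ħ k ρ σ A S).T m v = 0 ∧
      ∀ ε : ℤˣ, (ops ħ k ρ σ A S).K ε m v = 0 ∧ (ops ħ k ρ σ A S).G ε m v = 0 := by
  have h1 : ∃ N : ℤ, ∀ (x : Vertex × ℤ), x ∈ ({(Tv ħ k 1 (-1), 0), (Tv ħ k 1 1, 0),
      (Tv ħ k (-1) 1, 0), (Kv ħ 1, 0), (Kv ħ (-1), 0), (Gpv ħ k 1, 1), (Gpv ħ k (-1), 1),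
      (Gmv ħ k 1, -1), (Gmv ħ k (-1), -1)} : Set (Vertex × ℤ)) → ∀ E, S.sign * E < N →
        vop ħ k ρ σ A S x.1 x.2 E v = 0 := by
    choose N hN using fun x : Vertex × ℤ => vop_smooth ħ k ρ σ A S x.1 x.2 v
    obtain ⟨M, hM⟩ := (Set.Finite.bddBelow (Set.toFinite (N '' ({(Tv ħ k 1 (-1), 0),
      (Tv ħ k 1 1, 0), (Tv ħ k (-1) 1, 0), (Kv ħ 1, 0), (Kv ħ (-1), 0), (Gpv ħ k 1, 1),
      (Gpv ħ k (-1), 1), (Gmv ħ k 1, -1), (Gmv ħ k (-1), -1)} : Set (Vertex × ℤ)))))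
    exact ⟨M, fun x hx E hE => hN x E (hE.trans_le (hM ⟨x, hx, rfl⟩))⟩
  obtain ⟨N, hN⟩ := h1
  simp only [Set.mem_insert_iff, Set.mem_singleton_iff, forall_eq_or_imp, forall_eq] at hN
  obtain ⟨h1, h2, h3, h4, h5, h6, h7, h8, h9⟩ := hN
  refine ⟨2 - N, fun m hm => ?_⟩
  have e1 : S.sign * -m < N := by rw [mul_neg]; linarith
  have e2 : S.sign * (-m - 1) < N := by cases S <;> simp [Side.sign] at hm ⊢ <;> omega
  have e3 : S.sign * (-m - A.shift₂) < N := by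
    cases S <;> cases A <;> simp [Side.sign, Sector.shift₂] at hm ⊢ <;> omega
  refine ⟨?_, fun ε => ?_⟩
  · simp [ops, h1 _ e1, h2 _ e1, h3 _ e1]
  · rcases Int.units_eq_one_or ε with rfl | rfl
    · simp [ops, Gv, Sector.expo, h4 _ e1, h6 _ e2, h7 _ e2]
    · have hne : (-1 : ℤˣ) ≠ 1 := by decide
      simp [ops, Gv, Sector.expo, hne, h5 _ e1, h8 _ e3, h9 _ e3]

theorem vop_Kv_zero (ε : ℤˣ) (n : ℤ) (f : Osc) : vop ħ k ρ σ A S (Kv ħ ε) 0 0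
    (sv A k ρ σ n f) = qpow ħ (sectorMom A k ρ σ n .tilde) • sv A k ρ σ n f := by
  have h1 : oscOp ħ k S (Kv ħ ε) 0 = 1 := by
    rcases Int.units_eq_one_or ε with rfl | rfl
    · rw [oscOp_of_neg ħ k S (Kv_osc_one_neg ħ), anZ, neg_zero]
      exact (zext_natCast _ 0).trans (annihilation_zero ħ k S _)
    · rw [oscOp_of_pos ħ k S (Kv_osc_neg_one_pos ħ), crZ]
      exact (zext_natCast _ 0).trans (creation_zero ħ k S _)
  have h2 : (Kv ħ ε).zeroExp k ρ σ A n = sectorMom A k ρ σ n .tilde := by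
    have h0 : (Finset.univ : Finset Boson) = {.tilde, .bar, .beta} := rfl
    simp [Vertex.zeroExp, Kv, h0, zeroSign]
  rw [vop_sv]
  have h3 : S.zeroIdx 0 n = n := by cases S <;> simp [Side.zeroIdx]
  rw [h3, h2, mul_zero, add_zero, zero_mul, sub_zero, h1, LinearMap.smul_apply, Module.End.one_apply,
    map_smul]

theorem ops_K0_eq : (ops ħ k ρ σ A S).K 1 0 = (ops ħ k ρ σ A S).K (-1) 0 :=
  fock_ext fun n f => by
    simp only [ops, neg_zero]
    rw [vop_Kv_zero, vop_Kv_zero]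

theorem ops_K0_unit (ε : ℤˣ) : IsUnit ((ops ħ k ρ σ A S).K ε 0) := by
  refine isUnit_iff_exists.2 ⟨fockLift fun n =>
    qpow ħ (-sectorMom A k ρ σ n .tilde) • sv A k ρ σ n, ?_, ?_⟩
  all_goals
    refine fock_ext fun n f => ?_
    simp only [Module.End.mul_apply, ops, neg_zero, vop_Kv_zero, fockLift_sv, LinearMap.smul_apply,
      map_smul, smul_smul, ← qpow_add, neg_add_cancel, add_neg_cancel, qpow_zero, one_smul,
      Module.End.one_apply]

theorem ops_KK (ε : ℤˣ) (m n : ℤ) : S.mul ((ops ħ k ρ σ A S).K ε m) ((ops ħ k ρ σ A S).K ε n) =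
    S.mul ((ops ħ k ρ σ A S).K ε n) ((ops ħ k ρ σ A S).K ε m) := by
  have h : contr ħ k (Kv ħ ε) (Kv ħ ε) = 1 := by
    rcases Int.units_eq_one_or ε with rfl | rfl
    · exact contr_eq_one_of_neg ħ k (Kv_osc_one_neg ħ)
    · exact contr_eq_one_of_pos ħ k (Kv_osc_neg_one_pos ħ)
  simp only [ops]
  rw [vop_mul_of_contr_eq_one ħ k ρ σ A S h, vop_mul_of_contr_eq_one ħ k ρ σ A S h, vop₂_swap,
    zero_mul, sub_zero, sub_zero]

-- Common source of the relations for K^- with K^+, T and G: the coefficient of D at 0 is 1 and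
-- gives the leading product, while f interpolates the other coefficients. Modes of K^- past 0
-- vanish, so the sum stops at -m.
open PowerSeries in
theorem Km_mul_vop {V : Vertex} {D : PowerSeries ℂ} (hD : D * contr ħ k V (Kv ħ (-1)) = 1)
    (h0 : coeff 0 D = 1) {f : ℤ → ℂ} (hf : ∀ n : ℕ, n ≠ 0 → coeff n D = f n) (c m E : ℤ)
    (hm : m ≤ 0) :
    S.mul (vop ħ k ρ σ A S (Kv ħ (-1)) 0 (-m)) (vop ħ k ρ σ A S V c E) =
      qpow ħ (c * (k + 2)) • (S.mul (vop ħ k ρ σ A S V c E) (vop ħ k ρ σ A S (Kv ħ (-1)) 0 (-m)) +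
        ∑ l ∈ Finset.Icc 1 (-m), f l •
          S.mul (vop ħ k ρ σ A S V c (E + l)) (vop ħ k ρ σ A S (Kv ħ (-1)) 0 (-(m + l)))) := by
  obtain ⟨M, hM⟩ := Int.eq_ofNat_of_zero_le (neg_nonneg.2 hm)
  obtain rfl : m = -M := by omega
  have h1 := vop_exchange_creation ħ k ρ σ A S (Kv_osc_neg_one_pos ħ) hD c M E
  rw [zeroComm_Kv] at h1
  rw [neg_neg, h1]
  congr 1
  have h2 : ∀ l : ℕ, coeff l D = (fun l : ℤ => if l = 0 then 1 else f l) l := by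
    intro l
    rcases eq_or_ne l 0 with rfl | hl
    · simp [h0]
    · simp [hl, hf l hl]
  simp only [h2]
  rw [sum_range_succ_eq_Icc (fun l : ℤ => (if l = 0 then 1 else f l) •
    S.mul (vop ħ k ρ σ A S V c (E + l)) (vop ħ k ρ σ A S (Kv ħ (-1)) 0 (M - l)))]
  refine congrArg₂ (· + ·) ?_ (Finset.sum_congr rfl fun l hl => ?_)
  · rw [if_pos (by trivial), one_smul]
    simp only [add_zero, sub_zero]
  · rw [if_neg (by simp at hl; omega)]
    simp only [neg_add, neg_neg, sub_eq_add_neg, add_comm]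

open PowerSeries in
theorem vop_mul_Kp {V : Vertex} {D : PowerSeries ℂ} (hD : D * contr ħ k (Kv ħ 1) V = 1)
    (h0 : coeff 0 D = 1) {f : ℤ → ℂ} (hf : ∀ n : ℕ, n ≠ 0 → coeff n D = f n) (c n E : ℤ)
    (hn : 0 ≤ n) :
    S.mul (vop ħ k ρ σ A S V c E) (vop ħ k ρ σ A S (Kv ħ 1) 0 (-n)) =
      qpow ħ (-(c * (k + 2))) • (S.mul (vop ħ k ρ σ A S (Kv ħ 1) 0 (-n)) (vop ħ k ρ σ A S V c E) +
        ∑ l ∈ Finset.Icc 1 n, f l •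
          S.mul (vop ħ k ρ σ A S (Kv ħ 1) 0 (-(n - l))) (vop ħ k ρ σ A S V c (E - l))) := by
  obtain ⟨M, rfl⟩ := Int.eq_ofNat_of_zero_le hn
  have h1 := vop_exchange_annihilation ħ k ρ σ A S (Kv_osc_one_neg ħ) hD c M E
  rw [zeroComm_Kv] at h1
  rw [h1]
  congr 1
  have h2 : ∀ l : ℕ, coeff l D = (fun l : ℤ => if l = 0 then 1 else f l) l := by
    intro l
    rcases eq_or_ne l 0 with rfl | hl
    · simp [h0]
    · simp [hl, hf l hl]
  simp only [h2]
  rw [sum_range_succ_eq_Icc (fun l : ℤ => (if l = 0 then 1 else f l) •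
    S.mul (vop ħ k ρ σ A S (Kv ħ 1) 0 (-M + l)) (vop ħ k ρ σ A S V c (E - l)))]
  refine congrArg₂ (· + ·) ?_ (Finset.sum_congr rfl fun l hl => ?_)
  · rw [if_pos (by trivial), one_smul]
    simp only [add_zero, sub_zero]
  · rw [if_neg (by simp at hl; omega)]
    simp only [neg_add, neg_neg, sub_eq_add_neg, add_comm]

variable {ħ k} (h : Generic ħ k)

include h

theorem Generic.qnum_two_ne_zero : qpow ħ 2 - (qpow ħ 2)⁻¹ ≠ 0 := by
  intro h0
  refine h.q_pow 4 (by norm_num) ?_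
  have h1 := qpow_ne_zero ħ 2
  field_simp at h0
  have h2 : ((4 : ℕ) : ℂ) = 2 * (2 : ℕ) := by norm_num
  rw [h2, qpow_mul_nat]
  linear_combination h0

theorem ops_KmKp (m n : ℤ) (hm : m ≤ 0) :
    S.mul ((ops ħ k ρ σ A S).K (-1) m) ((ops ħ k ρ σ A S).K 1 n) =
      S.mul ((ops ħ k ρ σ A S).K 1 n) ((ops ħ k ρ σ A S).K (-1) m)
      - qdiff ħ ^ 2 • ∑ l ∈ Finset.Icc 1 (-m),
        (qnum ħ k * qnum ħ (k + 2) * qnum ħ (2 * l) / qnum ħ 2) •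
          S.mul ((ops ħ k ρ σ A S).K 1 (n - l)) ((ops ħ k ρ σ A S).K (-1) (m + l)) := by
  obtain ⟨D, hD, h0, hf⟩ := exists_inverse_reciprocal (qpow_ne_zero ħ _) (qpow_ne_zero ħ _)
    h.qnum_two_ne_zero (contr_Kv_Kv h)
  have hd := h.qdiff_ne_zero
  have h2 := h.qnum_two_ne_zero
  have := Km_mul_vop ħ k ρ σ A S hD h0
    (f := fun l => -(qdiff ħ ^ 2 * (qnum ħ k * qnum ħ (k + 2) * qnum ħ (2 * l) / qnum ħ 2)))
    (fun n hn => ?_) 0 m (-n) hm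
  · simp only [ops]
    rw [this, Int.cast_zero, zero_mul, qpow_zero, one_smul, sub_eq_add_neg, Finset.smul_sum,
      ← Finset.sum_neg_distrib]
    congr 1
    refine Finset.sum_congr rfl fun l _ => ?_
    rw [smul_smul, ← neg_smul]
    congr 3
    ring
  · rw [hf n hn]
    have e1 : qpow ħ (2 * n) = qpow ħ 2 ^ n := qpow_mul_nat _ _ _
    have e2 : qpow ħ (2 * k + 2) = qpow ħ k * qpow ħ k * qpow ħ 2 := by
      rw [← qpow_add, ← qpow_add]; congr 1; ring
    have e3 : qpow ħ (k + 2) = qpow ħ k * qpow ħ 2 := qpow_add _ _ _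
    have e4 := qpow_ne_zero ħ k
    have e5 := qpow_ne_zero ħ 2
    simp only [qnum, qpow_neg, Int.cast_natCast, e1, e2, e3]
    field_simp
    ring

theorem Generic.exists_inverse_T (hk₃ : qnum ħ (k + 3) ≠ 0) {F : PowerSeries ℂ}
    (hF : F * prodSeries [qpow ħ (k + 1), (qpow ħ (k + 1))⁻¹] =
      prodSeries [qpow ħ (k + 3), (qpow ħ (k + 3))⁻¹]) :
    ∃ D : PowerSeries ℂ, D * F = 1 ∧ PowerSeries.coeff 0 D = 1 ∧ ∀ n : ℕ, n ≠ 0 →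
      PowerSeries.coeff n D = (fun l : ℤ =>
        qdiff ħ ^ 2 * (qnum ħ (k + 2) * qnum ħ ((k + 3) * l) / qnum ħ (k + 3))) n := by
  have hd := h.qdiff_ne_zero
  have hy : qpow ħ (k + 3) - (qpow ħ (k + 3))⁻¹ ≠ 0 := fun h0 =>
    hk₃ (by rw [qnum, qpow_neg, h0, zero_div])
  obtain ⟨D, hD, h0, hf⟩ := exists_inverse_reciprocal (qpow_ne_zero ħ _) (qpow_ne_zero ħ _)
    hy hF
  refine ⟨D, hD, h0, fun n hn => ?_⟩
  rw [hf n hn]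
  have e1 : qpow ħ ((k + 3) * n) = qpow ħ (k + 3) ^ n := qpow_mul_nat _ _ _
  have e2 : qpow ħ (k + 3) = qpow ħ (k + 2) * qpow ħ 1 := by rw [← qpow_add]; congr 1; ring
  have e3 : qpow ħ (k + 1) = qpow ħ (k + 2) / qpow ħ 1 := by rw [← qpow_sub]; congr 1; ring
  have e4 := qpow_ne_zero ħ (k + 2)
  have e5 := qpow_ne_zero ħ 1
  have e6 : qpow ħ (k + 3) + (qpow ħ (k + 3))⁻¹ - qpow ħ (k + 1) - (qpow ħ (k + 1))⁻¹ =
      (qpow ħ (k + 2) - (qpow ħ (k + 2))⁻¹) * qdiff ħ := by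
    rw [qdiff, qpow_neg, e2, e3]
    field_simp
    ring
  simp only [qnum, qpow_neg, Int.cast_natCast, e1, e6]
  field_simp

theorem ops_KmT (hk₃ : qnum ħ (k + 3) ≠ 0) (m n : ℤ) (hm : m ≤ 0) :
    S.mul ((ops ħ k ρ σ A S).K (-1) m) ((ops ħ k ρ σ A S).T n) =
      S.mul ((ops ħ k ρ σ A S).T n) ((ops ħ k ρ σ A S).K (-1) m)
      + qdiff ħ ^ 2 • ∑ l ∈ Finset.Icc 1 (-m),
        (qnum ħ (k + 2) * qnum ħ ((k + 3) * l) / qnum ħ (k + 3)) •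
          S.mul ((ops ħ k ρ σ A S).T (n - l)) ((ops ħ k ρ σ A S).K (-1) (m + l)) := by
  -- The inverse contraction is the same for all terms of T, so the relation is proved term by term
  -- and combined linearly.
  have key : ∀ ε ε', S.mul (vop ħ k ρ σ A S (Kv ħ (-1)) 0 (-m))
      (vop ħ k ρ σ A S (Tv ħ k ε ε') 0 (-n)) =
      S.mul (vop ħ k ρ σ A S (Tv ħ k ε ε') 0 (-n)) (vop ħ k ρ σ A S (Kv ħ (-1)) 0 (-m)) +
      qdiff ħ ^ 2 • ∑ l ∈ Finset.Icc 1 (-m),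
        (qnum ħ (k + 2) * qnum ħ ((k + 3) * l) / qnum ħ (k + 3)) •
          S.mul (vop ħ k ρ σ A S (Tv ħ k ε ε') 0 (-(n - l)))
            (vop ħ k ρ σ A S (Kv ħ (-1)) 0 (-(m + l))) := by
    intro ε ε'
    obtain ⟨D, hD, h0, hf⟩ := h.exists_inverse_T hk₃ (contr_Tv_Kv h ε ε')
    rw [Km_mul_vop ħ k ρ σ A S hD h0 (f := fun l : ℤ =>
      qdiff ħ ^ 2 * (qnum ħ (k + 2) * qnum ħ ((k + 3) * l) / qnum ħ (k + 3))) hf 0 m (-n) hm, Int.cast_zero, zero_mul, qpow_zero, one_smul,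
      Finset.smul_sum]
    congr 1
    refine Finset.sum_congr rfl fun l _ => ?_
    rw [smul_smul]
    congr 3
    ring
  simp only [ops, Side.mul_add, Side.add_mul, Side.mul_sub, Side.sub_mul, Side.mul_smul,
    Side.smul_mul, key, smul_add, smul_sub, Finset.sum_add_distrib, Finset.sum_sub_distrib,
    Finset.smul_sum]
  simp only [smul_comm (_ * _ / _ : ℂ) (qpow ħ _ : ℂ), smul_comm (_ * _ / _ : ℂ) (_ / _ : ℂ),
    smul_comm (qdiff ħ ^ 2 : ℂ)]
  abel

theorem ops_TKp (hk₃ : qnum ħ (k + 3) ≠ 0) (m n : ℤ) (hn : 0 ≤ n) :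
    S.mul ((ops ħ k ρ σ A S).T m) ((ops ħ k ρ σ A S).K 1 n) =
      S.mul ((ops ħ k ρ σ A S).K 1 n) ((ops ħ k ρ σ A S).T m)
      + qdiff ħ ^ 2 • ∑ l ∈ Finset.Icc 1 n,
        (qnum ħ (k + 2) * qnum ħ ((k + 3) * l) / qnum ħ (k + 3)) •
          S.mul ((ops ħ k ρ σ A S).K 1 (n - l)) ((ops ħ k ρ σ A S).T (m + l)) := by
  have key : ∀ ε ε', S.mul (vop ħ k ρ σ A S (Tv ħ k ε ε') 0 (-m))
      (vop ħ k ρ σ A S (Kv ħ 1) 0 (-n)) =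
      S.mul (vop ħ k ρ σ A S (Kv ħ 1) 0 (-n)) (vop ħ k ρ σ A S (Tv ħ k ε ε') 0 (-m)) +
      qdiff ħ ^ 2 • ∑ l ∈ Finset.Icc 1 n,
        (qnum ħ (k + 2) * qnum ħ ((k + 3) * l) / qnum ħ (k + 3)) •
          S.mul (vop ħ k ρ σ A S (Kv ħ 1) 0 (-(n - l)))
            (vop ħ k ρ σ A S (Tv ħ k ε ε') 0 (-(m + l))) := by
    intro ε ε'
    obtain ⟨D, hD, h0, hf⟩ := h.exists_inverse_T hk₃ (contr_Kv_Tv h ε ε')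
    rw [vop_mul_Kp ħ k ρ σ A S hD h0 (f := fun l : ℤ =>
      qdiff ħ ^ 2 * (qnum ħ (k + 2) * qnum ħ ((k + 3) * l) / qnum ħ (k + 3))) hf 0 n (-m) hn,
      Int.cast_zero, zero_mul, neg_zero, qpow_zero, one_smul, Finset.smul_sum]
    refine congrArg₂ (· + ·) rfl (Finset.sum_congr rfl fun l _ => ?_)
    rw [smul_smul, neg_add, sub_eq_add_neg (-m)]
  simp only [ops, Side.mul_add, Side.add_mul, Side.mul_sub, Side.sub_mul, Side.mul_smul,
    Side.smul_mul, key, smul_add, smul_sub, Finset.sum_add_distrib, Finset.sum_sub_distrib,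
    Finset.smul_sum]
  simp only [smul_comm (_ * _ / _ : ℂ) (qpow ħ _ : ℂ), smul_comm (_ * _ / _ : ℂ) (_ / _ : ℂ),
    smul_comm (qdiff ħ ^ 2 : ℂ)]
  abel

theorem contr_Gv_Kv (ε ε' : ℤˣ) : contr ħ k (Gv ħ k ε ε') (Kv ħ (-1)) * prodSeries [1] =
    prodSeries [qpow ħ (sg ε * (2 * k + 4))] := by
  rcases Int.units_eq_one_or ε with rfl | rfl
  · rw [Gv, if_pos rfl, contr_Gpv_Kv h]
    simp [sg]
  · rw [Gv, if_neg (by decide), contr_Gmv_Kv h, ← qpow_neg]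
    simp [sg]

theorem contr_Kv_Gv (ε ε' : ℤˣ) : contr ħ k (Kv ħ 1) (Gv ħ k ε ε') * prodSeries [1] =
    prodSeries [qpow ħ (-sg ε * (2 * k + 4))] := by
  rcases Int.units_eq_one_or ε with rfl | rfl
  · rw [Gv, if_pos rfl, contr_Kv_Gpv h, ← qpow_neg]
    simp [sg]
  · rw [Gv, if_neg (by decide), contr_Kv_Gmv h]
    simp [sg]

omit h in
theorem qpow_sg_sub (hd : qdiff ħ ≠ 0) (ε : ℤˣ) (x : ℂ) :
    qpow ħ (sg ε * x) - qpow ħ (-(sg ε * x)) = sg ε * qdiff ħ * qnum ħ x := by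
  rw [qnum]
  rcases Int.units_eq_one_or ε with rfl | rfl
  · simp only [sg, Units.val_one, Int.cast_one, one_mul]
    field_simp
  · simp only [sg, Units.val_neg, Units.val_one, Int.cast_neg, Int.cast_one, neg_one_mul, neg_neg]
    field_simp
    ring

theorem ops_KmG (ε : ℤˣ) (m r : ℤ) (hm : m ≤ 0) :
    S.mul ((ops ħ k ρ σ A S).K (-1) m) ((ops ħ k ρ σ A S).G ε r) =
      qpow ħ (sg ε * (k + 2)) • S.mul ((ops ħ k ρ σ A S).G ε r) ((ops ħ k ρ σ A S).K (-1) m)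
      + (sg ε * qdiff ħ * qnum ħ (k + 2)) • ∑ l ∈ Finset.Icc 1 (-m),
        qpow ħ (sg ε * (2 * (k + 2) * l)) •
          S.mul ((ops ħ k ρ σ A S).G ε (r - l)) ((ops ħ k ρ σ A S).K (-1) (m + l)) := by
  have key : ∀ ε' E, S.mul (vop ħ k ρ σ A S (Kv ħ (-1)) 0 (-m))
      (vop ħ k ρ σ A S (Gv ħ k ε ε') ε E) = qpow ħ (sg ε * (k + 2)) •
      S.mul (vop ħ k ρ σ A S (Gv ħ k ε ε') ε E) (vop ħ k ρ σ A S (Kv ħ (-1)) 0 (-m)) +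
      (sg ε * qdiff ħ * qnum ħ (k + 2)) • ∑ l ∈ Finset.Icc 1 (-m),
        qpow ħ (sg ε * (2 * (k + 2) * l)) • S.mul (vop ħ k ρ σ A S (Gv ħ k ε ε') ε (E + l))
            (vop ħ k ρ σ A S (Kv ħ (-1)) 0 (-(m + l))) := by
    intro ε' E
    obtain ⟨D, hD, h0, hf⟩ := exists_inverse_single (qpow_ne_zero ħ _) (contr_Gv_Kv h ε ε')
    rw [Km_mul_vop ħ k ρ σ A S hD h0 (f := fun l : ℤ =>
      (qpow ħ (sg ε * (2 * k + 4)) - 1) / qpow ħ (sg ε * (2 * k + 4)) *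
        qpow ħ (sg ε * (2 * (k + 2) * l))) (fun n hn => ?_) ε m E hm, smul_add,
      Finset.smul_sum, Finset.smul_sum]
    · refine congrArg₂ (· + ·) rfl (Finset.sum_congr rfl fun l _ => ?_)
      -- With x = ±(k+2) and a = q^{2x}, the prefactor q^x (a - 1)/a is q^x - q^{-x}.
      rw [smul_smul, smul_smul, ← qpow_sg_sub h.qdiff_ne_zero, ← mul_assoc]
      congr 2
      have e1 : qpow ħ (sg ε * (2 * k + 4)) = qpow ħ (sg ε * (k + 2)) * qpow ħ (sg ε * (k + 2)) := by
        rw [← qpow_add]; congr 1; ring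
      have e2 := qpow_ne_zero ħ (sg ε * (k + 2))
      rw [e1, qpow_neg]
      change qpow ħ (sg ε * (k + 2)) * _ = _
      field_simp
    · rw [hf n hn, ← qpow_mul_nat]
      congr 2
      push_cast
      ring
  have e1 : ∀ l, A.expo ε (r - l) = A.expo ε r + l := fun l => by
    rw [sub_eq_add_neg, Sector.expo_add, sub_neg_eq_add]
  simp only [ops, Side.mul_sub, Side.sub_mul, Side.mul_smul, Side.smul_mul, key, smul_add,
    smul_sub, Finset.sum_sub_distrib, Finset.smul_sum, e1]
  simp only [smul_comm (sg ε / qdiff ħ : ℂ) (qpow ħ _ : ℂ),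
    smul_comm (sg ε / qdiff ħ : ℂ) (_ * _ * _ : ℂ)]
  abel

theorem ops_GKp (ε : ℤˣ) (r n : ℤ) (hn : 0 ≤ n) :
    S.mul ((ops ħ k ρ σ A S).G ε r) ((ops ħ k ρ σ A S).K 1 n) =
      qpow ħ (-sg ε * (k + 2)) • S.mul ((ops ħ k ρ σ A S).K 1 n) ((ops ħ k ρ σ A S).G ε r)
      - (sg ε * qdiff ħ * qnum ħ (k + 2)) • ∑ l ∈ Finset.Icc 1 n,
        qpow ħ (-sg ε * (2 * (k + 2) * l)) •
          S.mul ((ops ħ k ρ σ A S).K 1 (n - l)) ((ops ħ k ρ σ A S).G ε (r + l)) := by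
  have key : ∀ ε' E, S.mul (vop ħ k ρ σ A S (Gv ħ k ε ε') ε E)
      (vop ħ k ρ σ A S (Kv ħ 1) 0 (-n)) = qpow ħ (-sg ε * (k + 2)) •
      S.mul (vop ħ k ρ σ A S (Kv ħ 1) 0 (-n)) (vop ħ k ρ σ A S (Gv ħ k ε ε') ε E) -
      (sg ε * qdiff ħ * qnum ħ (k + 2)) • ∑ l ∈ Finset.Icc 1 n,
        qpow ħ (-sg ε * (2 * (k + 2) * l)) • S.mul (vop ħ k ρ σ A S (Kv ħ 1) 0 (-(n - l)))
            (vop ħ k ρ σ A S (Gv ħ k ε ε') ε (E - l)) := by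
    intro ε' E
    obtain ⟨D, hD, h0, hf⟩ := exists_inverse_single (qpow_ne_zero ħ _) (contr_Kv_Gv h ε ε')
    rw [vop_mul_Kp ħ k ρ σ A S hD h0 (f := fun l : ℤ =>
      (qpow ħ (-sg ε * (2 * k + 4)) - 1) / qpow ħ (-sg ε * (2 * k + 4)) *
        qpow ħ (-sg ε * (2 * (k + 2) * l))) (fun n hn => ?_) ε n E hn, smul_add,
      Finset.smul_sum, Finset.smul_sum, sub_eq_add_neg (qpow ħ (-sg ε * (k + 2)) • _),
      ← Finset.sum_neg_distrib]
    · rw [neg_mul (sg ε) (k + 2)]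
      refine congrArg₂ (· + ·) rfl (Finset.sum_congr rfl fun l _ => ?_)
      rw [smul_smul, smul_smul, ← neg_smul, ← qpow_sg_sub h.qdiff_ne_zero, ← mul_assoc]
      congr 1
      have e1 : qpow ħ (-sg ε * (2 * k + 4)) =
          (qpow ħ (sg ε * (k + 2)))⁻¹ * (qpow ħ (sg ε * (k + 2)))⁻¹ := by
        rw [← qpow_neg, ← qpow_add]; congr 1; ring
      have e2 := qpow_ne_zero ħ (sg ε * (k + 2))
      change qpow ħ (-(sg ε * (k + 2))) * _ * _ = _
      rw [e1, qpow_neg]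
      field_simp
      ring
    · rw [hf n hn, ← qpow_mul_nat]
      congr 2
      push_cast
      ring
  simp only [ops, Side.mul_sub, Side.sub_mul, Side.mul_smul, Side.smul_mul, key,
    smul_sub, Finset.sum_sub_distrib, Finset.smul_sum, Sector.expo_add]
  simp only [smul_comm (sg ε / qdiff ħ : ℂ) (qpow ħ _ : ℂ),
    smul_comm (sg ε / qdiff ħ : ℂ) (_ * _ * _ : ℂ)]
  abel

end Operators

end

section

/-! ### Charges and zero modes of the vertex operators. -/

section Charges

variable (ħ k : ℂ)

theorem hasCharge_Gpv (ε : ℤˣ) : HasCharge k (Gpv ħ k ε) 1 := by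
  constructor <;> simp [Vertex.nmul, Vertex.rescale, Vt, ev, Yv, Zv, sg, Gpv]

theorem hasCharge_Gmv (ε : ℤˣ) : HasCharge k (Gmv ħ k ε) (-1) := by
  constructor <;> simp [Vertex.nmul, Vertex.rescale, Vertex.inv, Vt, fv, Yv, Zv, sg, Gmv]

theorem hasCharge_Tv (ε ε' : ℤˣ) : HasCharge k (Tv ħ k ε ε') 0 := by
  constructor <;> simp [Vertex.nmul, Vertex.rescale, Vertex.inv, Vt, ev, fv, Yv, Zv, sg, Tv]

theorem hasCharge_Kv (ε : ℤˣ) : HasCharge k (Kv ħ ε) 0 := by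
  constructor <;> simp [Kv]

theorem Gpv_logq (ε : ℤˣ) : (Gpv ħ k ε).logq = fun
    | .tilde => -(k + 2) / k | .bar => -sg ε / 2 - (3 * k + 4) / (2 * k) | .beta => -sg ε / 2 := by
  funext i
  cases i <;> simp [Vertex.nmul, Vertex.rescale, Vt, ev, Yv, Zv, sg, Gpv] <;> ring

theorem Gmv_logq (ε : ℤˣ) : (Gmv ħ k ε).logq = fun
    | .tilde => -(k + 2) / k | .bar => -sg ε / 2 - (3 * k + 4) / (2 * k) | .beta => sg ε / 2 := by
  funext i
  cases i <;> simp [Vertex.nmul, Vertex.rescale, Vertex.inv, Vt, fv, Yv, Zv, sg, Gmv] <;> ring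

theorem Tv_logq (hk : k ≠ 0) (ε ε' : ℤˣ) : (Tv ħ k ε ε').logq = fun
    | .tilde => -2 / k | .bar => -sg ε / 2 - sg ε' / 2 - (k + 2) / k
    | .beta => -sg ε / 2 + sg ε' / 2 := by
  funext i
  cases i <;> simp [Vertex.nmul, Vertex.rescale, Vertex.inv, Vt, ev, fv, Yv, Zv, sg, Tv] <;>
    field_simp <;> ring

theorem zeroComm_Gpv (hk : k ≠ 0) (ε : ℤˣ) (c : ℤ) :
    (Gpv ħ k ε).zeroComm k c = c * (sg ε - (k + 1)) := by
  rw [Vertex.zeroComm, Gpv_logq]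
  field_simp
  ring

theorem zeroComm_Gmv (hk : k ≠ 0) (ε : ℤˣ) (c : ℤ) :
    (Gmv ħ k ε).zeroComm k c = c * (sg ε - (k + 1)) := by
  rw [Vertex.zeroComm, Gmv_logq]
  field_simp
  ring

end Charges

/-! ### Vanishing of the anticommutators of G^ε with itself. -/

section Anticommutation

open PowerSeries

variable {ħ k : ℂ} (ρ σ : ℂ) (A : Sector) (S : Side)

theorem contrZ_of_prodSeries_nil {V V' : Vertex} {β : ℂ}
    (h : contr ħ k V V' * prodSeries [] = prodSeries [β]) (l : ℤ) :
    contrZ ħ k V V' l = (if l = 0 then 1 else 0) - if l = 1 then β else 0 := by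
  rw [prodSeries_nil, mul_one] at h
  rw [contrZ, h]
  by_cases hl : 0 ≤ l
  · obtain ⟨n, rfl⟩ := Int.eq_ofNat_of_zero_le hl
    rw [zext_natCast]
    simp only [prodSeries_cons, prodSeries_nil, mul_one, map_sub, coeff_one, coeff_C_mul, coeff_X]
    rcases n with _ | _ | n
    · simp
    · simp
    · rw [if_neg (by omega), if_neg (by omega), if_neg (by omega), if_neg (by omega)]
      simp
  · rw [zext_of_neg _ (not_le.1 hl), if_neg (by omega), if_neg (by omega), sub_zero]

/-- Charges of product 1 contribute one power of z or w, so the two orders carry z - βw and w - β⁻¹z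
= -β⁻¹(z - βw). The zero mode factors differ by β, which leaves opposite polynomials; only l = 0 and
l = 1 occur. -/
theorem vop_anticomm {V V' : Vertex} {c : ℤ} (hc : c * c = 1) {β : ℂ} (hβ : β ≠ 0)
    (h : contr ħ k V V' * prodSeries [] = prodSeries [β])
    (h' : contr ħ k V' V * prodSeries [] = prodSeries [β⁻¹])
    (hκ : qpow ħ (V'.zeroComm k c) = β * qpow ħ (V.zeroComm k c)) (E E' : ℤ) :
    S.mul (vop ħ k ρ σ A S V c E) (vop ħ k ρ σ A S V' c E') +
      S.mul (vop ħ k ρ σ A S V' c E') (vop ħ k ρ σ A S V c E) = 0 := by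
  have h1 := hasLocSum_vop_comm ħ k ρ σ A S V c V' c E E' 1
  rw [one_smul] at h1
  refine h1.unique (HasLocSum.zero.congr (fun l => ?_) rfl)
  rw [contrZ_of_prodSeries_nil h, contrZ_of_prodSeries_nil h', hc, hκ]
  symm
  convert zero_smul ℂ _ using 2
  have e1 : (1 - l = 0) = (l = 1) := propext ⟨fun _ => by omega, fun _ => by omega⟩
  have e2 : (1 - l = 1) = (l = 0) := propext ⟨fun _ => by omega, fun _ => by omega⟩
  simp only [e1, e2]
  by_cases h0 : l = 0
  · simp only [h0, if_true, zero_ne_one, if_false]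
    field_simp
    ring
  · by_cases h1 : l = 1
    · simp only [h1, if_true, one_ne_zero, if_false]
      ring
    · simp [h0, h1]

variable (h : Generic ħ k)

include h

theorem Gv_anticomm (ε ε₁ ε₂ : ℤˣ) (E E' : ℤ) :
    S.mul (vop ħ k ρ σ A S (Gv ħ k ε ε₁) ε E) (vop ħ k ρ σ A S (Gv ħ k ε ε₂) ε E') +
      S.mul (vop ħ k ρ σ A S (Gv ħ k ε ε₂) ε E') (vop ħ k ρ σ A S (Gv ħ k ε ε₁) ε E) = 0 := by
  have hk := h.k_ne_zero
  have hne : (-1 : ℤˣ) ≠ 1 := by decide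
  have h2 := qpow_ne_zero ħ 2
  obtain ⟨p1, p2, p3, p4⟩ := contr_Gpv_Gpv h
  obtain ⟨m1, m2, m3, m4⟩ := contr_Gmv_Gmv h
  rcases Int.units_eq_one_or ε with rfl | rfl
  · simp only [Gv, if_true, Units.val_one]
    rcases Int.units_eq_one_or ε₁ with rfl | rfl <;> rcases Int.units_eq_one_or ε₂ with rfl | rfl
    · exact vop_anticomm ρ σ A S (by norm_num) one_ne_zero p1 (by rw [inv_one]; exact p1)
        (by rw [one_mul]) _ _
    · refine vop_anticomm ρ σ A S (by norm_num) (inv_ne_zero h2) p2 (by rw [inv_inv]; exact p3)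
        ?_ _ _
      rw [zeroComm_Gpv ħ k hk, zeroComm_Gpv ħ k hk, ← qpow_neg, ← qpow_add]
      congr 1; simp [sg]; ring
    · refine vop_anticomm ρ σ A S (by norm_num) h2 p3 p2 ?_ _ _
      rw [zeroComm_Gpv ħ k hk, zeroComm_Gpv ħ k hk, ← qpow_add]
      congr 1; simp [sg]; ring
    · exact vop_anticomm ρ σ A S (by norm_num) one_ne_zero p4 (by rw [inv_one]; exact p4)
        (by rw [one_mul]) _ _
  · simp only [Gv, hne, if_false, Units.val_neg, Units.val_one]
    rcases Int.units_eq_one_or ε₁ with rfl | rfl <;> rcases Int.units_eq_one_or ε₂ with rfl | rfl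
    · exact vop_anticomm ρ σ A S (by norm_num) one_ne_zero m1 (by rw [inv_one]; exact m1)
        (by rw [one_mul]) _ _
    · refine vop_anticomm ρ σ A S (by norm_num) h2 m2 m3 ?_ _ _
      rw [zeroComm_Gmv ħ k hk, zeroComm_Gmv ħ k hk, ← qpow_add]
      congr 1; simp [sg]; ring
    · refine vop_anticomm ρ σ A S (by norm_num) (inv_ne_zero h2) m3 (by rw [inv_inv]; exact m2)
        ?_ _ _
      rw [zeroComm_Gmv ħ k hk, zeroComm_Gmv ħ k hk, ← qpow_neg, ← qpow_add]
      congr 1; simp [sg]; ring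
    · exact vop_anticomm ρ σ A S (by norm_num) one_ne_zero m4 (by rw [inv_one]; exact m4)
        (by rw [one_mul]) _ _

theorem ops_GG (ε : ℤˣ) (r s : ℤ) :
    S.mul ((ops ħ k ρ σ A S).G ε r) ((ops ħ k ρ σ A S).G ε s) +
      S.mul ((ops ħ k ρ σ A S).G ε s) ((ops ħ k ρ σ A S).G ε r) = 0 := by
  have h1 := Gv_anticomm ρ σ A S h ε 1 1 (A.expo ε r) (A.expo ε s)
  have h2 := Gv_anticomm ρ σ A S h ε 1 (-1) (A.expo ε r) (A.expo ε s)
  have h3 := Gv_anticomm ρ σ A S h ε (-1) 1 (A.expo ε r) (A.expo ε s)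
  have h4 := Gv_anticomm ρ σ A S h ε (-1) (-1) (A.expo ε r) (A.expo ε s)
  rw [add_eq_zero_iff_eq_neg] at h1 h2 h3 h4
  simp only [ops, Side.mul_sub, Side.sub_mul, Side.mul_smul, Side.smul_mul, h1, h2, h3, h4]
  simp only [smul_sub, smul_neg]
  abel

end Anticommutation

/-! ### Truncated geometric sums and rearrangement of sums. -/

section Resummation

variable {V ι κ : Type*} [AddCommGroup V] [Module ℂ V]

/-- Resummation of a family whose members are combinations of a locally finite family. -/
theorem HasLocSum.of_smul_swap {X : κ → Module.End ℂ V} {c : ι → κ → ℂ} {w : κ → ℂ}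
    {N : ι → Module.End ℂ V} {L : Module.End ℂ V}
    (hX : ∀ v, (Function.support fun u => X u v).Finite)
    (hc : ∀ u, HasLocSum (fun g => c g u • (1 : Module.End ℂ ℂ)) (w u • 1))
    (hN : ∀ g, HasLocSum (fun u => c g u • X u) (N g))
    (hL : HasLocSum (fun u => w u • X u) L) : HasLocSum N L := by
  -- The scalar sums are encoded as multiples of the identity of ℂ so that the calculus of locally
  -- finite sums applies to them; evaluation at 1 recovers the finite sums.
  have hc' : ∀ u, (Function.support fun g => c g u).Finite ∧ w u = ∑ᶠ g, c g u := by
    intro u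
    have := hc u 1
    simpa using this
  have h1 : HasLocSum (fun x : κ × ι => c x.2 x.1 • X x.1) L := by
    refine HasLocSum.of_iterated (fun v => ?_) (fun u => ?_) hL
    · refine (Set.Finite.biUnion (hX v) (t := fun u => (fun g => (u, g)) ''
        (Function.support fun g => c g u)) fun u _ => (hc' u).1.image _).subset ?_
      rintro ⟨u, g⟩ hx
      simp only [Set.mem_iUnion, Set.mem_image, Function.mem_support, Prod.mk.injEq, exists_prop]
      simp only [Function.mem_support, LinearMap.smul_apply] at hx
      exact ⟨u, right_ne_zero_of_smul hx, g, left_ne_zero_of_smul hx, rfl, rfl⟩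
    · intro v
      refine ⟨(hc' u).1.subset fun g hg => ?_, ?_⟩
      · simp only [Function.mem_support, LinearMap.smul_apply] at hg
        exact left_ne_zero_of_smul hg
      · simp only [LinearMap.smul_apply]
        rw [(hc' u).2]
        exact finsum_smul' (hc' u).1 _
  exact (h1.comp_equiv (Equiv.prodComm ι κ)).iterated hN

/-- The step function with the value `1/2` at the jump. -/
def halfStep (P l : ℤ) : ℂ := if 2 * l < P then 1 else if 2 * l = P then 1 / 2 else 0

/-- The value of the truncated geometric sum. -/
def geomValue (a : ℂ) (P : ℤ) : ℂ :=
  if Even P then 1 / (1 - a) - a ^ (P / 2) * (1 + a) / (2 * (1 - a))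
  else 1 / (1 - a) - a ^ (P / 2 + 1) / (1 - a)

/-- Raising P by one adds 1/2 at one place: it completes the jump if P is even and starts the next
one if P is odd. This makes induction in steps of one possible. -/
theorem halfStep_succ (P l : ℤ) :
    halfStep (P + 1) l = halfStep P l + if l = (P + 1) / 2 then 1 / 2 else 0 := by
  unfold halfStep
  split_ifs <;> first | omega | norm_num

theorem geomValue_succ {a : ℂ} (ha : a ≠ 0) (ha' : 1 - a ≠ 0) (P : ℤ) :
    geomValue a (P + 1) = geomValue a P + 1 / 2 * a ^ ((P + 1) / 2) := by
  unfold geomValue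
  rcases Int.even_or_odd P with hP | hP
  · have h1 : ¬Even (P + 1) := by simpa [Int.even_add_one] using hP
    have h2 : (P + 1) / 2 = P / 2 := by obtain ⟨n, rfl⟩ := hP; omega
    rw [if_neg h1, if_pos hP, h2, zpow_add_one₀ ha]
    field_simp
    ring
  · have h1 : Even (P + 1) := by simpa [Int.even_add_one] using hP
    have h2 : (P + 1) / 2 = P / 2 + 1 := by obtain ⟨n, rfl⟩ := hP; omega
    rw [if_pos h1, if_neg (Int.not_even_iff_odd.2 hP), h2]
    field_simp
    ring

/-- Subtracting the step at 0 leaves a function of finite support, so no condition on |a| is needed.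
The value follows by induction on P in both directions from P = 0. -/
theorem hasLocSum_halfStep {a : ℂ} (ha : a ≠ 0) (ha' : 1 - a ≠ 0) (P : ℤ) :
    HasLocSum (fun l : ℤ => ((halfStep P l - if l < 0 then 1 else 0) * a ^ l) •
      (1 : Module.End ℂ ℂ)) (geomValue a P • 1) := by
  have hs : ∀ P : ℤ, HasLocSum (fun l : ℤ => ((if l = (P + 1) / 2 then 1 / 2 else 0) * a ^ l) •
      (1 : Module.End ℂ ℂ)) ((1 / 2 * a ^ ((P + 1) / 2)) • 1) := by
    intro P
    refine (HasLocSum.single ((P + 1) / 2) fun l hl => ?_).congr (fun l => rfl) ?_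
    · rw [if_neg hl, zero_mul, zero_smul]
    · rw [if_pos rfl]
  induction P using Int.induction_on with
  | zero =>
    refine (HasLocSum.single 0 fun l hl => ?_).congr (fun l => rfl) ?_
    · have : halfStep 0 l - (if l < 0 then 1 else 0) = 0 := by
        unfold halfStep
        split_ifs <;> first | omega | norm_num
      rw [this, zero_mul, zero_smul]
    · simp only [halfStep, geomValue]
      congr 1
      simp
      field_simp
      ring
  | succ n ih =>
    refine (ih.add (hs n)).congr (fun l => ?_) ?_
    · rw [← add_smul, halfStep_succ]
      congr 1
      ring
    · rw [← add_smul, geomValue_succ ha ha']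
  | pred n ih =>
    have h1 := halfStep_succ (-n - 1)
    have h2 := geomValue_succ ha ha' (-n - 1)
    rw [sub_add_cancel] at h2
    refine (ih.sub (hs (-n - 1))).congr (fun l => ?_) ?_
    · have := h1 l
      rw [sub_add_cancel] at this ⊢
      rw [← sub_smul, this]
      congr 1
      ring
    · rw [← sub_smul, h2, sub_add_cancel]
      congr 1
      ring

end Resummation

end

/-! ### Operator products with charges 1 and -1 and their residues. -/

section

open PowerSeries

variable {ħ k : ℂ} (ρ σ : ℂ) (A : Sector) (S : Side)

/-- The operator products of `V(z)` and `V'(w)`, in both orders, are the expansions of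
`∑ Bᵢ / (1 - q^{2xᵢ} w / z)`, `i = 1, 2`. -/
structure TwoSided (ħ k : ℂ) (V V' : Vertex) (B₁ x₁ B₂ x₂ : ℂ) : Prop where
  mul (l : ℤ) : qpow ħ (V.zeroComm k (-1)) * contrZ ħ k V V' l =
    (1 - if l < 0 then 1 else 0) * (B₁ * qpow ħ (2 * x₁) ^ l + B₂ * qpow ħ (2 * x₂) ^ l)
  mul' (l : ℤ) : -(qpow ħ (V'.zeroComm k 1) * contrZ ħ k V' V (-1 - l)) =
    (0 - if l < 0 then 1 else 0) * (B₁ * qpow ħ (2 * x₁) ^ l + B₂ * qpow ħ (2 * x₂) ^ l)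

theorem coeff_of_mul_prodSeries_zero {P : PowerSeries ℂ} {a b c : ℂ} (ha : a ≠ 0) (hc : c ≠ 0)
    (hac : a ≠ c) (h : P * prodSeries [a, c] = prodSeries [b, 0]) (n : ℕ) :
    coeff n P = (a - b) / (a - c) * a ^ n + (c - b) / (c - a) * c ^ n := by
  have h1 := sub_ne_zero.2 hac
  have h2 := sub_ne_zero.2 hac.symm
  rw [coeff_of_mul_prodSeries ha hc hac h, mul_zero, zero_div, ite_self, sub_zero, sub_zero,
    add_zero]
  field_simp

/-- Charges of product -1 contribute a factor z⁻¹ or w⁻¹, which explains the index -1 - l. The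
condition on the zero modes makes the geometric series in z/w continue the one in w/z with opposite
sign. The second pole is a dummy of residue 0. -/
theorem TwoSided.of_single {V V' : Vertex} {x : ℂ}
    (h : contr ħ k V V' * prodSeries [qpow ħ (2 * x)] = prodSeries [])
    (h' : contr ħ k V' V * prodSeries [(qpow ħ (2 * x))⁻¹] = prodSeries [])
    (hκ : V.zeroComm k (-1) = V'.zeroComm k 1 + 2 * x) :
    TwoSided ħ k V V' (qpow ħ (V.zeroComm k (-1))) x 0 x := by
  have hx := qpow_ne_zero ħ (2 * x)
  constructor
  · intro l
    by_cases hl : 0 ≤ l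
    · obtain ⟨n, rfl⟩ := Int.eq_ofNat_of_zero_le hl
      rw [contrZ, zext_natCast, coeff_of_mul_prodSeries_single h, if_neg (by omega), zpow_natCast]
      ring
    · rw [contrZ, zext_of_neg _ (by omega), if_pos (by omega)]
      ring
  · intro l
    by_cases hl : 0 ≤ l
    · rw [contrZ, zext_of_neg _ (by omega), if_neg (by omega)]
      ring
    · obtain ⟨n, hn⟩ := Int.eq_ofNat_of_zero_le (show 0 ≤ -1 - l by omega)
      obtain rfl : l = -(n + 1 : ℕ) := by push_cast; omega
      rw [contrZ, hn, zext_natCast, coeff_of_mul_prodSeries_single h', if_pos (by omega), zpow_neg,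
        zpow_natCast, hκ, qpow_add, inv_pow, pow_succ]
      field_simp
      ring

/-- Partial fractions for a numerator of degree one over two poles. The condition on the zero modes
equates the rational functions of the two orders up to sign, and each residue then continues
separately. -/
theorem TwoSided.of_double {V V' : Vertex} {x₁ x₂ y : ℂ} (hx : qpow ħ (2 * x₁) ≠ qpow ħ (2 * x₂))
    (h : contr ħ k V V' * prodSeries [qpow ħ (2 * x₁), qpow ħ (2 * x₂)] = prodSeries [qpow ħ y, 0])
    (h' : contr ħ k V' V * prodSeries [(qpow ħ (2 * x₁))⁻¹, (qpow ħ (2 * x₂))⁻¹] =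
      prodSeries [(qpow ħ y)⁻¹, 0])
    (hκ : V.zeroComm k (-1) + y = V'.zeroComm k 1 + 2 * x₁ + 2 * x₂) :
    TwoSided ħ k V V'
      (qpow ħ (V.zeroComm k (-1)) * ((qpow ħ (2 * x₁) - qpow ħ y) /
        (qpow ħ (2 * x₁) - qpow ħ (2 * x₂)))) x₁
      (qpow ħ (V.zeroComm k (-1)) * ((qpow ħ (2 * x₂) - qpow ħ y) /
        (qpow ħ (2 * x₂) - qpow ħ (2 * x₁)))) x₂ := by
  have hx1 := qpow_ne_zero ħ (2 * x₁)
  have hx2 := qpow_ne_zero ħ (2 * x₂)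
  have hy := qpow_ne_zero ħ y
  have e1 := sub_ne_zero.2 hx
  have e2 := sub_ne_zero.2 hx.symm
  have e3 : (qpow ħ (2 * x₁))⁻¹ ≠ (qpow ħ (2 * x₂))⁻¹ := fun h0 => hx (inv_injective h0)
  constructor
  · intro l
    by_cases hl : 0 ≤ l
    · obtain ⟨n, rfl⟩ := Int.eq_ofNat_of_zero_le hl
      rw [contrZ, zext_natCast, coeff_of_mul_prodSeries_zero hx1 hx2 hx h,
        if_neg (by omega), zpow_natCast, zpow_natCast]
      ring
    · rw [contrZ, zext_of_neg _ (by omega), if_pos (by omega)]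
      ring
  · intro l
    by_cases hl : 0 ≤ l
    · rw [contrZ, zext_of_neg _ (by omega), if_neg (by omega)]
      ring
    · obtain ⟨n, hn⟩ := Int.eq_ofNat_of_zero_le (show 0 ≤ -1 - l by omega)
      obtain rfl : l = -(n + 1 : ℕ) := by push_cast; omega
      have hκ' : qpow ħ (V.zeroComm k (-1)) = qpow ħ (V'.zeroComm k 1) * qpow ħ (2 * x₁) *
          qpow ħ (2 * x₂) / qpow ħ y := by
        rw [← qpow_add, ← qpow_add, ← qpow_sub, ← hκ]
        congr 1
        ring
      rw [contrZ, hn, zext_natCast, coeff_of_mul_prodSeries_zero (inv_ne_zero hx1) (inv_ne_zero hx2)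
        e3 h', if_pos (by omega), zpow_neg, zpow_natCast, zpow_neg, zpow_natCast, hκ', inv_pow,
        inv_pow, pow_succ, pow_succ]
      have g1 : (qpow ħ (2 * x₁))⁻¹ - (qpow ħ (2 * x₂))⁻¹ =
          (qpow ħ (2 * x₂) - qpow ħ (2 * x₁)) / (qpow ħ (2 * x₁) * qpow ħ (2 * x₂)) := by
        field_simp
      have g2 : (qpow ħ (2 * x₂))⁻¹ - (qpow ħ (2 * x₁))⁻¹ =
          (qpow ħ (2 * x₁) - qpow ħ (2 * x₂)) / (qpow ħ (2 * x₁) * qpow ħ (2 * x₂)) := by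
        field_simp
      rw [g1, g2]
      generalize qpow ħ (2 * x₁) = a at *
      generalize qpow ħ (2 * x₂) = b at *
      generalize qpow ħ y = c at *
      have e4 : b - a = -(a - b) := by ring
      rw [e4]
      field_simp
      ring

variable {V V' : Vertex}

/-- The modes of the residue of an operator product at `w = q^{-2x} z`. -/
def residueMode (ħ k ρ σ : ℂ) (A : Sector) (S : Side) (V V' : Vertex) (x : ℂ) (m : ℤ) :
    Module.End ℂ (FockSpace A k ρ σ) :=
  qpow ħ (-x * (m + 1)) • vop ħ k ρ σ A S (V.nmul (V'.rescale ħ (-(2 * x)))) 0 (-m)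

section

variable (hV : HasCharge k V' (-1)) (hk : k ≠ 0)

-- The symmetric normalization q^{x(2u + m - shift₂)} makes the residue independent of r and s
-- separately; their difference enters later as the scalar q^{x(r - s)}.
include hV hk in
theorem hasLocSum_residueMode (x : ℂ) (m : ℤ) :
    HasLocSum (fun u : ℤ => qpow ħ (x * (2 * u + m - A.shift₂)) •
      vop₂ ħ k ρ σ A S V 1 V' (-1) u (-m - u)) (residueMode ħ k ρ σ A S V V' x m) := by
  refine ((hasLocSum_vop_diag ħ ρ σ A S V 1 hV hk (2 * x) 0 (-m)).smul
    (qpow ħ (x * (m - A.shift₂)))).congr (fun u => ?_) ?_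
  · rw [smul_smul, ← qpow_add, zero_add]
    congr 2
    ring
  · rw [residueMode, smul_smul, ← qpow_add, Sector.frac_eq]
    norm_num
    congr 2
    ring

variable {B₁ x₁ B₂ x₂ : ℂ} (h : TwoSided ħ k V V' B₁ x₁ B₂ x₂) (r s m : ℤ)
  (hm : r + s + A.shift₂ = m)

include h hm in
theorem TwoSided.hasLocSum_mul :
    HasLocSum (fun u : ℤ => ((1 - if u + r < 0 then 1 else 0) *
        (B₁ * qpow ħ (2 * x₁) ^ (u + r) + B₂ * qpow ħ (2 * x₂) ^ (u + r))) •
          vop₂ ħ k ρ σ A S V 1 V' (-1) u (-m - u))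
      (S.mul (vop ħ k ρ σ A S V 1 (-r - 1)) (vop ħ k ρ σ A S V' (-1) (-s - A.shift₂))) := by
  refine ((hasLocSum_vop_mul ħ k ρ σ A S V 1 V' (-1) (-r - 1) (-s - A.shift₂)).comp_equiv
    (Equiv.addRight r)).congr (fun u => ?_) rfl
  simp only [Equiv.coe_addRight, h.mul]
  congr 2 <;> omega

include h hm in
theorem TwoSided.hasLocSum_mul' :
    HasLocSum (fun u : ℤ => ((0 - if u + r < 0 then 1 else 0) *
        (B₁ * qpow ħ (2 * x₁) ^ (u + r) + B₂ * qpow ħ (2 * x₂) ^ (u + r))) •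
          vop₂ ħ k ρ σ A S V 1 V' (-1) u (-m - u))
      (-S.mul (vop ħ k ρ σ A S V' (-1) (-s - A.shift₂)) (vop ħ k ρ σ A S V 1 (-r - 1))) := by
  refine ((hasLocSum_vop_mul ħ k ρ σ A S V' (-1) V 1 (-s - A.shift₂) (-r - 1)).comp_equiv
    ((Equiv.addRight r).trans (Equiv.subLeft (-1)))).neg.congr (fun u => ?_) rfl
  simp only [Equiv.trans_apply, Equiv.coe_addRight, Equiv.subLeft_apply]
  rw [← neg_smul, h.mul', vop₂_swap]
  congr 2 <;> omega

theorem qpow_two_mul_zpow (x : ℂ) (n : ℤ) : qpow ħ (2 * x) ^ n = qpow ħ (2 * x * n) :=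
  (qpow_mul_int _ _ _).symm

-- In the sum of the two orders the one-sided geometric series combine to full two-sided ones: the
-- step functions cancel and the coefficient 1 is left for every l. Each pole thus contributes its
-- residue mode.
include hV hk h hm in
theorem TwoSided.anticomm :
    S.mul (vop ħ k ρ σ A S V 1 (-r - 1)) (vop ħ k ρ σ A S V' (-1) (-s - A.shift₂)) +
      S.mul (vop ħ k ρ σ A S V' (-1) (-s - A.shift₂)) (vop ħ k ρ σ A S V 1 (-r - 1)) =
    (B₁ * qpow ħ (x₁ * (r - s))) • residueMode ħ k ρ σ A S V V' x₁ m +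
      (B₂ * qpow ħ (x₂ * (r - s))) • residueMode ħ k ρ σ A S V V' x₂ m := by
  rw [← sub_neg_eq_add]
  refine ((h.hasLocSum_mul ρ σ A S r s m hm).sub (h.hasLocSum_mul' ρ σ A S r s m hm)).unique
    ((((hasLocSum_residueMode ρ σ A S hV hk x₁ m).smul _).add
      ((hasLocSum_residueMode ρ σ A S hV hk x₂ m).smul _)).congr (fun u => ?_) rfl)
  rw [smul_smul, smul_smul, ← add_smul, ← sub_smul]
  congr 1
  have e : ∀ x : ℂ, qpow ħ (2 * x) ^ (u + r) =
      qpow ħ (x * (r - s)) * qpow ħ (x * (2 * u + m - A.shift₂)) := by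
    intro x
    rw [qpow_two_mul_zpow, ← qpow_add, ← hm]
    congr 1
    push_cast
    ring
  rw [e, e]
  ring

/-- The normal ordered product of the modes of two fermionic currents. -/
def normalPair (S : Side) {W : Type*} [AddCommGroup W] [Module ℂ W] (a b : Module.End ℂ W)
    (r s : ℤ) : Module.End ℂ W :=
  if r < s then S.mul a b else if r = s then (1 / 2 : ℂ) • (S.mul a b - S.mul b a) else -S.mul b a

-- For l = u + r and P = 2u + m - shift₂, the condition 2l < P says r < s. The choice of order in
-- the normal ordered product is therefore a step in l at height P/2, with value 1/2 when r = s.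
include h hm in
theorem TwoSided.hasLocSum_normalPair :
    HasLocSum (fun u : ℤ => ((halfStep (2 * u + m - A.shift₂) (u + r) -
        if u + r < 0 then 1 else 0) *
        (B₁ * qpow ħ (2 * x₁) ^ (u + r) + B₂ * qpow ħ (2 * x₂) ^ (u + r))) •
          vop₂ ħ k ρ σ A S V 1 V' (-1) u (-m - u))
      (normalPair S (vop ħ k ρ σ A S V 1 (-r - 1)) (vop ħ k ρ σ A S V' (-1) (-s - A.shift₂))
        r s) := by
  have h1 := h.hasLocSum_mul ρ σ A S r s m hm
  have h2 := h.hasLocSum_mul' ρ σ A S r s m hm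
  unfold normalPair
  split_ifs with hrs hrs'
  · refine h1.congr (fun u => ?_) rfl
    have : halfStep (2 * u + m - A.shift₂) (u + r) = 1 := if_pos (by omega)
    rw [this]
  · refine ((h1.add h2).smul (1 / 2)).congr (fun u => ?_) (by rw [← sub_eq_add_neg])
    have : halfStep (2 * u + m - A.shift₂) (u + r) = 1 / 2 :=
      (if_neg (by omega)).trans (if_pos (by omega))
    rw [this, ← add_smul, smul_smul]
    congr 1
    ring
  · refine h2.congr (fun u => ?_) rfl
    have : halfStep (2 * u + m - A.shift₂) (u + r) = 0 :=
      (if_neg (by omega)).trans (if_neg (by omega))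
    rw [this]

end

/-- The parity of 2u + m - shift₂ is fixed by the parity of m and the sector. This is precisely the
case distinction in c_m, the even case giving the averaged form because of the half term at the
jump. -/
theorem geomValue_eq {x : ℂ} (hd : qdiff ħ ≠ 0) (hx : qnum ħ x ≠ 0) (m u : ℤ) :
    geomValue (qpow ħ (2 * x)) (2 * u + m - A.shift₂) = 1 / (1 - qpow ħ (2 * x)) +
      cCoeff ħ A m x / qdiff ħ * qpow ħ (x * (2 * u + m - A.shift₂)) := by
  have hX := qpow_ne_zero ħ x
  have e0 : qpow ħ (2 * x) = qpow ħ x ^ 2 := by rw [mul_comm]; exact_mod_cast qpow_mul_nat ħ x 2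
  have e1 : qpow ħ x ^ 2 - 1 ≠ 0 := by
    intro h0
    apply hx
    rw [qnum, qpow_neg, div_eq_zero_iff]
    left
    field_simp
    linear_combination h0
  have e1' : 1 - qpow ħ x ^ 2 ≠ 0 := fun h0 => e1 (by linear_combination -h0)
  have e2 : qnum ħ x = (qpow ħ x ^ 2 - 1) / (qpow ħ x * qdiff ħ) := by
    rw [qnum, qpow_neg]
    field_simp
  generalize hP : 2 * u + m - A.shift₂ = P
  have e3 : qpow ħ (x * (2 * u + m - A.shift₂)) = qpow ħ x ^ P := by
    rw [← qpow_mul_int, ← hP]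
    push_cast
    rfl
  rcases Int.even_or_odd P with hev | hod
  · have e4 : cCoeff ħ A m x = 1 / qnum ħ x * ((qpow ħ x + qpow ħ (-x)) / 2) := by
      cases A
      · have : ¬Even m := by
          simp only [Sector.shift₂] at hP
          rw [Int.not_even_iff_odd]
          obtain ⟨n, hn⟩ := hev
          exact ⟨n - u, by omega⟩
        simp [cCoeff, this]
      · have : Even m := by
          simp only [Sector.shift₂] at hP
          obtain ⟨n, hn⟩ := hev
          exact ⟨n - u, by omega⟩
        simp [cCoeff, this]
    obtain ⟨n, rfl⟩ := hev
    have e5 : (n + n) / 2 = n := by omega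
    have e6 : (qpow ħ x ^ 2) ^ n = qpow ħ x ^ (n + n) := by
      rw [← zpow_natCast, ← zpow_mul]
      congr 1
      push_cast
      ring
    rw [geomValue, if_pos ⟨n, rfl⟩, e5, e4, e3, e2, qpow_neg, e0, e6]
    generalize qpow ħ x ^ (n + n) = Y
    have e7 : 1 - qpow ħ x ^ 2 = -(qpow ħ x ^ 2 - 1) := by ring
    rw [e7]
    field_simp
    ring
  · have e4 : cCoeff ħ A m x = 1 / qnum ħ x := by
      cases A
      · have : Even m := by
          simp only [Sector.shift₂] at hP
          obtain ⟨n, hn⟩ := hod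
          exact ⟨n - u + 1, by omega⟩
        simp [cCoeff, this]
      · have : ¬Even m := by
          simp only [Sector.shift₂] at hP
          rw [Int.not_even_iff_odd]
          obtain ⟨n, hn⟩ := hod
          exact ⟨n - u, by omega⟩
        simp [cCoeff, this]
    obtain ⟨n, rfl⟩ := hod
    have e5 : (2 * n + 1) / 2 = n := by omega
    have e6 : (qpow ħ x ^ 2) ^ (n + 1) = qpow ħ x ^ (2 * n + 1) * qpow ħ x := by
      rw [← zpow_natCast, ← zpow_mul, ← zpow_add_one₀ hX]
      congr 1
      push_cast
      ring
    rw [geomValue, if_neg (by simp), e5, e4, e3, e2, e0, e6]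
    generalize qpow ħ x ^ (2 * n + 1) = Y
    have e7 : 1 - qpow ħ x ^ 2 = -(qpow ħ x ^ 2 - 1) := by ring
    rw [e7]
    field_simp
    ring

/-- For fixed u the sum over modes is a truncated geometric sum. Its constant part yields the normal
ordered product of V and V' at one point, and its c_m part yields the residue modes. -/
theorem TwoSided.hasLocSum_normal (hV : HasCharge k V' (-1)) (hk : k ≠ 0) (hd : qdiff ħ ≠ 0)
    {B₁ x₁ B₂ x₂ : ℂ} (h : TwoSided ħ k V V' B₁ x₁ B₂ x₂) (hx₁ : qnum ħ x₁ ≠ 0)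
    (hx₂ : qnum ħ x₂ ≠ 0) (m : ℤ) :
    HasLocSum (fun g : ℤ => normalPair S (vop ħ k ρ σ A S V 1 (-(-g - A.shift₂) - 1))
        (vop ħ k ρ σ A S V' (-1) (-(m + g) - A.shift₂)) (-g - A.shift₂) (m + g))
      ((B₁ / (1 - qpow ħ (2 * x₁)) + B₂ / (1 - qpow ħ (2 * x₂))) •
          vop ħ k ρ σ A S (V.nmul V') 0 (-m) +
        ((B₁ * (cCoeff ħ A m x₁ / qdiff ħ)) • residueMode ħ k ρ σ A S V V' x₁ m +
          (B₂ * (cCoeff ħ A m x₂ / qdiff ħ)) • residueMode ħ k ρ σ A S V V' x₂ m)) := by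
  have hne : ∀ {x : ℂ}, qnum ħ x ≠ 0 → 1 - qpow ħ (2 * x) ≠ 0 := by
    intro x hx h0
    apply hx
    have h1 : qpow ħ x = qpow ħ (-x) := by
      rw [show -x = x - 2 * x by ring, qpow_sub, ← sub_eq_zero.1 h0, div_one]
    rw [qnum, h1, sub_self, zero_div]
  have hX : HasLocSum (fun u : ℤ => vop₂ ħ k ρ σ A S V 1 V' (-1) u (-m - u))
      (vop ħ k ρ σ A S (V.nmul V') 0 (-m)) :=
    (hasLocSum_vop_nmul ħ k ρ σ A S V 1 V' (-1) 0 (-m)).congr (fun u => by rw [zero_add])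
      (by rw [zero_add, add_neg_cancel])
  -- The sum over g is exchanged with the sum over u: the coefficients of :V V': form a locally
  -- finite family in u, and for each u only finitely many g have a non-zero coefficient.
  refine HasLocSum.of_smul_swap (fun v => (hX v).1)
    (c := fun g u => (halfStep (2 * u + m - A.shift₂) (u + (-g - A.shift₂)) -
        if u + (-g - A.shift₂) < 0 then 1 else 0) *
        (B₁ * qpow ħ (2 * x₁) ^ (u + (-g - A.shift₂)) +
          B₂ * qpow ħ (2 * x₂) ^ (u + (-g - A.shift₂))))
    (w := fun u => B₁ * geomValue (qpow ħ (2 * x₁)) (2 * u + m - A.shift₂) +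
      B₂ * geomValue (qpow ħ (2 * x₂)) (2 * u + m - A.shift₂))
    (fun u => ?_) (fun g => h.hasLocSum_normalPair ρ σ A S _ _ m (by ring)) ?_
  · have e := (((hasLocSum_halfStep (qpow_ne_zero ħ (2 * x₁)) (hne hx₁)
      (2 * u + m - A.shift₂)).smul B₁).add ((hasLocSum_halfStep (qpow_ne_zero ħ (2 * x₂))
      (hne hx₂) (2 * u + m - A.shift₂)).smul B₂)).comp_equiv (Equiv.subLeft (u - A.shift₂))
    refine e.congr (fun g => ?_) (by rw [smul_smul, smul_smul, ← add_smul])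
    have e1 : u - A.shift₂ - g = u + (-g - A.shift₂) := by ring
    rw [Equiv.subLeft_apply, e1, smul_smul, smul_smul, ← add_smul]
    congr 1
    ring
  · refine ((hX.smul (B₁ / (1 - qpow ħ (2 * x₁)) + B₂ / (1 - qpow ħ (2 * x₂)))).add
      (((hasLocSum_residueMode ρ σ A S hV hk x₁ m).smul _).add
        ((hasLocSum_residueMode ρ σ A S hV hk x₂ m).smul _))).congr (fun u => ?_) rfl
    rw [smul_smul, smul_smul, ← add_smul, ← add_smul, geomValue_eq A hd hx₁, geomValue_eq A hd hx₂]
    congr 1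
    ring

/-- Only the zero modes and the oscillators enter the modes of a vertex operator. -/
theorem vop_congr (h0 : ∀ i, V.logq i = V'.logq i)
    (hp : ∀ i (j : ℕ), V.osc i (j + 1) = V'.osc i (j + 1))
    (hn : ∀ i (j : ℕ), V.osc i (-(j + 1)) = V'.osc i (-(j + 1))) (c E : ℤ) :
    vop ħ k ρ σ A S V c E = vop ħ k ρ σ A S V' c E := by
  have e1 : negSeries ħ k S V = negSeries ħ k S V' := by
    ext1 n
    rcases n with _ | n <;> simp only [negSeries, coeff_mk]
    exact Finset.sum_congr rfl fun i _ => by rw [hn]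
  have e2 : posSeries ħ k S V = posSeries ħ k S V' := by
    ext1 n
    rcases n with _ | n <;> simp only [posSeries, coeff_mk]
    exact Finset.sum_congr rfl fun i _ => by rw [hp]
  have e3 : ∀ i, oscOp ħ k S V i = oscOp ħ k S V' i := fun i =>
    (hasLocSum_oscOp ħ k S V i).unique ((hasLocSum_oscOp ħ k S V' i).congr (fun b => by
      rw [crZ_eq, crZ_eq, anZ_eq, anZ_eq, e1, e2]) rfl)
  refine fock_ext fun n f => ?_
  rw [vop_sv, vop_sv, e3, Vertex.zeroExp, Vertex.zeroExp]
  simp only [h0]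

/-- The trivial vertex operator. -/
theorem vop_trivial (h0 : ∀ i, V.logq i = 0) (hp : ∀ i (j : ℕ), V.osc i (j + 1) = 0)
    (hn : ∀ i (j : ℕ), V.osc i (-(j + 1)) = 0) (E : ℤ) :
    vop ħ k ρ σ A S V 0 E = if E = 0 then 1 else 0 := by
  split_ifs with hE
  · subst hE
    refine fock_ext fun n f => ?_
    have h1 : oscOp ħ k S V 0 = 1 := by
      rw [oscOp_of_neg ħ k S hn, anZ, neg_zero]
      exact (zext_natCast _ 0).trans (annihilation_zero ħ k S _)
    have h2 : V.zeroExp k ρ σ A (S.zeroIdx 0 n) = 0 :=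
      Finset.sum_eq_zero fun i _ => by rw [h0, zero_mul]
    rw [vop_sv, mul_zero, add_zero, zero_mul, sub_zero, h1, h2, qpow_zero, one_smul,
      Module.End.one_apply, Module.End.one_apply]
  · rcases lt_or_gt_of_ne hE with h | h
    · exact vop_eq_zero_of_pos ħ k ρ σ A S hp h
    · exact vop_eq_zero_of_neg ħ k ρ σ A S hn h

end

/-! ### Residues: fusion of G^+ and G^- into T, the identity and :K^-K^+:. -/

section

open PowerSeries

variable {ħ k : ℂ} (h : Generic ħ k) (ρ σ : ℂ) (A : Sector) (S : Side)

section Fusion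

variable (ħ k)

/-- The vertex operator `: K^-(z) K^+(z) :`. -/
def KKv : Vertex := (Kv ħ (-1)).nmul (Kv ħ 1)

theorem KKv_osc_tilde_pos (j : ℕ) : (KKv ħ).osc .tilde (j + 1) = qdiff ħ := by
  rw [KKv, nmul_osc, Kv_osc_pos, Kv_osc_pos, if_neg (by decide), if_pos rfl, zero_add]

theorem KKv_osc_tilde_neg (j : ℕ) : (KKv ħ).osc .tilde (-(j + 1)) = qdiff ħ := by
  rw [KKv, nmul_osc, Kv_osc_neg, Kv_osc_neg, if_neg (by decide), if_pos rfl, add_zero]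

theorem KKv_osc_of_ne {i : Boson} (hi : i ≠ .tilde) (m : ℤ) : (KKv ħ).osc i m = 0 := by
  rw [KKv, nmul_osc, Kv_osc_of_ne ħ hi, Kv_osc_of_ne ħ hi, add_zero]

theorem hasCharge_KKv : HasCharge k (KKv ħ) 0 :=
  (hasCharge_Kv ħ k (-1)).nmul (hasCharge_Kv ħ k 1)

end Fusion

include h

/-- At w = q^{-2(k+1)} z the arguments of Ṽ^+, Ṽ^-, e and f are those in T, all multiplied by
q^{-(k+1)}; no factors cancel. -/
theorem residueMode_Gpv_Gmv (ε ε' : ℤˣ) (m : ℤ) :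
    residueMode ħ k ρ σ A S (Gpv ħ k ε) (Gmv ħ k ε') (k + 1) m =
      qpow ħ (-(k + 1)) • vop ħ k ρ σ A S (Tv ħ k ε ε') 0 (-m) := by
  have hk := h.k_ne_zero
  have hc : HasCharge k ((Gpv ħ k ε).nmul ((Gmv ħ k ε').rescale ħ (-(2 * (k + 1))))) 0 :=
    (hasCharge_Gpv ħ k ε).nmul ((hasCharge_Gmv ħ k ε').rescale ħ _)
  have e : vop ħ k ρ σ A S (Tv ħ k ε ε') 0 (-m) = vop ħ k ρ σ A S
      (((Gpv ħ k ε).nmul ((Gmv ħ k ε').rescale ħ (-(2 * (k + 1))))).rescale ħ (k + 1)) 0 (-m) := by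
    refine vop_congr ρ σ A S (fun i => ?_) (fun i j => ?_) (fun i j => ?_) _ _
    · simp only [Vertex.rescale, Vertex.nmul, Gpv_logq, Gmv_logq, Tv_logq ħ k hk]
      have e1 := hasCharge_Gpv ħ k ε
      have e2 := hasCharge_Gmv ħ k ε'
      cases i <;> simp only [e1.logz_tilde, e1.logz_bar, e1.logz_beta, e2.logz_tilde, e2.logz_bar,
        e2.logz_beta] <;> push_cast <;> field_simp <;> ring
    · have ht := tPow_ne_zero ħ k j
      have hy := yPow_ne_zero ħ j
      rw [rescale_osc_pos ħ k _ _ _ j (-2) (-1) (by push_cast; ring), nmul_osc,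
        rescale_osc_pos ħ k _ _ _ j 4 2 (by push_cast; ring)]
      cases i
      · rw [Tv_osc_tilde_pos, Gpv_osc_tilde_pos, Gmv_osc_tilde_pos]
        field_simp
        ring
      all_goals
        rw [Tv_osc_pos ħ k (by simp), Gpv_osc_pos ħ k (by simp), Gmv_osc_pos ħ k (by simp)]
        field_simp
    · have ht := tPow_ne_zero ħ k j
      have hy := yPow_ne_zero ħ j
      rw [rescale_osc_neg ħ k _ _ _ j 2 1 (by push_cast; ring), nmul_osc,
        rescale_osc_neg ħ k _ _ _ j (-4) (-2) (by push_cast; ring)]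
      cases i
      · rw [Tv_osc_tilde_neg, Gpv_osc_tilde_neg, Gmv_osc_tilde_neg]
        field_simp
        ring
      all_goals
        rw [Tv_osc_neg ħ k (by simp), Gpv_osc_neg ħ k (by simp), Gmv_osc_neg ħ k (by simp)]
        field_simp
  rw [e, vop_rescale ħ ρ σ A S hc hk, residueMode, smul_smul, ← qpow_add]
  congr 2
  push_cast
  ring

/-- At w = q^{-2(k+2)} z the arguments of Ṽ^+ and Ṽ^- coincide, so these cancel, and :e_-(z) f_-(q^k
z): = 1. The residue is the identity, the source of the δ term in the anticommutator. -/
theorem residueMode_neg_neg (m : ℤ) :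
    residueMode ħ k ρ σ A S (Gpv ħ k (-1)) (Gmv ħ k (-1)) (k + 2) m =
      qpow ħ (-(k + 2)) • if m = 0 then 1 else 0 := by
  have hk := h.k_ne_zero
  have hD := h.qdiff_ne_zero
  have hne : (-1 : ℤˣ) ≠ 1 := by decide
  rw [residueMode, vop_trivial ρ σ A S (fun i => ?_) (fun i j => ?_) (fun i j => ?_)]
  · by_cases hm : m = 0
    · simp [hm]
    · rw [if_neg (by omega), if_neg hm, smul_zero, smul_zero]
  · simp only [Vertex.rescale, Vertex.nmul, Gpv_logq, Gmv_logq]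
    have e2 := hasCharge_Gmv ħ k (-1)
    cases i <;> simp only [e2.logz_tilde, e2.logz_bar, e2.logz_beta, sg, Units.val_neg,
      Units.val_one] <;> push_cast <;> field_simp <;> ring
  · have ht := tPow_ne_zero ħ k j
    have hy := yPow_ne_zero ħ j
    rw [nmul_osc, rescale_osc_pos ħ k _ _ _ j 4 4 (by push_cast; ring)]
    cases i
    · rw [Gpv_osc_tilde_pos, Gmv_osc_tilde_pos]
      field_simp
      ring
    · rw [Gpv_osc_pos ħ k (by simp), Gmv_osc_pos ħ k (by simp), ev_osc_bar_pos ħ k hD,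
        fv_osc_bar_pos ħ k hD, if_neg hne, if_neg hne]
      field_simp
      ring
    · rw [Gpv_osc_pos ħ k (by simp), Gmv_osc_pos ħ k (by simp), ev_osc_beta_pos ħ k hD,
        fv_osc_beta_pos ħ k hD, if_neg hne, if_neg hne]
      ring
  · have ht := tPow_ne_zero ħ k j
    have hy := yPow_ne_zero ħ j
    rw [nmul_osc, rescale_osc_neg ħ k _ _ _ j (-4) (-4) (by push_cast; ring)]
    cases i
    · rw [Gpv_osc_tilde_neg, Gmv_osc_tilde_neg]
      field_simp
      ring
    · have ht4 := h.tPow_sub_ne j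
      have hy2 := h.yPow_add_ne j
      rw [Gpv_osc_neg ħ k (by simp), Gmv_osc_neg ħ k (by simp), ev_osc_bar_neg ħ k hD,
        fv_osc_bar_neg ħ k hD, if_neg hne, if_neg hne, h.rFrac_eq, h.wFrac_eq]
      field_simp
      ring
    · rw [Gpv_osc_neg ħ k (by simp), Gmv_osc_neg ħ k (by simp), ev_osc_beta_neg ħ k hD,
        fv_osc_beta_neg ħ k hD, if_neg hne, if_neg hne]
      field_simp
      ring

/-- Here :e_+(z) f_+(q^{-k} z): = 1, and :Ṽ^+(z) Ṽ^-(q^{-2k} z): is :K^-K^+: at q^{-k} z, because 1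
- q^{2km} cancels the denominator [km]. -/
theorem residueMode_pos_pos (m : ℤ) :
    residueMode ħ k ρ σ A S (Gpv ħ k 1) (Gmv ħ k 1) (2 * k + 2) m =
      qpow ħ (-(2 * k + 2)) • vop ħ k ρ σ A S (KKv ħ) 0 (-m) := by
  have hk := h.k_ne_zero
  have hD := h.qdiff_ne_zero
  have e : vop ħ k ρ σ A S
      ((Gpv ħ k 1).nmul ((Gmv ħ k 1).rescale ħ (-(2 * (2 * k + 2))))) 0 (-m) =
      vop ħ k ρ σ A S ((KKv ħ).rescale ħ (-(2 * k + 2))) 0 (-m) := by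
    refine vop_congr ρ σ A S (fun i => ?_) (fun i j => ?_) (fun i j => ?_) _ _
    · simp only [Vertex.rescale, Vertex.nmul, Gpv_logq, Gmv_logq, KKv, Kv]
      have e2 := hasCharge_Gmv ħ k 1
      cases i <;> simp only [e2.logz_tilde, e2.logz_bar, e2.logz_beta, sg,
        Units.val_one] <;> push_cast <;> field_simp <;> ring
    · have ht := tPow_ne_zero ħ k j
      have hy := yPow_ne_zero ħ j
      have ht4 := h.tPow_sub_ne j
      have hy2 := h.yPow_add_ne j
      rw [nmul_osc, rescale_osc_pos ħ k _ _ _ j 8 4 (by push_cast; ring),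
        rescale_osc_pos ħ k _ _ _ j 4 2 (by push_cast; ring)]
      cases i
      · rw [Gpv_osc_tilde_pos, Gmv_osc_tilde_pos, KKv_osc_tilde_pos, h.rFrac_eq]
        field_simp
        ring
      · rw [Gpv_osc_pos ħ k (by simp), Gmv_osc_pos ħ k (by simp), ev_osc_bar_pos ħ k hD,
          fv_osc_bar_pos ħ k hD, if_pos rfl, if_pos rfl, KKv_osc_of_ne ħ (by simp), h.rFrac_eq,
          h.wFrac_eq]
        field_simp
        ring
      · rw [Gpv_osc_pos ħ k (by simp), Gmv_osc_pos ħ k (by simp), ev_osc_beta_pos ħ k hD,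
          fv_osc_beta_pos ħ k hD, if_pos rfl, if_pos rfl, KKv_osc_of_ne ħ (by simp)]
        field_simp
        ring
    · have ht := tPow_ne_zero ħ k j
      have hy := yPow_ne_zero ħ j
      have ht4 := h.tPow_sub_ne j
      rw [nmul_osc, rescale_osc_neg ħ k _ _ _ j (-8) (-4) (by push_cast; ring),
        rescale_osc_neg ħ k _ _ _ j (-4) (-2) (by push_cast; ring)]
      cases i
      · rw [Gpv_osc_tilde_neg, Gmv_osc_tilde_neg, KKv_osc_tilde_neg, h.rFrac_eq]
        field_simp
        ring
      · rw [Gpv_osc_neg ħ k (by simp), Gmv_osc_neg ħ k (by simp), ev_osc_bar_neg ħ k hD,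
          fv_osc_bar_neg ħ k hD, if_pos rfl, if_pos rfl, KKv_osc_of_ne ħ (by simp)]
        field_simp
        ring
      · rw [Gpv_osc_neg ħ k (by simp), Gmv_osc_neg ħ k (by simp), ev_osc_beta_neg ħ k hD,
          fv_osc_beta_neg ħ k hD, if_pos rfl, if_pos rfl, KKv_osc_of_ne ħ (by simp)]
        ring
  rw [residueMode, e, vop_rescale ħ ρ σ A S (hasCharge_KKv ħ k) hk, smul_smul, ← qpow_add]
  congr 2
  push_cast
  ring

end

/-! ### The anticommutator of G^+ and G^- and the evaluation of W. -/

section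

open PowerSeries

variable {ħ k : ℂ} (h : Generic ħ k) (ρ σ : ℂ) (A : Sector) (S : Side)

theorem qnum_ne_zero_of_two_mul {x : ℂ} (h : qnum ħ (2 * x) ≠ 0) : qnum ħ x ≠ 0 := by
  intro h0
  apply h
  rw [qnum, div_eq_zero_iff] at h0 ⊢
  refine h0.imp_left fun h1 => ?_
  rw [show (2 : ℂ) * x = x + x by ring, neg_add, qpow_add, qpow_add, sub_eq_zero.1 h1, sub_self]

include h

theorem one_sub_qpow_two_mul (x : ℂ) :
    1 - qpow ħ (2 * x) = -(qpow ħ x * (qdiff ħ * qnum ħ x)) := by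
  have hd := h.qdiff_ne_zero
  have hX := qpow_ne_zero ħ x
  rw [qnum, qpow_neg, two_mul, qpow_add]
  field_simp
  ring

theorem twoSided_pos_neg : TwoSided ħ k (Gpv ħ k 1) (Gmv ħ k (-1))
    (qpow ħ (k + 1) * qpow ħ (-1)) (k + 1) 0 (k + 1) := by
  have hk := h.k_ne_zero
  have e1 : 2 * (k + 1) = 2 * k + 2 := by ring
  have h1 := TwoSided.of_single (x := k + 1) (by rw [e1]; exact (contr_Gpv_Gmv h).2.1)
    (by rw [e1]; exact (contr_Gmv_Gpv h).2.1)
    (by rw [zeroComm_Gpv ħ k hk, zeroComm_Gmv ħ k hk]; simp [sg]; ring)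
  convert h1 using 1
  rw [zeroComm_Gpv ħ k hk, ← qpow_add]
  congr 1
  simp [sg]

theorem twoSided_neg_pos : TwoSided ħ k (Gpv ħ k (-1)) (Gmv ħ k 1)
    (qpow ħ (k + 1) * qpow ħ 1) (k + 1) 0 (k + 1) := by
  have hk := h.k_ne_zero
  have e1 : 2 * (k + 1) = 2 * k + 2 := by ring
  have h1 := TwoSided.of_single (x := k + 1) (by rw [e1]; exact (contr_Gpv_Gmv h).2.2.1)
    (by rw [e1]; exact (contr_Gmv_Gpv h).2.2.1)
    (by rw [zeroComm_Gpv ħ k hk, zeroComm_Gmv ħ k hk]; simp [sg]; ring)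
  convert h1 using 1
  rw [zeroComm_Gpv ħ k hk, ← qpow_add]
  congr 1
  simp [sg]

theorem twoSided_neg_neg : TwoSided ħ k (Gpv ħ k (-1)) (Gmv ħ k (-1))
    (qpow ħ (k + 2)) (k + 2) 0 (k + 2) := by
  have hk := h.k_ne_zero
  have e1 : 2 * (k + 2) = 2 * k + 4 := by ring
  have h1 := TwoSided.of_single (x := k + 2) (by rw [e1]; exact (contr_Gpv_Gmv h).2.2.2)
    (by rw [e1]; exact (contr_Gmv_Gpv h).2.2.2)
    (by rw [zeroComm_Gpv ħ k hk, zeroComm_Gmv ħ k hk]; simp [sg]; ring)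
  convert h1 using 1
  rw [zeroComm_Gpv ħ k hk]
  congr 1
  simp [sg]
  ring

/-- The residues at the two poles supply the coefficients [k+2]/[k+1] of the middle term of T and
1/[k+1] of :K^-K^+:. -/
theorem twoSided_pos_pos (hk₁ : qnum ħ (k + 1) ≠ 0) :
    TwoSided ħ k (Gpv ħ k 1) (Gmv ħ k 1)
      (qpow ħ (k + 1) * (qnum ħ (k + 2) / qnum ħ (k + 1))) (k + 1)
      (-(qpow ħ (2 * k + 2) * (1 / qnum ħ (k + 1)))) (2 * k + 2) := by
  have hk := h.k_ne_zero
  have hd := h.qdiff_ne_zero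
  have e1 : 2 * (k + 1) = 2 * k + 2 := by ring
  have e2 : 2 * (2 * k + 2) = 4 * k + 4 := by ring
  have e3 : qpow ħ (4 * k + 4) = qpow ħ (2 * k + 2) * qpow ħ (2 * k + 2) := by
    rw [← qpow_add]; congr 1; ring
  have e4 : qpow ħ (2 * k + 2) = qpow ħ (k + 1) * qpow ħ (k + 1) := by
    rw [← qpow_add]; congr 1; ring
  have e5 : qpow ħ (4 * k + 6) = qpow ħ (2 * k + 2) * qpow ħ (2 * k + 2) * qpow ħ 1 * qpow ħ 1 := by
    rw [← qpow_add, ← qpow_add, ← qpow_add]; congr 1; ring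
  have e6 : qpow ħ (k + 2) = qpow ħ (k + 1) * qpow ħ 1 := by rw [← qpow_add]; congr 1; ring
  have e7 : qpow ħ k = qpow ħ (k + 1) / qpow ħ 1 := by rw [← qpow_sub]; congr 1; ring
  have hX := qpow_ne_zero ħ (k + 1)
  have hq := qpow_ne_zero ħ 1
  have hd' := hd
  rw [qdiff, qpow_neg] at hd'
  have hX1 : qpow ħ (k + 1) ^ 2 - 1 ≠ 0 := by
    intro h0
    apply hk₁
    rw [qnum, qpow_neg, div_eq_zero_iff]
    left
    field_simp
    linear_combination h0
  have hX2 : 1 - qpow ħ (k + 1) ^ 2 ≠ 0 := fun h0 => hX1 (by linear_combination -h0)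
  have h1 := TwoSided.of_double (ħ := ħ) (k := k) (x₁ := k + 1) (x₂ := 2 * k + 2)
    (y := 4 * k + 6) (V := Gpv ħ k 1) (V' := Gmv ħ k 1)
    (by
      rw [e1, e2, e3, e4]
      intro h0
      apply hX1
      field_simp at h0
      linear_combination -h0)
    (by rw [e1, e2]; exact (contr_Gpv_Gmv h).1)
    (by rw [e1, e2]; exact (contr_Gmv_Gpv h).1)
    (by rw [zeroComm_Gpv ħ k hk, zeroComm_Gmv ħ k hk]; simp [sg]; ring)
  have e8 : qpow ħ ((Gpv ħ k 1).zeroComm k (-1)) = qpow ħ (k + 1) / qpow ħ 1 := by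
    rw [zeroComm_Gpv ħ k hk, ← e7]; congr 1; simp [sg]
  have e9 : qnum ħ (k + 1) = (qpow ħ (k + 1) ^ 2 - 1) / (qpow ħ (k + 1) * qdiff ħ) := by
    rw [qnum, qpow_neg]; field_simp
  have e10 : qnum ħ (k + 2) = (qpow ħ (k + 1) ^ 2 * qpow ħ 1 ^ 2 - 1) /
      (qpow ħ (k + 1) * qpow ħ 1 * qdiff ħ) := by
    rw [qnum, qpow_neg, e6]; field_simp
  have g1 : qpow ħ (k + 1) * qpow ħ (k + 1) -
      qpow ħ (k + 1) * qpow ħ (k + 1) * (qpow ħ (k + 1) * qpow ħ (k + 1)) =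
      -(qpow ħ (k + 1) ^ 2 * (qpow ħ (k + 1) ^ 2 - 1)) := by ring
  have g2 : qpow ħ (k + 1) * qpow ħ (k + 1) * (qpow ħ (k + 1) * qpow ħ (k + 1)) -
      qpow ħ (k + 1) * qpow ħ (k + 1) = qpow ħ (k + 1) ^ 2 * (qpow ħ (k + 1) ^ 2 - 1) := by ring
  convert h1 using 1
  · rw [e8, e1, e2, e5, e3, e4, e9, e10, g1]
    field_simp
    ring
  · rw [e8, e1, e2, e5, e3, e4, e9, g2, qdiff, qpow_neg]
    field_simp
    ring

omit h in
theorem hasLocSum_ops_KK (m : ℤ) :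
    HasLocSum (fun x : ℕ × ℕ => if m + x.1 - x.2 = 0 then
        S.mul ((ops ħ k ρ σ A S).K (-1) (-x.1)) ((ops ħ k ρ σ A S).K 1 x.2) else 0)
      (vop ħ k ρ σ A S (KKv ħ) 0 (-m)) := by
  have h1 := hasLocSum_creation_mul_vop ħ k ρ σ A S (Kv_osc_neg_one_pos ħ) (Kv ħ 1) 0 (-m)
  rw [zeroComm_zero, qpow_zero, one_smul] at h1
  have h2 : HasLocSum (fun x : ℕ × ℤ => if m + x.1 - x.2 = 0 then
      S.mul ((ops ħ k ρ σ A S).K (-1) (-x.1)) ((ops ħ k ρ σ A S).K 1 x.2) else 0)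
      (vop ħ k ρ σ A S (KKv ħ) 0 (-m)) := by
    refine HasLocSum.of_comp_injective (e := fun a : ℕ => (a, m + a))
      (fun a b hab => congrArg Prod.fst hab) (h1.congr (fun a => ?_) rfl) ?_
    · rw [if_pos (by simp)]
      simp only [ops, neg_neg, neg_add, sub_eq_add_neg]
    · rintro ⟨a, b⟩ hx
      refine if_neg fun hab => hx ⟨a, ?_⟩
      simp only [Prod.mk.injEq, true_and]
      simp only at hab
      omega
  refine (h2.comp_injective (e := fun x : ℕ × ℕ => (x.1, (x.2 : ℤ))) ?_ ?_).congr (fun x => rfl) rfl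
  · rintro ⟨a, b⟩ ⟨a', b'⟩ hab
    simpa using hab
  · rintro ⟨a, b⟩ hx
    split_ifs
    · have : b < 0 := by
        by_contra hb
        exact hx ⟨(a, b.toNat), by simp [not_lt.1 hb]⟩
      rw [ops_K_zero ħ k ρ σ A S 1 b (by simpa using this), Side.mul_zero]
    · rfl

omit h in
theorem ops_Gp_mul_Gm (r s : ℤ) :
    S.mul ((ops ħ k ρ σ A S).G 1 r) ((ops ħ k ρ σ A S).G (-1) s) = (-(1 / qdiff ħ ^ 2)) •
      (S.mul (vop ħ k ρ σ A S (Gpv ħ k 1) 1 (-r - 1))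
          (vop ħ k ρ σ A S (Gmv ħ k 1) (-1) (-s - A.shift₂)) -
        S.mul (vop ħ k ρ σ A S (Gpv ħ k 1) 1 (-r - 1))
          (vop ħ k ρ σ A S (Gmv ħ k (-1)) (-1) (-s - A.shift₂)) -
        S.mul (vop ħ k ρ σ A S (Gpv ħ k (-1)) 1 (-r - 1))
          (vop ħ k ρ σ A S (Gmv ħ k 1) (-1) (-s - A.shift₂)) +
        S.mul (vop ħ k ρ σ A S (Gpv ħ k (-1)) 1 (-r - 1))
          (vop ħ k ρ σ A S (Gmv ħ k (-1)) (-1) (-s - A.shift₂))) := by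
  have hne : (-1 : ℤˣ) ≠ 1 := by decide
  simp only [ops, Gv, Sector.expo, hne, if_true, if_false, Units.val_one, Units.val_neg, sg,
    Side.smul_mul, Side.mul_smul, Side.sub_mul, Side.mul_sub]
  push_cast
  module

omit h in
theorem ops_Gm_mul_Gp (r s : ℤ) :
    S.mul ((ops ħ k ρ σ A S).G (-1) s) ((ops ħ k ρ σ A S).G 1 r) = (-(1 / qdiff ħ ^ 2)) •
      (S.mul (vop ħ k ρ σ A S (Gmv ħ k 1) (-1) (-s - A.shift₂))
          (vop ħ k ρ σ A S (Gpv ħ k 1) 1 (-r - 1)) -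
        S.mul (vop ħ k ρ σ A S (Gmv ħ k (-1)) (-1) (-s - A.shift₂))
          (vop ħ k ρ σ A S (Gpv ħ k 1) 1 (-r - 1)) -
        S.mul (vop ħ k ρ σ A S (Gmv ħ k 1) (-1) (-s - A.shift₂))
          (vop ħ k ρ σ A S (Gpv ħ k (-1)) 1 (-r - 1)) +
        S.mul (vop ħ k ρ σ A S (Gmv ħ k (-1)) (-1) (-s - A.shift₂))
          (vop ħ k ρ σ A S (Gpv ħ k (-1)) 1 (-r - 1))) := by
  have hne : (-1 : ℤˣ) ≠ 1 := by decide
  simp only [ops, Gv, Sector.expo, hne, if_true, if_false, Units.val_one, Units.val_neg, sg,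
    Side.smul_mul, Side.mul_smul, Side.sub_mul, Side.mul_sub]
  push_cast
  module

/-- The four pairs of terms are added with signs. The pole common to three of them assembles T with
its coefficients q⁻¹, -[k+2]/[k+1] and q; the two remaining poles give :K^-K^+: and 1. -/
theorem ops_GpGm' (hk₁ : qnum ħ (k + 1) ≠ 0) (r s : ℤ) :
    S.mul ((ops ħ k ρ σ A S).G 1 r) ((ops ħ k ρ σ A S).G (-1) s) +
      S.mul ((ops ħ k ρ σ A S).G (-1) s) ((ops ħ k ρ σ A S).G 1 r) =
      (1 / qdiff ħ ^ 2) •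
        ((1 / qnum ħ (k + 1) * qpow ħ ((2 * k + 2) * (r - s))) •
            vop ħ k ρ σ A S (KKv ħ) 0 (-(r + s + A.shift₂))
          - (if r + s + A.shift₂ = 0 then qpow ħ ((k + 2) * (r - s)) else 0) •
            (1 : Module.End ℂ (FockSpace A k ρ σ))
          + qpow ħ ((k + 1) * (r - s)) • (ops ħ k ρ σ A S).T (r + s + A.shift₂)) := by
  have hk := h.k_ne_zero
  obtain ⟨m, hm⟩ : ∃ m, r + s + A.shift₂ = m := ⟨_, rfl⟩
  have hc := fun ε => hasCharge_Gmv ħ k ε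
  have h1 := (twoSided_pos_pos h hk₁).anticomm ρ σ A S (hc 1) hk r s m hm
  have h2 := (twoSided_pos_neg h).anticomm ρ σ A S (hc (-1)) hk r s m hm
  have h3 := (twoSided_neg_pos h).anticomm ρ σ A S (hc 1) hk r s m hm
  have h4 := (twoSided_neg_neg h).anticomm ρ σ A S (hc (-1)) hk r s m hm
  rw [residueMode_Gpv_Gmv h, residueMode_pos_pos h] at h1
  rw [residueMode_Gpv_Gmv h, zero_mul, zero_smul, add_zero] at h2 h3
  rw [residueMode_neg_neg h, zero_mul, zero_smul, add_zero] at h4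
  rw [ops_Gp_mul_Gm, ops_Gm_mul_Gp, ← smul_add, hm]
  rw [← eq_sub_iff_add_eq] at h1 h2 h3 h4
  rw [h1, h2, h3, h4]
  have c1 : qpow ħ (k + 1) * qpow ħ (-(k + 1)) = 1 := by rw [← qpow_add, add_neg_cancel, qpow_zero]
  have c2 : qpow ħ (k + 2) * qpow ħ (-(k + 2)) = 1 := by rw [← qpow_add, add_neg_cancel, qpow_zero]
  have c3 : qpow ħ (2 * k + 2) * qpow ħ (-(2 * k + 2)) = 1 := by
    rw [← qpow_add, add_neg_cancel, qpow_zero]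
  have d : (if m = 0 then (1 : Module.End ℂ (FockSpace A k ρ σ)) else 0) =
      (if m = 0 then (1 : ℂ) else 0) • 1 := by split_ifs <;> simp
  have d' : (if m = 0 then qpow ħ ((k + 2) * (r - s)) else 0) =
      qpow ħ ((k + 2) * (r - s)) * (if m = 0 then (1 : ℂ) else 0) := by split_ifs <;> simp
  rw [d, d']
  simp only [ops]
  rw [neg_smul, ← smul_neg]
  congr 1
  generalize (if m = 0 then (1 : ℂ) else 0) = δ
  simp only [smul_sub, smul_add, smul_smul]
  have e1 : qpow ħ (k + 1) * (qnum ħ (k + 2) / qnum ħ (k + 1)) * qpow ħ ((k + 1) * (r - s)) *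
      qpow ħ (-(k + 1)) = qpow ħ ((k + 1) * (r - s)) * (qnum ħ (k + 2) / qnum ħ (k + 1)) := by
    linear_combination (qnum ħ (k + 2) / qnum ħ (k + 1)) * qpow ħ ((k + 1) * (r - s)) * c1
  have e2 : -(qpow ħ (2 * k + 2) * (1 / qnum ħ (k + 1))) * qpow ħ ((2 * k + 2) * (r - s)) *
      qpow ħ (-(2 * k + 2)) = -(1 / qnum ħ (k + 1) * qpow ħ ((2 * k + 2) * (r - s))) := by
    linear_combination -(1 / qnum ħ (k + 1) * qpow ħ ((2 * k + 2) * (r - s))) * c3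
  have e3 : ∀ x, qpow ħ (k + 1) * x * qpow ħ ((k + 1) * (r - s)) * qpow ħ (-(k + 1)) =
      qpow ħ ((k + 1) * (r - s)) * x := by
    intro x
    linear_combination (x * qpow ħ ((k + 1) * (r - s))) * c1
  have e4 : qpow ħ (k + 2) * qpow ħ ((k + 2) * (r - s)) * (qpow ħ (-(k + 2)) * δ) =
      qpow ħ ((k + 2) * (r - s)) * δ := by
    linear_combination (δ * qpow ħ ((k + 2) * (r - s))) * c2
  rw [e1, e2, e3, e3, e4, neg_smul]
  abel

theorem ops_GpGm (hk₁ : qnum ħ (k + 1) ≠ 0) (r s : ℤ) :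
    S.mul ((ops ħ k ρ σ A S).G 1 r) ((ops ħ k ρ σ A S).G (-1) s) +
      S.mul ((ops ħ k ρ σ A S).G (-1) s) ((ops ħ k ρ σ A S).G 1 r) =
      (1 / qdiff ħ ^ 2) •
        ((1 / qnum ħ (k + 1) * qpow ħ ((2 * k + 2) * (r - s))) •
            locSum (fun x : ℕ × ℕ => if r + s + A.shift₂ + x.1 - x.2 = 0 then
              S.mul ((ops ħ k ρ σ A S).K (-1) (-x.1)) ((ops ħ k ρ σ A S).K 1 x.2) else 0)
          - (if r + s + A.shift₂ = 0 then qpow ħ ((k + 2) * (r - s)) else 0) •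
            (1 : Module.End ℂ (FockSpace A k ρ σ))
          + qpow ħ ((k + 1) * (r - s)) • (ops ħ k ρ σ A S).T (r + s + A.shift₂)) := by
  rw [ops_GpGm' h ρ σ A S hk₁, (hasLocSum_ops_KK ρ σ A S (r + s + A.shift₂)).locSum_eq]

/-- The coefficients of the vertex operators `: Ṽ^+ e_ε Ṽ^- f_ε' :` in the currents `W(z)`. -/
def wCoeff (ħ k : ℂ) (ε ε' : ℤˣ) : ℂ :=
  if ε = 1 then
    if ε' = 1 then 1 / (qnum ħ (k + 1) * qnum ħ (2 * k + 2)) - qnum ħ (k + 2) / qnum ħ (k + 1) ^ 2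
    else qpow ħ (-1) / qnum ħ (k + 1)
  else if ε' = 1 then qpow ħ 1 / qnum ħ (k + 1) else -(1 / qnum ħ (k + 2))

/-- The modes of the normal ordered product of `Ṽ^+ e_ε` and `Ṽ^- f_ε'`. -/
def fermiPair (ħ k ρ σ : ℂ) (A : Sector) (S : Side) (ε ε' : ℤˣ) (E : ℤ) :
    Module.End ℂ (FockSpace A k ρ σ) :=
  vop ħ k ρ σ A S ((Gpv ħ k ε).nmul (Gmv ħ k ε')) 0 E

omit h in
theorem ops_normalG (r s : ℤ) : (ops ħ k ρ σ A S).normalG S r s = (-(1 / qdiff ħ ^ 2)) •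
      (normalPair S (vop ħ k ρ σ A S (Gpv ħ k 1) 1 (-r - 1))
          (vop ħ k ρ σ A S (Gmv ħ k 1) (-1) (-s - A.shift₂)) r s -
        normalPair S (vop ħ k ρ σ A S (Gpv ħ k 1) 1 (-r - 1))
          (vop ħ k ρ σ A S (Gmv ħ k (-1)) (-1) (-s - A.shift₂)) r s -
        normalPair S (vop ħ k ρ σ A S (Gpv ħ k (-1)) 1 (-r - 1))
          (vop ħ k ρ σ A S (Gmv ħ k 1) (-1) (-s - A.shift₂)) r s +
        normalPair S (vop ħ k ρ σ A S (Gpv ħ k (-1)) 1 (-r - 1))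
          (vop ħ k ρ σ A S (Gmv ħ k (-1)) (-1) (-s - A.shift₂)) r s) := by
  unfold SVirOps.normalG normalPair
  split_ifs with h1 h2
  · exact ops_Gp_mul_Gm ρ σ A S r s
  · subst h2
    rw [ops_Gp_mul_Gm, ops_Gm_mul_Gp]
    module
  · rw [ops_Gm_mul_Gp]
    module

/-- The terms of W with c_m are designed to cancel the residues that come from normal ordering modes
instead of oscillators. What remains has constant coefficients, independent of m and of the sector.
-/
theorem ops_W (hk₁ : qnum ħ (2 * k + 2) ≠ 0) (hk₂ : qnum ħ (k + 2) ≠ 0) (m : ℤ) :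
    (ops ħ k ρ σ A S).W ħ k A S m = wCoeff ħ k 1 1 • fermiPair ħ k ρ σ A S 1 1 (-m) +
      wCoeff ħ k 1 (-1) • fermiPair ħ k ρ σ A S 1 (-1) (-m) +
      wCoeff ħ k (-1) 1 • fermiPair ħ k ρ σ A S (-1) 1 (-m) +
      wCoeff ħ k (-1) (-1) • fermiPair ħ k ρ σ A S (-1) (-1) (-m) := by
  have hk := h.k_ne_zero
  have hd := h.qdiff_ne_zero
  have hk1 : qnum ħ (k + 1) ≠ 0 :=
    qnum_ne_zero_of_two_mul (by rwa [show 2 * (k + 1) = 2 * k + 2 by ring])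
  have hne : (-1 : ℤˣ) ≠ 1 := by decide
  have hc := fun ε => hasCharge_Gmv ħ k ε
  have h1 := (twoSided_pos_pos h hk1).hasLocSum_normal ρ σ A S (hc 1) hk hd hk1 hk₁ m
  have h2 := (twoSided_pos_neg h).hasLocSum_normal ρ σ A S (hc (-1)) hk hd hk1 hk1 m
  have h3 := (twoSided_neg_pos h).hasLocSum_normal ρ σ A S (hc 1) hk hd hk1 hk1 m
  have h4 := (twoSided_neg_neg h).hasLocSum_normal ρ σ A S (hc (-1)) hk hd hk₂ hk₂ m
  rw [residueMode_Gpv_Gmv h, residueMode_pos_pos h] at h1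
  rw [residueMode_Gpv_Gmv h, zero_mul, zero_smul, add_zero, zero_div, add_zero] at h2 h3
  rw [residueMode_neg_neg h, zero_mul, zero_smul, add_zero, zero_div, add_zero] at h4
  have hS := ((((h1.sub h2).sub h3).add h4).smul (-(1 / qdiff ħ ^ 2))).congr
    (fun g => (ops_normalG ρ σ A S (-g - A.shift₂) (m + g)).symm) rfl
  rw [SVirOps.W, hS.locSum_eq]
  have hKK := ((hasLocSum_ops_KK (ħ := ħ) (k := k) ρ σ A S m).smul
    (cCoeff ħ A m (2 * k + 2) * (1 / qnum ħ (k + 1)))).congr (g := fun x : ℕ × ℕ =>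
      if m + x.1 - x.2 = 0 then (cCoeff ħ A m (2 * k + 2) * (1 / qnum ħ (k + 1))) •
        S.mul ((ops ħ k ρ σ A S).K (-1) (-x.1)) ((ops ħ k ρ σ A S).K 1 x.2) else 0)
      (fun x => by rw [smul_ite, smul_zero]) rfl
  rw [hKK.locSum_eq]
  have c1 : qpow ħ (k + 1) * qpow ħ (-(k + 1)) = 1 := by rw [← qpow_add, add_neg_cancel, qpow_zero]
  have c2 : qpow ħ (k + 2) * qpow ħ (-(k + 2)) = 1 := by rw [← qpow_add, add_neg_cancel, qpow_zero]
  have c3 : qpow ħ (2 * k + 2) * qpow ħ (-(2 * k + 2)) = 1 := by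
    rw [← qpow_add, add_neg_cancel, qpow_zero]
  have d : (if m = 0 then (1 : Module.End ℂ (FockSpace A k ρ σ)) else 0) =
      (if m = 0 then (1 : ℂ) else 0) • 1 := by split_ifs <;> simp
  have d' : (if m = 0 then cCoeff ħ A m (k + 2) else 0) =
      cCoeff ħ A m (k + 2) * (if m = 0 then (1 : ℂ) else 0) := by split_ifs <;> simp
  rw [d, d']
  simp only [ops, wCoeff, if_true, hne, if_false, fermiPair]
  rw [one_sub_qpow_two_mul h, one_sub_qpow_two_mul h, one_sub_qpow_two_mul h]
  generalize (if m = 0 then (1 : ℂ) else 0) = δ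
  -- The numbers c_m can be treated as indeterminates: their coefficients cancel identically.
  generalize cCoeff ħ A m (k + 1) = a1
  generalize cCoeff ħ A m (k + 2) = a2
  generalize cCoeff ħ A m (2 * k + 2) = a3
  have n1 := qpow_ne_zero ħ (k + 1)
  have n2 := qpow_ne_zero ħ (k + 2)
  have n3 := qpow_ne_zero ħ (2 * k + 2)
  rw [qpow_neg] at c1 c2 c3
  rw [qpow_neg ħ (k + 1), qpow_neg ħ (k + 2), qpow_neg ħ (2 * k + 2)]
  generalize qpow ħ (k + 1) = X1 at *
  generalize qpow ħ (k + 2) = X2 at *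
  generalize qpow ħ (2 * k + 2) = X3 at *
  match_scalars <;> field_simp <;> ring

end

/-! ### The commutator of G and T. -/

section

open PowerSeries

variable {ħ k : ℂ} (h : Generic ħ k) (ρ σ : ℂ) (A : Sector) (S : Side)

theorem contr_congr {V V' W W' : Vertex} (h : ∀ i (j : ℕ), V.osc i (j + 1) = V'.osc i (j + 1))
    (h' : ∀ i (j : ℕ), W.osc i (-(j + 1)) = W'.osc i (-(j + 1))) :
    contr ħ k V W = contr ħ k V' W' := by
  have : contrCoeff ħ k V W = contrCoeff ħ k V' W' := by
    funext j
    simp only [contrCoeff, h, h']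
  rw [contr, contr, this]

theorem coeff_of_mul_prodSeries_one {F : PowerSeries ℂ} {a : ℂ}
    (h : F * prodSeries [1] = prodSeries [a]) (n : ℕ) :
    coeff n F = 1 - a + if n = 0 then a else 0 := by
  have e : F = PowerSeries.mk fun n => (1 - a) / 1 * 1 ^ n + if n = 0 then a / 1 else 0 :=
    mul_right_cancel₀ (prodSeries_ne_zero [1])
      (h.trans (partialFractions_single one_ne_zero).symm)
  rw [e, coeff_mk]
  simp

theorem zeroComm_KKv (c : ℤ) : (KKv ħ).zeroComm k c = c * (2 * k + 4) := by
  have e : (KKv ħ).zeroComm k c = (Kv ħ (-1)).zeroComm k c + (Kv ħ 1).zeroComm k c := by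
    simp only [Vertex.zeroComm, KKv, Vertex.nmul]
    ring
  rw [e, zeroComm_Kv, zeroComm_Kv]
  ring

include h

/-- Apart from the coefficient at 0, the contraction has the constant coefficient 1 - a with a =
q^{±(2k+4)}. The opposite order, with its zero mode factor a, has the coefficients a - 1, so the
difference is (1 - a) times the delta function at w = z. -/
theorem Gv_commutator_KKv (ε ε' : ℤˣ) (E E' : ℤ) :
    S.mul (vop ħ k ρ σ A S (Gv ħ k ε ε') ε E) (vop ħ k ρ σ A S (KKv ħ) 0 E') -
      S.mul (vop ħ k ρ σ A S (KKv ħ) 0 E') (vop ħ k ρ σ A S (Gv ħ k ε ε') ε E) =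
    (1 - qpow ħ (sg ε * (2 * k + 4))) •
      vop ħ k ρ σ A S ((Kv ħ (-1)).nmul ((Gv ħ k ε ε').nmul (Kv ħ 1))) ε (E + E') := by
  have hk := h.k_ne_zero
  have h1 : contr ħ k (Gv ħ k ε ε') (KKv ħ) * prodSeries [1] =
      prodSeries [qpow ħ (sg ε * (2 * k + 4))] := by
    rw [← contr_Gv_Kv h ε ε', contr_congr (fun _ _ => rfl) fun i j => ?_]
    rw [KKv, nmul_osc, Kv_osc_one_neg, add_zero]
  have h2 : contr ħ k (KKv ħ) (Gv ħ k ε ε') * prodSeries [1] =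
      prodSeries [(qpow ħ (sg ε * (2 * k + 4)))⁻¹] := by
    rw [← qpow_neg, ← neg_mul, ← contr_Kv_Gv h ε ε', contr_congr (fun i j => ?_) fun _ _ => rfl]
    rw [KKv, nmul_osc, Kv_osc_neg_one_pos, zero_add]
  have hp := qpow_ne_zero ħ (sg ε * (2 * k + 4))
  have hz : qpow ħ ((KKv ħ).zeroComm k ε) = qpow ħ (sg ε * (2 * k + 4)) := by
    rw [zeroComm_KKv]; rfl
  have hcomm := hasLocSum_vop_comm ħ k ρ σ A S (Gv ħ k ε ε') ε (KKv ħ) 0 E E' (-1)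
  have hdiag := (hasLocSum_vop_diag ħ ρ σ A S (Gv ħ k ε ε') ε (hasCharge_KKv ħ k) hk 0 E E').smul
    (1 - qpow ħ (sg ε * (2 * k + 4)))
  have e := hcomm.unique (hdiag.congr (fun l => ?_) rfl)
  · rw [neg_one_smul, ← sub_eq_add_neg, zero_mul, qpow_zero, one_smul, add_zero] at e
    refine e.trans (congrArg _ ?_)
    refine vop_congr ρ σ A S (fun i => ?_) (fun i j => ?_) (fun i j => ?_) _ _
    · simp only [KKv, Vertex.nmul, Vertex.rescale]
      ring
    all_goals
      simp only [KKv, Vertex.nmul, Vertex.rescale, neg_zero, zero_mul, qpow_zero, one_mul]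
      ring
  · rw [zero_mul, qpow_zero, one_smul, mul_zero, sub_zero, zero_sub, zeroComm_zero, qpow_zero,
      one_mul, hz]
    congr 1
    rcases lt_trichotomy l 0 with hl | rfl | hl
    · obtain ⟨n, rfl⟩ : ∃ n : ℕ, l = -(n : ℤ) := ⟨(-l).toNat, by omega⟩
      rw [contrZ, contrZ, zext_of_neg _ hl, neg_neg, zext_natCast, coeff_of_mul_prodSeries_one h2,
        if_neg (by omega)]
      field_simp
      ring
    · rw [neg_zero, contrZ, contrZ, ← Int.natCast_zero, zext_natCast, zext_natCast,
        coeff_of_mul_prodSeries_one h2, coeff_of_mul_prodSeries_one h1, if_pos rfl, if_pos rfl]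
      ring
    · obtain ⟨n, rfl⟩ : ∃ n : ℕ, l = n := ⟨l.toNat, by omega⟩
      rw [contrZ, contrZ, zext_of_neg _ (neg_lt_zero.2 hl), zext_natCast,
        coeff_of_mul_prodSeries_one h1, if_neg (by omega)]
      ring

omit h in
theorem hasLocSum_sandwich_G (ε : ℤˣ) (r : ℤ) :
    HasLocSum (fun x : ℕ × ℕ => S.mul ((ops ħ k ρ σ A S).K (-1) (-x.1))
        (S.mul ((ops ħ k ρ σ A S).G ε (r + x.1 - x.2)) ((ops ħ k ρ σ A S).K 1 x.2)))
      ((sg ε / qdiff ħ * qpow ħ (sg ε * (k + 2))) •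
        (vop ħ k ρ σ A S ((Kv ħ (-1)).nmul ((Gv ħ k ε 1).nmul (Kv ħ 1))) ε (A.expo ε r) -
          vop ħ k ρ σ A S ((Kv ħ (-1)).nmul ((Gv ħ k ε (-1)).nmul (Kv ħ 1))) ε (A.expo ε r))) := by
  have h1 := fun ε' => hasLocSum_sandwich ħ k ρ σ A S (Kv_osc_neg_one_pos ħ) (Kv_osc_one_neg ħ)
    (Gv ħ k ε ε') ε (A.expo ε r)
  refine (((h1 1).sub (h1 (-1))).smul (sg ε / qdiff ħ)).congr (fun x => ?_) ?_
  · simp only [ops, neg_neg, Side.smul_mul, Side.mul_smul, Side.sub_mul, Side.mul_sub]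
    rw [add_sub_assoc, Sector.expo_add, show A.expo ε r - ((x.1 : ℤ) - x.2) =
      A.expo ε r - x.1 + x.2 by ring]
  · rw [zeroComm_Kv, ← smul_sub, smul_smul]
    rfl

theorem ops_G_commutator_KKv (ε : ℤˣ) (r n : ℤ) :
    S.mul ((ops ħ k ρ σ A S).G ε r) (vop ħ k ρ σ A S (KKv ħ) 0 (-n)) -
      S.mul (vop ħ k ρ σ A S (KKv ħ) 0 (-n)) ((ops ħ k ρ σ A S).G ε r) =
    (-(sg ε * qdiff ħ * qnum ħ (k + 2))) • locSum fun x : ℕ × ℕ =>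
      S.mul ((ops ħ k ρ σ A S).K (-1) (-x.1))
        (S.mul ((ops ħ k ρ σ A S).G ε (r + n + x.1 - x.2)) ((ops ħ k ρ σ A S).K 1 x.2)) := by
  have h1 := fun ε' => Gv_commutator_KKv h ρ σ A S ε ε' (A.expo ε r) (-n)
  simp only [← sub_eq_add_neg] at h1
  rw [(hasLocSum_sandwich_G ρ σ A S ε (r + n)).locSum_eq, Sector.expo_add]
  have e : -(sg ε * qdiff ħ * qnum ħ (k + 2)) * qpow ħ (sg ε * (k + 2)) =
      1 - qpow ħ (sg ε * (2 * k + 4)) := by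
    rw [← qpow_sg_sub h.qdiff_ne_zero, show sg ε * (2 * k + 4) = sg ε * (k + 2) + sg ε * (k + 2)
      by ring, qpow_add, qpow_neg]
    have := qpow_ne_zero ħ (sg ε * (k + 2))
    field_simp
    ring
  simp only [ops, Side.smul_mul, Side.mul_smul, Side.sub_mul, Side.mul_sub]
  rw [smul_smul, show ∀ a b c : ℂ, a * (b * c) = b * (a * c) by intros; ring, e, mul_smul,
    smul_sub (1 - _), ← h1, ← h1, ← smul_sub, sub_sub_sub_comm]

-- As X² = 0, X commutes with XY + YX. Commuting X with the right side of the anticommutation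
-- relation then expresses [X, T] through [X, P], with no operator product of X and T.
omit h in
theorem Side.commutator_of_anticommutator {V : Type*} [AddCommGroup V] [Module ℂ V]
    {X Y P T : Module.End ℂ V} {a b c d : ℂ} (hX : S.mul X X = 0) (ha : a ≠ 0) (hd : d ≠ 0)
    (h : S.mul X Y + S.mul Y X = a • (b • P - c • (1 : Module.End ℂ V) + d • T)) :
    S.mul X T - S.mul T X = (-(b / d)) • (S.mul X P - S.mul P X) := by
  have h1 : S.mul X (S.mul X Y + S.mul Y X) - S.mul (S.mul X Y + S.mul Y X) X = 0 := by
    rw [Side.mul_add, Side.add_mul, ← Side.mul_assoc, hX, Side.zero_mul, Side.mul_assoc S Y X X,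
      hX, Side.mul_zero, Side.mul_assoc]
    abel
  rw [h] at h1
  simp only [Side.smul_mul, Side.mul_smul, Side.sub_mul, Side.mul_sub, Side.add_mul, Side.mul_add,
    Side.one_mul, Side.mul_one] at h1
  rw [← smul_sub, smul_eq_zero_iff_right ha] at h1
  have h2 : d • (S.mul X T - S.mul T X) = -(b • (S.mul X P - S.mul P X)) := by
    rw [← sub_eq_zero, ← h1]
    module
  rw [neg_smul, div_eq_inv_mul, ← smul_smul, ← smul_neg, ← h2, smul_smul, inv_mul_cancel₀ hd,
    one_smul]

theorem ops_GT (hk₁ : qnum ħ (k + 1) ≠ 0) (ε : ℤˣ) (r n : ℤ) :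
    S.mul ((ops ħ k ρ σ A S).G ε r) ((ops ħ k ρ σ A S).T n) -
      S.mul ((ops ħ k ρ σ A S).T n) ((ops ħ k ρ σ A S).G ε r) =
      (sg ε * qdiff ħ * (qnum ħ (k + 2) / qnum ħ (k + 1)) *
          qpow ħ (sg ε * ((k + 1) * (2 * r + A.shift₂ - n)))) •
        locSum fun x : ℕ × ℕ => S.mul ((ops ħ k ρ σ A S).K (-1) (-x.1))
          (S.mul ((ops ħ k ρ σ A S).G ε (r + n + x.1 - x.2)) ((ops ħ k ρ σ A S).K 1 x.2)) := by
  have hd := h.qdiff_ne_zero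
  have hX : S.mul ((ops ħ k ρ σ A S).G ε r) ((ops ħ k ρ σ A S).G ε r) = 0 := by
    have := ops_GG ρ σ A S h ε r r
    rwa [← two_smul ℂ, smul_eq_zero_iff_right two_ne_zero] at this
  have hp : ∀ x, qpow ħ ((2 * k + 2) * x) = qpow ħ ((k + 1) * x) * qpow ħ ((k + 1) * x) := by
    intro x
    rw [← qpow_add]
    congr 1
    ring
  have ha : 1 / qdiff ħ ^ 2 ≠ 0 := one_div_ne_zero (pow_ne_zero 2 hd)
  rcases Int.units_eq_one_or ε with rfl | rfl
  -- The partner mode of G^- is chosen so that the anticommutator contains exactly T_n.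
  · have h1 := ops_GpGm' h ρ σ A S hk₁ r (n - r - A.shift₂)
    rw [show r + (n - r - A.shift₂) + A.shift₂ = n by ring] at h1
    rw [S.commutator_of_anticommutator hX ha (qpow_ne_zero _ _) h1,
      ops_G_commutator_KKv h, smul_smul]
    congr 1
    have hne := qpow_ne_zero ħ ((k + 1) * (r - (n - r - A.shift₂ : ℤ)))
    rw [hp, show sg 1 * ((k + 1) * (2 * r + A.shift₂ - n)) = (k + 1) * (r - (n - r - A.shift₂ : ℤ))
      by simp only [sg, Units.val_one]; push_cast; ring]
    field_simp
  · have h1 := ops_GpGm' h ρ σ A S hk₁ (n - r - A.shift₂) r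
    rw [show n - r - A.shift₂ + r + A.shift₂ = n by ring, add_comm (S.mul _ _)] at h1
    rw [S.commutator_of_anticommutator hX ha (qpow_ne_zero _ _) h1,
      ops_G_commutator_KKv h, smul_smul]
    congr 1
    have hne := qpow_ne_zero ħ ((k + 1) * ((n - r - A.shift₂ : ℤ) - r))
    rw [hp, show sg (-1) * ((k + 1) * (2 * r + A.shift₂ - n)) =
      (k + 1) * ((n - r - A.shift₂ : ℤ) - r) by simp only [sg, Units.val_neg, Units.val_one]; push_cast; ring]
    field_simp

end

/-! ### The commutator of T with itself. -/

section

open PowerSeries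

variable {ħ k : ℂ} (h : Generic ħ k) (ρ σ : ℂ) (A : Sector) (S : Side)

/-- A commutator of modes of chargeless currents, from the delta functions at `1` and `q ^ t` in
the commutator of the currents. -/
theorem vop_commutator (hk : k ≠ 0) {V V' : Vertex} (hV' : HasCharge k V' 0) {B B' t t' : ℂ}
    (hr : ∀ l : ℤ, contrZ ħ k V V' l - contrZ ħ k V' V (-l) =
      B * qpow ħ (t * l) + B' * qpow ħ (t' * l)) (E E' : ℤ) :
    S.mul (vop ħ k ρ σ A S V 0 E) (vop ħ k ρ σ A S V' 0 E') -
      S.mul (vop ħ k ρ σ A S V' 0 E') (vop ħ k ρ σ A S V 0 E) =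
    (B * qpow ħ (t * E')) • vop ħ k ρ σ A S (V.nmul (V'.rescale ħ (-t))) 0 (E + E') +
      (B' * qpow ħ (t' * E')) • vop ħ k ρ σ A S (V.nmul (V'.rescale ħ (-t'))) 0 (E + E') := by
  have hcomm := hasLocSum_vop_comm ħ k ρ σ A S V 0 V' 0 E E' (-1)
  have hd := fun t => hasLocSum_vop_diag ħ ρ σ A S V 0 hV' hk t E E'
  have e := hcomm.unique ((((hd t).smul B).add ((hd t').smul B')).congr (fun l => ?_) rfl)
  · rw [neg_one_smul, ← sub_eq_add_neg] at e
    rw [e, smul_smul, smul_smul]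
    simp only [Int.cast_zero, zero_mul, add_zero]
  · rw [smul_smul, smul_smul, ← add_smul, zeroComm_zero, zeroComm_zero, qpow_zero, one_mul, one_mul,
      mul_zero, sub_zero, zero_sub, neg_one_mul, ← sub_eq_add_neg, hr]

theorem coeff_of_mul_prodSeries_pair {F : PowerSeries ℂ} {a b c d : ℂ} (ha : a ≠ 0) (hc : c ≠ 0)
    (hac : a ≠ c) (h : F * prodSeries [a, c] = prodSeries [b, d]) (hbd : b * d = a * c) (n : ℕ) :
    coeff n F = (a - b) * (a - d) / (a * (a - c)) * a ^ n +
      (c - b) * (c - d) / (c * (c - a)) * c ^ n + if n = 0 then 1 else 0 := by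
  rw [coeff_of_mul_prodSeries ha hc hac h, hbd, div_self (mul_ne_zero ha hc)]

/-- The two series expand one rational function with poles at ratio 1 and s. Its values at 0 and ∞
are both 1, so the residues are opposite and the difference is B(s^l - 1). -/
theorem contrZ_sub_of_lt {V V' : Vertex} {s y : ℂ} (hs : s ≠ 0) (hs' : s - 1 ≠ 0) (hy : y ≠ 0)
    (h : contr ħ k V V' * prodSeries [1, s] = prodSeries [y⁻¹, s * y])
    (h' : contr ħ k V' V * prodSeries [1, s⁻¹] = prodSeries [y, (s * y)⁻¹]) (l : ℤ) :
    contrZ ħ k V V' l - contrZ ħ k V' V (-l) =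
      (s - y⁻¹) * (1 - y) / (s - 1) * s ^ l - (s - y⁻¹) * (1 - y) / (s - 1) := by
  have h1 := coeff_of_mul_prodSeries_pair one_ne_zero hs (fun e => hs' (by rw [← e, sub_self])) h
    (by field_simp)
  have h2 := coeff_of_mul_prodSeries_pair one_ne_zero (inv_ne_zero hs)
    (fun e => hs' (by rw [← inv_eq_one.1 e.symm, sub_self])) h' (by field_simp)
  have hs1 : 1 - s ≠ 0 := fun e => hs' (by rw [← neg_sub, e, neg_zero])
  rcases lt_trichotomy l 0 with hl | rfl | hl
  · obtain ⟨n, rfl⟩ : ∃ n : ℕ, l = -(n : ℤ) := ⟨(-l).toNat, by omega⟩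
    rw [contrZ, contrZ, zext_of_neg _ hl, neg_neg, zext_natCast, h2, if_neg (by omega), inv_pow,
      zpow_neg, zpow_natCast]
    have hs1' : 1 - s⁻¹ ≠ 0 := fun e => hs' (by field_simp at e; simpa using e)
    have hs2' : s⁻¹ - 1 ≠ 0 := fun e => hs1 (by field_simp at e; simpa using e)
    have := pow_ne_zero n hs
    rw [show 1 - s⁻¹ = (s - 1) / s by field_simp, show s⁻¹ - 1 = -(s - 1) / s by field_simp; ring]
    field_simp
    ring
  · rw [neg_zero, contrZ, contrZ, ← Int.natCast_zero, zext_natCast, zext_natCast, h1, h2]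
    have hs1' : 1 - s⁻¹ ≠ 0 := fun e => hs' (by field_simp at e; simpa using e)
    rw [show 1 - s⁻¹ = (s - 1) / s by field_simp, show s⁻¹ - 1 = -(s - 1) / s by field_simp; ring,
      show 1 - s = -(s - 1) by ring]
    simp only [if_true, Int.natCast_zero, zpow_zero, pow_zero]
    field_simp
    ring
  · obtain ⟨n, rfl⟩ : ∃ n : ℕ, l = n := ⟨l.toNat, by omega⟩
    rw [contrZ, contrZ, zext_of_neg _ (neg_lt_zero.2 hl), zext_natCast, h1, if_neg (by omega),
      zpow_natCast, one_pow, show 1 - s = -(s - 1) by ring]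
    field_simp
    ring

/-- The expression is odd in l, so the partial fraction computation is needed only for l > 0. -/
theorem contrZ_sub_of_reciprocal {V : Vertex} {s p : ℂ} (hs : s ≠ 0) (hs' : s - s⁻¹ ≠ 0) (hp : p ≠ 0)
    (h : contr ħ k V V * prodSeries [s, s⁻¹] = prodSeries [p, p⁻¹]) (l : ℤ) :
    contrZ ħ k V V l - contrZ ħ k V V (-l) =
      (s - p) * (s - p⁻¹) / (s * (s - s⁻¹)) * s ^ l -
        (s - p) * (s - p⁻¹) / (s * (s - s⁻¹)) * (s ^ l)⁻¹ := by
  have hpos : ∀ n : ℕ, n ≠ 0 → contrZ ħ k V V n - contrZ ħ k V V (-n) =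
      (s - p) * (s - p⁻¹) / (s * (s - s⁻¹)) * s ^ n -
        (s - p) * (s - p⁻¹) / (s * (s - s⁻¹)) * (s ^ n)⁻¹ := by
    intro n hn
    rw [contrZ, zext_natCast, zext_of_neg _ (by omega), coeff_of_mul_prodSeries_pair hs
      (inv_ne_zero hs) (sub_ne_zero.1 hs') h (by field_simp), if_neg hn, inv_pow]
    have hs1 : s⁻¹ - s ≠ 0 := fun e => hs' (by rw [← neg_sub, e, neg_zero])
    have hs2 : s ^ 2 - 1 ≠ 0 := fun e => hs' (by field_simp; simpa using e)
    rw [show s - s⁻¹ = (s ^ 2 - 1) / s by field_simp,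
      show s⁻¹ - s = -(s ^ 2 - 1) / s by field_simp; ring]
    have := pow_ne_zero n hs
    field_simp
    ring
  rcases lt_trichotomy l 0 with hl | rfl | hl
  · obtain ⟨n, rfl⟩ : ∃ n : ℕ, l = -(n : ℤ) := ⟨(-l).toNat, by omega⟩
    have := hpos n (by omega)
    rw [neg_neg, ← neg_sub, this, zpow_neg, inv_inv, zpow_natCast]
    ring
  · simp
  · obtain ⟨n, rfl⟩ : ∃ n : ℕ, l = n := ⟨l.toNat, by omega⟩
    simpa using hpos n (by omega)

/-- The fusion of two terms of `T(z)` at distance `q ^ (2 k + 2)`. -/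
def fusedMode (ħ k ρ σ : ℂ) (A : Sector) (S : Side) (V V' : Vertex) (E : ℤ) :
    Module.End ℂ (FockSpace A k ρ σ) :=
  vop ħ k ρ σ A S (V.nmul (V'.rescale ħ (-(2 * k + 2)))) 0 E

section

include h

/-- At ratio q^{-(2k+2)} the factor e_+ of the first term and f_+ of the second meet as :e_+(z)
f_+(q^{-k} z): = 1. The surviving e_ε and f_ε' are those of :G^+G^-: up to a common rescaling, and
the surplus Ṽ's form K^- and K^+. -/
theorem fusedMode_Tv (ε ε' : ℤˣ) (E : ℤ) :
    fusedMode ħ k ρ σ A S (Tv ħ k 1 ε') (Tv ħ k ε 1) E = qpow ħ (-((k + 1) * E)) •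
      vop ħ k ρ σ A S ((Kv ħ (-1)).nmul (((Gpv ħ k ε).nmul (Gmv ħ k ε')).nmul (Kv ħ 1))) 0 E := by
  have hk := h.k_ne_zero
  have hD := h.qdiff_ne_zero
  have hne : (-1 : ℤˣ) ≠ 1 := by decide
  have hc : HasCharge k ((Kv ħ (-1)).nmul (((Gpv ħ k ε).nmul (Gmv ħ k ε')).nmul (Kv ħ 1))) 0 :=
    (hasCharge_Kv ħ k (-1)).nmul
      (((hasCharge_Gpv ħ k ε).nmul (hasCharge_Gmv ħ k ε')).nmul (hasCharge_Kv ħ k 1))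
  have e1 := vop_rescale ħ ρ σ A S hc hk (-(k + 1)) E
  rw [Int.cast_zero, zero_mul, add_zero, neg_mul] at e1
  rw [← e1, fusedMode]
  have ha := hasCharge_Tv ħ k ε 1
  have hb := hasCharge_Gpv ħ k ε
  have hb' := hasCharge_Gmv ħ k ε'
  refine vop_congr ρ σ A S (fun i => ?_) (fun i j => ?_) (fun i j => ?_) _ _
  · simp only [Vertex.rescale, Vertex.nmul, Gpv_logq, Gmv_logq, Tv_logq ħ k hk]
    cases i <;> simp only [ha.logz_tilde, ha.logz_bar, ha.logz_beta, hb.logz_tilde, hb.logz_bar,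
      hb.logz_beta, hb'.logz_tilde, hb'.logz_bar, hb'.logz_beta, Kv, sg, Units.val_one] <;>
      push_cast <;> field_simp <;> ring_nf
  · have ht := tPow_ne_zero ħ k j
    have hy := yPow_ne_zero ħ j
    have ht4 := h.tPow_sub_ne j
    have hy2 := h.yPow_add_ne j
    rw [rescale_osc_pos ħ k _ _ _ j 2 1 (by push_cast; ring), nmul_osc, nmul_osc, nmul_osc, nmul_osc,
      rescale_osc_pos ħ k _ _ _ j 4 2 (by push_cast; ring)]
    cases i
    · rw [Tv_osc_tilde_pos, Tv_osc_tilde_pos, Gpv_osc_tilde_pos, Gmv_osc_tilde_pos, Kv_osc_pos,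
        Kv_osc_pos, if_neg hne, if_pos rfl, h.rFrac_eq]
      field_simp
      ring
    · rw [Tv_osc_pos ħ k (by simp), Tv_osc_pos ħ k (by simp), Gpv_osc_pos ħ k (by simp),
        Gmv_osc_pos ħ k (by simp), Kv_osc_of_ne ħ (by simp), Kv_osc_of_ne ħ (by simp),
        ev_osc_bar_pos ħ k hD 1, fv_osc_bar_pos ħ k hD 1, if_pos rfl, if_pos rfl, h.rFrac_eq, h.wFrac_eq]
      field_simp
      ring
    · rw [Tv_osc_pos ħ k (by simp), Tv_osc_pos ħ k (by simp), Gpv_osc_pos ħ k (by simp),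
        Gmv_osc_pos ħ k (by simp), Kv_osc_of_ne ħ (by simp), Kv_osc_of_ne ħ (by simp),
        ev_osc_beta_pos ħ k hD 1, fv_osc_beta_pos ħ k hD 1, if_pos rfl, if_pos rfl]
      field_simp
      ring
  · have ht := tPow_ne_zero ħ k j
    have hy := yPow_ne_zero ħ j
    have ht4 := h.tPow_sub_ne j
    have hy2 := h.yPow_add_ne j
    rw [rescale_osc_neg ħ k _ _ _ j (-2) (-1) (by push_cast; ring), nmul_osc, nmul_osc, nmul_osc,
      nmul_osc, rescale_osc_neg ħ k _ _ _ j (-4) (-2) (by push_cast; ring)]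
    cases i
    · rw [Tv_osc_tilde_neg, Tv_osc_tilde_neg, Gpv_osc_tilde_neg, Gmv_osc_tilde_neg, Kv_osc_neg,
        Kv_osc_neg, if_neg hne, if_pos rfl, h.rFrac_eq]
      field_simp
      ring
    · rw [Tv_osc_neg ħ k (by simp), Tv_osc_neg ħ k (by simp), Gpv_osc_neg ħ k (by simp),
        Gmv_osc_neg ħ k (by simp), Kv_osc_of_ne ħ (by simp), Kv_osc_of_ne ħ (by simp),
        ev_osc_bar_neg ħ k hD 1, fv_osc_bar_neg ħ k hD 1, if_pos rfl, if_pos rfl, h.rFrac_eq]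
      field_simp
      ring
    · rw [Tv_osc_neg ħ k (by simp), Tv_osc_neg ħ k (by simp), Gpv_osc_neg ħ k (by simp),
        Gmv_osc_neg ħ k (by simp), Kv_osc_of_ne ħ (by simp), Kv_osc_of_ne ħ (by simp),
        ev_osc_beta_neg ħ k hD 1, fv_osc_beta_neg ħ k hD 1, if_pos rfl, if_pos rfl]
      field_simp
      ring

theorem qpow_two_k_add_two_sub_one : qpow ħ (2 * k + 2) - 1 =
    qpow ħ (k + 1) * (qdiff ħ * qnum ħ (k + 1)) := by
  have := one_sub_qpow_two_mul h (k + 1)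
  rw [show 2 * (k + 1) = 2 * k + 2 by ring] at this
  linear_combination -this

/-- The two mixed commutators are taken together because their delta functions at ratio 1 cancel;
the one at q^{2k+2} survives antisymmetrized in m and n. -/
theorem Tv_commutator_of_lt (hk₁ : qnum ħ (k + 1) ≠ 0) {V V' : Vertex} (hV' : HasCharge k V' 0)
    (hc : contr ħ k V V' * prodSeries [1, qpow ħ (2 * k + 2)] =
      prodSeries [(qpow ħ 2)⁻¹, qpow ħ (2 * k + 4)])
    (hc' : contr ħ k V' V * prodSeries [1, (qpow ħ (2 * k + 2))⁻¹] =
      prodSeries [qpow ħ 2, (qpow ħ (2 * k + 4))⁻¹]) (m n : ℤ) :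
    S.mul (vop ħ k ρ σ A S V 0 (-m)) (vop ħ k ρ σ A S V' 0 (-n)) -
      S.mul (vop ħ k ρ σ A S V' 0 (-n)) (vop ħ k ρ σ A S V 0 (-m)) +
      (S.mul (vop ħ k ρ σ A S V' 0 (-m)) (vop ħ k ρ σ A S V 0 (-n)) -
      S.mul (vop ħ k ρ σ A S V 0 (-n)) (vop ħ k ρ σ A S V' 0 (-m))) =
    (-(qdiff ħ * qnum ħ (k + 2) / qnum ħ (k + 1)) *
      (qpow ħ ((2 * k + 2) * (-n)) - qpow ħ ((2 * k + 2) * (-m)))) •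
      fusedMode ħ k ρ σ A S V V' (-(m + n)) := by
  have hd := h.qdiff_ne_zero
  have hX := qpow_ne_zero ħ (k + 1)
  have hs1 : qpow ħ (2 * k + 2) - 1 ≠ 0 := by
    rw [qpow_two_k_add_two_sub_one h]
    exact mul_ne_zero hX (mul_ne_zero hd hk₁)
  have e1 : qpow ħ (2 * k + 4) = qpow ħ (2 * k + 2) * qpow ħ 2 := by
    rw [← qpow_add]; congr 1; ring
  rw [e1] at hc hc'
  have hB : (qpow ħ (2 * k + 2) - (qpow ħ 2)⁻¹) * (1 - qpow ħ 2) / (qpow ħ (2 * k + 2) - 1) =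
      -(qdiff ħ * qnum ħ (k + 2) / qnum ħ (k + 1)) := by
    rw [qpow_two_k_add_two_sub_one h]
    have e2 := one_sub_qpow_two_mul h (k + 2)
    have e3 := one_sub_qpow_two_mul h 1
    rw [show 2 * (k + 2) = 2 * k + 4 by ring, e1] at e2
    rw [mul_one, show qdiff ħ * qnum ħ 1 = qdiff ħ by
      rw [qnum, ← qdiff, div_self hd, mul_one]] at e3
    have e4 : qpow ħ (k + 2) = qpow ħ (k + 1) * qpow ħ 1 := by rw [← qpow_add]; congr 1; ring
    have e5 : qpow ħ 2 = qpow ħ 1 * qpow ħ 1 := by rw [← qpow_add]; norm_num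
    have hy := qpow_ne_zero ħ 1
    have e6 : qpow ħ (2 * k + 2) - (qpow ħ 2)⁻¹ =
        qpow ħ (k + 2) * (qdiff ħ * qnum ħ (k + 2)) / qpow ħ 2 := by
      rw [eq_div_iff (qpow_ne_zero _ _), sub_mul, inv_mul_cancel₀ (qpow_ne_zero _ _)]
      linear_combination -e2
    rw [e3, e6, e4, e5]
    field_simp
  have hr := contrZ_sub_of_lt (qpow_ne_zero ħ (2 * k + 2)) hs1 (qpow_ne_zero ħ 2) hc hc'
  rw [hB] at hr
  have hcomm := fun E E' => vop_commutator ρ σ A S h.k_ne_zero hV' (t := 2 * k + 2) (t' := 0)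
    (B := -(qdiff ħ * qnum ħ (k + 2) / qnum ħ (k + 1)))
    (B' := qdiff ħ * qnum ħ (k + 2) / qnum ħ (k + 1)) (fun l => by
      rw [hr, qpow_mul_int, zero_mul, qpow_zero]; ring) E E'
  have h1 := hcomm (-m) (-n)
  have h2 := hcomm (-n) (-m)
  rw [show -m + -n = -(m + n) by ring] at h1
  rw [show -n + -m = -(m + n) by ring] at h2
  rw [h1, ← neg_sub (S.mul (vop ħ k ρ σ A S V 0 (-n)) _), h2, fusedMode]
  push_cast
  rw [zero_mul, zero_mul]
  module

/-- The delta functions at q^{2k+2} and q^{-(2k+2)} give the same fused operator up to a rescaling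
of z, which turns their opposite coefficients into the antisymmetric difference. -/
theorem Tv_commutator_same (hk₁ : qnum ħ (2 * k + 2) ≠ 0) {V : Vertex} (hV : HasCharge k V 0)
    (hc : contr ħ k V V * prodSeries [qpow ħ (2 * k + 2), (qpow ħ (2 * k + 2))⁻¹] =
      prodSeries [qpow ħ (2 * k + 4), (qpow ħ (2 * k + 4))⁻¹]) (m n : ℤ) :
    S.mul (vop ħ k ρ σ A S V 0 (-m)) (vop ħ k ρ σ A S V 0 (-n)) -
      S.mul (vop ħ k ρ σ A S V 0 (-n)) (vop ħ k ρ σ A S V 0 (-m)) =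
    ((qpow ħ (2 * k + 2) - qpow ħ (2 * k + 4)) * (qpow ħ (2 * k + 2) - (qpow ħ (2 * k + 4))⁻¹) /
        (qpow ħ (2 * k + 2) * (qpow ħ (2 * k + 2) - (qpow ħ (2 * k + 2))⁻¹)) *
      (qpow ħ ((2 * k + 2) * (-n)) - qpow ħ ((2 * k + 2) * (-m)))) •
      fusedMode ħ k ρ σ A S V V (-(m + n)) := by
  have hk := h.k_ne_zero
  have hs1 : qpow ħ (2 * k + 2) - (qpow ħ (2 * k + 2))⁻¹ ≠ 0 := by
    intro e
    apply hk₁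
    rw [qnum, qpow_neg, e, zero_div]
  have hr := contrZ_sub_of_reciprocal (qpow_ne_zero ħ (2 * k + 2)) hs1 (qpow_ne_zero ħ _) hc
  generalize (qpow ħ (2 * k + 2) - qpow ħ (2 * k + 4)) *
    (qpow ħ (2 * k + 2) - (qpow ħ (2 * k + 4))⁻¹) /
    (qpow ħ (2 * k + 2) * (qpow ħ (2 * k + 2) - (qpow ħ (2 * k + 2))⁻¹)) = B at hr ⊢
  rw [vop_commutator ρ σ A S hk hV (t := 2 * k + 2) (t' := -(2 * k + 2)) (B := B) (B' := -B)
    (fun l => by rw [hr, qpow_mul_int, qpow_mul_int, qpow_neg, inv_zpow]; ring),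
    show -m + -n = -(m + n) by ring, fusedMode]
  have hc2 : HasCharge k (V.nmul (V.rescale ħ (-(2 * k + 2)))) 0 := hV.nmul (hV.rescale ħ _)
  have e1 := vop_rescale ħ ρ σ A S hc2 hk (2 * k + 2) (-(m + n))
  have e2 : vop ħ k ρ σ A S (V.nmul (V.rescale ħ (-(-(2 * k + 2))))) 0 (-(m + n)) =
      vop ħ k ρ σ A S ((V.nmul (V.rescale ħ (-(2 * k + 2)))).rescale ħ (2 * k + 2)) 0
        (-(m + n)) := by
    refine vop_congr ρ σ A S (fun i => ?_) (fun i j => ?_) (fun i j => ?_) _ _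
    · simp only [Vertex.rescale, Vertex.nmul]
      ring
    all_goals
      simp only [Vertex.rescale, Vertex.nmul]
      rw [mul_add, ← mul_assoc (qpow ħ (-(2 * k + 2) * _)) (qpow ħ _), ← qpow_add,
        neg_mul (-(2 * k + 2)), add_neg_cancel, qpow_zero]
      ring_nf
  rw [e2, e1, smul_smul, ← add_smul]
  congr 1
  have e3 : qpow ħ ((2 * k + 2) * (-m)) = qpow ħ (-(2 * k + 2) * (-n : ℤ)) *
      qpow ħ ((2 * k + 2) * ((-(m + n) : ℤ) + (0 : ℤ) * A.frac)) := by
    rw [← qpow_add]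
    congr 1
    push_cast
    ring
  rw [e3]
  push_cast
  ring

/-- The residue of the middle term of T with itself is matched with the coefficient of :e_+ f_+: in
W. Without this identity the quadratic relation would not close on W. -/
theorem Tv_fusion_same (hk₁ : qnum ħ (2 * k + 2) ≠ 0) :
    (qpow ħ (2 * k + 2) - qpow ħ (2 * k + 4)) * (qpow ħ (2 * k + 2) - (qpow ħ (2 * k + 4))⁻¹) /
        (qpow ħ (2 * k + 2) * (qpow ħ (2 * k + 2) - (qpow ħ (2 * k + 2))⁻¹)) =
      qdiff ħ * qnum ħ (k + 1) * wCoeff ħ k 1 1 := by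
  have hd := h.qdiff_ne_zero
  have hk1 : qnum ħ (k + 1) ≠ 0 :=
    qnum_ne_zero_of_two_mul (by rwa [show 2 * (k + 1) = 2 * k + 2 by ring])
  have hX := qpow_ne_zero ħ (k + 1)
  have hy := qpow_ne_zero ħ 1
  have e1 : qpow ħ (2 * k + 4) = qpow ħ (k + 1) ^ 2 * qpow ħ 1 ^ 2 := by
    rw [sq, sq, ← qpow_add, ← qpow_add, ← qpow_add]; congr 1; ring
  have e2 : qpow ħ (2 * k + 2) = qpow ħ (k + 1) ^ 2 := by
    rw [sq, ← qpow_add]; congr 1; ring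
  have e3 : qpow ħ (k + 2) = qpow ħ (k + 1) * qpow ħ 1 := by rw [← qpow_add]; congr 1; ring
  have hd' := hd
  rw [qdiff, qpow_neg] at hd'
  have h1 := hk1
  have h2 := hk₁
  rw [qnum, qpow_neg] at h1 h2
  rw [e2] at h2
  rw [wCoeff, if_pos rfl, if_pos rfl]
  simp only [qnum, qpow_neg, qdiff, e1, e2, e3] at h1 h2 ⊢
  generalize qpow ħ (k + 1) = x at *
  generalize qpow ħ 1 = y at *
  have g1 : y ^ 2 - 1 ≠ 0 := fun e => hd' (by field_simp; simpa using e)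
  have g2 : x ^ 2 - 1 ≠ 0 := fun e => h1 (by
    rw [show x - x⁻¹ = (x ^ 2 - 1) / x by field_simp, e, zero_div, zero_div])
  have g3 : x ^ 4 - 1 ≠ 0 := fun e => h2 (by
    rw [show x ^ 2 - (x ^ 2)⁻¹ = (x ^ 4 - 1) / x ^ 2 by field_simp, e, zero_div, zero_div])
  have g4 : x ^ 2 + 1 ≠ 0 := fun e => g3 (by linear_combination (x ^ 2 - 1) * e)
  rw [show y - y⁻¹ = (y ^ 2 - 1) / y by field_simp, show x - x⁻¹ = (x ^ 2 - 1) / x by field_simp,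
    show x ^ 2 - (x ^ 2)⁻¹ = (x ^ 2 - 1) * (x ^ 2 + 1) / x ^ 2 by field_simp; ring,
    show x * y - (x * y)⁻¹ = (x ^ 2 * y ^ 2 - 1) / (x * y) by field_simp]
  field_simp
  ring

/-- By `ops_W` the double sum of K^- W K^+ is a combination of four sandwiched normal ordered
products, and each of them is a fusion of two terms of T. -/
theorem hasLocSum_sandwich_W (hk₁ : qnum ħ (2 * k + 2) ≠ 0) (hk₂ : qnum ħ (k + 2) ≠ 0) (m : ℤ) :
    HasLocSum (fun x : ℕ × ℕ => S.mul ((ops ħ k ρ σ A S).K (-1) (-x.1))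
        (S.mul ((ops ħ k ρ σ A S).W ħ k A S (m + x.1 - x.2)) ((ops ħ k ρ σ A S).K 1 x.2)))
      (qpow ħ (-((k + 1) * m)) •
        (wCoeff ħ k 1 1 • fusedMode ħ k ρ σ A S (Tv ħ k 1 1) (Tv ħ k 1 1) (-m) +
          wCoeff ħ k 1 (-1) • fusedMode ħ k ρ σ A S (Tv ħ k 1 (-1)) (Tv ħ k 1 1) (-m) +
          wCoeff ħ k (-1) 1 • fusedMode ħ k ρ σ A S (Tv ħ k 1 1) (Tv ħ k (-1) 1) (-m) +
          wCoeff ħ k (-1) (-1) •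
            fusedMode ħ k ρ σ A S (Tv ħ k 1 (-1)) (Tv ħ k (-1) 1) (-m))) := by
  have h1 := fun ε ε' => (hasLocSum_sandwich ħ k ρ σ A S (Kv_osc_neg_one_pos ħ) (Kv_osc_one_neg ħ)
    ((Gpv ħ k ε).nmul (Gmv ħ k ε')) 0 (-m)).smul (wCoeff ħ k ε ε')
  refine ((((h1 1 1).add (h1 1 (-1))).add (h1 (-1) 1)).add (h1 (-1) (-1))).congr (fun x => ?_) ?_
  · rw [ops_W h ρ σ A S hk₁ hk₂]
    simp only [ops, neg_neg, fermiPair, Side.smul_mul, Side.mul_smul, Side.add_mul, Side.mul_add]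
    rw [show -(m + x.1 - x.2) = -m - (x.1 : ℤ) + x.2 by ring]
  · have e : ∀ ε ε', qpow ħ ((Kv ħ (-1)).zeroComm k 0) • vop ħ k ρ σ A S ((Kv ħ (-1)).nmul
        (((Gpv ħ k ε).nmul (Gmv ħ k ε')).nmul (Kv ħ 1))) 0 (-m) = qpow ħ (-((k + 1) * m)) •
          fusedMode ħ k ρ σ A S (Tv ħ k 1 ε') (Tv ħ k ε 1) (-m) := by
      intro ε ε'
      rw [zeroComm_zero, qpow_zero, one_smul, fusedMode_Tv h, smul_smul, ← qpow_add,
        show -((k + 1) * (m : ℂ)) + -((k + 1) * (-m : ℤ)) = 0 by push_cast; ring, qpow_zero,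
        one_smul]
    rw [e, e, e, e]
    module

omit h in
theorem Side.commutator_sum (a b c a' b' c' : Module.End ℂ (FockSpace A k ρ σ)) (x y z : ℂ) :
    S.mul (x • a - y • b + z • c) (x • a' - y • b' + z • c') -
      S.mul (x • a' - y • b' + z • c') (x • a - y • b + z • c) =
    x ^ 2 • (S.mul a a' - S.mul a' a) + y ^ 2 • (S.mul b b' - S.mul b' b) +
      z ^ 2 • (S.mul c c' - S.mul c' c) -
      (x * y) • (S.mul a b' - S.mul b' a + (S.mul b a' - S.mul a' b)) +
      (x * z) • (S.mul a c' - S.mul c' a + (S.mul c a' - S.mul a' c)) -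
      (y * z) • (S.mul b c' - S.mul c' b + (S.mul c b' - S.mul b' c)) := by
  simp only [Side.smul_mul, Side.mul_smul, Side.add_mul, Side.mul_add, Side.sub_mul, Side.mul_sub]
  module

theorem vop_commute_of_nil {V : Vertex} (hV : HasCharge k V 0)
    (hc : contr ħ k V V * prodSeries [] = prodSeries []) (E E' : ℤ) :
    S.mul (vop ħ k ρ σ A S V 0 E) (vop ħ k ρ σ A S V 0 E') -
      S.mul (vop ħ k ρ σ A S V 0 E') (vop ħ k ρ σ A S V 0 E) = 0 := by
  rw [prodSeries_nil, mul_one] at hc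
  have hz : ∀ l : ℤ, contrZ ħ k V V l = if l = 0 then 1 else 0 := by
    intro l
    rcases lt_or_ge l 0 with hl | hl
    · rw [contrZ, zext_of_neg _ hl, if_neg hl.ne]
    · obtain ⟨n, rfl⟩ : ∃ n : ℕ, l = n := ⟨l.toNat, by omega⟩
      rw [contrZ, zext_natCast, hc, coeff_one]
      simp
  rw [vop_commutator ρ σ A S h.k_ne_zero hV (t := 0) (t' := 0) (B := 0) (B' := 0)
    fun l => by rw [hz, hz]; simp]
  simp

/-- Of the nine commutators of terms, two vanish and the others combine to four fused modes. Their
coefficients agree with those of W after the common scalar is removed. -/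
theorem ops_TT (hk₁ : qnum ħ (2 * k + 2) ≠ 0) (hk₂ : qnum ħ (k + 2) ≠ 0) (m n : ℤ) :
    S.mul ((ops ħ k ρ σ A S).T m) ((ops ħ k ρ σ A S).T n) -
      S.mul ((ops ħ k ρ σ A S).T n) ((ops ħ k ρ σ A S).T m) =
      (qdiff ħ ^ 2 * (qnum ħ (k + 2) ^ 2 / qnum ħ (k + 1)) * qnum ħ ((m - n) * (k + 1))) •
        locSum fun x : ℕ × ℕ => S.mul ((ops ħ k ρ σ A S).K (-1) (-x.1))
          (S.mul ((ops ħ k ρ σ A S).W ħ k A S (m + n + x.1 - x.2))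
            ((ops ħ k ρ σ A S).K 1 x.2)) := by
  have hd := h.qdiff_ne_zero
  have hk1 : qnum ħ (k + 1) ≠ 0 :=
    qnum_ne_zero_of_two_mul (by rwa [show 2 * (k + 1) = 2 * k + 2 by ring])
  have hne : (-1 : ℤˣ) ≠ 1 := by decide
  rw [(hasLocSum_sandwich_W h ρ σ A S hk₁ hk₂ (m + n)).locSum_eq]
  simp only [ops]
  rw [Side.commutator_sum, vop_commute_of_nil h ρ σ A S (hasCharge_Tv ħ k _ _)
      (contr_Tv_Tv_diag h).1,
    vop_commute_of_nil h ρ σ A S (hasCharge_Tv ħ k _ _) (contr_Tv_Tv_diag h).2.2,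
    Tv_commutator_same h ρ σ A S hk₁ (hasCharge_Tv ħ k _ _) (contr_Tv_Tv_diag h).2.1,
    Tv_commutator_of_lt h ρ σ A S hk1 (hasCharge_Tv ħ k _ _) (contr_Tv_Tv_lt h).1
      (contr_Tv_Tv_gt h).1,
    Tv_commutator_of_lt h ρ σ A S hk1 (hasCharge_Tv ħ k _ _) (contr_Tv_Tv_lt h).2.1
      (contr_Tv_Tv_gt h).2.1,
    Tv_commutator_of_lt h ρ σ A S hk1 (hasCharge_Tv ħ k _ _) (contr_Tv_Tv_lt h).2.2
      (contr_Tv_Tv_gt h).2.2, Tv_fusion_same h hk₁]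
  -- The antisymmetric difference factors as [(m-n)(k+1)] times a power that depends on m + n only
  -- and cancels the one in `hasLocSum_sandwich_W`.
  have e : qpow ħ ((2 * k + 2) * (-n)) - qpow ħ ((2 * k + 2) * (-m)) =
      qdiff ħ * qnum ħ ((m - n) * (k + 1)) * qpow ħ (-((k + 1) * (m + n : ℤ))) := by
    rw [qnum, mul_div_cancel₀ _ hd, sub_mul, ← qpow_add, ← qpow_add]
    congr 2 <;> push_cast <;> ring_nf
  rw [e]
  have hy : qpow ħ (-1) * qpow ħ 1 = 1 := by rw [← qpow_add, neg_add_cancel, qpow_zero]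
  simp only [wCoeff, if_true, hne, if_false, smul_zero, zero_add, add_zero]
  generalize (qpow ħ (-((k + 1) * (m + n : ℤ)))) = Q
  generalize qnum ħ ((m - n) * (k + 1)) = R
  generalize fusedMode ħ k ρ σ A S (Tv ħ k 1 1) (Tv ħ k 1 1) (-(m + n)) = P1
  generalize fusedMode ħ k ρ σ A S (Tv ħ k 1 (-1)) (Tv ħ k 1 1) (-(m + n)) = P2
  generalize fusedMode ħ k ρ σ A S (Tv ħ k 1 1) (Tv ħ k (-1) 1) (-(m + n)) = P3
  generalize fusedMode ħ k ρ σ A S (Tv ħ k 1 (-1)) (Tv ħ k (-1) 1) (-(m + n)) = P4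
  rw [hy]
  match_scalars <;> field_simp

theorem isSVirRep_ops (hk₁ : qnum ħ (2 * k + 2) ≠ 0) (hk₂ : qnum ħ (k + 2) ≠ 0)
    (hk₃ : qnum ħ (k + 3) ≠ 0) : IsSVirRep ħ k A S (ops ħ k ρ σ A S) := by
  have hk1 : qnum ħ (k + 1) ≠ 0 :=
    qnum_ne_zero_of_two_mul (by rwa [show 2 * (k + 1) = 2 * k + 2 by ring])
  exact
  { K_zero := ops_K_zero ħ k ρ σ A S
    smooth := ops_smooth ħ k ρ σ A S
    K0_eq := ops_K0_eq ħ k ρ σ A S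
    K0_unit := ops_K0_unit ħ k ρ σ A S
    KK := ops_KK ħ k ρ σ A S
    KmKp := fun m n hm _ => ops_KmKp ρ σ A S h m n hm
    KmT := fun m n hm => ops_KmT ρ σ A S h hk₃ m n hm
    TKp := fun m n hn => ops_TKp ρ σ A S h hk₃ m n hn
    KmG := fun ε m r hm => ops_KmG ρ σ A S h ε m r hm
    GKp := fun ε r n hn => ops_GKp ρ σ A S h ε r n hn
    GG := ops_GG ρ σ A S h
    GpGm := ops_GpGm h ρ σ A S hk1
    GT := ops_GT h ρ σ A S hk1
    TT := ops_TT h ρ σ A S hk₁ hk₂ }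

end

end

section

variable {ħ k : ℂ} (ρ σ : ℂ) (A : Sector) (S : Side)

/-! ### Identification with the modes of the given currents. -/

section Currents

variable (hk : k ≠ 0)
include hk

theorem toBig_ops_K (ε : ℤˣ) (m : ℤ) (x : FockSpace A k ρ σ) :
    toBig A k ρ σ ((ops ħ k ρ σ A S).K ε m x) = Kmode ħ k S ε m (toBig A k ρ σ x) := by
  rw [ops, Kmode, toBig_vop ħ ρ σ A S (hasCharge_Kv ħ k ε) hk]
  congr 2
  push_cast
  ring

theorem toBig_ops_T (m : ℤ) (x : FockSpace A k ρ σ) :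
    toBig A k ρ σ ((ops ħ k ρ σ A S).T m x) = Tmode ħ k S m (toBig A k ρ σ x) := by
  have e : ∀ ε ε', toBig A k ρ σ (vop ħ k ρ σ A S (Tv ħ k ε ε') 0 (-m) x) =
      (Tv ħ k ε ε').coeff ħ k S (-m) (toBig A k ρ σ x) := by
    intro ε ε'
    rw [toBig_vop ħ ρ σ A S (hasCharge_Tv ħ k ε ε') hk]
    congr 2
    push_cast
    ring
  simp only [ops, Tmode, LinearMap.add_apply, LinearMap.sub_apply, LinearMap.smul_apply, map_add,
    map_sub, map_smul, e]

omit hk in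
theorem hasCharge_Gv (ħ k : ℂ) (ε ε' : ℤˣ) : HasCharge k (Gv ħ k ε ε') ε := by
  rcases Int.units_eq_one_or ε with rfl | rfl
  · exact hasCharge_Gpv ħ k ε'
  · exact hasCharge_Gmv ħ k ε'

theorem toBig_ops_G (ε : ℤˣ) (m : ℤ) (x : FockSpace A k ρ σ) :
    toBig A k ρ σ ((ops ħ k ρ σ A S).G ε m x) =
      Gmode ħ k S ε (m + A.shift₂ / 2) (toBig A k ρ σ x) := by
  have e : ∀ ε', toBig A k ρ σ (vop ħ k ρ σ A S (Gv ħ k ε ε') ε (A.expo ε m) x) =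
      (Gv ħ k ε ε').coeff ħ k S (-(m + A.shift₂ / 2) - 1 / 2) (toBig A k ρ σ x) := by
    intro ε'
    rw [toBig_vop ħ ρ σ A S (hasCharge_Gv ħ k ε ε') hk]
    congr 2
    rcases Int.units_eq_one_or ε with rfl | rfl
    · rw [Sector.expo, if_pos rfl, Sector.frac_eq]
      push_cast
      ring
    · rw [Sector.expo, if_neg (by decide), Sector.frac_eq]
      push_cast
      ring
  simp only [ops, Gmode, LinearMap.sub_apply, LinearMap.smul_apply, map_sub, map_smul, e]
  rfl

theorem isCurrents_ops : IsCurrents ħ k ρ σ A S (ops ħ k ρ σ A S) := fun m x =>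
  ⟨toBig_ops_T ρ σ A S hk m x, fun ε => ⟨toBig_ops_K ρ σ A S hk ε m x,
    toBig_ops_G ρ σ A S hk ε m x⟩⟩

end Currents

/-! ### Highest weight vectors. -/

section HighestWeight

theorem one_mem_weightSpan : (1 : Osc) ∈ weightSpan (· ≤ 0) := by
  have := monomial_mem_weightSpan (P := (· ≤ 0)) (μ := 0) (by simp [oscWeight]) 1
  rwa [← MvPolynomial.C_apply, MvPolynomial.C_1] at this

theorem oscOp_one_eq_zero (V : Vertex) {i : ℤ} (hi : S.sign * i < 0) :
    oscOp ħ k S V i (1 : Osc) = 0 :=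
  oscOp_eq_zero ħ k S one_mem_weightSpan (by simpa using hi)

theorem oscOp_zero_one (V : Vertex) : oscOp ħ k S V 0 (1 : Osc) = 1 := by
  rw [((hasLocSum_oscOp ħ k S V 0) 1).2, finsum_eq_single _ 0]
  · beta_reduce
    rw [zero_add, crZ, anZ, ← Int.natCast_zero, zext_natCast, zext_natCast, creation_zero,
      annihilation_zero, Side.one_mul]
    rfl
  · intro b hb
    by_contra hne
    obtain ⟨h1, h2, h3⟩ := pair_bounds ħ k S one_mem_weightSpan hne
    cases S <;> simp only [zero_add] at h1 h3 <;> exact hb (by omega)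

theorem vop_sv_one_eq_zero (V : Vertex) (c E : ℤ) (hE : S.sign * (E - c * S.zeroIdx c 0) < 0) :
    vop ħ k ρ σ A S V c E (sv A k ρ σ 0 1) = 0 := by
  rw [vop_sv, LinearMap.smul_apply, oscOp_one_eq_zero S V hE, smul_zero, map_zero]

theorem vop_zero_sv_one (V : Vertex) : vop ħ k ρ σ A S V 0 0 (sv A k ρ σ 0 1) =
    qpow ħ (V.zeroExp k ρ σ A 0) • sv A k ρ σ 0 1 := by
  have e : S.zeroIdx 0 0 = 0 := by cases S <;> rfl
  rw [vop_sv, e, mul_zero, mul_zero, sub_zero, add_zero, LinearMap.smul_apply, oscOp_zero_one,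
    map_smul]

theorem zeroExp_Tv (hk : k ≠ 0) (ε ε' : ℤˣ) : (Tv ħ k ε ε').zeroExp k ρ σ A 0 =
    (1 + sg ε / 2 + sg ε' / 2) * ρ + (sg ε' / 2 - sg ε / 2) * σ - 2 * A.frac := by
  have hs : ∀ f : Boson → ℂ, ∑ i, f i = f .tilde + f .bar + f .beta := by
    intro f
    change ∑ i ∈ ({.tilde, .bar, .beta} : Finset Boson), f i = _
    rw [Finset.sum_insert (by decide), Finset.sum_insert (by decide), Finset.sum_singleton]
    ring
  rw [Vertex.zeroExp, hs, Tv_logq ħ k hk]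
  cases A <;> simp only [sectorMom, mom3, zeroSign, Sector.frac] <;> push_cast <;> field_simp <;>
    ring

theorem hwVec_ne_zero : hwVec A k ρ σ ≠ 0 := by
  intro h
  have h1 : (hwVec A k ρ σ : BigFock) = 0 := by rw [h]; rfl
  exact one_ne_zero (Finsupp.single_eq_zero.1 h1)

/-- The ground vector has weight 0, so a mode that would lower the weight kills it, and zero modes
act by the momenta. The three terms of T_0 give uv⁻¹, u² and uv, each times q^{-2 frac}. Both
sectors are treated at once, the Ramond one having `A.frac` = 1/2. -/
theorem isHighestWeight_ops (hk : k ≠ 0) {u v : ℂ} (hu : u = qpow ħ ρ) (hv : v = qpow ħ σ) :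
    IsHighestWeight A S (ops ħ k ρ σ A S : SVirOps (Fock A k ρ σ)) (qpow ħ (k * A.frac) * u)
      (qpow ħ (-2 * A.frac) * hwt ħ k u v) (hwVec A k ρ σ) := by
  have hK : ∀ ε (m : ℤ), 0 < S.sign * m → (ops ħ k ρ σ A S).K ε m (sv A k ρ σ 0 1) = 0 :=
    fun ε m hm => vop_sv_one_eq_zero ρ σ A S _ _ _ (by
      rw [zero_mul, sub_zero, mul_neg]; exact neg_lt_zero.2 hm)
  have hT : ∀ m : ℤ, 0 < S.sign * m → (ops ħ k ρ σ A S).T m (sv A k ρ σ 0 1) = 0 := by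
    intro m hm
    have := fun V => vop_sv_one_eq_zero (ħ := ħ) (k := k) ρ σ A S V 0 (-m) (by
      rw [zero_mul, sub_zero, mul_neg]; exact neg_lt_zero.2 hm)
    simp only [ops, LinearMap.add_apply, LinearMap.sub_apply, LinearMap.smul_apply, this,
      smul_zero, sub_zero, add_zero]
  have hG : ∀ (ε : ℤˣ) (r : ℤ), S.sign * (A.expo ε r - ε * S.zeroIdx ε 0) < 0 →
      (ops ħ k ρ σ A S).G ε r (sv A k ρ σ 0 1) = 0 := by
    intro ε r hr
    simp only [ops, LinearMap.sub_apply, LinearMap.smul_apply, vop_sv_one_eq_zero ρ σ A S _ _ _ hr,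
      smul_zero, sub_zero]
  refine ⟨hwVec_ne_zero ρ σ A, fun ε => ?_, ?_, ?_⟩
  · have := vop_Kv_zero ħ k ρ σ A S ε 0 1
    have e : qpow ħ (sectorMom A k ρ σ 0 .tilde) = qpow ħ (k * A.frac) * u := by
      rw [hu, ← qpow_add]
      congr 1
      cases A <;> simp only [sectorMom, mom3, Sector.frac] <;> push_cast <;> ring
    rw [e] at this
    exact this
  · change (ops ħ k ρ σ A S).T 0 (sv A k ρ σ 0 1) = _ • sv A k ρ σ 0 1
    simp only [ops, LinearMap.add_apply, LinearMap.sub_apply, LinearMap.smul_apply, neg_zero,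
      vop_zero_sv_one, zeroExp_Tv ρ σ A hk, smul_smul, ← add_smul, ← sub_smul, sg, Units.val_one,
      Units.val_neg]
    congr 1
    have e1 : qpow ħ ((1 + ((1 : ℤ) : ℂ) / 2 + ((-1 : ℤ) : ℂ) / 2) * ρ +
        (((-1 : ℤ) : ℂ) / 2 - ((1 : ℤ) : ℂ) / 2) * σ - 2 * A.frac) =
        qpow ħ (-2 * A.frac) * (u * v⁻¹) := by
      rw [hu, hv, ← qpow_neg, ← qpow_add, ← qpow_add]
      congr 1
      push_cast
      ring
    have e2 : qpow ħ ((1 + ((1 : ℤ) : ℂ) / 2 + ((1 : ℤ) : ℂ) / 2) * ρ +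
        (((1 : ℤ) : ℂ) / 2 - ((1 : ℤ) : ℂ) / 2) * σ - 2 * A.frac) =
        qpow ħ (-2 * A.frac) * u ^ 2 := by
      rw [hu, sq, ← qpow_add, ← qpow_add]
      congr 1
      push_cast
      ring
    have e3 : qpow ħ ((1 + ((-1 : ℤ) : ℂ) / 2 + ((1 : ℤ) : ℂ) / 2) * ρ +
        (((1 : ℤ) : ℂ) / 2 - ((-1 : ℤ) : ℂ) / 2) * σ - 2 * A.frac) =
        qpow ħ (-2 * A.frac) * (u * v) := by
      rw [hu, hv, ← qpow_add, ← qpow_add]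
      congr 1
      push_cast
      ring
    rw [e1, e2, e3, hwt]
    ring
  · cases S <;> cases A
    · refine ⟨fun m hm => ⟨hK 1 m ?_, hT m ?_⟩, fun ε r hr => hG ε r ?_⟩
      · simpa [Side.sign] using hm
      · simpa [Side.sign] using hm
      · rcases Int.units_eq_one_or ε with rfl | rfl <;>
          simp [Side.sign, Side.zeroIdx, Sector.expo, Sector.shift₂] <;> omega
    · refine ⟨fun m hm => ⟨hK 1 m ?_, hT m ?_⟩, fun r hr => hG 1 r ?_, fun r hr => hG (-1) r ?_⟩
      · simpa [Side.sign] using hm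
      · simpa [Side.sign] using hm
      · simp [Side.sign, Side.zeroIdx, Sector.expo]; omega
      · simp [Side.sign, Side.zeroIdx, Sector.expo, Sector.shift₂]; omega
    · refine ⟨fun m hm => ⟨hK (-1) m ?_, hT m ?_⟩, fun ε r hr => hG ε r ?_⟩
      · simpa [Side.sign] using hm
      · simpa [Side.sign] using hm
      · rcases Int.units_eq_one_or ε with rfl | rfl <;>
          simp [Side.sign, Side.zeroIdx, Sector.expo, Sector.shift₂] <;> omega
    · refine ⟨fun m hm => ⟨hK (-1) m ?_, hT m ?_⟩, fun r hr => hG 1 r ?_, fun r hr => hG (-1) r ?_⟩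
      · simpa [Side.sign] using hm
      · simpa [Side.sign] using hm
      · simp [Side.sign, Side.zeroIdx, Sector.expo]; omega
      · simp [Side.sign, Side.zeroIdx, Sector.expo, Sector.shift₂]; omega

end HighestWeight

/-! ### Degrees of the generators. -/

section Homogeneous

theorem degreePiece_eq_map (N j : ℤ) : degreePiece A k ρ σ N j =
    (weightSpan fun n => 2 * n + groundDeg₂ A j = N).map (sv A k ρ σ j) := by
  have e : Submodule.span ℂ {x : BigFock | ∃ μ : Boson × ℕ →₀ ℕ,
      2 * (oscWeight μ : ℤ) + groundDeg₂ A j = N ∧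
        x = Finsupp.single (sectorMom A k ρ σ j) (MvPolynomial.monomial μ 1)} =
      ((weightSpan fun n => 2 * n + groundDeg₂ A j = N).map (sv A k ρ σ j)).map
        (toBig A k ρ σ) := by
    rw [weightSpan, Submodule.map_span, Submodule.map_span]
    congr 1
    ext x
    constructor
    · rintro ⟨μ, h1, rfl⟩
      exact ⟨_, ⟨_, ⟨μ, h1, rfl⟩, rfl⟩, rfl⟩
    · rintro ⟨_, ⟨_, ⟨μ, h1, rfl⟩, rfl⟩, rfl⟩
      exact ⟨μ, h1, rfl⟩
  rw [degreePiece, e]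
  exact Submodule.comap_map_eq_of_injective (Submodule.injective_subtype _) _

/-- The oscillator weight changes by the power of z left after the zero modes; the hypothesis on N'
adds the change of the ground degree, which is quadratic in the x-degree. -/
theorem vop_mem_degreePiece (V : Vertex) (c E : ℤ) {N N' j j' : ℤ} (hj : j' = j + S.sign * c)
    (hN : N' - groundDeg₂ A j' = N - groundDeg₂ A j + 2 * (S.sign * (E - c * S.zeroIdx c j)))
    {x : FockSpace A k ρ σ} (hx : x ∈ degreePiece A k ρ σ N j) :
    vop ħ k ρ σ A S V c E x ∈ degreePiece A k ρ σ N' j' := by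
  rw [degreePiece_eq_map] at hx ⊢
  obtain ⟨f, hf, rfl⟩ := hx
  have h1 := oscOp_mem ħ k S V (E - c * S.zeroIdx c j)
    (fun w n => 2 * n + groundDeg₂ A j = N + 2 * w) (fun w d n => by omega) 0
    (by simpa using hf)
  rw [vop_sv, ← hj]
  refine Submodule.mem_map_of_mem (Submodule.smul_mem _ _ (weightSpan_mono (fun n hn => ?_) h1))
  omega

theorem isHomogeneous_ops : IsHomogeneous A S (ops ħ k ρ σ A S : SVirOps (Fock A k ρ σ)) := by
  intro N j m x hx
  have h0 := fun V => vop_mem_degreePiece (ħ := ħ) ρ σ A S V 0 (-m) (N := N)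
    (N' := N - S.sign * (2 * m)) (j := j) (j' := j) (by ring) (by ring) hx
  refine ⟨?_, fun ε => ⟨h0 _, ?_⟩⟩
  · exact Submodule.add_mem _ (Submodule.sub_mem _ (Submodule.smul_mem _ _ (h0 _))
      (Submodule.smul_mem _ _ (h0 _))) (Submodule.smul_mem _ _ (h0 _))
  · have h1 := fun V => vop_mem_degreePiece (ħ := ħ) ρ σ A S V ε (A.expo ε m) (N := N)
      (N' := N - S.sign * (2 * m + A.shift₂)) (j := j) (j' := j + S.sign * ε) rfl (by
        rcases Int.units_eq_one_or ε with rfl | rfl <;> cases A <;> cases S <;>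
          simp [Side.sign, Side.zeroIdx, Sector.expo, Sector.shift₂, groundDeg₂] <;> ring) hx
    exact Submodule.smul_mem _ _ (Submodule.sub_mem _ (h1 _) (h1 _))

end Homogeneous

end

section

open Filter Topology

/-! ### Generating functions of monomials as infinite products. -/

section MonomialSums

variable {𝕜 : Type*} [NormedField 𝕜] [CompleteSpace 𝕜] {ι : Type*} (t : ι → 𝕜)

/-- Splitting off the exponent of one variable identifies monomials with pairs (n, ν) where ν does
not involve that variable. Other pairs contribute zero, so the sum is a product with a geometric
series. -/
theorem hasSum_geometric_mul_erase {a : ι} {c : 𝕜} (hc : ‖c‖ < 1) {F F' : (ι →₀ ℕ) → 𝕜} {L : 𝕜}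
    (h1 : Summable fun μ => ‖F μ‖) (h2 : HasSum F L) (h0 : ∀ ν, ν a ≠ 0 → F ν = 0)
    (hF : ∀ μ, F' μ = c ^ μ a * F (μ.erase a)) :
    (Summable fun μ => ‖F' μ‖) ∧ HasSum F' ((1 - c)⁻¹ * L) := by
  have hinj : Function.Injective fun μ : ι →₀ ℕ => (μ a, μ.erase a) := by
    intro μ ν h
    simp only [Prod.mk.injEq] at h
    rw [← Finsupp.single_add_erase a μ, ← Finsupp.single_add_erase a ν, h.1, h.2]
  have h0' : ∀ x : ℕ × (ι →₀ ℕ), x ∉ Set.range (fun μ : ι →₀ ℕ => (μ a, μ.erase a)) →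
      c ^ x.1 * F x.2 = 0 := by
    rintro ⟨n, ν⟩ hx
    refine mul_eq_zero_of_right _ (h0 _ fun hν => hx ⟨Finsupp.single a n + ν, ?_⟩)
    simp only [Finsupp.add_apply, Finsupp.single_eq_same, hν, add_zero, Finsupp.erase_add,
      Finsupp.erase_single, zero_add]
    rw [Finsupp.erase_of_notMem_support (Finsupp.notMem_support_iff.2 hν)]
  have hg := summable_norm_geometric_of_norm_lt_one hc
  constructor
  · have hm : Summable fun x : ℕ × (ι →₀ ℕ) => ‖c ^ x.1 * F x.2‖ :=
      Summable.mul_norm (f := fun n : ℕ => c ^ n) (g := F) hg h1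
    refine (hm.comp_injective hinj).congr fun μ => ?_
    rw [hF]
    rfl
  · have hm := (hasSum_geometric_of_norm_lt_one hc).mul h2
      (summable_mul_of_summable_norm (f := fun n : ℕ => c ^ n) (g := F) hg h1)
    rw [funext hF]
    exact (hinj.hasSum_iff h0').2 hm

theorem hasSum_monomials_supported [DecidableEq ι] (ht : ∀ i, ‖t i‖ < 1) (s : Finset ι) :
    (Summable fun μ : ι →₀ ℕ => ‖if μ.support ⊆ s then μ.prod fun i n => t i ^ n else 0‖) ∧
      HasSum (fun μ : ι →₀ ℕ => if μ.support ⊆ s then μ.prod fun i n => t i ^ n else 0)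
        (∏ i ∈ s, (1 - t i)⁻¹) := by
  induction s using Finset.induction_on with
  | empty =>
    have h0 : ∀ μ : ι →₀ ℕ, μ ≠ 0 →
        (if μ.support ⊆ ∅ then μ.prod fun i n => t i ^ n else 0) = 0 := fun μ hμ =>
      if_neg fun h => hμ (Finsupp.support_eq_empty.1 (Finset.subset_empty.1 h))
    constructor
    · exact (hasSum_single (0 : ι →₀ ℕ) fun μ hμ => by rw [h0 μ hμ, norm_zero]).summable
    · convert hasSum_single (0 : ι →₀ ℕ) h0
      simp
  | insert a s ha ih =>
    rw [Finset.prod_insert ha]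
    refine hasSum_geometric_mul_erase (ht a) ih.1 ih.2 (fun ν hν => if_neg fun h =>
      ha (h (Finsupp.mem_support_iff.2 hν))) fun μ => ?_
    rw [Finsupp.support_erase, mul_ite, mul_zero,
      Finsupp.mul_prod_erase' μ a (fun i n => t i ^ n) fun i => pow_zero _]
    simp only [← Finset.subset_insert_iff]

/-- Each factor is 1 + a/(1 - a) ≤ exp(a/(1 - r)), which gives a bound uniform in the finite set. -/
theorem prod_one_sub_inv_le {a : ι → ℝ} {r : ℝ} (ha : ∀ i, 0 ≤ a i) (har : ∀ i, a i ≤ r) (hr : r < 1)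
    (hs : Summable a) (s : Finset ι) :
    ∏ i ∈ s, (1 - a i)⁻¹ ≤ Real.exp ((∑' i, a i) / (1 - r)) := by
  have h1 : ∀ i, (1 - a i)⁻¹ ≤ Real.exp (a i / (1 - r)) := by
    intro i
    have hp : 0 < 1 - a i := by linarith [har i]
    have hp' : 0 < 1 - r := by linarith
    calc (1 - a i)⁻¹ = a i / (1 - a i) + 1 := by field_simp; ring
      _ ≤ a i / (1 - r) + 1 := by
        gcongr
        · exact ha i
        · exact har i
      _ ≤ _ := Real.add_one_le_exp _
  calc ∏ i ∈ s, (1 - a i)⁻¹ ≤ ∏ i ∈ s, Real.exp (a i / (1 - r)) :=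
        Finset.prod_le_prod (fun i _ => inv_nonneg.2 (by linarith [har i])) fun i _ => h1 i
    _ = Real.exp ((∑ i ∈ s, a i) / (1 - r)) := by rw [← Real.exp_sum, Finset.sum_div]
    _ ≤ _ := by
      gcongr
      exact hs.sum_le_tsum _ fun i _ => ha i

/-- The geometric series in several variables. -/
theorem hasProd_one_sub_inv {r : ℝ} (htr : ∀ i, ‖t i‖ ≤ r) (hr : r < 1)
    (hs : Summable fun i => ‖t i‖) :
    (Summable fun μ : ι →₀ ℕ => ‖μ.prod fun i n => t i ^ n‖) ∧
      HasProd (fun i => (1 - t i)⁻¹) (∑' μ : ι →₀ ℕ, μ.prod fun i n => t i ^ n) := by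
  classical
  have ht : ∀ i, ‖t i‖ < 1 := fun i => (htr i).trans_lt hr
  have hsum : Summable fun μ : ι →₀ ℕ => ‖μ.prod fun i n => t i ^ n‖ := by
    -- A finite set of monomials involves finitely many variables, so the sum of its norms is at
    -- most a finite product of geometric series in the norms.
    refine summable_of_sum_le (fun _ => norm_nonneg _) (c := Real.exp ((∑' i, ‖t i‖) / (1 - r)))
      fun F => ?_
    set s := F.biUnion Finsupp.support
    refine le_trans ?_ (prod_one_sub_inv_le (fun i => norm_nonneg (t i)) htr hr hs s)
    obtain ⟨-, h2⟩ := hasSum_monomials_supported (fun i => ‖t i‖) (by simpa using ht) s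
    refine le_trans (Finset.sum_le_sum fun μ hμ => ?_) (sum_le_hasSum F (fun μ _ => ?_) h2)
    · rw [if_pos (Finset.subset_biUnion_of_mem Finsupp.support hμ), Finsupp.prod, Finsupp.prod,
        norm_prod]
      simp only [norm_pow, le_refl]
    · split_ifs
      · exact Finset.prod_nonneg fun i _ => pow_nonneg (norm_nonneg _) _
      · exact le_rfl
  refine ⟨hsum, ?_⟩
  -- Restriction to monomials in a finite set of variables gives the partial products; the full
  -- absolute series dominates, so the limit along finite sets may be taken termwise.
  have h1 := tendsto_tsum_of_dominated_convergence (𝓕 := (atTop : Filter (Finset ι)))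
    (f := fun s (μ : ι →₀ ℕ) => if μ.support ⊆ s then μ.prod fun i n => t i ^ n else 0)
    (g := fun μ : ι →₀ ℕ => μ.prod fun i n => t i ^ n) hsum (fun μ => ?_)
    (Eventually.of_forall fun s μ => ?_)
  · refine h1.congr fun s => ?_
    exact (hasSum_monomials_supported t ht s).2.tsum_eq
  · refine tendsto_const_nhds.congr' ?_
    filter_upwards [eventually_ge_atTop μ.support] with s hs
    exact (if_pos hs).symm
  · split_ifs
    · exact le_rfl
    · rw [norm_zero]
      exact norm_nonneg _

end MonomialSums

/-! ### The finite form of the Jacobi triple product. -/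

section TripleProduct

variable {s x : ℂ}

/-- The finite `q`-Pochhammer symbol at `q = s ^ 2`. -/
def poch (s : ℂ) (n : ℕ) : ℂ := ∏ i ∈ Finset.range n, (1 - s ^ (2 * (i + 1)))

/-- The inverse of the finite `q`-Pochhammer symbol, extended by zero to negative arguments. -/
def pochInv (s : ℂ) (n : ℤ) : ℂ := if 0 ≤ n then (poch s n.toNat)⁻¹ else 0

theorem one_sub_pow_ne_zero (hs : ‖s‖ < 1) (n : ℕ) (hn : n ≠ 0) : 1 - s ^ n ≠ 0 := by
  intro h
  have h1 : ‖s ^ n‖ = 1 := by rw [← sub_eq_zero.1 h, norm_one]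
  rw [norm_pow] at h1
  exact (pow_lt_one₀ (norm_nonneg _) hs hn).ne h1

theorem poch_ne_zero (hs : ‖s‖ < 1) (n : ℕ) : poch s n ≠ 0 :=
  Finset.prod_ne_zero_iff.2 fun _ _ => one_sub_pow_ne_zero hs _ (by omega)

/-- Extension by zero makes the recursion valid for all integers: at n = 0 the factor 1 - s^0
vanishes. Boundary terms of the finite triple product then need no separate treatment. -/
theorem pochInv_sub_one (hs : ‖s‖ < 1) (n : ℤ) :
    pochInv s (n - 1) = (1 - s ^ (2 * n)) * pochInv s n := by
  rcases lt_trichotomy n 0 with hn | rfl | hn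
  · rw [pochInv, pochInv, if_neg (by omega), if_neg (by omega), mul_zero]
  · simp [pochInv]
  · obtain ⟨m, rfl⟩ : ∃ m : ℕ, n = m + 1 := ⟨(n - 1).toNat, by omega⟩
    have h1 := poch_ne_zero hs m
    have h2 := one_sub_pow_ne_zero hs (2 * (m + 1)) (by omega)
    rw [add_sub_cancel_right, pochInv, pochInv, if_pos (by omega), if_pos (by omega),
      Int.toNat_natCast, show ((m : ℤ) + 1).toNat = m + 1 by omega, poch, poch,
      Finset.prod_range_succ, ← poch, mul_inv]
    have e : s ^ (2 * ((m : ℤ) + 1)) = s ^ (2 * (m + 1)) := by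
      rw [← zpow_natCast]; congr 1
    rw [e]
    field_simp

/-- The coefficients of the finite form of the Jacobi triple product. -/
def tripleCoeff (s : ℂ) (n : ℕ) (j : ℤ) : ℂ := poch s (2 * n) * (pochInv s (n - j) * pochInv s (n + j))

/-- These are the q²-step Pascal identities for the binomials of 2n over n + j at q = s²; after both
neighbours are expressed by the values at n + 1 ± j, the identity is polynomial. -/
theorem tripleCoeff_succ (hs : ‖s‖ < 1) (hs0 : s ≠ 0) (n : ℕ) (j : ℤ) :
    tripleCoeff s (n + 1) j = (1 + s ^ (4 * n + 2)) * tripleCoeff s n j +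
      s ^ (2 * (n + 1 - j)) * tripleCoeff s n (j - 1) +
      s ^ (2 * (n + 1 + j)) * tripleCoeff s n (j + 1) := by
  have a1 := pochInv_sub_one hs (n + 1 - j)
  have a2 := pochInv_sub_one hs (n - j)
  have b1 := pochInv_sub_one hs (n + 1 + j)
  have b2 := pochInv_sub_one hs (n + j)
  rw [show (n : ℤ) + 1 - j - 1 = n - j by ring] at a1
  rw [show (n : ℤ) + 1 + j - 1 = n + j by ring] at b1
  rw [a1] at a2
  rw [b1] at b2
  have e1 : s ^ (2 * ((n : ℤ) + 1 - j)) = s ^ 2 * s ^ (2 * ((n : ℤ) - j)) := by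
    rw [← zpow_natCast, ← zpow_add₀ hs0]; congr 1; push_cast; ring
  have e2 : s ^ (2 * ((n : ℤ) + 1 + j)) = s ^ 2 * s ^ (2 * ((n : ℤ) + j)) := by
    rw [← zpow_natCast, ← zpow_add₀ hs0]; congr 1; push_cast; ring
  have e3 : s ^ (4 * n) = s ^ (2 * ((n : ℤ) - j)) * s ^ (2 * ((n : ℤ) + j)) := by
    rw [← zpow_natCast, ← zpow_add₀ hs0]; congr 1; push_cast; ring
  have p : poch s (2 * (n + 1)) =
      poch s (2 * n) * (1 - s ^ (4 * n) * s ^ 2) * (1 - s ^ (4 * n) * s ^ 4) := by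
    rw [poch, show 2 * (n + 1) = 2 * n + 1 + 1 by ring, Finset.prod_range_succ,
      Finset.prod_range_succ, ← poch]
    ring
  rw [tripleCoeff, tripleCoeff, tripleCoeff, tripleCoeff, p,
    show (n : ℤ) - (j - 1) = n + 1 - j by ring, show (n : ℤ) + (j - 1) = n + j - 1 by ring,
    show (n : ℤ) - (j + 1) = n - j - 1 by ring, show (n : ℤ) + (j + 1) = n + 1 + j by ring,
    show ((n + 1 : ℕ) : ℤ) = n + 1 by push_cast; rfl, a2, b2, a1, b1, pow_add, e1, e2, e3]
  ring

theorem tripleCoeff_eq_zero {n : ℕ} {j : ℤ} (h : (n : ℤ) < |j|) : tripleCoeff s n j = 0 := by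
  rcases lt_abs.1 h with h1 | h1
  · rw [tripleCoeff, pochInv, if_neg (by omega), zero_mul, mul_zero]
  · rw [tripleCoeff, mul_comm (pochInv s _), pochInv, if_neg (by omega), zero_mul, mul_zero]

/-- Induction on n: the new factor is 1 + s^{4n+2} + s^{2n+1}(x + x⁻¹), whose last two terms shift j
by one. Completing squares in the exponent of s reproduces the recursion of the coefficients. -/
theorem finite_triple_product (hs : ‖s‖ < 1) (hs0 : s ≠ 0) (hx : x ≠ 0) (n : ℕ) :
    HasSum (fun j : ℤ => tripleCoeff s n j * (s ^ (j ^ 2) * x ^ j))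
      (∏ i ∈ Finset.range n, (1 + s ^ (2 * i + 1) * x) * (1 + s ^ (2 * i + 1) * x⁻¹)) := by
  induction n with
  | zero =>
    convert hasSum_single (f := fun j : ℤ => tripleCoeff s 0 j * (s ^ (j ^ 2) * x ^ j)) 0
      fun j hj => by rw [tripleCoeff_eq_zero (by simpa using hj), zero_mul]
    simp [tripleCoeff, pochInv, poch]
  | succ n ih =>
    rw [Finset.prod_range_succ]
    have h1 := ih.mul_right (1 + s ^ (4 * n + 2))
    have h2 := ((Equiv.subRight (1 : ℤ)).hasSum_iff.2 ih).mul_right (s ^ (2 * n + 1) * x)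
    have h3 := ((Equiv.addRight (1 : ℤ)).hasSum_iff.2 ih).mul_right (s ^ (2 * n + 1) * x⁻¹)
    have h := (h1.add h2).add h3
    have e : s ^ (4 * n + 2) = s ^ (2 * n + 1) * s ^ (2 * n + 1) := by
      rw [← pow_add]; congr 1; ring
    rw [← mul_add, ← mul_add] at h
    have e0 : 1 + s ^ (4 * n + 2) + s ^ (2 * n + 1) * x + s ^ (2 * n + 1) * x⁻¹ =
      (1 + s ^ (2 * n + 1) * x) * (1 + s ^ (2 * n + 1) * x⁻¹) := by
      rw [e]
      field_simp
      ring
    rw [e0] at h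
    refine Eq.subst (motive := fun f => HasSum f _) (funext fun j => ?_) h
    simp only [Function.comp_apply, Equiv.subRight_apply, Equiv.coe_addRight]
    have e1 : s ^ ((j - 1) ^ 2) * s ^ (2 * n + 1) = s ^ (2 * ((n : ℤ) + 1 - j)) * s ^ (j ^ 2) := by
      rw [← zpow_natCast, ← zpow_add₀ hs0, ← zpow_add₀ hs0]; congr 1; push_cast; ring
    have e2 : s ^ ((j + 1) ^ 2) * s ^ (2 * n + 1) = s ^ (2 * ((n : ℤ) + 1 + j)) * s ^ (j ^ 2) := by
      rw [← zpow_natCast, ← zpow_add₀ hs0, ← zpow_add₀ hs0]; congr 1; push_cast; ring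
    have e3 : x ^ (j - 1) * x = x ^ j := by rw [← zpow_add_one₀ hx, sub_add_cancel]
    have e4 : x ^ (j + 1) * x⁻¹ = x ^ j := by rw [← zpow_sub_one₀ hx, add_sub_cancel_right]
    rw [tripleCoeff_succ hs hs0]
    linear_combination ((tripleCoeff s n (j - 1) * (x ^ (j - 1) * x))) * e1 +
      (tripleCoeff s n (j + 1) * (x ^ (j + 1) * x⁻¹)) * e2 +
      tripleCoeff s n (j - 1) * s ^ (2 * ((n : ℤ) + 1 - j)) * s ^ (j ^ 2) * e3 +
      tripleCoeff s n (j + 1) * s ^ (2 * ((n : ℤ) + 1 + j)) * s ^ (j ^ 2) * e4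

end TripleProduct

end

section

open Filter Topology

/-! ### The Jacobi triple product and the numerators of the characters. -/

section TripleProductLimit

variable {s x : ℂ}

/-- These are the terms of Jacobi's theta function with nome s, at τ = log s/(πi) and z = log
x/(2πi); |s| < 1 says that τ lies in the upper half plane. -/
theorem summable_theta (hs : ‖s‖ < 1) (hs0 : s ≠ 0) (hx : x ≠ 0) :
    Summable fun j : ℤ => ‖s ^ (j ^ 2) * x ^ j‖ := by
  have hπ : (Real.pi : ℂ) ≠ 0 := Complex.ofReal_ne_zero.2 Real.pi_ne_zero
  have him : 0 < (Complex.log s / (Real.pi * Complex.I)).im := by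
    have e : Complex.log s / (Real.pi * Complex.I) = -(Complex.I * Complex.log s) / Real.pi := by
      field_simp
      rw [Complex.I_sq]
      ring
    rw [e, Complex.div_ofReal_im, Complex.neg_im, Complex.I_mul_im, Complex.log_re]
    exact div_pos (neg_pos.2 (Real.log_neg (norm_pos_iff.2 hs0) hs)) Real.pi_pos
  have h1 := ((summable_jacobiTheta₂_term_iff (Complex.log x / (2 * Real.pi * Complex.I)) _).2
    him).norm
  refine h1.congr fun j => ?_
  congr 1
  rw [jacobiTheta₂_term, mul_comm (s ^ _), ← Complex.exp_log hs0, ← Complex.exp_log hx,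
    ← Complex.exp_int_mul, ← Complex.exp_int_mul, ← Complex.exp_add, Complex.exp_log hs0,
    Complex.exp_log hx]
  congr 1
  push_cast
  field_simp

theorem summable_norm_pow_two_mul (hs : ‖s‖ < 1) : Summable fun i : ℕ => ‖s ^ (2 * (i + 1))‖ := by
  have h1 := summable_norm_geometric_of_norm_lt_one hs
  exact h1.comp_injective (i := fun i : ℕ => 2 * (i + 1)) fun a b hab => by
    simp only at hab
    omega

theorem exists_pochhammer_limit (hs : ‖s‖ < 1) : ∃ E I : ℂ, I * E = 1 ∧
    HasProd (fun i : ℕ => 1 - s ^ (2 * (i + 1))) E ∧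
    HasProd (fun i : ℕ => (1 - s ^ (2 * (i + 1)))⁻¹) I := by
  have h1 := summable_norm_pow_two_mul hs
  have h2 := (multipliable_one_add_of_summable (f := fun i : ℕ => -s ^ (2 * (i + 1)))
    (by simpa only [norm_neg] using h1)).hasProd
  simp only [← sub_eq_add_neg] at h2
  have h3 := (hasProd_one_sub_inv (fun i : ℕ => s ^ (2 * (i + 1))) (r := ‖s‖) (fun i => by
    rw [norm_pow]
    exact pow_le_of_le_one (norm_nonneg _) hs.le (by omega)) hs h1).2
  refine ⟨_, _, (h3.mul h2).unique ?_, h2, h3⟩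
  refine Eq.subst (motive := fun f => HasProd f _) (funext fun i => ?_) hasProd_one
  exact (inv_mul_cancel₀ (one_sub_pow_ne_zero hs _ (by omega))).symm

variable {E I : ℂ}

theorem tendsto_pochInv (hIE : I * E = 1)
    (hE : HasProd (fun i : ℕ => 1 - s ^ (2 * (i + 1))) E) : Tendsto (pochInv s) atTop (𝓝 I) := by
  have h1 : Tendsto (fun n => (poch s n)⁻¹) atTop (𝓝 I) := by
    rw [eq_inv_of_mul_eq_one_left hIE]
    exact hE.tendsto_prod_nat.inv₀ (right_ne_zero_of_mul_eq_one hIE)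
  have h2 : Tendsto Int.toNat atTop atTop := tendsto_atTop.2 fun b => by
    filter_upwards [eventually_ge_atTop (b : ℤ)] with n hn
    omega
  refine (h1.comp h2).congr' ?_
  filter_upwards [eventually_ge_atTop 0] with n hn
  rw [Function.comp_apply, pochInv, if_pos hn]

theorem exists_pochInv_bound (hIE : I * E = 1)
    (hE : HasProd (fun i : ℕ => 1 - s ^ (2 * (i + 1))) E) : ∃ C, ∀ n, ‖pochInv s n‖ ≤ C := by
  obtain ⟨C, hC⟩ := ((tendsto_pochInv hIE hE).comp tendsto_natCast_atTop_atTop).norm.bddAbove_range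
  refine ⟨C, fun n => ?_⟩
  rcases le_or_gt 0 n with hn | hn
  · obtain ⟨m, rfl⟩ := Int.eq_ofNat_of_zero_le hn
    exact hC ⟨m, rfl⟩
  · rw [pochInv, if_neg hn.not_ge, norm_zero]
    exact (norm_nonneg _).trans (hC ⟨0, rfl⟩)

theorem tendsto_tripleCoeff (hIE : I * E = 1)
    (hE : HasProd (fun i : ℕ => 1 - s ^ (2 * (i + 1))) E) (j : ℤ) :
    Tendsto (fun n => tripleCoeff s n j) atTop (𝓝 I) := by
  have h1 : Tendsto (fun n => poch s (2 * n)) atTop (𝓝 E) :=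
    hE.tendsto_prod_nat.comp (tendsto_id.const_mul_atTop' two_pos)
  have h2 := tendsto_pochInv hIE hE
  have h3 : ∀ l : ℤ, Tendsto (fun n : ℕ => pochInv s (n + l)) atTop (𝓝 I) := fun l =>
    h2.comp (tendsto_atTop_add_const_right _ l tendsto_natCast_atTop_atTop)
  have h4 := h1.mul ((h3 (-j)).mul (h3 j))
  rw [← mul_assoc, mul_comm E, hIE, one_mul] at h4
  exact h4

/-- The Jacobi triple product. -/
theorem hasProd_triple_product (hs : ‖s‖ < 1) (hs0 : s ≠ 0) (hx : x ≠ 0) (hIE : I * E = 1)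
    (hE : HasProd (fun i : ℕ => 1 - s ^ (2 * (i + 1))) E) :
    HasProd (fun i : ℕ => (1 + s ^ (2 * i + 1) * x) * (1 + s ^ (2 * i + 1) * x⁻¹))
      (I * ∑' j : ℤ, s ^ (j ^ 2) * x ^ j) := by
  have hm : Multipliable fun i : ℕ => (1 + s ^ (2 * i + 1) * x) * (1 + s ^ (2 * i + 1) * x⁻¹) := by
    have h1 := summable_norm_geometric_of_norm_lt_one hs
    have h2 : Summable fun i : ℕ => ‖s ^ (2 * i + 1)‖ :=
      h1.comp_injective (i := fun i : ℕ => 2 * i + 1) fun a b hab => by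
        simp only at hab
        omega
    exact (multipliable_one_add_of_summable ((h2.mul_right ‖x‖).congr fun i =>
      (norm_mul _ _).symm)).mul (multipliable_one_add_of_summable
        ((h2.mul_right ‖x⁻¹‖).congr fun i => (norm_mul _ _).symm))
  obtain ⟨C, hC⟩ := exists_pochInv_bound hIE hE
  obtain ⟨D, hD⟩ := hE.tendsto_prod_nat.norm.bddAbove_range
  -- The finite coefficients are bounded by D C² uniformly in n and j, and each tends to E I² = I,
  -- so the finite identity passes to the limit under the theta majorant.
  have h1 := tendsto_tsum_of_dominated_convergence (𝓕 := atTop)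
    (f := fun (n : ℕ) (j : ℤ) => tripleCoeff s n j * (s ^ (j ^ 2) * x ^ j))
    (g := fun j => I * (s ^ (j ^ 2) * x ^ j))
    ((summable_theta hs hs0 hx).mul_left (D * (C * C)))
    (fun j => (tendsto_tripleCoeff hIE hE j).mul_const _) (Eventually.of_forall fun n j => ?_)
  · have h2 : Tendsto (fun n => ∏ i ∈ Finset.range n,
        (1 + s ^ (2 * i + 1) * x) * (1 + s ^ (2 * i + 1) * x⁻¹)) atTop
        (𝓝 (∑' j : ℤ, I * (s ^ (j ^ 2) * x ^ j))) :=
      h1.congr fun n => (finite_triple_product hs hs0 hx n).tsum_eq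
    rw [tsum_mul_left] at h2
    rw [← tendsto_nhds_unique hm.hasProd.tendsto_prod_nat h2]
    exact hm.hasProd
  · rw [norm_mul]
    refine mul_le_mul_of_nonneg_right ?_ (norm_nonneg _)
    rw [tripleCoeff, norm_mul, norm_mul]
    have hD' : ‖poch s (2 * n)‖ ≤ D := hD ⟨2 * n, rfl⟩
    have hC0 : 0 ≤ C := (norm_nonneg _).trans (hC 0)
    gcongr
    · exact (norm_nonneg _).trans hD'
    · exact hC _
    · exact hC _

/-- The factors of the numerator of the Verma character. -/
def charFactor : Sector → ℂ → ℂ → ℕ → ℂ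
  | .NS, s, x, i => (1 + s ^ (2 * i + 1) * x) * (1 + s ^ (2 * i + 1) * x⁻¹)
  | .R, s, x, i => (1 + s ^ (2 * (i + 1)) * x) * (1 + s ^ (2 * i) * x⁻¹)

theorem groundDeg₂_nonneg (A : Sector) (j : ℤ) : 0 ≤ groundDeg₂ A j := by
  cases A
  · exact sq_nonneg j
  · simp only [groundDeg₂]
    rcases le_or_gt 0 j with h | h
    · positivity
    · exact mul_nonneg_of_nonpos_of_nonpos h.le (by omega)

/-- The Ramond case is the triple product at s x, since j(j+1) = j² + j. The case s = 0 is separate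
because the triple product uses integer powers of s; there the Ramond sector keeps two ground
vectors of degree 0, at j = 0 and j = -1. -/
theorem exists_hasSum_groundDeg (A : Sector) (hs : ‖s‖ < 1) (hx : x ≠ 0) (hIE : I * E = 1)
    (hE : HasProd (fun i : ℕ => 1 - s ^ (2 * (i + 1))) E) : ∃ Θ : ℂ,
    HasSum (fun j : ℤ => s ^ (groundDeg₂ A j).toNat * x ^ j) Θ ∧
      HasProd (charFactor A s x) (I * Θ) := by
  have hg := groundDeg₂_nonneg A
  by_cases hs0 : s = 0
  · subst hs0
    have hE1 : E = 1 := hE.unique (by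
      refine Eq.subst (motive := fun f => HasProd f _) (funext fun i => ?_) hasProd_one
      simp)
    have hI : I = 1 := by simpa [hE1] using hIE
    rw [hI]
    cases A
    · refine ⟨1, ?_, ?_⟩
      · convert hasSum_single (f := fun j : ℤ =>
          (0 : ℂ) ^ (groundDeg₂ .NS j).toNat * x ^ j) 0 fun j hj => ?_
        · simp [groundDeg₂]
        · have : 0 < j ^ 2 := by positivity
          rw [groundDeg₂, zero_pow (by omega), zero_mul]
      · rw [one_mul]
        refine Eq.subst (motive := fun f => HasProd f _) (funext fun i => ?_) hasProd_one
        simp [charFactor]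
    · refine ⟨1 + x⁻¹, ?_, ?_⟩
      · have h0 : ∑ j ∈ ({0, -1} : Finset ℤ),
            (0 : ℂ) ^ (groundDeg₂ .R j).toNat * x ^ j = 1 + x⁻¹ := by
          simp [groundDeg₂]
        rw [← h0]
        refine hasSum_sum_of_ne_finset_zero fun j hj => ?_
        · simp only [Finset.mem_insert, Finset.mem_singleton, not_or] at hj
          have h1 : groundDeg₂ .R j ≠ 0 := mul_ne_zero hj.1 (by omega)
          have := hg j
          rw [zero_pow (by omega), zero_mul]
      · rw [one_mul]
        convert hasProd_single (f := charFactor .R 0 x) 0 fun i hi => ?_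
        · simp [charFactor]
        · simp [charFactor, hi]
  · cases A
    · refine ⟨_, ?_, hasProd_triple_product hs hs0 hx hIE hE⟩
      refine Eq.subst (motive := fun f => HasSum f _) (funext fun j => ?_)
        (summable_theta hs hs0 hx).of_norm.hasSum
      rw [← zpow_natCast, Int.toNat_of_nonneg (hg j)]
      rfl
    · have hsx : s * x ≠ 0 := mul_ne_zero hs0 hx
      refine ⟨∑' j : ℤ, s ^ (j ^ 2) * (s * x) ^ j, ?_, ?_⟩
      · refine Eq.subst (motive := fun f => HasSum f _) (funext fun j => ?_)
          (summable_theta hs hs0 hsx).of_norm.hasSum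
        rw [← zpow_natCast, Int.toNat_of_nonneg (hg j), groundDeg₂, mul_zpow, ← mul_assoc,
          ← zpow_add₀ hs0]
        congr 2
        ring
      · refine Eq.subst (motive := fun f => HasProd f _) (funext fun i => ?_)
          (hasProd_triple_product hs hs0 hsx hIE hE)
        rw [charFactor]
        have e : s ^ (2 * i + 1) * (s * x)⁻¹ = s ^ (2 * i) * x⁻¹ := by
          rw [mul_inv, pow_succ]
          field_simp
        rw [e]
        ring

end TripleProductLimit

/-! ### Dimensions of the homogeneous components and the characters. -/

section Counting

variable {s : ℂ}

/-- The variables of the monomials are pairs of a boson and a mode number; grouping the product by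
mode number gives each factor three times, hence the cube. -/
theorem hasSum_oscWeight (hs : ‖s‖ < 1) {I : ℂ}
    (hI : HasProd (fun i : ℕ => (1 - s ^ (2 * (i + 1)))⁻¹) I) :
    HasSum (fun μ : Boson × ℕ →₀ ℕ => s ^ (2 * oscWeight μ)) (I ^ 3) := by
  have h1 := summable_norm_pow_two_mul hs
  have h2 : Summable fun y : Boson × ℕ => ‖s ^ (2 * (y.2 + 1))‖ := by
    refine (summable_prod_of_nonneg fun _ => norm_nonneg _).2 ⟨fun b => h1, ?_⟩
    exact (hasSum_fintype _).summable
  obtain ⟨h3, h4⟩ := hasProd_one_sub_inv (fun y : Boson × ℕ => s ^ (2 * (y.2 + 1))) (r := ‖s‖)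
    (fun i => by
      rw [norm_pow]
      exact pow_le_of_le_one (norm_nonneg _) hs.le (by omega)) hs h2
  have h5 := ((Equiv.prodComm ℕ Boson).hasProd_iff.2 h4).prod_fiberwise
    (g := fun i => ((1 - s ^ (2 * (i + 1)))⁻¹) ^ 3) fun i => by
      have := hasProd_fintype (fun _ : Boson => (1 - s ^ (2 * (i + 1)))⁻¹)
      rw [Finset.prod_const] at this
      exact this
  have h6 : HasProd (fun i : ℕ => ((1 - s ^ (2 * (i + 1)))⁻¹) ^ 3) (I ^ 3) := by
    have := (hI.mul hI).mul hI
    simpa only [pow_succ, pow_zero, one_mul] using this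
  rw [h6.unique h5]
  refine Eq.subst (motive := fun f => HasSum f _) (funext fun μ => ?_) h3.of_norm.hasSum
  rw [Finsupp.prod, oscWeight, Finsupp.sum, Finset.mul_sum, ← Finset.prod_pow_eq_pow_sum]
  refine Finset.prod_congr rfl fun i _ => ?_
  rw [← pow_mul]
  congr 1
  ring

theorem finite_oscWeight_le (n : ℕ) : {μ : Boson × ℕ →₀ ℕ | oscWeight μ ≤ n}.Finite := by
  refine (Set.finite_Iic (Finsupp.indicator ((Finset.univ : Finset Boson) ×ˢ Finset.range n)
    fun _ _ => n)).subset fun μ hμ y => ?_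
  have h1 : μ y * (y.2 + 1) ≤ n := by
    by_cases hy : y ∈ μ.support
    · exact (Finset.single_le_sum (f := fun y => μ y * (y.2 + 1)) (fun _ _ => Nat.zero_le _)
        hy).trans hμ
    · rw [Finsupp.notMem_support_iff.1 hy, zero_mul]
      exact Nat.zero_le _
  rw [Finsupp.indicator_apply]
  split_ifs with hy
  · nlinarith
  · have h2 : n ≤ y.2 := by simpa using hy
    by_contra h3
    nlinarith

variable (A : Sector) (k ρ σ : ℂ)

/-- The monomials that span a homogeneous component. -/
abbrev PieceIndex (N j : ℤ) : Type :=
  {μ : Boson × ℕ →₀ ℕ // 2 * (oscWeight μ : ℤ) + groundDeg₂ A j = N}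

instance finite_pieceIndex (N j : ℤ) : Finite (PieceIndex A N j) := by
  refine ((finite_oscWeight_le (N - groundDeg₂ A j).toNat).subset fun μ hμ => ?_).to_subtype
  change 2 * (oscWeight μ : ℤ) + groundDeg₂ A j = N at hμ
  change oscWeight μ ≤ _
  omega

theorem degreePiece_eq_span (N j : ℤ) : degreePiece A k ρ σ N j =
    Submodule.span ℂ (Set.range fun μ : PieceIndex A N j =>
      sv A k ρ σ j (MvPolynomial.monomial μ.1 1)) := by
  rw [degreePiece_eq_map, weightSpan, Submodule.map_span]
  congr 1
  ext y
  constructor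
  · rintro ⟨_, ⟨μ, hμ, rfl⟩, rfl⟩
    exact ⟨⟨μ, hμ⟩, rfl⟩
  · rintro ⟨μ, rfl⟩
    exact ⟨_, ⟨μ.1, μ.2, rfl⟩, rfl⟩

theorem sv_injective (j : ℤ) : Function.Injective (sv A k ρ σ j) := fun _ _ h =>
  Finsupp.single_injective (sectorMom A k ρ σ j) (congrArg (toBig A k ρ σ) h)

theorem linearIndependent_piece (N j : ℤ) : LinearIndependent ℂ fun μ : PieceIndex A N j =>
    sv A k ρ σ j (MvPolynomial.monomial μ.1 1) := by
  have h1 := (MvPolynomial.basisMonomials (Boson × ℕ) ℂ).linearIndependent.comp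
    (Subtype.val : PieceIndex A N j → _) Subtype.val_injective
  have h2 := h1.map' (sv A k ρ σ j) (LinearMap.ker_eq_bot.2 (sv_injective A k ρ σ j))
  simpa only [Function.comp_def, MvPolynomial.coe_basisMonomials] using h2

theorem finite_degreePiece (N j : ℤ) : Module.Finite ℂ (degreePiece A k ρ σ N j) := by
  have h : (degreePiece A k ρ σ N j).FG := by
    rw [degreePiece_eq_span]
    exact Submodule.fg_span (Set.finite_range _)
  exact Module.Finite.iff_fg.2 h

theorem finrank_degreePiece (N j : ℤ) :
    Module.finrank ℂ (degreePiece A k ρ σ N j) = Nat.card (PieceIndex A N j) := by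
  have := Fintype.ofFinite (PieceIndex A N j)
  have h : ∀ P : Submodule ℂ (FockSpace A k ρ σ), P = Submodule.span ℂ (Set.range
      fun μ : PieceIndex A N j => sv A k ρ σ j (MvPolynomial.monomial μ.1 1)) →
      Module.finrank ℂ P = Nat.card (PieceIndex A N j) := by
    rintro _ rfl
    rw [Nat.card_eq_fintype_card]
    exact finrank_span_eq_card (linearIndependent_piece A k ρ σ N j)
  exact h _ (degreePiece_eq_span A k ρ σ N j)

theorem hasSum_mul_prod {α β : Type*} {f : α → ℂ} {g : β → ℂ} {a b : ℂ} (hf : HasSum f a)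
    (hg : HasSum g b) : HasSum (fun y : α × β => f y.1 * g y.2) (a * b) :=
  hf.mul hg (summable_mul_of_summable_norm hf.summable.norm hg.summable.norm)

/-- Regrouping an unconditionally convergent sum along a map. It turns the sum over basis vectors
into the sum of dimensions over bidegrees. -/
theorem hasSum_of_fibers {α β : Type*} (φ : α → β) {f : α → ℂ} {g : β → ℂ} {c : ℂ}
    (hf : HasSum f c) (hg : ∀ b, HasSum (fun y : {y // φ y = b} => f y) (g b)) : HasSum g c :=
  ((Equiv.sigmaFiberEquiv φ).hasSum_iff.2 hf).sigma hg

/-- The degrees of the vector `sv A k ρ σ j (monomial μ 1)`. -/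
def svDegree (y : (Boson × ℕ →₀ ℕ) × ℤ) : ℕ × ℤ :=
  (2 * oscWeight y.1 + (groundDeg₂ A y.2).toNat, y.2)

/-- The vectors of given degrees. -/
def svDegreeFiber (d : ℕ × ℤ) : {y // svDegree A y = d} ≃ PieceIndex A d.1 d.2 where
  toFun y := ⟨y.1.1, by
    obtain ⟨⟨μ, j⟩, rfl⟩ := y
    have := groundDeg₂_nonneg A j
    simp only [svDegree]
    omega⟩
  invFun μ := ⟨(μ.1, d.2), by
    have := μ.2
    have := groundDeg₂_nonneg A d.2
    refine Prod.ext ?_ rfl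
    simp only [svDegree]
    omega⟩
  left_inv := by
    rintro ⟨⟨μ, j⟩, rfl⟩
    rfl
  right_inv _ := rfl

theorem hasSum_svDegreeFiber (s x : ℂ) (d : ℕ × ℤ) :
    HasSum (fun y : {y // svDegree A y = d} =>
      s ^ (2 * oscWeight y.1.1) * (s ^ (groundDeg₂ A y.1.2).toNat * x ^ y.1.2))
      ((Nat.card (PieceIndex A d.1 d.2) : ℂ) * s ^ d.1 * x ^ d.2) := by
  have := Fintype.ofFinite (PieceIndex A d.1 d.2)
  have h := (svDegreeFiber A d).hasSum_iff.2
    (hasSum_fintype fun _ : PieceIndex A d.1 d.2 => s ^ d.1 * x ^ d.2)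
  rw [Finset.sum_const, Finset.card_univ, ← Nat.card_eq_fintype_card, nsmul_eq_mul,
    ← mul_assoc] at h
  refine Eq.subst (motive := fun f => HasSum f _) (funext fun y => ?_) h
  obtain ⟨⟨μ, j⟩, rfl⟩ := y
  simp only [Function.comp_apply, svDegree]
  rw [pow_add, mul_assoc]

/-- The basis vectors are pairs of an oscillator monomial and an x-degree, so the character is I³Θ.
The triple product evaluates IΘ as the numerator, and the remaining I² is the denominator. -/
theorem exists_hasCharacter (hs : ‖s‖ < 1) {x : ℂ} (hx : x ≠ 0) : ∃ c : ℂ,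
    HasProd (fun i : ℕ => charFactor A s x i / (1 - s ^ (2 * (i + 1))) ^ 2) c ∧
      HasCharacter A k ρ σ s x c := by
  obtain ⟨E, I, hIE, hE, hI⟩ := exists_pochhammer_limit hs
  obtain ⟨Θ, hΘ, hP⟩ := exists_hasSum_groundDeg A hs hx hIE hE
  have hW := hasSum_oscWeight hs hI
  refine ⟨I ^ 3 * Θ, ?_, fun N j => finite_degreePiece A k ρ σ N j, ?_⟩
  · have h1 := (hP.mul hI).mul hI
    rw [show I * Θ * I * I = I ^ 3 * Θ by ring] at h1
    refine Eq.subst (motive := fun f => HasProd f _) (funext fun i => ?_) h1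
    rw [div_eq_mul_inv, sq, mul_inv, mul_assoc]
  · have h1 : HasSum (fun y : (Boson × ℕ →₀ ℕ) × ℤ => s ^ (2 * oscWeight y.1) *
        (s ^ (groundDeg₂ A y.2).toNat * x ^ y.2)) (I ^ 3 * Θ) :=
      by
        have := hasSum_mul_prod hW hΘ
        exact this
    simp_rw [finrank_degreePiece A k ρ σ]
    exact hasSum_of_fibers (svDegree A) h1 fun d => hasSum_svDegreeFiber A s x d

end Counting

end

end SVirFock

end

/-! ### The theorem for both sectors. -/

open SVirFock

theorem mainTheorem4 (ħ k ρ σ : ℂ)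
    (hq : ∀ n : ℕ, 0 < n → qpow ħ n ≠ 1)
    (hqk : ∀ n : ℕ, 0 < n → qpow ħ (k * n) ≠ 1)
    (hk₁ : qnum ħ (2 * k + 2) ≠ 0) (hk₂ : qnum ħ (k + 2) ≠ 0) (hk₃ : qnum ħ (k + 3) ≠ 0)
    (u v : ℂ) (hu : u = qpow ħ ρ) (hv : v = qpow ħ σ) (S : Side) :
    ((∃ X : SVirOps (Fock .NS k ρ σ),
        IsCurrents ħ k ρ σ .NS S X ∧ IsSVirRep ħ k .NS S X ∧
        IsHighestWeight .NS S X u (hwt ħ k u v) (hwVec .NS k ρ σ) ∧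
        IsHomogeneous .NS S X) ∧
      ∀ s x : ℂ, ‖s‖ < 1 → x ≠ 0 → ∃ c : ℂ,
        HasProd (fun i : ℕ => (1 + s ^ (2 * i + 1) * x) * (1 + s ^ (2 * i + 1) * x⁻¹) /
          (1 - s ^ (2 * (i + 1))) ^ 2) c ∧
        HasCharacter .NS k ρ σ s x c) ∧
    ((∃ X : SVirOps (Fock .R k ρ σ),
        IsCurrents ħ k ρ σ .R S X ∧ IsSVirRep ħ k .R S X ∧
        IsHighestWeight .R S X (qpow ħ (k / 2) * u) (qpow ħ (-1) * hwt ħ k u v)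
          (hwVec .R k ρ σ) ∧
        IsHomogeneous .R S X) ∧
      ∀ s x : ℂ, ‖s‖ < 1 → x ≠ 0 → ∃ c : ℂ,
        HasProd (fun i : ℕ => (1 + s ^ (2 * (i + 1)) * x) * (1 + s ^ (2 * i) * x⁻¹) /
          (1 - s ^ (2 * (i + 1))) ^ 2) c ∧
        HasCharacter .R k ρ σ s x c) := by
  have h : Generic ħ k := ⟨hq, hqk⟩
  have hk := h.k_ne_zero
  refine ⟨⟨⟨ops ħ k ρ σ .NS S, isCurrents_ops ρ σ .NS S hk, isSVirRep_ops h ρ σ .NS S hk₁ hk₂ hk₃,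
    ?_, isHomogeneous_ops ρ σ .NS S⟩, fun s x hs hx => exists_hasCharacter .NS k ρ σ hs hx⟩,
    ⟨ops ħ k ρ σ .R S, isCurrents_ops ρ σ .R S hk, isSVirRep_ops h ρ σ .R S hk₁ hk₂ hk₃,
    ?_, isHomogeneous_ops ρ σ .R S⟩, fun s x hs hx => exists_hasCharacter .R k ρ σ hs hx⟩
  -- The uniform eigenvalues specialize: `frac` is 0 here and 1/2 in the Ramond sector, which gives
  -- the factors q^{k/2} and q⁻¹ there.
  · have e := isHighestWeight_ops ρ σ .NS S hk hu hv
    rwa [show k * Sector.NS.frac = 0 by simp [Sector.frac],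
      show (-2 : ℂ) * Sector.NS.frac = 0 by simp [Sector.frac],
      show qpow ħ 0 = 1 by simp [qpow], one_mul, one_mul] at e
  · have e := isHighestWeight_ops ρ σ .R S hk hu hv
    rwa [show k * Sector.R.frac = k / 2 by simp [Sector.frac, div_eq_mul_inv],
      show (-2 : ℂ) * Sector.R.frac = -1 by simp [Sector.frac]] at e
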